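/- **Setting.** Let $v_1=(\frac{\sqrt3}{2},\frac12)$, $v_2=(\frac{\sqrt3}{2},-\frac12)$, $\Lambda_h=\mathbb Z v_1\oplus\mathbb Z v_2$, $\Omega_h=\{\theta_1v_1+\theta_2v_2:0\le\theta_j\le1\}$, $q=\frac{4\pi}{\sqrt3}$, $k_1=q(\frac12,\frac{\sqrt3}{2})$, $k_2=q(\frac12,-\frac{\sqrt3}{2})$, $K=\frac13(k_1-k_2)$; let $R$ be the clockwise rotation of $\mathbb R^2$ by $2\pi/3$, and $\tau=e^{2\pi i/3}$. For a smooth, real-valued, even, $\Lambda_h$-periodic $V$ and $k\in\mathbb R^2$, let $L^2_k$ be the space of functions with $f(x+v)=e^{ik\cdot v}f(x)$ for $v\in\Lambda_h$, with inner product $\langle f,g\rangle=\int_{\Omega_h}\overline f g$, and let $E_1(k)\le E_2(k)\le\cdots$ be the eigenvalues of $H_V=-\Delta+V$ on $L^2_k$, listed with multiplicity, with orthonormal eigenfunctions $\Phi_b(\cdot;k)$. The pair $(K,E_\star)$ is a *Dirac point* if for some $b_\star\ge1$: (1) $E_\star$ is an $L^2_K$-eigenvalue of $H_V$ of multiplicity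 two; (2) the nullspace of $H_V-E_\star$ in $L^2_K$ has an orthonormal basis $\Phi_1$, $\Phi_2(x)=\overline{\Phi_1(-x)}$ with $\Phi_1(R^{*}x)=\tau\Phi_1(x)$, $\Phi_2(R^{*}x)=\overline\tau\,\Phi_2(x)$; (3) there are $\ell\in\mathbb C\setminus\{0\}$, $\zeta>0$ and Lipschitz functions $e_{b_\star},e_{b_\star+1}=O(|k-K|)$ with $E_{b_\star+1}(k)-E_\star=|\ell||k-K|(1+e_{b_\star+1}(k))$ and $E_{b_\star}(k)-E_\star=-|\ell||k-K|(1+e_{b_\star}(k))$ for $|k-K|<\zeta$. Put $K^m=K+m_1k_1+m_2k_2$ for $m\in\mathbb Z^2$, let $\mathcal S\subset\mathbb Z^2$ contain exactly one index from each orbit of the action of $R$ on $\{K^m\}$, let $$\psi_m(x)=\tfrac{1}{\sqrt{3|\Omega_h|}}\bigl(e^{iK^m\cdot x}+\overline\tau e^{iRK^m\cdot x}+\tau e^{iR^2K^m\cdot x}\bigr),\quad c(m)=\langle\psi_m,\Phi_1\rangle,\quad \lambda_\sharp=\sum_{m\in\mathcal S}c(m)^2\,(1,i)\cdot K^m .$$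 Let $a_1,b_1$ be coprime integers, $\mathfrak K_2=-b_1k_1+a_1k_2$, $\mathfrak z_2=\mathfrak K_2^{(1)}+i\mathfrak K_2^{(2)}$, and $P_j(x)=e^{-iK\cdot x}\Phi_j(x)$ for $j=1,2$. **Proposition.** Let $(K,E_\star)$ be a Dirac point. For $|\lambda|\le\frac12$ there are $L^2_{K+\lambda\mathfrak K_2}$-eigenpairs $(\Phi_\pm(\cdot;\lambda),E_\pm(\lambda))$ of $H_V$, with $\Phi_\pm(x;\lambda)=e^{i(K+\lambda\mathfrak K_2)\cdot x}p_\pm(x;\lambda)$, $p_\pm$ being $\Lambda_h$-periodic in $x$, such that $\langle\Phi_a(\cdot;\lambda),\Phi_b(\cdot;\lambda)\rangle=\langle p_a(\cdot;\lambda),p_b(\cdot;\lambda)\rangle=\delta_{ab}$ for $a,b\in\{+,-\}$; the maps $\lambda\mapsto E_\pm(\lambda)$, $\lambda\mapsto\Phi_\pm(x;\lambda)$ for each $x$, and $\lambda\mapsto p_\pm(\cdot;\lambda)$ with values in the space $C^2_b(\mathbb R^2)$ of functions with bounded continuous derivatives of order at most two, are real analytic on $[-\frac12,\frac12]$; and $$\operatorname{span}\{\Phi_-(\cdot;\lambda),\Phi_+(\cdot;\lambda)\}=\operatorname{span}\{\Phi_{b_\star}(\cdot;K+\lambda\mathfrak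 K_2),\Phi_{b_\star+1}(\cdot;K+\lambda\mathfrak K_2)\}\qquad(*)$$ for every $|\lambda|\le\frac12$ such that at no $k$ on the segment from $K$ to $K+\lambda\mathfrak K_2$ does an $E_j(k)$ with $j\ne b_\star,b_\star+1$ lie in $[E_{b_\star}(k),E_{b_\star+1}(k)]$. Moreover $$p_\pm(\cdot;0)=P_\pm:=\tfrac1{\sqrt2}\Bigl[\tfrac{\overline{\lambda_\sharp}}{|\lambda_\sharp|}\tfrac{\mathfrak z_2}{|\mathfrak z_2|}P_1\pm P_2\Bigr],\qquad \Phi_\pm(\cdot;0)=\tfrac1{\sqrt2}\Bigl[\tfrac{\overline{\lambda_\sharp}}{|\lambda_\sharp|}\tfrac{\mathfrak z_2}{|\mathfrak z_2|}\Phi_1\pm\Phi_2\Bigr],$$ and there are $0<\zeta_0\le\frac12$ and constants $C,C'>0$ such that for $|\lambda|<\zeta_0$: $(*)$ holds; $E_\pm(\lambda)=E_\star\pm|\lambda_\sharp||\mathfrak K_2|\lambda+E_{2,\pm}(\lambda)\lambda^2$ with $|E_{2,\pm}(\lambda)|\le C$; and $\varphi_\pm=p_\pm-P_\pm$ satisfies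 $|\partial_x^{\aleph}\varphi_\pm(x;\lambda)|\le C'|\lambda|$ for all $x\in\mathbb R^2$ and all multi-indices $|\aleph|\le2$. -/

import Mathlib

open scoped ContDiff InnerProductSpace BoundedContinuousFunction

noncomputable section

namespace Honeycomb

/-- The Euclidean plane `ℝ²`. -/
abbrev Plane : Type := EuclideanSpace ℝ (Fin 2)

/-! ### The honeycomb lattice and its dual -/

/-- Lattice vector `v₁ = (√3/2, 1/2)`. -/
def v₁ : Plane := !₂[√3 / 2, 1 / 2]

/-- Lattice vector `v₂ = (√3/2, -1/2)`. -/
def v₂ : Plane := !₂[√3 / 2, -(1 / 2)]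

/-- The constant `q = 4π/√3`. -/
def q : ℝ := 4 * Real.pi / √3

/-- Dual lattice vector `k₁ = q (1/2, √3/2)`. -/
def k₁ : Plane := q • !₂[1 / 2, √3 / 2]

/-- Dual lattice vector `k₂ = q (1/2, -√3/2)`. -/
def k₂ : Plane := q • !₂[1 / 2, -(√3 / 2)]

/-- The triangular lattice `Λ_h = ℤ v₁ ⊕ ℤ v₂`. -/
def lattice : Set Plane := {v | ∃ m n : ℤ, v = (m : ℝ) • v₁ + (n : ℝ) • v₂}

/-- The period cell `Ω_h = {θ₁ v₁ + θ₂ v₂ : 0 ≤ θ₁, θ₂ ≤ 1}`. -/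
def cell : Set Plane :=
  {x | ∃ θ₁ ∈ Set.Icc (0 : ℝ) 1, ∃ θ₂ ∈ Set.Icc (0 : ℝ) 1, x = θ₁ • v₁ + θ₂ • v₂}

/-- The vertex `K = (k₁ - k₂)/3` of the Brillouin zone. -/
def vertexK : Plane := (1 / 3 : ℝ) • (k₁ - k₂)

/-- The matrix `R` of the clockwise rotation by `2π/3`. -/
def rotMatrix : Matrix (Fin 2) (Fin 2) ℝ := !![-(1 / 2), √3 / 2; -(√3 / 2), -(1 / 2)]

/-- `R x`. -/
def rot (x : Plane) : Plane := Matrix.toEuclideanLin rotMatrix x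

/-- `R* x`, the counter-clockwise rotation by `2π/3`. -/
def rotAdj (x : Plane) : Plane := Matrix.toEuclideanLin rotMatrix.transpose x

/-- The cube root of unity `τ = exp(2πi/3)`. -/
def tau : ℂ := Complex.exp (2 * Real.pi * Complex.I / 3)

/-- The dual vector `𝔎₂ = -b₁ k₁ + a₁ k₂` of the edge `ℝ (a₁ v₁ + b₁ v₂)`. -/
def dualK₂ (a₁ b₁ : ℤ) : Plane := (-(b₁ : ℝ)) • k₁ + (a₁ : ℝ) • k₂

/-- The plane wave `x ↦ exp(i k·x)`. -/
def planeWave (k x : Plane) : ℂ := Complex.exp (Complex.I * ((⟪k, x⟫_ℝ : ℝ) : ℂ))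

/-- A function on the plane is `Λ_h`-periodic. -/
def IsLatticePeriodic {β : Type*} (f : Plane → β) : Prop :=
  ∀ v ∈ lattice, ∀ x, f (x + v) = f x

/-- The inner product `⟨f, g⟩ = ∫_{Ω_h} conj(f) g`. -/
def cellInner (f g : Plane → ℂ) : ℂ := ∫ x in cell, starRingEnd ℂ (f x) * g x

/-! ### Floquet-Bloch eigenvalue problem -/

/-- The space of solutions of `(-Δ + V) Φ = E Φ` with `Φ(x + v) = exp(i k·v) Φ(x)` for `v ∈ Λ_h`.
As `V` is smooth, every `L²_k` eigenfunction is smooth, so that these are all of them. -/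
def eigenspace (V : Plane → ℝ) (k : Plane) (E : ℝ) : Submodule ℂ (Plane → ℂ) where
  carrier := {Φ | ContDiff ℝ ∞ Φ ∧ (∀ v ∈ lattice, ∀ x, Φ (x + v) = planeWave k v * Φ x) ∧
    ∀ x, -(Laplacian.laplacian Φ x) + (V x : ℂ) * Φ x = (E : ℂ) * Φ x}
  add_mem' := by
    rintro f g ⟨hf, pf, ef⟩ ⟨hg, pg, eg⟩
    refine ⟨hf.add hg, fun v hv x => ?_, fun x => ?_⟩
    · simp only [Pi.add_apply, pf v hv x, pg v hv x]; ring
    · rw [ContDiffAt.laplacian_add (hf.contDiffAt.of_le (by norm_cast))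
        (hg.contDiffAt.of_le (by norm_cast))]
      simp only [Pi.add_apply]
      linear_combination ef x + eg x
  zero_mem' := by
    refine ⟨contDiff_const, fun v hv x => by simp, fun x => ?_⟩
    have h : Laplacian.laplacian (0 : Plane → ℂ) = 0 :=
      InnerProductSpace.laplacian_const (E := Plane) (c := (0 : ℂ))
    simp [h]
  smul_mem' := by
    rintro c f ⟨hf, pf, ef⟩
    refine ⟨contDiff_const.smul hf, fun v hv x => ?_, fun x => ?_⟩
    · simp only [Pi.smul_apply, smul_eq_mul, pf v hv x]; ring
    · rw [InnerProductSpace.laplacian_smul c (hf.contDiffAt.of_le (by norm_cast))]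
      simp only [Pi.smul_apply, smul_eq_mul]
      linear_combination c * ef x

/-- The `b`-th Floquet-Bloch eigenvalue `E_b(k)`, `b ≥ 1`, in the nondecreasing enumeration
with multiplicity: the least `E` such that the eigenvalues `≤ E` have total multiplicity at
least `b`. -/
def bandEnergy (V : Plane → ℝ) (b : ℕ) (k : Plane) : ℝ :=
  sInf {E : ℝ | (b : Cardinal) ≤ Module.rank ℂ ↥(⨆ E' ∈ Set.Iic E, eigenspace V k E')}

/-- `φ, ψ` are orthonormal eigenfunctions of the bands `b` and `b + 1` at quasi-momentum `k`. -/
structure IsBandPair (V : Plane → ℝ) (b : ℕ) (k : Plane) (φ ψ : Plane → ℂ) : Prop where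
  mem_lower : φ ∈ eigenspace V k (bandEnergy V b k)
  mem_upper : ψ ∈ eigenspace V k (bandEnergy V (b + 1) k)
  norm_lower : cellInner φ φ = 1
  norm_upper : cellInner ψ ψ = 1
  orthogonal : cellInner φ ψ = 0

/-- `W = span {Φ_b(·;k), Φ_{b+1}(·;k)}` for every choice of the eigenfunctions
(and such a choice exists). -/
def SpansBands (V : Plane → ℝ) (b : ℕ) (k : Plane) (W : Submodule ℂ (Plane → ℂ)) : Prop :=
  (∃ φ ψ, IsBandPair V b k φ ψ) ∧
    ∀ φ ψ, IsBandPair V b k φ ψ → W = Submodule.span ℂ {φ, ψ}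

/-- At quasi-momentum `k` no other band meets the bands `b` and `b + 1`, i.e.
`E_{b-1}(k) < E_b(k)` (if `b ≥ 2`) and `E_{b+1}(k) < E_{b+2}(k)`. -/
def BandsIsolated (V : Plane → ℝ) (b : ℕ) (k : Plane) : Prop :=
  ∀ j, 1 ≤ j → j ≠ b → j ≠ b + 1 →
    bandEnergy V j k ∉ Set.Icc (bandEnergy V b k) (bandEnergy V (b + 1) k)

/-! ### Dirac points -/

/-- `(𝓒 ∘ 𝓘)[Φ](x) = conj(Φ(-x))`. -/
def conjInv (Φ : Plane → ℂ) : Plane → ℂ := fun x => starRingEnd ℂ (Φ (-x))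

/-- `(K, E⋆)` is a Dirac point of `-Δ + V` at which the bands `b` and `b + 1` touch, and
`Φ₁, Φ₂ = conjInv Φ₁` is the associated orthonormal basis of the nullspace of
`-Δ + V - E⋆` in `L²_K`. -/
structure IsDiracPoint (V : Plane → ℝ) (Estar : ℝ) (b : ℕ) (Φ₁ : Plane → ℂ) : Prop where
  one_le : 1 ≤ b
  multiplicity_two : Module.finrank ℂ ↥(eigenspace V vertexK Estar) = 2
  nullspace : eigenspace V vertexK Estar = Submodule.span ℂ {Φ₁, conjInv Φ₁}
  rot_one : ∀ x, Φ₁ (rotAdj x) = tau * Φ₁ x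
  rot_two : ∀ x, conjInv Φ₁ (rotAdj x) = starRingEnd ℂ tau * conjInv Φ₁ x
  norm_one : cellInner Φ₁ Φ₁ = 1
  norm_two : cellInner (conjInv Φ₁) (conjInv Φ₁) = 1
  orthogonal : cellInner Φ₁ (conjInv Φ₁) = 0
  cones : ∃ (l : ℂ) (ζ₀ C : ℝ) (L : NNReal) (eLow eHigh : Plane → ℝ), l ≠ 0 ∧ 0 < ζ₀ ∧ 0 < C ∧
    LipschitzOnWith L eLow (Metric.ball vertexK ζ₀) ∧
    LipschitzOnWith L eHigh (Metric.ball vertexK ζ₀) ∧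
    eLow vertexK = 0 ∧ eHigh vertexK = 0 ∧
    ∀ k ∈ Metric.ball vertexK ζ₀,
      bandEnergy V (b + 1) k - Estar = ‖l‖ * ‖k - vertexK‖ * (1 + eHigh k) ∧
      bandEnergy V b k - Estar = -(‖l‖ * ‖k - vertexK‖ * (1 + eLow k)) ∧
      |eLow k| ≤ C * ‖k - vertexK‖ ∧ |eHigh k| ≤ C * ‖k - vertexK‖

/-! ### The parameter `λ_♯` -/

/-- The frequency `K + m₁ k₁ + m₂ k₂`. -/
def freq (m : ℤ × ℤ) : Plane := vertexK + (m.1 : ℝ) • k₁ + (m.2 : ℝ) • k₂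

/-- `S` contains exactly one index from each orbit of the rotation `R` acting on the
frequencies `K + m₁ k₁ + m₂ k₂` (every orbit has three elements). -/
def IsRepSystem (S : Set (ℤ × ℤ)) : Prop :=
  ∀ m : ℤ × ℤ, ∃! s, s ∈ S ∧
    (freq m = freq s ∨ freq m = rot (freq s) ∨ freq m = rot (rot (freq s)))

/-- The orthonormal Fourier basis of the space `L²_{K,τ}` of functions in `L²_K` with
`f(R* x) = τ f(x)`, indexed by a system of representatives of the orbits:
`(3|Ω_h|)^{-1/2} (e^{i K^m·x} + conj(τ) e^{i R K^m·x} + τ e^{i R² K^m·x})`,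
where `K^m = K + m₁ k₁ + m₂ k₂`. -/
def tauMode (m : ℤ × ℤ) (x : Plane) : ℂ :=
  ((√(3 * MeasureTheory.volume.real cell))⁻¹ : ℝ) *
    (planeWave (freq m) x + starRingEnd ℂ tau * planeWave (rot (freq m)) x +
      tau * planeWave (rot (rot (freq m))) x)

/-- The Fourier coefficient `c(m)` of `Φ₁` in `L²_{K,τ}`. -/
def tauCoeff (Φ₁ : Plane → ℂ) (m : ℤ × ℤ) : ℂ := cellInner (tauMode m) Φ₁

/-- `λ_♯ = ∑_{m ∈ S} c(m)² (1, i)·(K + m₁ k₁ + m₂ k₂)`. -/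
def lambdaSharp (S : Set (ℤ × ℤ)) (Φ₁ : Plane → ℂ) : ℂ :=
  ∑' m : S, tauCoeff Φ₁ m ^ 2 * ((freq m 0 : ℂ) + Complex.I * (freq m 1 : ℂ))

/-- `2^{-1/2} [ (conj(l)/|l|) (𝔷/|𝔷|) f ± g ]` with `𝔷 = κ⁽¹⁾ + i κ⁽²⁾` and sign `s = ±1`. -/
def diracComb (l : ℂ) (κ : Plane) (s : ℤˣ) (f g : Plane → ℂ) : Plane → ℂ := fun x =>
  ((√2)⁻¹ : ℝ) * (starRingEnd ℂ l / (‖l‖ : ℂ) *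
    (((κ 0 : ℂ) + Complex.I * (κ 1 : ℂ)) / (‖(κ 0 : ℂ) + Complex.I * (κ 1 : ℂ)‖ : ℂ)) * f x
      + ((s : ℤ) : ℂ) * g x)

/-- Real analyticity on `I` of a one-parameter family of functions on the plane, with values in
the Banach space of functions with bounded derivatives of order at most two: each derivative of
order `n ≤ 2` is a real-analytic map into bounded continuous functions with the sup norm. -/
def AnalyticInC2 (p : ℝ → Plane → ℂ) (I : Set ℝ) : Prop :=
  ∀ n : ℕ, n ≤ 2 → ∃ F : ℝ → (Plane →ᵇ (Plane [×n]→L[ℝ] ℂ)),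
    AnalyticOnNhd ℝ F I ∧ ∀ t x, F t x = iteratedFDeriv ℝ n (p t) x

end Honeycomb

end

open scoped ContDiff InnerProductSpace BoundedContinuousFunction

noncomputable section

namespace Honeycomb

open Filter Topology

/-! Fourier series turn the Floquet-Bloch problem at quasi-momentum `k` into an eigenvalue problem
on `ℓ²(ℤ²)` for multiplication by `|k + ξ|²` plus convolution with the Fourier coefficients of `V`.
After the shift by `μ = specShift` this operator is positive, and its inverse `resolv` is compact,
positive and real analytic in `t` along `k = K + t κ`. Energies correspond to `E = 1 / ν - μ`, and
the min-max count of eigenvalues gives `bandEnergy_eq`. So everything reduces to analytic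
perturbation theory of compact positive operators.

Locally this is Rellich's theorem. A family is made block diagonal by an analytic similarity
(`exists_analytic_block_diagonal`), and an induction on the dimension splits the finite block
completely (`rellich_finiteDimensional`, `rellich_compact`). At the Dirac point the double
eigenvalue is split to first order. The Fourier coefficients of `Φ₁` and `Φ₂` are `u` and its
conjugate, and `u` picks up a cube root of unity under the rotation of the frequencies. This
symmetry kills the diagonal of the matrix of `2 κ·(K + ξ)` and leaves an off-diagonal entry
proportional to `𝔷 conj(λ_♯)` (`IsDiracCoef.inner_momentum`). Hence every branch has energy slope `±
|λ_♯| |κ|` (`IsDiracCoef.branch`), with eigenvector at `0` fixed up to a scalar by the sign. If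
`λ_♯` were zero, all branches would be flat to first order, against the cones
(`IsDiracCoef.diracEntry_ne_zero`). Therefore both signs occur once, and each branch is simple off
`t = 0`.

Globally, such a branch is continued to `[-1, 1]`. By Hellmann-Feynman `|ν'| ≤ C ν`, so `ν` has a
positive limit at the end of any interval of existence; there Rellich's theorem applies again, and
the branch stays generically simple because it was so before (`exists_simpleBranch_closed`,
`exists_branch`). Its eigenlines form an analytic family of rank-one projections, which has a
nowhere vanishing section because a differentiable curve cannot fill `ℂ`
(`exists_analytic_unit_eigenvector`). The two branches are orthogonal near `0`, hence everywhere by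
the identity theorem.

The eigenvalue equation gains powers of the weight `1 + |ξ|²` (`exists_analytic_weighted`), so the
families are analytic in `C²` as well. If the bands `b`, `b + 1` are isolated along a segment,
connectedness keeps both branches inside the pair, and a dimension count identifies the spans
(`spansBands_of_family`). Isolation near `t = 0` follows from multiplicity two and the continuity of
the eigenvalues. -/

/-! ### Block diagonalization of analytic families -/

section Splitting

variable {A : Type*} [NormedRing A] [NormedAlgebra ℝ A]

/-- The block-diagonal part of `x` with respect to the idempotent `q`. -/
def diagPart (q : A) : A →L[ℝ] A :=
  ContinuousLinearMap.mulLeftRight ℝ A q q + ContinuousLinearMap.mulLeftRight ℝ A (1 - q) (1 - q)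

theorem diagPart_apply (q x : A) : diagPart q x = q * x * q + (1 - q) * x * (1 - q) := by
  simp only [diagPart, add_apply, ContinuousLinearMap.mulLeftRight_apply]

theorem diagPart_comm {q : A} (hq : q * q = q) (x : A) :
    diagPart q x * q = q * diagPart q x := by
  have h1 : (1 - q) * q = 0 := by rw [sub_mul, one_mul, hq, sub_self]
  have h2 : q * (1 - q) = 0 := by rw [mul_sub, mul_one, hq, sub_self]
  rw [diagPart_apply, add_mul, mul_add, mul_assoc (q * x), hq, mul_assoc _ (1 - q), h1]
  simp only [← mul_assoc, hq, h2, zero_mul, mul_zero]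

theorem diagPart_of_comm {q : A} (hq : q * q = q) {x : A} (hx : x * q = q * x) :
    diagPart q x = x := by
  have h1 : (1 - q) * (1 - q) = 1 - q := by simp [sub_mul, mul_sub, hq]
  have h2 : (1 - q) * x = x * (1 - q) := by simp [sub_mul, mul_sub, hx]
  rw [diagPart_apply, ← hx, h2, mul_assoc, mul_assoc, hq, h1]
  simp [mul_sub]

theorem diagPart_mul_left {q : A} {m : A} (hm : m * q = q * m) (x : A) :
    diagPart q (m * x) = m * diagPart q x := by
  have h2 : (1 - q) * m = m * (1 - q) := by simp [sub_mul, mul_sub, hm]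
  simp only [diagPart_apply, mul_add, ← mul_assoc, ← hm, h2]

theorem diagPart_mul_right {q : A} {m : A} (hm : m * q = q * m) (x : A) :
    diagPart q (x * m) = diagPart q x * m := by
  have h2 : (1 - q) * m = m * (1 - q) := by simp [sub_mul, mul_sub, hm]
  simp only [diagPart_apply, add_mul, mul_assoc, hm, h2]

theorem diagPart_idem {q : A} (hq : q * q = q) (x : A) :
    diagPart q (diagPart q x) = diagPart q x :=
  diagPart_of_comm hq (diagPart_comm hq x)

theorem sandwich_offPart {q : A} (hq : q * q = q) (x : A) :
    (1 - q) * (x - diagPart q x) * (1 - q) = 0 := by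
  have h1 : (1 - q) * (1 - q) = 1 - q := by simp [sub_mul, mul_sub, hq]
  have h3 : (1 - q) * q = 0 := by rw [sub_mul, one_mul, hq, sub_self]
  rw [diagPart_apply]
  generalize 1 - q = p at *
  have e : p * (x - (q * x * q + p * x * p)) * p
      = p * x * p - (p * q) * x * q * p - (p * p) * x * (p * p) := by noncomm_ring
  rw [e, h1, h3]
  simp

theorem sandwich_offPart' {q : A} (hq : q * q = q) (x : A) :
    q * (x - diagPart q x) * q = 0 := by
  have h2 : q * (1 - q) = 0 := by rw [mul_sub, mul_one, hq, sub_self]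
  rw [diagPart_apply, mul_sub, sub_mul, mul_add, add_mul]
  simp only [← mul_assoc, h2, zero_mul, hq, add_zero]
  simp only [mul_assoc, hq, sub_self]

/-- The off-diagonal part consists of the two blocks between `q` and `1 - q`, and each of them
survives exactly one of the two multiplications. -/
theorem offPart_split {q : A} (hq : q * q = q) (x : A) :
    (1 - q) * (x - diagPart q x) + (x - diagPart q x) * (1 - q) = x - diagPart q x := by
  have h1 := sandwich_offPart hq x
  have h2 := sandwich_offPart' hq x
  set y := x - diagPart q x
  have e : (1 - q) * y + y * (1 - q) - y = (1 - q) * y * (1 - q) - q * y * q := by noncomm_ring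
  rw [h1, h2, sub_zero] at e
  exact sub_eq_zero.1 e

variable [CompleteSpace A]

/-- An analytic family `a` whose value at `t₀` annihilates the idempotent `q` and is invertible on
the complement is similar, near `t₀`, to a block-diagonal analytic family. -/
theorem exists_analytic_block_diagonal {a : ℝ → A} {t₀ : ℝ} (ha : AnalyticAt ℝ a t₀) {q : A}
    (hq : q * q = q) (h1 : q * a t₀ = 0) (h2 : a t₀ * q = 0) (hu : IsUnit (a t₀ + q)) :
    ∃ s n : ℝ → A, AnalyticAt ℝ s t₀ ∧ AnalyticAt ℝ n t₀ ∧ s t₀ = 1 ∧ n t₀ = a t₀ ∧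
      ∀ᶠ t in 𝓝 t₀, a t * s t = s t * n t ∧ n t * q = q * n t := by
  set m := a t₀ with hm
  have hmq : m * q = q * m := by rw [h1, h2]
  obtain ⟨y, hy⟩ := hu
  set z : A := ↑y⁻¹ with hz
  have hz1 : z * (m + q) = 1 := by rw [← hy, hz]; exact y.inv_mul
  have hz2 : (m + q) * z = 1 := by rw [← hy, hz]; exact y.mul_inv
  have zq : z * q = q := by
    calc z * q = z * ((m + q) * q) := by rw [add_mul, h2, zero_add, hq]
      _ = q := by rw [← mul_assoc, hz1, one_mul]
  have qz : q * z = q := by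
    calc q * z = q * (m + q) * z := by rw [mul_add, h1, zero_add, hq]
      _ = q := by rw [mul_assoc, hz2, mul_one]
  -- The reduced inverse of `m`: zero on the range of `q`, inverse to `m` on the complement.
  obtain ⟨r, hr⟩ : ∃ r, r = z - q := ⟨_, rfl⟩
  have rm : r * m = 1 - q := by
    have : z * m + z * q = 1 := by rw [← mul_add, hz1]
    rw [hr, sub_mul, h1, sub_zero, eq_sub_iff_add_eq, ← zq, ]
    simpa [zq] using this
  have mr : m * r = 1 - q := by
    have : m * z + q * z = 1 := by rw [← add_mul, hz2]
    rw [hr, mul_sub, h2, sub_zero, eq_sub_iff_add_eq]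
    simpa [qz] using this
  have rq : r * q = 0 := by rw [hr, sub_mul, zq, hq, sub_self]
  have qr : q * r = 0 := by rw [hr, mul_sub, qz, hq, sub_self]
  have hrq : r * q = q * r := by rw [rq, qr]
  have r1 : r * (1 - q) = r := by rw [mul_sub, rq, mul_one, sub_zero]
  have r1' : (1 - q) * r = r := by rw [sub_mul, qr, one_mul, sub_zero]
  have m1 : m * (1 - q) = m := by rw [mul_sub, h2, mul_one, sub_zero]
  have m1' : (1 - q) * m = m := by rw [sub_mul, h1, one_mul, sub_zero]
  let d := diagPart q
  let o : A →L[ℝ] A := ContinuousLinearMap.id ℝ A - d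
  have ho : ∀ x, o x = x - diagPart q x := fun x => rfl
  have od : ∀ x, o (d x) = 0 := fun x => by
    rw [ho]; show d x - diagPart q (diagPart q x) = 0
    rw [diagPart_idem hq]; exact sub_self _
  have do_ : ∀ x, d (o x) = 0 := fun x => by
    rw [ho, map_sub]; show d x - diagPart q (diagPart q x) = 0
    rw [diagPart_idem hq]; exact sub_self _
  have oo : ∀ x, o (o x) = o x := fun x => by
    show o x - d (o x) = o x
    rw [do_, sub_zero]
  have oml : ∀ {p : A}, p * q = q * p → ∀ x, o (p * x) = p * o x := fun hp x => by
    rw [ho, ho, diagPart_mul_left hp, mul_sub]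
  have omr : ∀ {p : A}, p * q = q * p → ∀ x, o (x * p) = o x * p := fun hp x => by
    rw [ho, ho, diagPart_mul_right hp, sub_mul]
  have dml : ∀ {p : A}, p * q = q * p → ∀ x, d (p * x) = p * d x := fun hp x =>
    diagPart_mul_left hp x
  have dmr : ∀ {p : A}, p * q = q * p → ∀ x, d (x * p) = d x * p := fun hp x =>
    diagPart_mul_right hp x
  let ml (p : A) : A →L[ℝ] A := ContinuousLinearMap.mulLeftRight ℝ A p 1
  let mr' (p : A) : A →L[ℝ] A := ContinuousLinearMap.mulLeftRight ℝ A 1 p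
  have key : ∀ {p p' : A}, p * q = q * p → p' * q = q * p' → p * (1 - q) = p →
      (1 - q) * p' = p' → ∀ x, p * o x * p' = 0 := by
    intro p p' _ _ h3 h4 x
    rw [← h3, ← h4, ho]
    have := sandwich_offPart hq x
    calc p * (1 - q) * (x - diagPart q x) * ((1 - q) * p')
        = p * ((1 - q) * (x - diagPart q x) * (1 - q)) * p' := by simp only [mul_assoc]
      _ = 0 := by rw [this]; simp
  -- The linearization will be the commutator with `m` on off-diagonal elements and the identity on
  -- diagonal ones; the commutator with `r` inverts it. The mixed terms `r * o x * m` and `m * o x *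
  -- r` vanish, since `m` and `r` live in the corner of `1 - q`, where `o x` has no block.
  have inv1 : ∀ x, r * o (m * o x - o x * m + d x) - o (m * o x - o x * m + d x) * r
      + d (m * o x - o x * m + d x) = x := by
    intro x
    rw [map_add, map_sub, oml hmq, omr hmq, oo, od, map_add, map_sub, dml hmq, dmr hmq, do_]
    show _ + (m * 0 - 0 * m + diagPart q (diagPart q x)) = x
    rw [diagPart_idem hq]
    have e1 := key hrq hmq r1 m1' x
    have e2 := key hmq hrq m1 r1' x
    have e3 := offPart_split hq x
    rw [← ho] at e3
    have e4 : r * (m * o x) = (1 - q) * o x := by rw [← mul_assoc, rm]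
    have e5 : o x * m * r = o x * (1 - q) := by rw [mul_assoc, mr]
    simp only [add_zero, mul_sub, mul_zero, zero_mul, sub_self, zero_add]
    rw [sub_mul, e4, e5, e2, ← mul_assoc r, e1, sub_zero, zero_sub, sub_neg_eq_add, e3, ho]
    abel
  have inv2 : ∀ x, m * o (r * o x - o x * r + d x) - o (r * o x - o x * r + d x) * m
      + d (r * o x - o x * r + d x) = x := by
    intro x
    rw [map_add, map_sub, oml hrq, omr hrq, oo, od, map_add, map_sub, dml hrq, dmr hrq, do_]
    show _ + (r * 0 - 0 * r + diagPart q (diagPart q x)) = x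
    rw [diagPart_idem hq]
    have e1 := key hrq hmq r1 m1' x
    have e2 := key hmq hrq m1 r1' x
    have e3 := offPart_split hq x
    rw [← ho] at e3
    have e4 : m * (r * o x) = (1 - q) * o x := by rw [← mul_assoc, mr]
    have e5 : o x * r * m = o x * (1 - q) := by rw [mul_assoc, rm]
    simp only [add_zero, mul_sub, mul_zero, zero_mul, sub_self, zero_add]
    rw [sub_mul, e4, e5, e1, ← mul_assoc m, e2, sub_zero, zero_sub, sub_neg_eq_add, e3, ho]
    abel
  let L : A ≃L[ℝ] A := ContinuousLinearEquiv.equivOfInverse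
    ((ml m).comp o - (mr' m).comp o + d) ((ml r).comp o - (mr' r).comp o + d)
    (fun x => by simpa [ml, mr'] using inv1 x) (fun x => by simpa [ml, mr'] using inv2 x)
  have hL : ∀ x, L x = m * o x - o x * m + d x := fun x => by simp [L, ml, mr']
  -- With `s = 1 + Z`, `Z` off-diagonal, and `n` the diagonal part of `a s`, the equation `a s = s
  -- n` says that the off-diagonal part of `a s` is `Z n`. The summand `d Z` forces `Z` to be
  -- off-diagonal and makes the derivative invertible on all of `A`, so that the implicit function
  -- theorem applies.
  let G : ℝ × A → A := fun v =>
    o (a v.1 * (1 + v.2)) - o v.2 * d (a v.1 * (1 + v.2)) + d v.2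
  have hG : ContDiffAt ℝ ω G (t₀, 0) := by
    have ha' : ContDiffAt ℝ ω (fun v : ℝ × A => a v.1) (t₀, 0) :=
      ha.contDiffAt.comp (t₀, (0 : A)) contDiffAt_fst
    have hs : ContDiffAt ℝ ω (fun v : ℝ × A => v.2) (t₀, 0) := contDiffAt_snd
    have hx : ContDiffAt ℝ ω (fun v : ℝ × A => a v.1 * (1 + v.2)) (t₀, 0) :=
      ha'.mul (contDiffAt_const.add hs)
    exact ((o.contDiff.contDiffAt.comp _ hx).sub ((o.contDiff.contDiffAt.comp _ hs).mul
      (d.contDiff.contDiffAt.comp _ hx))).add (d.contDiff.contDiffAt.comp _ hs)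
  have hdm : d m = m := diagPart_of_comm hq hmq
  have hom : o m = 0 := by rw [← hdm, od]
  have hG0 : G (t₀, 0) = 0 := by
    simp only [G, add_zero, mul_one, map_zero, zero_mul, sub_zero, ← hm, hom]
  have hder : fderiv ℝ G (t₀, 0) ∘L .inr ℝ ℝ A = (L : A →L[ℝ] A) := by
    have e1 : HasFDerivAt (fun Z : A => G (t₀, Z)) (fderiv ℝ G (t₀, 0) ∘L .inr ℝ ℝ A) 0 :=
      (hG.differentiableAt (by simp)).hasFDerivAt.comp (0 : A) (hasFDerivAt_prodMk_right t₀ 0)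
    have e2 : (fun Z : A => G (t₀, Z)) = fun Z => L Z - o Z * (d.comp (ml m)) Z := by
      funext Z
      have : d (m * (1 + Z)) = m + d (m * Z) := by rw [mul_add, mul_one, map_add, hdm]
      have h' : o (m * (1 + Z)) = m * o Z := by
        rw [mul_add, mul_one, map_add, hom, zero_add, oml hmq]
      simp only [G, ← hm, this, h', hL]
      simp [ml]
      noncomm_ring
    have e3 : HasFDerivAt (fun Z : A => L Z - o Z * (d.comp (ml m)) Z) (L : A →L[ℝ] A) 0 := by
      have := (L : A →L[ℝ] A).hasFDerivAt (x := (0 : A)) |>.sub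
        ((o.hasFDerivAt (x := (0 : A))).mul' ((d.comp (ml m)).hasFDerivAt (x := (0 : A))))
      refine this.congr_fderiv ?_
      ext Z
      simp
    rw [e2] at e1
    exact e1.unique e3
  have hinv : (fderiv ℝ G (t₀, 0) ∘L .inr ℝ ℝ A).IsInvertible := by
    rw [hder]; exact ContinuousLinearMap.isInvertible_equiv
  let Z := hG.implicitFunction (by simp) hinv
  have Z0 : Z t₀ = 0 := hG.implicitFunction_apply_self (by simp) hinv
  have hZ : AnalyticAt ℝ Z t₀ :=
    (hG.contDiffAt_implicitFunction (by simp) hinv).analyticAt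
  have hZeq : ∀ᶠ t in 𝓝 t₀, G (t, Z t) = 0 := by
    have := hG.eventually_apply_implicitFunction (by simp) hinv
    simpa only [hG0] using this
  refine ⟨fun t => 1 + Z t, fun t => d (a t * (1 + Z t)), analyticAt_const.add hZ,
    (d.analyticAt _).comp (ha.mul (analyticAt_const.add hZ)), by simp [Z0], ?_, ?_⟩
  · simp only [Z0, add_zero, mul_one, ← hm, hdm]
  · filter_upwards [hZeq] with t ht
    refine ⟨?_, diagPart_comm hq _⟩
    have ht' : o (a t * (1 + Z t)) - o (Z t) * d (a t * (1 + Z t)) + d (Z t) = 0 := ht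
    -- The first two terms of `G` are off-diagonal, so the diagonal part of the equation reads `d Z
    -- = 0`.
    have hd : d (Z t) = 0 := by
      have := congrArg d ht'
      rw [map_add, map_sub, do_, map_zero, dmr (diagPart_comm hq _), do_] at this
      have h' : d (d (Z t)) = d (Z t) := diagPart_idem hq _
      simpa [h'] using this
    have hoZ : o (Z t) = Z t := by show Z t - d (Z t) = Z t; rw [hd, sub_zero]
    rw [hd, hoZ, add_zero, sub_eq_zero] at ht'
    calc a t * (1 + Z t) = o (a t * (1 + Z t)) + d (a t * (1 + Z t)) := by
          show _ = _ - d _ + d _; abel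
      _ = (1 + Z t) * d (a t * (1 + Z t)) := by rw [ht', add_mul, one_mul, add_comm]

end Splitting

/-! ### Rellich's theorem on analytic families of self-adjoint operators -/

section AnalyticOperators

variable {X Y Z : Type*} [NormedAddCommGroup X] [NormedSpace ℂ X] [NormedAddCommGroup Y]
  [NormedSpace ℂ Y] [NormedAddCommGroup Z] [NormedSpace ℂ Z]

/-- The operators are complex linear but the parameter is real; evaluation is bilinear over `ℝ`
after restriction of scalars. -/
theorem analyticAt_clm_apply_real {T : ℝ → X →L[ℂ] Y} {u : ℝ → X} {t : ℝ}
    (hT : AnalyticAt ℝ T t) (hu : AnalyticAt ℝ u t) : AnalyticAt ℝ (fun s => T s (u s)) t :=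
  (((ContinuousLinearMap.id ℂ (X →L[ℂ] Y)).bilinearRestrictScalars ℝ).analyticAt_bilinear
    (T t, u t)).comp₂ hT hu

theorem analyticAt_clm_comp_real {T : ℝ → Y →L[ℂ] Z} {S : ℝ → X →L[ℂ] Y} {t : ℝ}
    (hT : AnalyticAt ℝ T t) (hS : AnalyticAt ℝ S t) :
    AnalyticAt ℝ (fun s => (T s).comp (S s)) t :=
  (((ContinuousLinearMap.compL ℂ X Y Z).bilinearRestrictScalars ℝ).analyticAt_bilinear
    (T t, S t)).comp₂ hT hS

theorem analyticAt_clm_const (T : X →L[ℂ] Y) {u : ℝ → X} {t : ℝ}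
    (hu : AnalyticAt ℝ u t) : AnalyticAt ℝ (fun s => T (u s)) t :=
  analyticAt_clm_apply_real analyticAt_const hu

end AnalyticOperators

/-! ### Rellich's theorem in finite dimensions, with a varying inner product. -/

section FiniteDimensional

open Module

variable {E : Type*} [NormedAddCommGroup E] [InnerProductSpace ℂ E]

/-- Symmetry of `T` with respect to the sesquilinear form `⟪·, g ·⟫`. -/
def SymmWrt (g T : E →L[ℂ] E) : Prop := ∀ x y, ⟪T x, g y⟫_ℂ = ⟪x, g (T y)⟫_ℂ

theorem SymmWrt.eigenvalue_real {g T : E →L[ℂ] E} (h : SymmWrt g T)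
    (hg : ∀ x, x ≠ 0 → 0 < (⟪x, g x⟫_ℂ).re) {μ : ℂ} {x : E} (hx : x ≠ 0) (hT : T x = μ • x) :
    ((μ.re : ℝ) : ℂ) = μ := by
  have h1 := h x x
  rw [hT, map_smul, inner_smul_left, inner_smul_right] at h1
  have h2 : ⟪x, g x⟫_ℂ ≠ 0 := fun h0 => by have := hg x hx; rw [h0] at this; simp at this
  have h3 := mul_right_cancel₀ h2 h1
  exact Complex.conj_eq_iff_re.1 h3

/-- The square of the `g`-norm of `T x` is `⟪x, g (T (T x))⟫ = 0`. This is what makes kernel and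
range of a symmetric operator complementary. -/
theorem SymmWrt.semisimple {g T : E →L[ℂ] E} (h : SymmWrt g T)
    (hg : ∀ x, x ≠ 0 → 0 < (⟪x, g x⟫_ℂ).re) {x : E} (hx : T (T x) = 0) : T x = 0 := by
  by_contra h0
  have h1 := hg _ h0
  rw [h x (T x), hx, map_zero, inner_zero_right] at h1
  simp at h1

theorem SymmWrt.sub_smul {g T : E →L[ℂ] E} (h : SymmWrt g T)
    (c : ℝ) :
    SymmWrt g (T - (c : ℂ) • (1 : E →L[ℂ] E)) := by
  intro x y
  simp only [sub_apply, smul_apply,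
    one_apply_eq_self, map_sub, map_smul, inner_sub_left, inner_sub_right,
    inner_smul_left, inner_smul_right, Complex.conj_ofReal]
  rw [h x y]

theorem isCompl_ker_range_of_semisimple [FiniteDimensional ℂ E] {m : E →L[ℂ] E}
    (hm : ∀ x, m (m x) = 0 → m x = 0) :
    IsCompl (LinearMap.ker m.toLinearMap) (LinearMap.range m.toLinearMap) := by
  have hd : Disjoint (LinearMap.ker m.toLinearMap) (LinearMap.range m.toLinearMap) := by
    rw [Submodule.disjoint_def]
    rintro x hx ⟨y, rfl⟩
    exact hm y hx
  refine ⟨hd, codisjoint_iff.2 (Submodule.eq_top_of_disjoint _ _ ?_ hd)⟩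
  rw [add_comm, LinearMap.finrank_range_add_finrank_ker]

/-- Needed for quotients by a power of `t - t₀`, whose symmetry is known directly only for `t ≠ t₀`.
-/
theorem SymmWrt.of_tendsto {g T : ℝ → E →L[ℂ] E} {t₀ : ℝ} (hg : ContinuousAt g t₀)
    (hT : ContinuousAt T t₀) (h : ∀ᶠ t in 𝓝[≠] t₀, SymmWrt (g t) (T t)) :
    SymmWrt (g t₀) (T t₀) := by
  intro x y
  have h1 : ContinuousAt (fun t => ⟪T t x, g t y⟫_ℂ) t₀ :=
    (hT.clm_apply continuousAt_const).inner (𝕜 := ℂ) (hg.clm_apply continuousAt_const)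
  have h2 : ContinuousAt (fun t => ⟪x, g t (T t y)⟫_ℂ) t₀ :=
    continuousAt_const.inner (𝕜 := ℂ) (hg.clm_apply (hT.clm_apply continuousAt_const))
  refine tendsto_nhds_unique_of_eventuallyEq (l := 𝓝[≠] t₀) (h1.tendsto.mono_left nhdsWithin_le_nhds)
    (h2.tendsto.mono_left nhdsWithin_le_nhds) ?_
  filter_upwards [h] with t ht using ht x y

/-- The part of an analytic family on an invariant block, with its symmetrizer. -/
theorem compress_block [CompleteSpace E] {a s n g : ℝ → E →L[ℂ] E} {t₀ : ℝ}
    (hs : AnalyticAt ℝ s t₀) (hn : AnalyticAt ℝ n t₀) (hs0 : s t₀ = 1)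
    (h : ∀ᶠ t in 𝓝 t₀, a t * s t = s t * n t)
    (hg : ContinuousAt g t₀) (hgs : ∀ᶠ t in 𝓝 t₀, ∀ x y, ⟪x, g t y⟫_ℂ = ⟪g t x, y⟫_ℂ)
    (hga : ∀ᶠ t in 𝓝 t₀, SymmWrt (g t) (a t))
    (hpos : ∀ x, x ≠ 0 → 0 < (⟪x, g t₀ x⟫_ℂ).re)
    (U : Submodule ℂ E) [CompleteSpace U] (π : E →L[ℂ] U) (hπ : ∀ᶠ t in 𝓝 t₀, ∀ x : U, (π (n t x) : E) = n t x) :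
    ∃ N G : ℝ → U →L[ℂ] U, AnalyticAt ℝ N t₀ ∧ ContinuousAt G t₀ ∧
      (∀ᶠ t in 𝓝 t₀, ∀ x y, ⟪x, G t y⟫_ℂ = ⟪G t x, y⟫_ℂ) ∧
      (∀ᶠ t in 𝓝 t₀, SymmWrt (G t) (N t)) ∧ (∀ x, x ≠ 0 → 0 < (⟪x, G t₀ x⟫_ℂ).re) ∧
      (∀ᶠ t in 𝓝 t₀, ∀ x : U, a t (s t x) = s t (N t x)) ∧ ∀ t, ∀ x : U, N t x = π (n t x) := by
  let i : U →L[ℂ] E := U.subtypeL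
  -- The similarity `s` is not unitary, so the block is symmetric only for the inner product pulled
  -- back along `s`. This is the reason to carry `g` through the induction.
  let W : ℝ → U →L[ℂ] E := fun t => (s t).comp i
  have hW : ContinuousAt W t₀ := hs.continuousAt.clm_comp continuousAt_const
  have hin : ∀ t x y, ⟪x, ((W t).adjoint.comp ((g t).comp (W t))) y⟫_ℂ
      = ⟪s t x, g t (s t y)⟫_ℂ := by
    intro t x y
    simp [ContinuousLinearMap.adjoint_inner_right, W, i]
  have hcomm : ∀ᶠ t in 𝓝 t₀, ∀ x : U, a t (s t x) = s t (π (n t x)) := by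
    filter_upwards [h, hπ] with t h1 h2 x
    rw [h2 x]
    exact congrArg (fun T : E →L[ℂ] E => T x) h1
  refine ⟨fun t => π.comp ((n t).comp i), fun t => (W t).adjoint.comp ((g t).comp (W t)),
    analyticAt_clm_comp_real analyticAt_const (analyticAt_clm_comp_real hn analyticAt_const),
    ?_, ?_, ?_, ?_, ?_, fun t x => rfl⟩
  · exact (((ContinuousLinearMap.adjoint (𝕜 := ℂ) (E := U) (F := E)).continuous.continuousAt).comp
      hW).clm_comp (hg.clm_comp hW)
  · filter_upwards [hgs] with t ht x y
    rw [hin, ht, ← inner_conj_symm _ y, hin, inner_conj_symm]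
  · filter_upwards [hga, hcomm] with t ht hc x y
    rw [hin, hin]
    show ⟪s t (π (n t x)), _⟫_ℂ = ⟪_, g t (s t (π (n t y)))⟫_ℂ
    rw [← hc, ← hc]
    exact ht _ _
  · intro x hx
    rw [hin, hs0]
    exact hpos x (by simpa using hx)
  · exact hcomm

/-- **Rellich's theorem** in finite dimensions, for an analytic family that is symmetric with
respect to a continuous family of inner products: near `t₀` there is a basis of eigenvectors that
depends analytically on the parameter, with analytic eigenvalues. -/
theorem rellich_finiteDimensional (d : ℕ) : ∀ (E : Type) [NormedAddCommGroup E]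
    [InnerProductSpace ℂ E] [FiniteDimensional ℂ E] (T g : ℝ → E →L[ℂ] E) (t₀ : ℝ),
    finrank ℂ E = d → AnalyticAt ℝ T t₀ → ContinuousAt g t₀ →
    (∀ᶠ t in 𝓝 t₀, ∀ x y, ⟪x, g t y⟫_ℂ = ⟪g t x, y⟫_ℂ) →
    (∀ᶠ t in 𝓝 t₀, SymmWrt (g t) (T t)) → (∀ x, x ≠ 0 → 0 < (⟪x, g t₀ x⟫_ℂ).re) →
    ∃ (ι : Type) (_ : Fintype ι) (ν : ι → ℝ → ℝ) (u : ι → ℝ → E), Fintype.card ι = d ∧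
      (∀ i, AnalyticAt ℝ (ν i) t₀ ∧ AnalyticAt ℝ (u i) t₀) ∧
      LinearIndependent ℂ (fun i => u i t₀) ∧
      ∀ᶠ t in 𝓝 t₀, ∀ i, T t (u i t) = (ν i t : ℂ) • u i t := by
  induction d using Nat.strong_induction_on with
  | _ d IH =>
  intro E _ _ _ T g t₀ hd hT hg hgs hgT hpos
  rcases Nat.eq_zero_or_pos d with rfl | hd0
  · have : Subsingleton E := finrank_zero_iff.1 hd
    exact ⟨Empty, inferInstance, fun i => i.elim, fun i => i.elim, rfl, fun i => i.elim,
      linearIndependent_empty_type, Eventually.of_forall fun t i => i.elim⟩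
  have : Nontrivial E := by
    rw [← hd] at hd0; exact nontrivial_of_finrank_pos hd0
  obtain ⟨e, he⟩ := exists_norm_eq E (zero_le_one)
  -- A real functional with value `c` at each real scalar operator `c`. Subtracting it normalizes
  -- the family so that its leading coefficient cannot be a nonzero scalar.
  let φ : (E →L[ℂ] E) →L[ℝ] ℝ := Complex.reCLM.comp
    (((innerSL ℂ e).comp (ContinuousLinearMap.apply ℂ E e)).restrictScalars ℝ)
  have hφ : ∀ S, φ S = (⟪e, S e⟫_ℂ).re := fun S => rfl
  have hee : ⟪e, e⟫_ℂ = 1 := by rw [inner_self_eq_norm_sq_to_K, he]; simp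
  have hφ1 : ∀ c : ℝ, φ ((c : ℂ) • 1) = c := by 
    intro c
    rw [hφ, smul_apply, one_apply_eq_self, inner_smul_right, hee]
    simp
  let σ : ℝ → ℝ := fun t => φ (T t)
  have hσ : AnalyticAt ℝ σ t₀ := (φ.analyticAt _).comp hT
  let T₀ : ℝ → E →L[ℂ] E := fun t => T t - (σ t : ℂ) • 1
  have hT₀ : AnalyticAt ℝ T₀ t₀ := by
    refine hT.sub ?_
    have : (fun t => (σ t : ℂ) • (1 : E →L[ℂ] E)) = fun t => σ t • (1 : E →L[ℂ] E) := by
      funext t; simp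
    rw [this]
    exact hσ.smul analyticAt_const
  by_cases hz : ∀ᶠ t in 𝓝 t₀, T₀ t = 0
  · let bas := finBasis ℂ E
    refine ⟨Fin (finrank ℂ E), inferInstance, fun _ => σ, fun i _ => bas i, by simp [hd],
      fun i => ⟨hσ, analyticAt_const⟩, bas.linearIndependent, ?_⟩
    filter_upwards [hz] with t ht i
    have : T t = (σ t : ℂ) • 1 := sub_eq_zero.1 ht
    rw [this]; simp
  -- Dividing by the exact order of vanishing leaves a family `M` with `M t₀ ≠ 0` and the same
  -- eigenvectors off `t₀`.
  obtain ⟨k, M, hM, hM0, hTM⟩ := (hT₀.exists_eventuallyEq_pow_smul_nonzero_iff).2 hz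
  have hTM' : ∀ᶠ t in 𝓝[≠] t₀, M t = (((t - t₀) ^ k)⁻¹ : ℝ) • T₀ t := by
    filter_upwards [hTM.filter_mono nhdsWithin_le_nhds, self_mem_nhdsWithin] with t h1 h2
    rw [h1, inv_smul_smul₀ (pow_ne_zero _ (sub_ne_zero.2 h2))]
  have hMsymm' : ∀ᶠ t in 𝓝[≠] t₀, SymmWrt (g t) (M t) := by
    filter_upwards [hTM', hgT.filter_mono nhdsWithin_le_nhds] with t h1 h3 x y
    rw [h1]
    have := h3.sub_smul (σ t) x y
    simp only [smul_apply, ContinuousLinearMap.map_smul_of_tower]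
    rw [← Complex.coe_smul, ← Complex.coe_smul (((t - t₀) ^ k)⁻¹ : ℝ), inner_smul_left,
      inner_smul_right, Complex.conj_ofReal]
    exact congrArg _ this
  have hMsymm0 : SymmWrt (g t₀) (M t₀) := SymmWrt.of_tendsto hg hM.continuousAt hMsymm'
  have hMsymm : ∀ᶠ t in 𝓝 t₀, SymmWrt (g t) (M t) := by
    have := eventually_nhdsWithin_iff.1 hMsymm'
    filter_upwards [this] with t ht
    by_cases h : t = t₀
    · rw [h]; exact hMsymm0
    · exact ht h
  have hφM : φ (M t₀) = 0 := by
    refine tendsto_nhds_unique_of_eventuallyEq (f := fun t => φ (M t)) (g := fun _ => (0 : ℝ))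
      (l := 𝓝[≠] t₀) (((φ.continuous.continuousAt.comp hM.continuousAt).tendsto).mono_left
        nhdsWithin_le_nhds) tendsto_const_nhds ?_
    filter_upwards [hTM'] with t ht
    rw [ht, map_smul, map_sub, hφ1]
    simp [σ]
  obtain ⟨μ', hμ'⟩ := End.exists_eigenvalue (M t₀).toLinearMap
  obtain ⟨x₀, hx₀⟩ := hμ'.exists_hasEigenvector
  have hx₀' : M t₀ x₀ = μ' • x₀ := hx₀.apply_eq_smul
  have hμr := hMsymm0.eigenvalue_real hpos hx₀.2 hx₀'
  set μ : ℝ := μ'.re with hμ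
  let a : ℝ → E →L[ℂ] E := fun t => M t - (μ : ℂ) • 1
  have ha : AnalyticAt ℝ a t₀ := hM.sub analyticAt_const
  have hasymm : ∀ᶠ t in 𝓝 t₀, SymmWrt (g t) (a t) := by
    filter_upwards [hMsymm] with t h1 using h1.sub_smul μ
  have ha0 : SymmWrt (g t₀) (a t₀) := hasymm.self_of_nhds
  have hax : a t₀ x₀ = 0 := by simp [a, hx₀', hμr]
  -- Otherwise `M t₀` would be a scalar, namely `φ (M t₀) = 0`. So both the kernel and the range of
  -- `a t₀` are proper, and the dimension drops in the induction.
  have hane : a t₀ ≠ 0 := by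
    intro h0
    have h1 : M t₀ = (μ : ℂ) • 1 := sub_eq_zero.1 h0
    rw [h1, hφ1] at hφM
    rw [h1, hφM] at hM0
    simp at hM0
  have hss : ∀ x, a t₀ (a t₀ x) = 0 → a t₀ x = 0 := fun x => ha0.semisimple hpos
  have hc := isCompl_ker_range_of_semisimple hss
  set U := LinearMap.ker (a t₀).toLinearMap with hU
  set W := LinearMap.range (a t₀).toLinearMap with hW
  let π₁ : E →L[ℂ] U := LinearMap.toContinuousLinearMap (U.projectionOnto W hc)
  let π₂ : E →L[ℂ] W := LinearMap.toContinuousLinearMap (W.projectionOnto U hc.symm)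
  let q : E →L[ℂ] E := U.subtypeL.comp π₁
  have hqU : ∀ x ∈ U, q x = x := fun x hx => by
    have : U.projectionOnto W hc x = ⟨x, hx⟩ := Submodule.projectionOnto_apply_of_mem_left hc hx
    show ((U.projectionOnto W hc x : U) : E) = x
    rw [this]
  have hqW : ∀ x ∈ W, q x = 0 := fun x hx => by
    have : U.projectionOnto W hc x = 0 := (Submodule.projectionOnto_apply_eq_zero_iff hc).2 hx
    show ((U.projectionOnto W hc x : U) : E) = 0
    rw [this]; rfl
  have hqmem : ∀ x, q x ∈ U := fun x => (π₁ x).2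
  have hq : q * q = q := by ext x; exact hqU _ (hqmem x)
  have h1 : q * a t₀ = 0 := by ext x; exact hqW _ ⟨x, rfl⟩
  have h2 : a t₀ * q = 0 := by ext x; exact hqmem x
  have hq1 : ∀ x, q x = 0 → x ∈ W := fun x hx => by
    rw [← Submodule.projectionOnto_apply_eq_zero_iff hc]
    exact Subtype.ext hx
  have hπ₂ : ∀ x, q x = 0 → (π₂ x : E) = x := fun x hx => by
    have : W.projectionOnto U hc.symm x = ⟨x, hq1 x hx⟩ :=
      Submodule.projectionOnto_apply_of_mem_left hc.symm (hq1 x hx)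
    show ((W.projectionOnto U hc.symm x : W) : E) = x
    rw [this]
  have hunit : IsUnit (a t₀ + q) := by
    have hinj : Function.Injective (a t₀ + q) := by
      rw [injective_iff_map_eq_zero]
      intro x hx
      have hx' : a t₀ x + q x = 0 := hx
      have hqx : q x = 0 := by
        have := congrArg q hx'
        rw [map_add, map_zero, hqU _ (hqmem x)] at this
        have h3 : q (a t₀ x) = 0 := hqW _ ⟨x, rfl⟩
        simpa [h3] using this
      have hax : a t₀ x = 0 := by simpa [hqx] using hx'
      rw [← hqU x hax, hqx]
    rw [ContinuousLinearMap.isUnit_iff_bijective]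
    exact ⟨hinj, (LinearMap.injective_iff_surjective (f := (a t₀ + q).toLinearMap)).1 hinj⟩
  obtain ⟨s, n, hs, hn, hs0, hn0, hsn⟩ := exists_analytic_block_diagonal ha hq h1 h2 hunit
  have hsn1 : ∀ᶠ t in 𝓝 t₀, a t * s t = s t * n t := hsn.mono fun t h => h.1
  have hcomm : ∀ᶠ t in 𝓝 t₀, ∀ x, n t (q x) = q (n t x) := hsn.mono fun t h x =>
    congrArg (fun T : E →L[ℂ] E => T x) h.2
  obtain ⟨N₁, G₁, b1, b2, b3, b4, b5, b6, -⟩ := compress_block hs hn hs0 hsn1 hg hgs hasymm hpos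
    U π₁ (by
      filter_upwards [hcomm] with t ht x
      have := ht x
      rw [hqU x x.2] at this
      exact this.symm)
  obtain ⟨N₂, G₂, c1, c2, c3, c4, c5, c6, -⟩ := compress_block hs hn hs0 hsn1 hg hgs hasymm hpos
    W π₂ (by
      filter_upwards [hcomm] with t ht x
      refine hπ₂ _ ?_
      rw [← ht, hqW x x.2, map_zero])
  have hsum : finrank ℂ U + finrank ℂ W = d := by
    rw [← hd]; exact Submodule.finrank_add_eq_of_isCompl hc
  have hUpos : 0 < finrank ℂ U := by
    have : Nontrivial U := ⟨⟨⟨x₀, hax⟩, 0, fun h => hx₀.2 (congrArg Subtype.val h)⟩⟩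
    exact finrank_pos
  have hWpos : 0 < finrank ℂ W := by
    obtain ⟨y, hy⟩ : ∃ y, a t₀ y ≠ 0 := by
      by_contra! h; exact hane (ContinuousLinearMap.ext h)
    have : Nontrivial W := ⟨⟨⟨_, ⟨y, rfl⟩⟩, 0, fun h => hy (congrArg Subtype.val h)⟩⟩
    exact finrank_pos
  obtain ⟨ι₁, _, ν₁, u₁, d1, d2, d3, d4⟩ :=
    IH _ (by omega) U N₁ G₁ t₀ rfl b1 b2 b3 b4 b5
  obtain ⟨ι₂, _, ν₂, u₂, e1, e2, e3, e4⟩ :=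
    IH _ (by omega) W N₂ G₂ t₀ rfl c1 c2 c3 c4 c5
  -- Undoes the normalizations: `T = σ + (t - t₀) ^ k (μ + a)`.
  have hfin : ∀ t, ∀ ν : ℝ, ∀ v : E, T₀ t = (t - t₀) ^ k • M t → a t (s t v) = (ν : ℂ) • s t v →
      T t (s t v) = ((σ t + (t - t₀) ^ k * (μ + ν) : ℝ) : ℂ) • s t v := by
    intro t ν v h1 h2
    have hTt : T t = (σ t : ℂ) • 1 + (t - t₀) ^ k • (a t + (μ : ℂ) • 1) := by
      have : a t + (μ : ℂ) • 1 = M t := by simp [a]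
      rw [this, ← h1]; simp [T₀]
    rw [hTt]
    simp only [add_apply, smul_apply,
      one_apply_eq_self, h2, smul_add, ← Complex.coe_smul, smul_smul]
    push_cast
    module
  refine ⟨ι₁ ⊕ ι₂, inferInstance,
    Sum.elim (fun i t => σ t + (t - t₀) ^ k * (μ + ν₁ i t))
      (fun i t => σ t + (t - t₀) ^ k * (μ + ν₂ i t)),
    Sum.elim (fun i t => s t (u₁ i t : E)) (fun i t => s t (u₂ i t : E)), ?_, ?_, ?_, ?_⟩
  · rw [Fintype.card_sum, d1, e1, hsum]
  · have hp : AnalyticAt ℝ (fun t : ℝ => (t - t₀) ^ k) t₀ := by fun_prop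
    rintro (i | i)
    · exact ⟨hσ.add (hp.mul (analyticAt_const.add (d2 i).1)),
        analyticAt_clm_apply_real hs (analyticAt_clm_const U.subtypeL (d2 i).2)⟩
    · exact ⟨hσ.add (hp.mul (analyticAt_const.add (e2 i).1)),
        analyticAt_clm_apply_real hs (analyticAt_clm_const W.subtypeL (e2 i).2)⟩
  · have l1 : LinearIndependent ℂ (fun i => (u₁ i t₀ : E)) :=
      d3.map' U.subtype (Submodule.ker_subtype _)
    have l2 : LinearIndependent ℂ (fun i => (u₂ i t₀ : E)) :=
      e3.map' W.subtype (Submodule.ker_subtype _)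
    have := l1.sum_type l2 (hc.disjoint.mono
      (Submodule.span_le.2 (by rintro _ ⟨i, rfl⟩; exact (u₁ i t₀).2))
      (Submodule.span_le.2 (by rintro _ ⟨i, rfl⟩; exact (u₂ i t₀).2)))
    refine Eq.mpr (congrArg (fun v => LinearIndependent ℂ v) (funext fun i => ?_)) this
    rcases i with i | i <;> simp [hs0]
  · filter_upwards [hTM, d4, e4, b6, c6] with t f1 f2 f3 f4 f5
    rintro (i | i)
    · refine hfin t _ _ f1 ?_
      rw [f4, f2 i]; simp
    · refine hfin t _ _ f1 ?_
      rw [f5, f3 i]; simp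

end FiniteDimensional

/-! ### Rellich's theorem at a nonzero eigenvalue of a compact operator. -/

section Compact

open Module

variable {H : Type} [NormedAddCommGroup H] [InnerProductSpace ℂ H] [CompleteSpace H]

/-- **Rellich's theorem** for an analytic family of symmetric operators, near a nonzero eigenvalue
of a compact member of the family. -/
theorem rellich_compact {T : ℝ → H →L[ℂ] H} {t₀ : ℝ} (hT : AnalyticAt ℝ T t₀)
    (hsymm : ∀ t, (T t).IsSymmetric) (hK : IsCompactOperator (T t₀)) {ν₀ : ℝ} (hν₀ : ν₀ ≠ 0) :
    ∃ (ι : Type) (_ : Fintype ι) (ν : ι → ℝ → ℝ) (u : ι → ℝ → H),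
      Fintype.card ι = finrank ℂ (End.eigenspace (T t₀).toLinearMap (ν₀ : ℂ)) ∧
      (∀ i, AnalyticAt ℝ (ν i) t₀ ∧ AnalyticAt ℝ (u i) t₀ ∧ ν i t₀ = ν₀) ∧
      LinearIndependent ℂ (fun i => u i t₀) ∧
      (∀ᶠ t in 𝓝 t₀, ∀ i, T t (u i t) = (ν i t : ℂ) • u i t) ∧
      ∃ ε > 0, ∀ᶠ t in 𝓝 t₀, ∀ ν' : ℝ, |ν' - ν₀| < ε → ∀ x, T t x = (ν' : ℂ) • x →
        x ∈ Submodule.span ℂ (Set.range fun i => u i t) := by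
  have hν₀' : (ν₀ : ℂ) ≠ 0 := by exact_mod_cast hν₀
  set U := End.eigenspace (T t₀).toLinearMap (ν₀ : ℂ) with hU
  have : FiniteDimensional ℂ U :=
    ContinuousLinearMap.finite_dimensional_eigenspace hK _ hν₀'
  have hmem : ∀ x, x ∈ U ↔ T t₀ x = (ν₀ : ℂ) • x := fun x => End.mem_eigenspace_iff
  let π : H →L[ℂ] U := U.orthogonalProjectionOnto
  let q : H →L[ℂ] H := U.subtypeL.comp π
  have hqU : ∀ x ∈ U, q x = x := fun x hx =>
    congrArg Subtype.val (Submodule.orthogonalProjectionOnto_mem_subspace_eq_self (K := U) ⟨x, hx⟩)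
  have hqmem : ∀ x, q x ∈ U := fun x => (π x).2
  have hqsymm : ∀ x y, ⟪q x, y⟫_ℂ = ⟪x, q y⟫_ℂ := fun x y =>
    Submodule.inner_starProjection_left_eq_right U x y
  let a : ℝ → H →L[ℂ] H := fun t => T t - (ν₀ : ℂ) • 1
  have haT : ∀ t x, a t x = T t x - (ν₀ : ℂ) • x := fun t x => by simp [a]
  have ha : AnalyticAt ℝ a t₀ := hT.sub analyticAt_const
  have hasymm : ∀ t x y, ⟪a t x, y⟫_ℂ = ⟪x, a t y⟫_ℂ := by
    intro t x y
    have h1 : ⟪T t x, y⟫_ℂ = ⟪x, T t y⟫_ℂ := hsymm t x y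
    rw [haT, haT, inner_sub_left, inner_sub_right, inner_smul_left, inner_smul_right,
      Complex.conj_ofReal, h1]
  have hq : q * q = q := by ext x; exact hqU _ (hqmem x)
  have haq : ∀ x, a t₀ (q x) = 0 := fun x => by
    rw [haT, (hmem _).1 (hqmem x), sub_self]
  have hqa : ∀ x, q (a t₀ x) = 0 := fun x => by
    refine ext_inner_right ℂ fun y => ?_
    rw [hqsymm, hasymm, haq, inner_zero_right, inner_zero_left]
  have h1 : q * a t₀ = 0 := by ext x; exact hqa x
  have h2 : a t₀ * q = 0 := by ext x; exact haq x
  -- Fredholm alternative for the compact operator `T t₀ + q`: an eigenvector for `ν₀` would have `q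
  -- x = 0`, hence lie in the eigenspace of `T t₀`, hence be `q x = 0`.
  have hunit : IsUnit (a t₀ + q) := by
    have hKq : IsCompactOperator (T t₀ + q : H →L[ℂ] H) := by
      have hq' : IsCompactOperator q :=
        have : ProperSpace U := FiniteDimensional.proper ℂ U
        (isCompactOperator_of_locallyCompactSpace_dom π).clm_comp U.subtypeL
      exact hK.add hq'
    rcases hKq.hasEigenvalue_or_mem_resolventSet hν₀' with h | h
    · exfalso
      obtain ⟨x, hx⟩ := h.exists_hasEigenvector
      have hx' : T t₀ x + q x = (ν₀ : ℂ) • x := hx.apply_eq_smul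
      have h3 : a t₀ x + q x = 0 := by rw [haT, ← hx']; abel
      have h4 : q x = 0 := by
        have := congrArg q h3
        rwa [map_add, hqa, hqU _ (hqmem x), zero_add, map_zero] at this
      have h5 : x ∈ U := by
        rw [hmem, ← hx', h4, add_zero]
      exact hx.2 (by rw [← hqU x h5, h4])
    · rw [spectrum.mem_resolventSet_iff, ← IsUnit.neg_iff] at h
      convert h using 1
      ext x
      simp [a]
      abel
  obtain ⟨s, n, hs, hn, hs0, hn0, hsn⟩ := exists_analytic_block_diagonal ha hq h1 h2 hunit
  have hsn1 : ∀ᶠ t in 𝓝 t₀, a t * s t = s t * n t := hsn.mono fun t h => h.1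
  have hcomm : ∀ᶠ t in 𝓝 t₀, ∀ x, n t (q x) = q (n t x) := hsn.mono fun t h x =>
    congrArg (fun T : H →L[ℂ] H => T x) h.2
  obtain ⟨N, G, b1, b2, b3, b4, b5, b6, b7⟩ := compress_block (g := fun _ => 1) hs hn hs0 hsn1
    continuousAt_const (Eventually.of_forall fun t x y => rfl)
    (Eventually.of_forall fun t x y => hasymm t x y)
    (fun x hx => by
      have := inner_self_eq_norm_sq (𝕜 := ℂ) x
      have h3 : (0 : ℝ) < ‖x‖ ^ 2 := by have := norm_pos_iff.2 hx; positivity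
      rw [← this] at h3
      exact h3)
    U π (by
      filter_upwards [hcomm] with t ht x
      have := ht x
      rw [hqU x x.2] at this
      exact this.symm)
  obtain ⟨ι, _, ν, u, d1, d2, d3, d4⟩ :=
    rellich_finiteDimensional _ U N G t₀ rfl b1 b2 b3 b4 b5
  have hN0 : ∀ x : U, N t₀ x = 0 := fun x => by
    rw [b7, hn0]
    have : a t₀ x = 0 := by rw [haT, (hmem _).1 x.2, sub_self]
    rw [this, map_zero]
  have hν0 : ∀ i, ν i t₀ = 0 := fun i => by
    have := d4.self_of_nhds i
    rw [hN0] at this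
    rcases smul_eq_zero.1 this.symm with h | h
    · exact_mod_cast h
    · exact absurd h (d3.ne_zero i)
  have hLI : ∀ᶠ t in 𝓝 t₀, LinearIndependent ℂ (fun i => u i t) := by
    have hc : ContinuousAt (fun t => fun i => u i t) t₀ :=
      continuousAt_pi.2 fun i => (d2 i).2.continuousAt
    exact hc.eventually d3.eventually
  refine ⟨ι, inferInstance, fun i t => ν₀ + ν i t, fun i t => s t (u i t), d1, fun i =>
    ⟨analyticAt_const.add (d2 i).1,
      analyticAt_clm_apply_real hs (analyticAt_clm_const U.subtypeL (d2 i).2), by simp [hν0]⟩,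
    ?_, ?_, ?_⟩
  · have := d3.map' U.subtype (Submodule.ker_subtype _)
    simpa [hs0] using! this
  · filter_upwards [d4, b6] with t e1 e2 i
    have h3 := e2 (u i t)
    rw [e1 i, haT, sub_eq_iff_eq_add] at h3
    rw [h3]
    push_cast
    simp only [map_smul, add_smul]
    exact add_comm _ _
  · have hsu : ∀ᶠ t in 𝓝 t₀, IsUnit (s t) := by
      refine hs.continuousAt.eventually (Units.isOpen.mem_nhds ?_)
      rw [hs0]; exact isUnit_one
    -- Invertibility of `n + q - (ν' - ν₀)` is open in `(t, ν')`. It forces every eigenvector of `n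
    -- t` with eigenvalue `ν' - ν₀` into `U`, because its component `y - q y` is annihilated by this
    -- operator.
    have hnu : ∀ᶠ p : ℝ × ℝ in 𝓝 t₀ ×ˢ 𝓝 ν₀,
        IsUnit (n p.1 + q - ((p.2 - ν₀ : ℝ) : ℂ) • (1 : H →L[ℂ] H)) := by
      rw [← nhds_prod_eq]
      have hc : ContinuousAt (fun p : ℝ × ℝ =>
          n p.1 + q - ((p.2 - ν₀ : ℝ) : ℂ) • (1 : H →L[ℂ] H)) (t₀, ν₀) := by
        have h3 : ContinuousAt (fun p : ℝ × ℝ => n p.1) (t₀, ν₀) :=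
          ContinuousAt.comp (f := Prod.fst) (g := n) (x := (t₀, ν₀)) hn.continuousAt
            continuousAt_fst
        have h4 : ContinuousAt (fun p : ℝ × ℝ =>
          ((p.2 - ν₀ : ℝ) : ℂ) • (1 : H →L[ℂ] H)) (t₀, ν₀) := by fun_prop
        exact (h3.add continuousAt_const).sub h4
      refine hc.eventually (Units.isOpen.mem_nhds ?_)
      simpa [hn0] using hunit
    obtain ⟨pa, hpa, pb, hpb, hp⟩ := eventually_prod_iff.1 hnu
    obtain ⟨ε, hε, hball⟩ := Metric.eventually_nhds_iff.1 hpb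
    refine ⟨ε, hε, ?_⟩
    filter_upwards [hsu, hpa, hsn1, hcomm, hLI] with t f1 f2 f3 f4 f5 ν' hν' x hx
    rw [ContinuousLinearMap.isUnit_iff_bijective] at f1
    obtain ⟨y, rfl⟩ := f1.2 x
    have hny : n t y = ((ν' - ν₀ : ℝ) : ℂ) • y := by
      refine f1.1 ?_
      have h3 : a t (s t y) = s t (n t y) := congrArg (fun T : H →L[ℂ] H => T y) f3
      rw [← h3, haT, hx, map_smul, ← sub_smul]
      push_cast; rfl
    have hu := hp f2 (hball (y := ν') (by simpa [Real.dist_eq] using hν'))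
    rw [ContinuousLinearMap.isUnit_iff_bijective] at hu
    have hz : y - q y = 0 := by
      refine hu.1 ?_
      have h3 : q (q y) = q y := hqU _ (hqmem y)
      simp only [sub_apply, add_apply, smul_apply, one_apply_eq_self, map_sub, f4, hny, h3,
        map_smul, map_zero]
      abel
    have hyU : y ∈ U := by rw [sub_eq_zero.1 hz]; exact hqmem y
    have htop := f5.span_eq_top_of_card_eq_finrank' d1
    have hy' : (⟨y, hyU⟩ : U) ∈ Submodule.span ℂ (Set.range fun i => u i t) := by
      rw [htop]; trivial
    have := Submodule.mem_map_of_mem (f := (s t).toLinearMap ∘ₗ U.subtype) hy'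
    rw [Submodule.map_span, ← Set.range_comp] at this
    exact this

end Compact

/-- The eigenvalues near `ν₀` are exhausted by the branches of Rellich's theorem. -/
theorem exists_eq_branch_of_mem_span {H : Type} [NormedAddCommGroup H]
    [InnerProductSpace ℂ H] {ι : Type} [Fintype ι] {T : H →L[ℂ] H} {ν : ι → ℝ} {u : ι → H}
    (hLI : LinearIndependent ℂ u) (hu : ∀ i, T (u i) = (ν i : ℂ) • u i) {ν' : ℝ} {x : H}
    (hx : T x = (ν' : ℂ) • x) (hmem : x ∈ Submodule.span ℂ (Set.range u)) (hx0 : x ≠ 0) :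
    ∃ c : ι → ℂ, x = ∑ i, c i • u i ∧ (∀ i, c i ≠ 0 → ν i = ν') ∧ ∃ i, c i ≠ 0 := by
  obtain ⟨c, rfl⟩ := (Submodule.mem_span_range_iff_exists_fun ℂ).1 hmem
  refine ⟨c, rfl, fun i hi => ?_, ?_⟩
  · have h1 : ∑ i, (c i * (ν i - ν' : ℂ)) • u i = 0 := by
      rw [map_sum, Finset.smul_sum, ← sub_eq_zero, ← Finset.sum_sub_distrib] at hx
      rw [← hx]
      refine Finset.sum_congr rfl fun i _ => ?_
      rw [map_smul, hu]
      module
    have h2 := Fintype.linearIndependent_iff.1 hLI _ h1 i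
    have h3 := (mul_eq_zero.1 h2).resolve_left hi
    exact_mod_cast sub_eq_zero.1 h3
  · by_contra! h
    exact hx0 (by simp [h])

/-! ### Counting eigenvalues of compact positive operators -/

section Counting

open Module

variable {H : Type} [NormedAddCommGroup H] [InnerProductSpace ℂ H]

/-- A compact symmetric operator with `⟪T x, x⟫ > 0` for all `x ≠ 0`. -/
structure IsCompactPos (T : H →L[ℂ] H) : Prop where
  symm : T.IsSymmetric
  compact : IsCompactOperator T
  pos : ∀ x, x ≠ 0 → 0 < (⟪T x, x⟫_ℂ).re

/-- The span of the eigenvectors of `T` with eigenvalue at least `ν`. -/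
def specSpace (T : H →L[ℂ] H) (ν : ℝ) : Submodule ℂ H :=
  ⨆ ν' : Set.Ici ν, End.eigenspace T.toLinearMap ((ν' : ℝ) : ℂ)

theorem eigenspace_le_specSpace (T : H →L[ℂ] H) {ν ν' : ℝ} (h : ν ≤ ν') :
    End.eigenspace T.toLinearMap (ν' : ℂ) ≤ specSpace T ν :=
  le_iSup (fun ν' : Set.Ici ν => End.eigenspace T.toLinearMap ((ν' : ℝ) : ℂ)) ⟨ν', h⟩

theorem specSpace_le_iff {T : H →L[ℂ] H} {ν : ℝ} {W : Submodule ℂ H} :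
    specSpace T ν ≤ W ↔ ∀ ν', ν ≤ ν' → End.eigenspace T.toLinearMap ((ν' : ℝ) : ℂ) ≤ W := by
  simp only [specSpace, iSup_le_iff, Subtype.forall, Set.mem_Ici]

theorem specSpace_antitone (T : H →L[ℂ] H) {ν ν' : ℝ} (h : ν ≤ ν') :
    specSpace T ν' ≤ specSpace T ν :=
  specSpace_le_iff.2 fun _ h' => eigenspace_le_specSpace T (h.trans h')

namespace IsCompactPos

variable {T : H →L[ℂ] H} (hT : IsCompactPos T)
include hT

/-- Such `x` is a finite sum of mutually orthogonal eigenvectors with eigenvalues at least `ν`. -/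
theorem inner_le_of_mem {ν : ℝ} {x : H} (hx : x ∈ specSpace T ν) :
    ν * ‖x‖ ^ 2 ≤ (⟪T x, x⟫_ℂ).re := by
  classical
  obtain ⟨f, hf, rfl⟩ := (Submodule.mem_iSup_iff_exists_finsupp _ _).1 hx
  have ho : OrthogonalFamily ℂ (fun ν' : Set.Ici ν => End.eigenspace T.toLinearMap ((ν' : ℝ) : ℂ))
      fun ν' => (End.eigenspace T.toLinearMap ((ν' : ℝ) : ℂ)).subtypeₗᵢ :=
    hT.symm.orthogonalFamily_eigenspaces.comp (γ := Set.Ici ν) (f := fun ν' => ((ν' : ℝ) : ℂ))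
      (fun a b h => Subtype.ext (Complex.ofReal_injective h))
  have h1 : T (f.sum fun _ x => x)
      = ∑ i ∈ f.support, (End.eigenspace T.toLinearMap ((i : ℝ) : ℂ)).subtypeₗᵢ
        (((i : ℝ) : ℂ) • ⟨f i, hf i⟩) := by
    rw [Finsupp.sum, map_sum]
    refine Finset.sum_congr rfl fun i _ => ?_
    exact End.mem_eigenspace_iff.1 (hf i)
  have h2 : (f.sum fun _ x => x)
      = ∑ i ∈ f.support, (End.eigenspace T.toLinearMap ((i : ℝ) : ℂ)).subtypeₗᵢ ⟨f i, hf i⟩ := rfl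
  have h3 : ‖f.sum fun _ x => x‖ ^ 2 = ∑ i ∈ f.support, ‖f i‖ ^ 2 := by
    rw [h2, ho.norm_sum]; rfl
  rw [h3, h1, h2, ho.inner_sum, Complex.re_sum, Finset.mul_sum]
  refine Finset.sum_le_sum fun i _ => ?_
  have h4 : ⟪(⟨f i, hf i⟩ : End.eigenspace T.toLinearMap ((i : ℝ) : ℂ)), ⟨f i, hf i⟩⟫_ℂ
      = ((‖f i‖ ^ 2 : ℝ) : ℂ) := by
    rw [inner_self_eq_norm_sq_to_K]; push_cast; rfl
  rw [inner_smul_left, h4, Complex.conj_ofReal, ← Complex.ofReal_mul, Complex.ofReal_re]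
  exact mul_le_mul_of_nonneg_right i.2 (sq_nonneg _)

theorem inner_eq_zero_of_lt {ν ν' : ℝ} (h : ν' < ν) {x y : H} (hx : T x = (ν' : ℂ) • x)
    (hy : y ∈ specSpace T ν) : ⟪x, y⟫_ℂ = 0 := by
  have : specSpace T ν ≤ (Submodule.span ℂ {x})ᗮ := by
    refine specSpace_le_iff.2 fun ν₁ h1 z hz => ?_
    rw [Submodule.mem_orthogonal_singleton_iff_inner_right]
    have hne : (ν' : ℂ) ≠ ν₁ := by
      intro h0; have : ν' = ν₁ := by exact_mod_cast h0
      linarith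
    exact hT.symm.orthogonalFamily_eigenspaces hne ⟨x, End.mem_eigenspace_iff.2 hx⟩ ⟨z, hz⟩
  exact (Submodule.mem_orthogonal_singleton_iff_inner_right).1 (this hy)

theorem eigenvalue_pos {μ : ℂ} {x : H} (hx0 : x ≠ 0) (hx : T x = μ • x) :
    0 < μ.re ∧ ((μ.re : ℝ) : ℂ) = μ := by
  have hev : End.HasEigenvalue T.toLinearMap μ :=
    End.hasEigenvalue_of_hasEigenvector (x := x) ⟨End.mem_eigenspace_iff.2 hx, hx0⟩
  have h2 : ((μ.re : ℝ) : ℂ) = μ := Complex.conj_eq_iff_re.1 (hT.symm.conj_eigenvalue_eq_self hev)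
  refine ⟨?_, h2⟩
  have h1 := hT.pos x hx0
  rw [hx, ← h2, inner_smul_left, inner_self_eq_norm_sq_to_K, Complex.conj_ofReal] at h1
  have h3 : (((μ.re : ℝ) : ℂ) * ((‖x‖ : ℂ)) ^ 2).re = μ.re * ‖x‖ ^ 2 := by
    rw [← Complex.ofReal_pow, ← Complex.ofReal_mul, Complex.ofReal_re]
  have h4 : 0 < μ.re * ‖x‖ ^ 2 := by rw [← h3]; exact h1
  exact pos_of_mul_pos_left h4 (sq_nonneg _)

variable [CompleteSpace H]

/-- The quadratic form bounds `T` below on the closure of the space, so `T` restricts to a closed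
embedding there. Compactness of `T` then makes the identity compact, and Riesz's theorem applies. -/
theorem finiteDimensional_specSpace {ν : ℝ} (hν : 0 < ν) :
    FiniteDimensional ℂ (specSpace T ν) := by
  let M := (specSpace T ν).topologicalClosure
  have hM : ∀ x ∈ M, ν * ‖x‖ ^ 2 ≤ (⟪T x, x⟫_ℂ).re := by
    have hcl : IsClosed {x : H | ν * ‖x‖ ^ 2 ≤ (⟪T x, x⟫_ℂ).re} :=
      isClosed_le (by fun_prop) (Complex.continuous_re.comp (T.continuous.inner continuous_id))
    intro x hx
    exact closure_minimal (fun y hy => hT.inner_le_of_mem hy) hcl hx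
  have : CompleteSpace M := (Submodule.isClosed_topologicalClosure _).completeSpace_coe
  let S : M →L[ℂ] H := T.comp M.subtypeL
  have hS : AntilipschitzWith (Real.toNNReal ν⁻¹) S := by
    refine AddMonoidHomClass.antilipschitz_of_bound S fun x => ?_
    rw [Real.coe_toNNReal _ (by positivity), inv_mul_eq_div, le_div_iff₀ hν]
    have h1 := hM x x.2
    have h2 : (⟪T x, x⟫_ℂ).re ≤ ‖T x‖ * ‖(x : H)‖ :=
      (Complex.re_le_norm _).trans (norm_inner_le_norm _ _)
    have h3 : ‖(x : H)‖ = ‖x‖ := rfl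
    have h4 : ‖S x‖ = ‖T x‖ := rfl
    rw [h3] at h1 h2
    rcases eq_or_lt_of_le (norm_nonneg x) with h0 | h0
    · rw [← h0]; simp
    · rw [h4]; nlinarith
  obtain ⟨K, hK, hKn⟩ := hT.compact
  have hid : IsCompactOperator (id : M → M) := by
    refine ⟨S ⁻¹' K, (hS.isClosedEmbedding S.uniformContinuous).isCompact_preimage hK, ?_⟩
    exact M.subtypeL.continuous.continuousAt.preimage_mem_nhds (x := 0) (t := T ⁻¹' K)
      (by rw [map_zero]; exact hKn)
  have : FiniteDimensional ℂ M := FiniteDimensional.of_isCompactOperator_id hid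
  exact Submodule.finiteDimensional_of_le (Submodule.le_topologicalClosure _)

/-- `T` restricts to the orthogonal complement. A nonzero compact symmetric operator attains its
norm as the modulus of an eigenvalue, here a positive one; were it at least `ν`, the eigenvector
would already lie in `specSpace T ν`. The strict gap `ρ < ν` is used for the attainment of suprema
in `nuBand_spec`. -/
theorem exists_bound_orthogonal {ν : ℝ} (hν : 0 < ν) :
    ∃ ρ, ρ < ν ∧ ∀ x ∈ (specSpace T ν)ᗮ, (⟪T x, x⟫_ℂ).re ≤ ρ * ‖x‖ ^ 2 := by
  obtain ⟨M, hM⟩ : ∃ M, M = (specSpace T ν)ᗮ := ⟨_, rfl⟩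
  rw [← hM]
  have : CompleteSpace M := by rw [hM]; infer_instance
  have hinv : ∀ x ∈ M, T x ∈ M := by
    intro x hx
    rw [hM, Submodule.mem_orthogonal] at hx ⊢
    intro y hy
    have h1 : ⟪y, T x⟫_ℂ = ⟪T y, x⟫_ℂ := (hT.symm y x).symm
    rw [h1]
    refine hx _ (?_ : T y ∈ specSpace T ν)
    have : specSpace T ν ≤ (specSpace T ν).comap T.toLinearMap := by
      refine specSpace_le_iff.2 fun ν' h z hz => ?_
      have hz' : T z = (ν' : ℂ) • z := End.mem_eigenspace_iff.1 hz
      show T z ∈ specSpace T ν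
      rw [hz']
      exact Submodule.smul_mem _ _ (eigenspace_le_specSpace T h hz)
    exact this hy
  let S : M →L[ℂ] M := T.restrict hinv
  have hSx : ∀ x : M, ((S x : M) : H) = T x := fun x => rfl
  have hSc : IsCompactOperator S := hT.compact.restrict' hinv
  have hSs : S.IsSymmetric := hT.symm.restrict_invariant hinv
  have hb : ∀ x ∈ M, (⟪T x, x⟫_ℂ).re ≤ ‖S‖ * ‖x‖ ^ 2 := by
    intro x hx
    have h1 : (⟪T x, x⟫_ℂ).re ≤ ‖T x‖ * ‖x‖ :=
      (Complex.re_le_norm _).trans (norm_inner_le_norm _ _)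
    have h2 : ‖T x‖ ≤ ‖S‖ * ‖x‖ := S.le_opNorm ⟨x, hx⟩
    nlinarith [norm_nonneg x]
  by_cases hS0 : S = 0
  · refine ⟨0, hν, fun x hx => ?_⟩
    have : T x = 0 := by rw [← hSx ⟨x, hx⟩, hS0]; rfl
    simp [this]
  refine ⟨‖S‖, ?_, hb⟩
  have : Nontrivial M := by
    by_contra h
    rw [not_nontrivial_iff_subsingleton] at h
    exact hS0 (ContinuousLinearMap.ext fun x => Subsingleton.elim _ _)
  obtain ⟨k, hk, hk'⟩ := spectrum.exists_nnnorm_eq_spectralRadius S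
  rw [S.spectralRadius_eq_nnnorm hSs.isSelfAdjoint] at hk'
  have hkS : ‖k‖ = ‖S‖ := by
    have : ‖k‖₊ = ‖S‖₊ := by exact_mod_cast hk'
    exact congrArg NNReal.toReal this
  have hk0 : k ≠ 0 := by
    rintro rfl
    rw [norm_zero] at hkS
    refine hS0 (ContinuousLinearMap.ext fun x => ?_)
    have := S.le_opNorm x
    rw [← hkS, zero_mul] at this
    exact norm_le_zero_iff.1 this
  have hev := (hSc.hasEigenvalue_iff_mem_spectrum hk0).2 hk
  obtain ⟨x, hx⟩ := hev.exists_hasEigenvector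
  have hx1 : S x = k • x := hx.apply_eq_smul
  have hx' : T x = k • (x : H) := by rw [← hSx, hx1]; rfl
  have hx0 : (x : H) ≠ 0 := fun h => hx.2 (Subtype.ext h)
  obtain ⟨hp, hr⟩ := hT.eigenvalue_pos hx0 hx'
  rw [← hkS, ← hr, Complex.norm_of_nonneg hp.le]
  by_contra! hle
  have h1 : (x : H) ∈ specSpace T ν :=
    eigenspace_le_specSpace T hle (by rw [End.mem_eigenspace_iff, hr]; exact hx')
  have hxM : (x : H) ∈ (specSpace T ν)ᗮ := by rw [← hM]; exact x.2
  have h2 := (Submodule.mem_orthogonal _ _).1 hxM x h1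
  exact hx0 (inner_self_eq_zero.1 h2)

/-- The variational bound for the number of eigenvalues `≥ ν`. -/
theorem exists_finrank_le {ν : ℝ} (hν : 0 < ν) :
    ∃ ρ, ρ < ν ∧ ∀ (L : Submodule ℂ H) [FiniteDimensional ℂ L] (c : ℝ), ρ < c →
      (∀ x ∈ L, c * ‖x‖ ^ 2 ≤ (⟪T x, x⟫_ℂ).re) → finrank ℂ L ≤ finrank ℂ (specSpace T ν) := by
  obtain ⟨ρ, hρ, hb⟩ := hT.exists_bound_orthogonal hν
  have := hT.finiteDimensional_specSpace hν
  refine ⟨ρ, hρ, fun L _ c hc hL => ?_⟩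
  by_contra! hlt
  let P : L →ₗ[ℂ] specSpace T ν :=
    (specSpace T ν).orthogonalProjectionOnto.toLinearMap ∘ₗ L.subtype
  -- A larger `L` contains a nonzero vector orthogonal to `specSpace T ν`, where the form is at most
  -- `ρ` and, by assumption, at least `c > ρ`.
  obtain ⟨x, hx, hx0⟩ := (Submodule.ne_bot_iff _).1 (LinearMap.ker_ne_bot_of_finrank_lt (f := P) hlt)
  have h1 : (x : H) ∈ (specSpace T ν)ᗮ :=
    Submodule.orthogonalProjectionOnto_eq_zero_iff.1 hx
  have h2 := hb x h1
  have h3 := hL x x.2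
  have h4 : 0 < ‖(x : H)‖ := norm_pos_iff.2 fun h => hx0 (Subtype.ext h)
  have h5 : 0 < ‖(x : H)‖ ^ 2 := by positivity
  nlinarith

/-- Weyl's inequality in terms of counting functions: on `specSpace T ν` the form of `T'` is at
least `ν - ‖T - T'‖`. -/
theorem finrank_specSpace_le {T' : H →L[ℂ] H} (hT' : IsCompactPos T') {ν ν' : ℝ} (hν' : 0 < ν')
    (h : ‖T - T'‖ ≤ ν - ν') :
    finrank ℂ (specSpace T ν) ≤ finrank ℂ (specSpace T' ν') := by
  obtain ⟨ρ, hρ, hb⟩ := hT'.exists_finrank_le hν'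
  have hνν : 0 < ν := by linarith [norm_nonneg (T - T')]
  have := hT.finiteDimensional_specSpace hνν
  refine hb _ ν' hρ fun x hx => ?_
  have h1 := hT.inner_le_of_mem hx
  have h2 : (⟪T x, x⟫_ℂ).re - (⟪T' x, x⟫_ℂ).re ≤ ‖T - T'‖ * ‖x‖ ^ 2 := by
    rw [← Complex.sub_re, ← inner_sub_left]
    calc _ ≤ ‖T x - T' x‖ * ‖x‖ := (Complex.re_le_norm _).trans (norm_inner_le_norm _ _)
      _ ≤ (‖T - T'‖ * ‖x‖) * ‖x‖ := by
        gcongr; exact (T - T').le_opNorm x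
      _ = _ := by ring
  nlinarith [sq_nonneg ‖x‖]

/-- On the unit sphere of an `n`-dimensional subspace the form attains a positive minimum, which
serves as `ν` in the variational bound. -/
theorem exists_le_finrank (hinf : ¬ FiniteDimensional ℂ H) (n : ℕ) :
    ∃ ν, 0 < ν ∧ n ≤ finrank ℂ (specSpace T ν) := by
  rcases Nat.eq_zero_or_pos n with rfl | hn
  · exact ⟨1, one_pos, Nat.zero_le _⟩
  have hrank : (n : Cardinal) ≤ Module.rank ℂ H := by
    have : Cardinal.aleph0 ≤ Module.rank ℂ H := by
      by_contra! h
      exact hinf (Module.rank_lt_aleph0_iff.1 h)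
    exact (Cardinal.natCast_lt_aleph0).le.trans this
  obtain ⟨s, hs, hli⟩ := le_rank_iff_exists_linearIndependent_finset.1 hrank
  let L := Submodule.span ℂ (s : Set H)
  have hL : finrank ℂ L = n := by rw [finrank_span_finset_eq_card hli, hs]
  have hLf : FiniteDimensional ℂ L := FiniteDimensional.span_finset ℂ s
  have : ProperSpace L := FiniteDimensional.proper ℂ L
  have : Nontrivial L := nontrivial_of_finrank_pos (R := ℂ) (by omega)
  have hne : (Metric.sphere (0 : L) 1).Nonempty := by
    obtain ⟨x, hx⟩ := exists_norm_eq L zero_le_one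
    exact ⟨x, by simpa using hx⟩
  obtain ⟨x₀, hx₀, hmin⟩ := (isCompact_sphere (0 : L) 1).exists_isMinOn hne
    (f := fun x : L => (⟪T x, x⟫_ℂ).re) (Complex.continuous_re.comp
      ((T.continuous.comp continuous_subtype_val).inner continuous_subtype_val)).continuousOn
  have hx₀' : ‖(x₀ : H)‖ = 1 := by simpa using hx₀
  set c := (⟪T x₀, x₀⟫_ℂ).re with hc
  have hcpos : 0 < c := hT.pos _ (by rw [← norm_pos_iff, hx₀']; exact one_pos)
  obtain ⟨ρ, hρ, hb⟩ := hT.exists_finrank_le hcpos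
  refine ⟨c, hcpos, ?_⟩
  rw [← hL]
  refine hb L c hρ fun x hx => ?_
  by_cases hx0 : x = 0
  · simp [hx0]
  have hnx : 0 < ‖x‖ := norm_pos_iff.2 hx0
  have h1 := hmin (a := ((‖x‖⁻¹ : ℝ) : ℂ) • (⟨x, hx⟩ : L)) (by
    have h1 : ‖(⟨x, hx⟩ : L)‖ = ‖x‖ := rfl
    rw [mem_sphere_zero_iff_norm, norm_smul, h1, Complex.norm_real, norm_inv, norm_norm,
      inv_mul_cancel₀ hnx.ne'])
  have h2 : c ≤ (⟪T (((‖x‖⁻¹ : ℝ) : ℂ) • x), ((‖x‖⁻¹ : ℝ) : ℂ) • x⟫_ℂ).re := h1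
  rw [map_smul, inner_smul_left, inner_smul_right, Complex.conj_ofReal, ← mul_assoc,
    ← Complex.ofReal_mul, Complex.re_ofReal_mul] at h2
  calc c * ‖x‖ ^ 2 ≤ (‖x‖⁻¹ * ‖x‖⁻¹ * (⟪T x, x⟫_ℂ).re) * ‖x‖ ^ 2 := by gcongr
    _ = (⟪T x, x⟫_ℂ).re := by field_simp

theorem finite_eigenvalues {ν : ℝ} (hν : 0 < ν) :
    {ν' : ℝ | ν ≤ ν' ∧ End.eigenspace T.toLinearMap (ν' : ℂ) ≠ ⊥}.Finite := by
  have := hT.finiteDimensional_specSpace hν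
  set s := {ν' : ℝ | ν ≤ ν' ∧ End.eigenspace T.toLinearMap (ν' : ℂ) ≠ ⊥}
  have hv : ∀ i : s, ∃ v, End.HasEigenvector T.toLinearMap ((i : ℝ) : ℂ) v := fun i => by
    obtain ⟨v, h1, h2⟩ := (Submodule.ne_bot_iff _).1 i.2.2
    exact ⟨v, h1, h2⟩
  choose v hv using hv
  have hli := End.eigenvectors_linearIndependent' T.toLinearMap (fun i : s => ((i : ℝ) : ℂ))
    (fun a b h => Subtype.ext (Complex.ofReal_injective h)) v hv
  let w : s → specSpace T ν := fun i => ⟨v i, eigenspace_le_specSpace T i.2.1 (hv i).1⟩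
  have hw : LinearIndependent ℂ w := LinearIndependent.of_comp (specSpace T ν).subtype hli
  have : Finite s := hw.finite
  exact Set.toFinite s

theorem exists_min_eigenvalue {ν : ℝ} (hν : 0 < ν) (h : specSpace T ν ≠ ⊥) :
    ∃ ν₀, ν ≤ ν₀ ∧ End.eigenspace T.toLinearMap (ν₀ : ℂ) ≠ ⊥ ∧ specSpace T ν = specSpace T ν₀ := by
  have hfin := hT.finite_eigenvalues hν
  have hne : {ν' : ℝ | ν ≤ ν' ∧ End.eigenspace T.toLinearMap (ν' : ℂ) ≠ ⊥}.Nonempty := by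
    by_contra hem
    rw [Set.not_nonempty_iff_eq_empty] at hem
    refine h (le_bot_iff.1 (specSpace_le_iff.2 fun ν' h1 => le_bot_iff.2 ?_))
    by_contra h2
    have : ν' ∈ {ν' : ℝ | ν ≤ ν' ∧ End.eigenspace T.toLinearMap (ν' : ℂ) ≠ ⊥} := ⟨h1, h2⟩
    rw [hem] at this
    exact this
  obtain ⟨ν₀, hmem, hmin⟩ := Set.exists_min_image _ id hfin hne
  refine ⟨ν₀, hmem.1, hmem.2, le_antisymm (specSpace_le_iff.2 fun ν' h1 => ?_)
    (specSpace_antitone T hmem.1)⟩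
  by_cases h2 : End.eigenspace T.toLinearMap (ν' : ℂ) = ⊥
  · rw [h2]; exact bot_le
  · exact eigenspace_le_specSpace T (hmin ν' ⟨h1, h2⟩)

/-- Eigenvalues do not accumulate at `ν > 0`, so `ν₀` can be the next one above `ν`. -/
theorem exists_specSpace_eq_sup {ν : ℝ} (hν : 0 < ν) :
    ∃ ν₀, ν < ν₀ ∧ specSpace T ν = specSpace T ν₀ ⊔ End.eigenspace T.toLinearMap (ν : ℂ) := by
  have hfin : {ν' : ℝ | ν < ν' ∧ End.eigenspace T.toLinearMap (ν' : ℂ) ≠ ⊥}.Finite :=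
    (hT.finite_eigenvalues hν).subset fun x hx => ⟨hx.1.le, hx.2⟩
  obtain ⟨ν₀, h0, hmin⟩ : ∃ ν₀, ν < ν₀ ∧ ∀ ν', ν < ν' →
      End.eigenspace T.toLinearMap (ν' : ℂ) ≠ ⊥ → ν₀ ≤ ν' := by
    rcases Set.eq_empty_or_nonempty
      {ν' : ℝ | ν < ν' ∧ End.eigenspace T.toLinearMap (ν' : ℂ) ≠ ⊥} with hem | hne
    · refine ⟨ν + 1, by linarith, fun ν' h1 h2 => ?_⟩
      have : ν' ∈ {ν' : ℝ | ν < ν' ∧ End.eigenspace T.toLinearMap (ν' : ℂ) ≠ ⊥} := ⟨h1, h2⟩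
      rw [hem] at this
      exact this.elim
    · obtain ⟨ν₀, hmem, hmin⟩ := Set.exists_min_image _ id hfin hne
      exact ⟨ν₀, hmem.1, fun ν' h1 h2 => hmin ν' ⟨h1, h2⟩⟩
  refine ⟨ν₀, h0, le_antisymm (specSpace_le_iff.2 fun ν' h1 => ?_)
    (sup_le (specSpace_antitone T h0.le) (eigenspace_le_specSpace T le_rfl))⟩
  by_cases h2 : End.eigenspace T.toLinearMap (ν' : ℂ) = ⊥
  · rw [h2]; exact bot_le
  · rcases h1.eq_or_lt with rfl | h1
    · exact le_sup_right
    · exact (eigenspace_le_specSpace T (hmin _ h1 h2)).trans le_sup_left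

end IsCompactPos
end Counting

/-! ### Continuation of simple branches -/

section Continuation

open Module

variable {H : Type} [NormedAddCommGroup H] [InnerProductSpace ℂ H]

/-- `ν` is near `t` a real-analytic positive eigenvalue of the family `T` with an analytic
eigenvector, and it is a simple eigenvalue at all parameters `≠ t` close to `t`. -/
structure SimpleBranchAt (T : ℝ → H →L[ℂ] H) (ν : ℝ → ℝ) (t : ℝ) : Prop where
  analytic : AnalyticAt ℝ ν t
  pos : 0 < ν t
  vec : ∃ u : ℝ → H, AnalyticAt ℝ u t ∧ u t ≠ 0 ∧ ∀ᶠ s in 𝓝 t, T s (u s) = (ν s : ℂ) • u s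
  simple : ∀ᶠ s in 𝓝[≠] t, ∀ x y, T s x = (ν s : ℂ) • x → T s y = (ν s : ℂ) • y → x ≠ 0 →
    ∃ c : ℂ, y = c • x

theorem eventually_eventually_nhdsNE {p : ℝ → Prop} {t : ℝ} (h : ∀ᶠ s in 𝓝[≠] t, p s) :
    ∀ᶠ s in 𝓝 t, ∀ᶠ r in 𝓝[≠] s, p r := by
  have h1 := eventually_eventually_nhds.2 (eventually_nhdsWithin_iff.1 h)
  filter_upwards [h1] with s hs
  by_cases hst : s = t
  · rw [hst]; exact h
  · filter_upwards [hs.filter_mono nhdsWithin_le_nhds,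
      mem_nhdsWithin_of_mem_nhds (isOpen_ne.mem_nhds hst)] with r h2 h3
    exact h2 h3

namespace SimpleBranchAt

variable {T : ℝ → H →L[ℂ] H} {ν ν' : ℝ → ℝ} {t : ℝ}

theorem congr (h : SimpleBranchAt T ν t) (he : ν =ᶠ[𝓝 t] ν') : SimpleBranchAt T ν' t := by
  obtain ⟨u, hu, hu0, hev⟩ := h.vec
  refine ⟨h.analytic.congr he, he.eq_of_nhds ▸ h.pos, ⟨u, hu, hu0, ?_⟩, ?_⟩
  · filter_upwards [hev, he] with s h1 h2
    rw [h1, h2]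
  · filter_upwards [h.simple, he.filter_mono nhdsWithin_le_nhds] with s h1 h2
    rw [← h2]; exact h1

theorem eventually [CompleteSpace H] (h : SimpleBranchAt T ν t) : ∀ᶠ s in 𝓝 t, SimpleBranchAt T ν s := by
  obtain ⟨u, hu, hu0, hev⟩ := h.vec
  filter_upwards [h.analytic.eventually_analyticAt, h.analytic.continuousAt.eventually
    (lt_mem_nhds h.pos), hu.eventually_analyticAt, hu.continuousAt.eventually_ne hu0,
    eventually_eventually_nhds.2 hev, eventually_eventually_nhdsNE h.simple] with s a1 a2 a3 a4 a5 a6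
  exact ⟨a1, a2, ⟨u, a3, a4, a5⟩, a6⟩

theorem comp_neg (h : SimpleBranchAt T ν t) :
    SimpleBranchAt (fun s => T (-s)) (fun s => ν (-s)) (-t) := by
  obtain ⟨u, hu, hu0, hev⟩ := h.vec
  have hneg : Tendsto (fun s : ℝ => -s) (𝓝 (-t)) (𝓝 t) := by
    have := (continuous_neg (G := ℝ)).tendsto (-t); rwa [neg_neg] at this
  have han : AnalyticAt ℝ (fun s : ℝ => -s) (-t) := analyticAt_id.neg
  refine ⟨?_, by simpa using h.pos, ⟨fun s => u (-s), ?_, by simpa using hu0, hneg.eventually hev⟩,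
    ?_⟩
  · exact AnalyticAt.comp (g := ν) (f := fun s : ℝ => -s) (by simpa using h.analytic) han
  · exact AnalyticAt.comp (g := u) (f := fun s : ℝ => -s) (by simpa using hu) han
  · have : Tendsto (fun s : ℝ => -s) (𝓝[≠] (-t)) (𝓝[≠] t) := by
      refine tendsto_nhdsWithin_of_tendsto_nhds_of_eventually_within _
        (hneg.mono_left nhdsWithin_le_nhds) ?_
      filter_upwards [self_mem_nhdsWithin] with s hs h0
      exact hs (by rw [← h0, neg_neg]; rfl)
    exact this.eventually h.simple

/-- Two continuous eigenvectors along a simple branch are parallel. -/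
theorem parallel (h : SimpleBranchAt T ν t) {u w : ℝ → H} (hu : ContinuousAt u t)
    (hw : ContinuousAt w t) (hu0 : u t ≠ 0) (hw0 : w t ≠ 0)
    (hue : ∀ᶠ s in 𝓝 t, T s (u s) = (ν s : ℂ) • u s)
    (hwe : ∀ᶠ s in 𝓝 t, T s (w s) = (ν s : ℂ) • w s) : ∃ c : ℂ, c ≠ 0 ∧ w t = c • u t := by
  -- At `t` itself the eigenvalue may be multiple. The relation expresses parallelism without
  -- division, holds at nearby parameters by simplicity, and passes to the limit.
  have hlim : ⟪u t, u t⟫_ℂ • w t = ⟪u t, w t⟫_ℂ • u t := by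
    refine tendsto_nhds_unique_of_eventuallyEq (l := 𝓝[≠] t)
      (((hu.inner (𝕜 := ℂ) hu).smul hw).tendsto.mono_left nhdsWithin_le_nhds)
      (((hu.inner (𝕜 := ℂ) hw).smul hu).tendsto.mono_left nhdsWithin_le_nhds) ?_
    filter_upwards [h.simple, hue.filter_mono nhdsWithin_le_nhds,
      hwe.filter_mono nhdsWithin_le_nhds,
      (hu.eventually_ne hu0).filter_mono nhdsWithin_le_nhds] with s h1 h2 h3 h4
    obtain ⟨c, hc⟩ := h1 _ _ h2 h3 h4
    simp only [Pi.smul_apply', hc, inner_smul_right]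
    rw [smul_smul, mul_comm]
  have hne : ⟪u t, u t⟫_ℂ ≠ 0 := inner_self_ne_zero.2 hu0
  have hw' : w t = (⟪u t, w t⟫_ℂ / ⟪u t, u t⟫_ℂ) • u t := by
    rw [div_eq_inv_mul, mul_smul, ← hlim, inv_smul_smul₀ hne]
  refine ⟨_, fun h0 => hw0 ?_, hw'⟩
  rw [hw', h0, zero_smul]

/-- Hellmann-Feynman bound for the derivative of an eigenvalue. -/
theorem abs_deriv_le (h : SimpleBranchAt T ν t) (hsymm : ∀ t, (T t).IsSymmetric)
    (hT : AnalyticAt ℝ T t) {C : ℝ}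
    (hC : ∀ (ν : ℝ) (u : H), T t u = (ν : ℂ) • u → |(⟪u, deriv T t u⟫_ℂ).re| ≤ C * ν * ‖u‖ ^ 2) :
    |deriv ν t| ≤ C * ν t := by
  obtain ⟨u, hu, hu0, hev⟩ := h.vec
  have hu' := hu.differentiableAt.hasDerivAt
  have hν' := h.analytic.differentiableAt.hasDerivAt
  have hT' : HasDerivAt (fun s => (T s).restrictScalars ℝ) ((deriv T t).restrictScalars ℝ) t :=
    (ContinuousLinearMap.restrictScalarsL ℂ H H ℝ ℝ).hasFDerivAt.comp_hasDerivAt t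
      hT.differentiableAt.hasDerivAt
  have h1 := hT'.clm_apply hu'
  have h2 : HasDerivAt (fun s => ν s • u s) (ν t • deriv u t + deriv ν t • u t) t := hν'.smul hu'
  have h3 : (fun s => (T s).restrictScalars ℝ (u s)) =ᶠ[𝓝 t] fun s => ν s • u s := by
    filter_upwards [hev] with s hs
    exact hs.trans (Complex.coe_smul _ _)
  -- Derivative of the eigenvalue equation; pairing it with `u t` cancels the unknown `deriv u t`,
  -- by symmetry of `T t`.
  have h4 : deriv T t (u t) + T t (deriv u t) = ν t • deriv u t + deriv ν t • u t :=
    h1.unique (h2.congr_of_eventuallyEq h3)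
  have h5 : ⟪u t, T t (deriv u t)⟫_ℂ = (ν t : ℂ) * ⟪u t, deriv u t⟫_ℂ := by
    have : ⟪T t (u t), deriv u t⟫_ℂ = ⟪u t, T t (deriv u t)⟫_ℂ := hsymm t _ _
    rw [← this, hev.self_of_nhds, inner_smul_left, Complex.conj_ofReal]
  have h6 := congrArg (fun x => ⟪u t, x⟫_ℂ) h4
  simp only [inner_add_right, h5, ← Complex.coe_smul, inner_smul_right] at h6
  have h7 : ⟪u t, deriv T t (u t)⟫_ℂ = ((deriv ν t : ℝ) : ℂ) * ⟪u t, u t⟫_ℂ := by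
    linear_combination h6
  have h8 := hC _ _ hev.self_of_nhds
  have h9 : ⟪u t, u t⟫_ℂ = ((‖u t‖ ^ 2 : ℝ) : ℂ) := by
    rw [inner_self_eq_norm_sq_to_K]; push_cast; rfl
  rw [h7, h9, ← Complex.ofReal_mul, Complex.ofReal_re, abs_mul, abs_of_nonneg (sq_nonneg ‖u t‖)]
    at h8
  have h10 : 0 < ‖u t‖ ^ 2 := by have := norm_pos_iff.2 hu0; positivity
  exact le_of_mul_le_mul_right h8 h10

end SimpleBranchAt

/-- A branch of Rellich's theorem that differs from all the others is a simple branch. -/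
theorem simpleBranchAt_of_branches {T : ℝ → H →L[ℂ] H} {t₀ ν₀ : ℝ} (hν₀ : 0 < ν₀) {ι : Type}
    [Fintype ι] {ν : ι → ℝ → ℝ} {u : ι → ℝ → H}
    (han : ∀ i, AnalyticAt ℝ (ν i) t₀ ∧ AnalyticAt ℝ (u i) t₀ ∧ ν i t₀ = ν₀)
    (hLI : LinearIndependent ℂ (fun i => u i t₀))
    (heig : ∀ᶠ t in 𝓝 t₀, ∀ i, T t (u i t) = (ν i t : ℂ) • u i t)
    {ε : ℝ} (hε : 0 < ε) (hex : ∀ᶠ t in 𝓝 t₀, ∀ ν' : ℝ, |ν' - ν₀| < ε → ∀ x, T t x = (ν' : ℂ) • x →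
        x ∈ Submodule.span ℂ (Set.range fun i => u i t))
    (i : ι) (hi : ∀ j, j ≠ i → ∀ᶠ t in 𝓝[≠] t₀, ν j t ≠ ν i t) :
    SimpleBranchAt T (ν i) t₀ := by
  have hLI' : ∀ᶠ t in 𝓝 t₀, LinearIndependent ℂ (fun i => u i t) := by
    have hc : ContinuousAt (fun t => fun i => u i t) t₀ :=
      continuousAt_pi.2 fun i => (han i).2.1.continuousAt
    exact hc.eventually hLI.eventually
  refine ⟨(han i).1, by rw [(han i).2.2]; exact hν₀, ⟨u i, (han i).2.1, hLI.ne_zero i,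
    heig.mono fun t h => h i⟩, ?_⟩
  have hi' : ∀ᶠ t in 𝓝[≠] t₀, ∀ j, j ≠ i → ν j t ≠ ν i t := by
    rw [eventually_all]; intro j
    by_cases hj : j = i
    · simp [hj]
    · filter_upwards [hi j hj] with t ht _ using ht
  have hclose : ∀ᶠ t in 𝓝 t₀, |ν i t - ν₀| < ε := by
    have : ContinuousAt (fun t => |ν i t - ν₀|) t₀ := ((han i).1.continuousAt.sub
      continuousAt_const).abs
    refine this.eventually (gt_mem_nhds ?_)
    simpa [(han i).2.2] using hε
  filter_upwards [hi', hLI'.filter_mono nhdsWithin_le_nhds, heig.filter_mono nhdsWithin_le_nhds,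
    hex.filter_mono nhdsWithin_le_nhds, hclose.filter_mono nhdsWithin_le_nhds] with s a1 a2 a3 a4 a5
  -- An eigenvector only involves branches with its own eigenvalue, and at `s` no other branch takes
  -- the value `ν i s`.
  have key : ∀ x, x ≠ 0 → T s x = (ν i s : ℂ) • x → ∃ c : ℂ, c ≠ 0 ∧ x = c • u i s := by
    intro x hx0 hx
    obtain ⟨c, h1, h2, j, hj⟩ := exists_eq_branch_of_mem_span a2 a3 hx (a4 _ a5 _ hx) hx0
    have h3 : ∀ j, j ≠ i → c j = 0 := fun j hji => by
      by_contra h; exact a1 j hji (h2 j h)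
    have hji : j = i := by by_contra h; exact hj (h3 j h)
    refine ⟨c i, hji ▸ hj, ?_⟩
    rw [h1]
    exact Finset.sum_eq_single i (fun j _ hji => by rw [h3 j hji, zero_smul]) (by simp)
  intro x y hx hy hx0
  by_cases hy0 : y = 0
  · exact ⟨0, by simp [hy0]⟩
  obtain ⟨c, hc, hxc⟩ := key x hx0 hx
  obtain ⟨d, hd, hyd⟩ := key y hy0 hy
  exact ⟨d * c⁻¹, by rw [hyd, hxc, smul_smul, mul_assoc, inv_mul_cancel₀ hc, mul_one]⟩

variable [CompleteSpace H] {T : ℝ → H →L[ℂ] H}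

/-- A simple branch on `[0, a)` extends to `[0, a]`. -/
theorem exists_simpleBranch_closed (hT : ∀ t, AnalyticAt ℝ T t) (hcp : ∀ t, IsCompactPos (T t))
    {a C : ℝ} (ha : 0 < a)
    (hC : ∀ t ∈ Set.Ico 0 a, ∀ (ν : ℝ) (u : H), T t u = (ν : ℂ) • u →
      |(⟪u, deriv T t u⟫_ℂ).re| ≤ C * ν * ‖u‖ ^ 2) {N : ℝ → ℝ}
    (hN : ∀ t ∈ Set.Ico 0 a, SimpleBranchAt T N t) :
    ∃ N', (∀ t < a, N' =ᶠ[𝓝 t] N) ∧ SimpleBranchAt T N' a := by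
  have hsymm : ∀ t, (T t).IsSymmetric := fun t => (hcp t).symm
  have hder : ∀ t ∈ Set.Ico 0 a, |deriv N t| ≤ C * N t := fun t ht =>
    (hN t ht).abs_deriv_le hsymm (hT t) (hC t ht)
  have hdiff : ∀ t ∈ Set.Ico 0 a, HasDerivAt N (deriv N t) t := fun t ht =>
    (hN t ht).analytic.differentiableAt.hasDerivAt
  have hC0 : 0 ≤ C := by
    have h1 := hder 0 ⟨le_rfl, ha⟩
    have h2 := (hN 0 ⟨le_rfl, ha⟩).pos
    by_contra! h
    have := abs_nonneg (deriv N 0)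
    nlinarith
  -- Grönwall: for `σ = 1` and `σ = -1` the inequality `|N'| ≤ C N` gives lower and upper
  -- exponential bounds, which keep `N` away from `0`, where compactness would be of no use.
  have hmono : ∀ σ : ℝ, |σ| = 1 → MonotoneOn (fun t => σ * (N t * Real.exp (σ * C * t)))
      (Set.Ico 0 a) := by
    intro σ hσ
    have hd : ∀ t ∈ Set.Ico 0 a, HasDerivAt (fun t => σ * (N t * Real.exp (σ * C * t)))
        (σ * (deriv N t * Real.exp (σ * C * t) + N t * (Real.exp (σ * C * t) * (σ * C)))) t := by
      intro t ht
      have h1 : HasDerivAt (fun t => Real.exp (σ * C * t)) (Real.exp (σ * C * t) * (σ * C)) t := by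
        have := ((hasDerivAt_id t).const_mul (σ * C)).exp
        simpa using this
      exact ((hdiff t ht).mul h1).const_mul σ
    refine monotoneOn_of_deriv_nonneg (convex_Ico 0 a)
      (fun t ht => (hd t ht).continuousAt.continuousWithinAt)
      (fun t ht => (hd t (interior_subset ht)).differentiableAt.differentiableWithinAt) ?_
    intro t ht
    have ht' := interior_subset ht
    rw [(hd t ht').deriv]
    have h1 := hder t ht'
    have h2 := (hN t ht').pos
    have h3 : σ * σ = 1 := by rw [← abs_mul_abs_self, hσ, one_mul]
    have h4 : -(C * N t) ≤ σ * deriv N t := by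
      have : |σ * deriv N t| ≤ C * N t := by rw [abs_mul, hσ, one_mul]; exact h1
      exact (abs_le.1 this).1
    have h5 : σ * (deriv N t * Real.exp (σ * C * t) + N t * (Real.exp (σ * C * t) * (σ * C)))
        = (σ * deriv N t + (σ * σ) * (C * N t)) * Real.exp (σ * C * t) := by ring
    rw [h5, h3, one_mul]
    exact mul_nonneg (by linarith) (Real.exp_pos _).le
  have hlow : ∀ t ∈ Set.Ico 0 a, N 0 * Real.exp (-(C * a)) ≤ N t := by
    intro t ht
    have h1 := hmono 1 (by simp) ⟨le_rfl, ha⟩ ht ht.1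
    simp only [one_mul, mul_zero, Real.exp_zero, mul_one] at h1
    have h2 : Real.exp (C * t) ≤ Real.exp (C * a) :=
      Real.exp_le_exp.2 (mul_le_mul_of_nonneg_left ht.2.le hC0)
    have h3 := (hN t ht).pos
    calc N 0 * Real.exp (-(C * a)) ≤ (N t * Real.exp (C * t)) * Real.exp (-(C * a)) := by gcongr
      _ ≤ (N t * Real.exp (C * a)) * Real.exp (-(C * a)) := by gcongr
      _ = N t := by rw [mul_assoc, ← Real.exp_add, add_neg_cancel, Real.exp_zero, mul_one]
  have hup : ∀ t ∈ Set.Ico 0 a, N t ≤ N 0 * Real.exp (C * a) := by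
    intro t ht
    have h1 := hmono (-1) (by simp) ⟨le_rfl, ha⟩ ht ht.1
    simp only [neg_mul, one_mul, mul_zero, Real.exp_zero, mul_one, neg_le_neg_iff] at h1
    have h2 : Real.exp (C * t) ≤ Real.exp (C * a) :=
      Real.exp_le_exp.2 (mul_le_mul_of_nonneg_left ht.2.le hC0)
    have h3 := (hN 0 ⟨le_rfl, ha⟩).pos
    calc N t = (N t * Real.exp (-(C * t))) * Real.exp (C * t) := by
          rw [mul_assoc, ← Real.exp_add, neg_add_cancel, Real.exp_zero, mul_one]
      _ ≤ N 0 * Real.exp (C * t) := by gcongr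
      _ ≤ _ := by gcongr
  have hN0 := (hN 0 ⟨le_rfl, ha⟩).pos
  have hlip : LipschitzOnWith (Real.toNNReal (C * (N 0 * Real.exp (C * a)))) N (Set.Ico 0 a) := by
    refine (convex_Ico 0 a).lipschitzOnWith_of_nnnorm_hasDerivWithin_le (f' := deriv N)
      (fun t ht => (hdiff t ht).hasDerivWithinAt) fun t ht => ?_
    rw [← NNReal.coe_le_coe, coe_nnnorm, Real.coe_toNNReal _ (by positivity)]
    exact (hder t ht).trans (mul_le_mul_of_nonneg_left (hup t ht) hC0)
  -- The Lipschitz extension supplies the limit of `N` at `a`.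
  obtain ⟨g, hg, hgN⟩ := hlip.extend_real
  set ν₀ := g a with hν₀
  have hgt : Tendsto g (𝓝[<] a) (𝓝 ν₀) :=
    (hg.continuous.continuousAt (x := a)).tendsto.mono_left nhdsWithin_le_nhds
  have hleft : ∀ᶠ t in 𝓝[<] a, t ∈ Set.Ico 0 a := by
    filter_upwards [self_mem_nhdsWithin,
      (lt_mem_nhds ha).filter_mono nhdsWithin_le_nhds] with t h1 h2
      using ⟨h2.le, h1⟩
  have hν₀pos : 0 < ν₀ := by
    refine lt_of_lt_of_le (by positivity : 0 < N 0 * Real.exp (-(C * a))) (ge_of_tendsto hgt ?_)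
    filter_upwards [hleft] with t ht
    rw [← hgN ht]; exact hlow t ht
  obtain ⟨ι, _, ν, u, -, han, hLI, heig, ε, hε, hex⟩ :=
    rellich_compact (hT a) hsymm (hcp a).compact hν₀pos.ne'
  have hLI' : ∀ᶠ t in 𝓝 a, LinearIndependent ℂ (fun i => u i t) := by
    have hc : ContinuousAt (fun t => fun i => u i t) a :=
      continuousAt_pi.2 fun i => (han i).2.1.continuousAt
    exact hc.eventually hLI.eventually
  have hana : ∀ᶠ t in 𝓝 a, ∀ i, AnalyticAt ℝ (ν i) t :=
    eventually_all.2 fun i => (han i).1.eventually_analyticAt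
  have hclose : ∀ᶠ t in 𝓝 a, |g t - ν₀| < ε := by
    have : ContinuousAt (fun t => |g t - ν₀|) a :=
      ((hg.continuous.sub continuous_const).abs).continuousAt
    exact this.eventually (gt_mem_nhds (by change |g a - g a| < ε; rwa [sub_self, abs_zero]))
  obtain ⟨δ, hδ, hball⟩ := Metric.eventually_nhds_iff.1
    (hLI'.and (hana.and (hclose.and (heig.and (hex.and (lt_mem_nhds ha))))))
  have hIoo : ∀ t ∈ Set.Ioo (a - δ) a, LinearIndependent ℂ (fun i => u i t) ∧
      (∀ i, AnalyticAt ℝ (ν i) t) ∧ |g t - ν₀| < ε ∧ (∀ i, T t (u i t) = (ν i t : ℂ) • u i t) ∧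
      (∀ ν' : ℝ, |ν' - ν₀| < ε → ∀ x, T t x = (ν' : ℂ) • x →
        x ∈ Submodule.span ℂ (Set.range fun i => u i t)) ∧ 0 < t := fun t ht =>
    hball (by rw [Real.dist_eq, abs_lt]; constructor <;> linarith [ht.1, ht.2])
  have hIco : ∀ t ∈ Set.Ioo (a - δ) a, t ∈ Set.Ico 0 a := fun t ht =>
    ⟨(hIoo t ht).2.2.2.2.2.le, ht.2⟩
  -- Close to `a` the eigenvalue `N t` is within `ε` of `ν₀`, so the finitely many Rellich branches
  -- at `a` exhaust it. One index then recurs arbitrarily close to `t'`, and the identity theorem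
  -- makes `N` that branch.
  have hsome : ∀ t ∈ Set.Ioo (a - δ) a, ∃ i, N t = ν i t := by
    intro t ht
    obtain ⟨h1, h2, h3, h4, h5, h6⟩ := hIoo t ht
    obtain ⟨w, hw, hw0, hwe⟩ := (hN t (hIco t ht)).vec
    rw [← hgN (hIco t ht)] at h3
    obtain ⟨c, -, h7, i, hi⟩ := exists_eq_branch_of_mem_span h1 h4 hwe.self_of_nhds
      (h5 _ h3 _ hwe.self_of_nhds) hw0
    exact ⟨i, (h7 i hi).symm⟩
  set t' := a - δ / 2 with ht'
  have ht'm : t' ∈ Set.Ioo (a - δ) a := ⟨by linarith, by linarith⟩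
  have hfreq : ∃ᶠ t in 𝓝[≠] t', ∃ i, N t = ν i t := by
    refine Eventually.frequently ?_
    filter_upwards [mem_nhdsWithin_of_mem_nhds (isOpen_Ioo.mem_nhds ht'm)] with t ht using hsome t ht
  obtain ⟨i, hi⟩ := frequently_exists.1 hfreq
  have hNan : AnalyticOnNhd ℝ N (Set.Ioo (a - δ) a) := fun t ht => (hN t (hIco t ht)).analytic
  have hνan : AnalyticOnNhd ℝ (ν i) (Set.Ioo (a - δ) a) := fun t ht => (hIoo t ht).2.1 i
  have heq : Set.EqOn N (ν i) (Set.Ioo (a - δ) a) :=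
    hNan.eqOn_of_preconnected_of_frequently_eq hνan isPreconnected_Ioo ht'm hi
  -- If another branch agreed with `ν i` near `a`, then at points left of `a` the eigenvalue `N`
  -- would have two independent eigenvectors, against its simplicity there.
  have hdist : ∀ j, j ≠ i → ∀ᶠ t in 𝓝[≠] a, ν j t ≠ ν i t := by
    intro j hj
    rcases (han j).1.eventually_eq_or_eventually_ne (han i).1 with h | h
    · exfalso
      obtain ⟨δ', hδ', hb'⟩ := Metric.eventually_nhds_iff.1 h
      set s := a - min δ δ' / 2 with hs
      have hmin : 0 < min δ δ' := lt_min hδ hδ'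
      have hsm : s ∈ Set.Ioo (a - min δ δ') a := ⟨by linarith, by linarith⟩
      have hev : ∀ᶠ r in 𝓝[≠] s, r ∈ Set.Ioo (a - min δ δ') a :=
        mem_nhdsWithin_of_mem_nhds (isOpen_Ioo.mem_nhds hsm)
      have hsm' : s ∈ Set.Ioo (a - δ) a := ⟨by linarith [hsm.1, min_le_left δ δ'], hsm.2⟩
      obtain ⟨r, hr, hsimp⟩ := (hev.and (hN s (hIco s hsm')).simple).exists
      have hr' : r ∈ Set.Ioo (a - δ) a := ⟨by linarith [hr.1, min_le_left δ δ'], hr.2⟩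
      obtain ⟨h1, h2, h3, h4, h5, h6⟩ := hIoo r hr'
      have hji : ν j r = ν i r := hb' (by
        rw [Real.dist_eq, abs_lt]; constructor <;> linarith [hr.1, hr.2, min_le_right δ δ'])
      obtain ⟨c, hc⟩ := hsimp (u i r) (u j r) (by rw [heq hr']; exact h4 i)
        (by rw [heq hr', ← hji]; exact h4 j) (h1.ne_zero i)
      exact h1.notMem_span_image (s := {i}) (x := j) (by simpa using hj)
        (by rw [hc, Set.image_singleton]
            exact Submodule.smul_mem _ _ (Submodule.mem_span_singleton_self _))
    · exact h
  refine ⟨fun t => if t < t' then N t else ν i t, ?_, ?_⟩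
  · intro t ht
    rcases lt_or_ge t t' with h | h
    · filter_upwards [gt_mem_nhds h] with s hs
      rw [if_pos hs]
    · have : t ∈ Set.Ioo (a - δ) a := ⟨by linarith, ht⟩
      filter_upwards [isOpen_Ioo.mem_nhds this] with s hs
      split_ifs
      · rfl
      · exact (heq hs).symm
  · refine (simpleBranchAt_of_branches hν₀pos han hLI heig hε hex i hdist).congr ?_
    filter_upwards [lt_mem_nhds ht'm.2] with s hs
    rw [if_neg (not_lt.2 hs.le)]

end Continuation

/-! ### Global analytic branches and their eigenvectors. -/

section GlobalBranch

open Module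

variable {H : Type} [NormedAddCommGroup H] [InnerProductSpace ℂ H] [CompleteSpace H]
variable {T : ℝ → H →L[ℂ] H}

-- Uniqueness of the continuation by the identity theorem. Every point of a nontrivial interval is
-- an accumulation point of it, so agreement on the interval gives equality of germs, also at its
-- ends.
omit [CompleteSpace H] in
theorem SimpleBranchAt.eventuallyEq_of_le {ν₀ ν ν' : ℝ → ℝ} {a : ℝ} (h0 : ν =ᶠ[𝓝 0] ν₀)
    (h0' : ν' =ᶠ[𝓝 0] ν₀) (h : ∀ t ∈ Set.Icc 0 a, SimpleBranchAt T ν t)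
    (h' : ∀ t ∈ Set.Icc 0 a, SimpleBranchAt T ν' t) {t : ℝ} (ht : t ∈ Set.Icc 0 a) :
    ν =ᶠ[𝓝 t] ν' := by
  have ha : 0 ≤ a := ht.1.trans ht.2
  rcases ha.eq_or_lt with rfl | ha
  · rw [le_antisymm ht.2 ht.1]; exact h0.trans h0'.symm
  have heq : Set.EqOn ν ν' (Set.Icc 0 a) :=
    AnalyticOnNhd.eqOn_of_preconnected_of_eventuallyEq (fun t ht => (h t ht).analytic)
      (fun t ht => (h' t ht).analytic) isPreconnected_Icc ⟨le_rfl, ha.le⟩ (h0.trans h0'.symm)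
  refine ((h t ht).analytic.frequently_eq_iff_eventually_eq (h' t ht).analytic).1 ?_
  have hacc : AccPt t (𝓟 (Set.Icc 0 a)) :=
    IsPreconnected.preperfect_of_nontrivial
      (⟨0, ⟨le_rfl, ha.le⟩, a, ⟨ha.le, le_rfl⟩, ha.ne⟩ : (Set.Icc 0 a).Nontrivial) isPreconnected_Icc t ht
  exact (accPt_iff_frequently_nhdsNE.1 hacc).mono fun s hs => heq hs

theorem exists_branch_right (hT : ∀ t, AnalyticAt ℝ T t) (hcp : ∀ t, IsCompactPos (T t)) {C : ℝ}
    (hC : ∀ t ∈ Set.Icc (-1 : ℝ) 1, ∀ (ν : ℝ) (u : H), T t u = (ν : ℂ) • u →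
      |(⟪u, deriv T t u⟫_ℂ).re| ≤ C * ν * ‖u‖ ^ 2) {ν₀ : ℝ → ℝ} (h0 : SimpleBranchAt T ν₀ 0) :
    ∃ ν : ℝ → ℝ, ν =ᶠ[𝓝 0] ν₀ ∧ ∀ t ∈ Set.Icc (0 : ℝ) 1, SimpleBranchAt T ν t := by
  -- Continuity method: the set of reachable endpoints contains `0`, is open to the right, and is
  -- closed.
  let P : ℝ → Prop := fun a => ∃ ν : ℝ → ℝ, ν =ᶠ[𝓝 0] ν₀ ∧ ∀ t ∈ Set.Icc 0 a, SimpleBranchAt T ν t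
  have hmono : ∀ a b, a ≤ b → P b → P a := fun a b hab ⟨ν, h1, h2⟩ =>
    ⟨ν, h1, fun t ht => h2 t ⟨ht.1, ht.2.trans hab⟩⟩
  have hP0 : P 0 := ⟨ν₀, EventuallyEq.rfl, fun t ht => by rwa [le_antisymm ht.2 ht.1]⟩
  have hopen : ∀ a, 0 ≤ a → P a → ∃ b > a, P b := by
    rintro a ha ⟨ν, h1, h2⟩
    obtain ⟨δ, hδ, hb⟩ := Metric.eventually_nhds_iff.1 (h2 a ⟨ha, le_rfl⟩).eventually
    refine ⟨a + δ / 2, by linarith, ν, h1, fun t ht => ?_⟩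
    rcases le_or_gt t a with h | h
    · exact h2 t ⟨ht.1, h⟩
    · exact hb (by rw [Real.dist_eq, abs_lt]; constructor <;> linarith [ht.2])
  have hclosed : ∀ a, 0 < a → a ≤ 1 → (∀ b, 0 ≤ b → b < a → P b) → P a := by
    intro a ha ha1 hb
    have hb' : ∀ b, ∃ ν : ℝ → ℝ, 0 ≤ b → b < a →
        ν =ᶠ[𝓝 0] ν₀ ∧ ∀ t ∈ Set.Icc 0 b, SimpleBranchAt T ν t := by
      intro b
      by_cases h : 0 ≤ b ∧ b < a
      · obtain ⟨ν, hν⟩ := hb b h.1 h.2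
        exact ⟨ν, fun _ _ => hν⟩
      · exact ⟨0, fun h1 h2 => absurd ⟨h1, h2⟩ h⟩
    choose ν hν using hb'
    -- The branches on the intervals `[0, b]`, `b < a`, are glued by evaluating at `s` the one that
    -- reaches the midpoint of `s` and `a`. The maximum with `0` fixes a single branch for negative
    -- `s`.
    have hN : ∀ t ∈ Set.Ico 0 a, (fun s => ν ((max s 0 + a) / 2) s) =ᶠ[𝓝 t] ν ((t + a) / 2) := by
      intro t ht
      have hc : 0 ≤ (t + a) / 2 ∧ (t + a) / 2 < a ∧ t < (t + a) / 2 :=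
        ⟨by linarith [ht.1], by linarith [ht.2], by linarith [ht.2]⟩
      have hpos : ∀ᶠ s in 𝓝 t, 0 ≤ s → ν ((max s 0 + a) / 2) s = ν ((t + a) / 2) s := by
        filter_upwards [gt_mem_nhds hc.2.2] with s hs hs0
        rw [max_eq_left hs0]
        have hd : 0 ≤ (s + a) / 2 ∧ (s + a) / 2 < a ∧ s < (s + a) / 2 :=
          ⟨by linarith, by linarith [hc.2.1], by linarith [hc.2.1]⟩
        obtain ⟨a1, a2⟩ := hν _ hd.1 hd.2.1
        obtain ⟨b1, b2⟩ := hν _ hc.1 hc.2.1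
        exact (SimpleBranchAt.eventuallyEq_of_le (a := s) a1 b1
          (fun r hr => a2 r ⟨hr.1, hr.2.trans hd.2.2.le⟩)
          (fun r hr => b2 r ⟨hr.1, hr.2.trans hs.le⟩) ⟨hs0, le_rfl⟩).eq_of_nhds
      rcases ht.1.eq_or_lt with h | h
      · subst h
        filter_upwards [hpos] with s hs
        rcases le_total 0 s with h | h
        · exact hs h
        · simp only [max_eq_right h]
      · filter_upwards [hpos, lt_mem_nhds h] with s h1 h2 using h1 h2.le
    have hNb : ∀ t ∈ Set.Ico 0 a, SimpleBranchAt T (fun s => ν ((max s 0 + a) / 2) s) t := by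
      intro t ht
      have hc : 0 ≤ (t + a) / 2 ∧ (t + a) / 2 < a ∧ t < (t + a) / 2 :=
        ⟨by linarith [ht.1], by linarith [ht.2], by linarith [ht.2]⟩
      exact ((hν _ hc.1 hc.2.1).2 t ⟨ht.1, hc.2.2.le⟩).congr (hN t ht).symm
    obtain ⟨N', h1, h2⟩ := exists_simpleBranch_closed hT hcp ha
      (fun t ht => hC t ⟨by linarith [ht.1], by linarith [ht.2]⟩) hNb
    refine ⟨N', (h1 0 ha).trans ((hN 0 ⟨le_rfl, ha⟩).trans
      (hν _ (by linarith) (by linarith)).1), fun t ht => ?_⟩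
    rcases ht.2.eq_or_lt with h | h
    · rwa [h]
    · exact (hNb t ⟨ht.1, h⟩).congr (h1 t h).symm
  by_contra hcon
  set B := {a : ℝ | 0 ≤ a ∧ a ≤ 1 ∧ ¬ P a} with hB
  have h1B : (1 : ℝ) ∈ B := ⟨zero_le_one, le_rfl, hcon⟩
  have hbdd : BddBelow B := ⟨0, fun a ha => ha.1⟩
  have hm0 : 0 ≤ sInf B := le_csInf ⟨1, h1B⟩ fun a ha => ha.1
  have hm1 : sInf B ≤ 1 := csInf_le hbdd h1B
  have hlt : ∀ b, 0 ≤ b → b < sInf B → P b := by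
    intro b hb hbm
    by_contra h
    exact absurd (csInf_le hbdd ⟨hb, hbm.le.trans hm1, h⟩) (not_le.2 hbm)
  have hPm : P (sInf B) := by
    rcases hm0.eq_or_lt with h | h
    · rw [← h]; exact hP0
    · exact hclosed _ h hm1 hlt
  obtain ⟨b, hb, hPb⟩ := hopen _ hm0 hPm
  have : b ≤ sInf B := le_csInf ⟨1, h1B⟩ fun a ha => by
    by_contra! h
    exact ha.2.2 (hmono a b h.le hPb)
  exact absurd hb (not_lt.2 this)

/-- A generically simple analytic branch of positive eigenvalues extends to `[-1, 1]`. -/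
theorem exists_branch (hT : ∀ t, AnalyticAt ℝ T t) (hcp : ∀ t, IsCompactPos (T t)) {C : ℝ}
    (hC : ∀ t ∈ Set.Icc (-1 : ℝ) 1, ∀ (ν : ℝ) (u : H), T t u = (ν : ℂ) • u →
      |(⟪u, deriv T t u⟫_ℂ).re| ≤ C * ν * ‖u‖ ^ 2) {ν₀ : ℝ → ℝ} (h0 : SimpleBranchAt T ν₀ 0) :
    ∃ ν : ℝ → ℝ, ν =ᶠ[𝓝 0] ν₀ ∧ ∀ t ∈ Set.Icc (-1 : ℝ) 1, SimpleBranchAt T ν t := by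
  obtain ⟨N₁, h1, h1'⟩ := exists_branch_right hT hcp hC h0
  obtain ⟨N₂, h2, h2'⟩ := exists_branch_right (T := fun t => T (-t)) (ν₀ := fun t => ν₀ (-t))
    (fun t => AnalyticAt.comp (g := T) (f := fun s : ℝ => -s) (hT _) analyticAt_id.neg)
    (fun t => hcp _) (C := C) (fun t ht ν u hu => by
      rw [deriv_comp_neg (f := T), _root_.neg_apply, inner_neg_right, Complex.neg_re,
        abs_neg]
      exact hC (-t) ⟨by linarith [ht.2], by linarith [ht.1]⟩ ν u hu)
    (by simpa using h0.comp_neg)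
  have h2n : (fun t => N₂ (-t)) =ᶠ[𝓝 0] ν₀ := by
    have : Tendsto (fun s : ℝ => -s) (𝓝 0) (𝓝 0) := by
      simpa using (continuous_neg (G := ℝ)).tendsto 0
    filter_upwards [this.eventually h2] with s hs
    rw [hs, neg_neg]
  have hglue : (fun t => if 0 ≤ t then N₁ t else N₂ (-t)) =ᶠ[𝓝 0] ν₀ := by
    filter_upwards [h1, h2n] with s a b
    split_ifs
    exacts [a, b]
  refine ⟨fun t => if 0 ≤ t then N₁ t else N₂ (-t), hglue, fun t ht => ?_⟩
  rcases lt_trichotomy t 0 with h | h | h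
  · have := (h2' (-t) ⟨by linarith, by linarith [ht.1]⟩).comp_neg
    simp only [neg_neg] at this
    refine this.congr ?_
    filter_upwards [gt_mem_nhds h] with s hs
    rw [if_neg (not_le.2 hs)]
  · rw [h]; exact h0.congr hglue.symm
  · refine (h1' t ⟨h.le, ht.2⟩).congr ?_
    filter_upwards [lt_mem_nhds h] with s hs
    rw [if_pos hs.le]

/-- A differentiable curve in `ℂ` does not fill `ℂ`. -/
theorem exists_notMem_image_of_differentiableOn {h : ℝ → ℂ} {D : Set ℝ}
    (hd : ∀ t ∈ D, DifferentiableAt ℝ h t) : ∃ c : ℂ, c ∉ h '' D := by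
  -- The curve is read as a map of the plane that ignores the imaginary part. Its derivative is
  -- singular everywhere, so its image is a null set.
  let s : Set ℂ := Complex.re ⁻¹' D
  let f' : ℂ → ℂ →L[ℝ] ℂ := fun z => (fderiv ℝ h z.re).comp Complex.reCLM
  have hf : ∀ z ∈ s, HasFDerivWithinAt (fun z : ℂ => h z.re) (f' z) s z := fun z hz =>
    ((hd z.re hz).hasFDerivAt.comp z Complex.reCLM.hasFDerivAt).hasFDerivWithinAt
  have hdet : ∀ z ∈ s, (f' z).det = 0 := by
    intro z _
    by_contra hne
    have hinj := (LinearMap.equivOfDetNeZero (f' z : ℂ →ₗ[ℝ] ℂ) hne).injective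
    have : Complex.I = 0 := hinj (by
      change f' z Complex.I = f' z 0
      simp [f'])
    exact Complex.I_ne_zero this
  have hz := MeasureTheory.addHaar_image_eq_zero_of_det_fderivWithin_eq_zero MeasureTheory.volume hf hdet
  by_contra! hall
  have : (fun z : ℂ => h z.re) '' s = Set.univ := by
    refine Set.eq_univ_of_forall fun c => ?_
    obtain ⟨t, ht, rfl⟩ := hall c
    exact ⟨(t : ℂ), by simpa [s] using ht, by simp⟩
  rw [this] at hz
  exact NeZero.ne _ (MeasureTheory.Measure.measure_univ_eq_zero.1 hz)

theorem analyticAt_inner {u w : ℝ → H} {t : ℝ} (hu : AnalyticAt ℝ u t) (hw : AnalyticAt ℝ w t) :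
    AnalyticAt ℝ (fun s => ⟪u s, w s⟫_ℂ) t := by
  have h1 : ContDiffAt ℝ ω u t := hu.contDiffAt
  have h2 : ContDiffAt ℝ ω w t := hw.contDiffAt
  exact (h1.inner ℂ h2).analyticAt

theorem analyticAt_norm {u : ℝ → H} {t : ℝ} (hu : AnalyticAt ℝ u t) (h0 : u t ≠ 0) :
    AnalyticAt ℝ (fun s => ‖u s‖) t := by
  have h1 : ContDiffAt ℝ ω u t := hu.contDiffAt
  exact (h1.norm ℂ h0).analyticAt

omit [CompleteSpace H] in
theorem analyticAt_complex_smul {c : ℝ → ℂ} {u : ℝ → H} {t : ℝ} (hc : AnalyticAt ℝ c t)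
    (hu : AnalyticAt ℝ u t) : AnalyticAt ℝ (fun s => c s • u s) t := hc.smul hu

/-- An analytic family of projections of rank one on an interval has a nowhere vanishing section
of the form `t ↦ R t v`. -/
theorem exists_forall_ne_zero {R : ℝ → H →ₗ[ℂ] H}
    (han : ∀ x, ∀ t ∈ Set.Ioo (-1 : ℝ) 1, AnalyticAt ℝ (fun s => R s x) t)
    (hne : ∀ t ∈ Set.Ioo (-1 : ℝ) 1, ∃ x, R t x ≠ 0) :
    ∃ v, ∀ t ∈ Set.Icc (-(1 / 2) : ℝ) (1 / 2), R t v ≠ 0 := by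
  have hsub : Set.Icc (-(1 / 2) : ℝ) (1 / 2) ⊆ Set.Ioo (-1) 1 := fun t ht =>
    ⟨by linarith [ht.1], by linarith [ht.2]⟩
  obtain ⟨e, he⟩ := hne 0 (by norm_num)
  -- The zeros of one analytic section are finite in number. A second vector `f` is chosen outside
  -- the finitely many kernels at these zeros.
  set Z := {t | t ∈ Set.Icc (-(1 / 2) : ℝ) (1 / 2) ∧ R t e = 0} with hZ
  have hfin : Z.Finite := by
    by_contra hinf
    obtain ⟨z, hz, hacc⟩ := Set.Infinite.exists_accPt_of_subset_isCompact (K := Set.Icc (-(1 / 2) : ℝ) (1 / 2)) hinf isCompact_Icc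
      (fun t ht => ht.1)
    have h1 : ∃ᶠ s in 𝓝[≠] z, R s e = 0 :=
      (accPt_iff_frequently_nhdsNE.1 hacc).mono fun s hs => hs.2
    have h2 := AnalyticOnNhd.eqOn_zero_of_preconnected_of_frequently_eq_zero
      (f := fun s => R s e) (U := Set.Ioo (-1 : ℝ) 1) (fun t ht => han e t ht) isPreconnected_Ioo
      (hsub hz) h1
    exact he (h2 (by norm_num : (0 : ℝ) ∈ Set.Ioo (-1 : ℝ) 1))
  obtain ⟨f, hf⟩ : ∃ f, ∀ z ∈ Z, R z f ≠ 0 := by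
    have := Subspace.biUnion_ne_univ_of_top_notMem
      (s := (hfin.image fun z => LinearMap.ker (R z)).toFinset) (by
        simp only [Set.Finite.mem_toFinset, Set.mem_image, not_exists, not_and]
        intro z hz htop
        obtain ⟨x, hx⟩ := hne z (hsub hz.1)
        exact hx (by
          have : x ∈ LinearMap.ker (R z) := by rw [htop]; trivial
          exact this))
    obtain ⟨f, hf⟩ := (Set.ne_univ_iff_exists_notMem _).1 this
    refine ⟨f, fun z hz h0 => hf ?_⟩
    simp only [Set.Finite.mem_toFinset, Set.mem_iUnion]
    exact ⟨_, ⟨z, hz, rfl⟩, h0⟩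
  -- Where `R t f ≠ 0`, a zero of `R t (e - c • f)` determines `c` as the value of this
  -- differentiable curve, so any `c` off the curve works.
  obtain ⟨c, hc⟩ := exists_notMem_image_of_differentiableOn
    (h := fun t => ⟪R t f, R t e⟫_ℂ / ⟪R t f, R t f⟫_ℂ)
    (D := {t | t ∈ Set.Icc (-(1 / 2) : ℝ) (1 / 2) ∧ R t f ≠ 0}) (by
      rintro t ⟨ht, ht0⟩
      exact ((analyticAt_inner (han f t (hsub ht)) (han e t (hsub ht))).div
        (analyticAt_inner (han f t (hsub ht)) (han f t (hsub ht)))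
        (inner_self_ne_zero.2 ht0)).differentiableAt)
  refine ⟨e - c • f, fun t ht h0 => ?_⟩
  rw [map_sub, map_smul, sub_eq_zero] at h0
  by_cases hft : R t f = 0
  · rw [hft, smul_zero] at h0
    exact hf t ⟨ht, h0⟩ hft
  · refine hc ⟨t, ⟨ht, hft⟩, ?_⟩
    simp only [h0, inner_smul_right]
    exact mul_div_cancel_right₀ _ (inner_self_ne_zero.2 hft)

/-- A simple branch on `[-1, 1]` has an analytic unit eigenvector on `[-1/2, 1/2]`. -/
theorem exists_analytic_unit_eigenvector {ν : ℝ → ℝ}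
    (h : ∀ t ∈ Set.Icc (-1 : ℝ) 1, SimpleBranchAt T ν t) :
    ∃ u : ℝ → H, ∀ t ∈ Set.Icc (-(1 / 2) : ℝ) (1 / 2),
      AnalyticAt ℝ u t ∧ ‖u t‖ = 1 ∧ T t (u t) = (ν t : ℂ) • u t := by
  have hw : ∀ t, ∃ w : ℝ → H, t ∈ Set.Icc (-1 : ℝ) 1 → AnalyticAt ℝ w t ∧ w t ≠ 0 ∧
      ∀ᶠ s in 𝓝 t, T s (w s) = (ν s : ℂ) • w s := by
    intro t
    by_cases ht : t ∈ Set.Icc (-1 : ℝ) 1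
    · obtain ⟨w, hw⟩ := (h t ht).vec
      exact ⟨w, fun _ => hw⟩
    · exact ⟨0, fun h => absurd h ht⟩
  choose w hw using hw
  -- The orthogonal projection onto the line of the eigenvector. It does not depend on the scalar
  -- ambiguity of the local choices `w t`, hence is analytic although these need not fit together.
  let R : ℝ → H →ₗ[ℂ] H := fun t =>
    (((⟪w t t, w t t⟫_ℂ)⁻¹ • (innerSL ℂ (w t t))).smulRight (w t t)).toLinearMap
  have hR : ∀ t x, R t x = ((⟪w t t, w t t⟫_ℂ)⁻¹ * ⟪w t t, x⟫_ℂ) • w t t := fun t x => rfl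
  have hloc : ∀ t ∈ Set.Ioo (-1 : ℝ) 1, ∀ x,
      (fun s => R s x) =ᶠ[𝓝 t] fun s => ((⟪w t s, w t s⟫_ℂ)⁻¹ * ⟪w t s, x⟫_ℂ) • w t s := by
    intro t ht x
    obtain ⟨h1, h2, h3⟩ := hw t (Set.Ioo_subset_Icc_self ht)
    filter_upwards [isOpen_Ioo.mem_nhds ht, h1.eventually_analyticAt,
      h1.continuousAt.eventually_ne h2, eventually_eventually_nhds.2 h3] with s a1 a2 a3 a4
    obtain ⟨b1, b2, b3⟩ := hw s (Set.Ioo_subset_Icc_self a1)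
    obtain ⟨c, hc, hcs⟩ := (h s (Set.Ioo_subset_Icc_self a1)).parallel a2.continuousAt
      b1.continuousAt a3 b2 a4 b3
    rw [hR, hcs]
    simp only [inner_smul_left, inner_smul_right, smul_smul]
    have h4 : ⟪w t s, w t s⟫_ℂ ≠ 0 := inner_self_ne_zero.2 a3
    have h5 : starRingEnd ℂ c ≠ 0 := by simpa using hc
    congr 1
    field_simp
  have han : ∀ x, ∀ t ∈ Set.Ioo (-1 : ℝ) 1, AnalyticAt ℝ (fun s => R s x) t := by
    intro x t ht
    obtain ⟨h1, h2, h3⟩ := hw t (Set.Ioo_subset_Icc_self ht)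
    refine AnalyticAt.congr ?_ (hloc t ht x).symm
    exact analyticAt_complex_smul (((analyticAt_inner h1 h1).inv (inner_self_ne_zero.2 h2)).mul
      (analyticAt_inner h1 analyticAt_const)) h1
  obtain ⟨v, hv⟩ := exists_forall_ne_zero han (fun t ht => ⟨w t t, by
    obtain ⟨h1, h2, h3⟩ := hw t (Set.Ioo_subset_Icc_self ht)
    rw [hR, inv_mul_cancel₀ (inner_self_ne_zero.2 h2), one_smul]
    exact h2⟩)
  refine ⟨fun t => ((‖R t v‖⁻¹ : ℝ) : ℂ) • R t v, fun t ht => ?_⟩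
  have ht' : t ∈ Set.Ioo (-1 : ℝ) 1 := ⟨by linarith [ht.1], by linarith [ht.2]⟩
  have h0 := hv t ht
  refine ⟨?_, ?_, ?_⟩
  · have h1 := (analyticAt_norm (han v t ht') h0).inv (norm_ne_zero_iff.2 h0)
    exact analyticAt_complex_smul
      ((Complex.ofRealCLM.analyticAt _).comp h1) (han v t ht')
  · rw [norm_smul, Complex.norm_real, norm_inv, norm_norm, inv_mul_cancel₀ (norm_ne_zero_iff.2 h0)]
  · have h3 := (hw t (Set.Ioo_subset_Icc_self ht')).2.2.self_of_nhds
    have h4 : T t (R t v) = (ν t : ℂ) • R t v := by rw [hR, map_smul, h3, smul_comm]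
    rw [map_smul, h4, smul_comm]

end GlobalBranch

/-! ### The lattice, its dual, and plane waves -/

section Geometry

/-- The dual lattice vector `m₁ k₁ + m₂ k₂`. -/
def dualVec (m : ℤ × ℤ) : Plane := (m.1 : ℝ) • k₁ + (m.2 : ℝ) • k₂

/-- The weight `1 + |m₁ k₁ + m₂ k₂|²`. -/
def weight (m : ℤ × ℤ) : ℝ := 1 + ‖dualVec m‖ ^ 2

theorem freq_eq (m : ℤ × ℤ) : freq m = vertexK + dualVec m := add_assoc _ _ _

theorem inner_plane (x y : Plane) : ⟪x, y⟫_ℝ = x 0 * y 0 + x 1 * y 1 := by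
  simp [PiLp.inner_apply, Fin.sum_univ_two, mul_comm]

theorem norm_sq_plane (x : Plane) : ‖x‖ ^ 2 = x 0 ^ 2 + x 1 ^ 2 := by
  rw [← real_inner_self_eq_norm_sq, inner_plane]; ring

theorem sqrt_three_sq : √3 * √3 = (3 : ℝ) := Real.mul_self_sqrt (by norm_num)

theorem sqrt_three_pos : 0 < √(3 : ℝ) := Real.sqrt_pos.2 (by norm_num)

theorem q_mul_sqrt_three : q * √3 = 4 * Real.pi := by
  rw [q, div_mul_cancel₀ _ sqrt_three_pos.ne']

theorem q_pos : 0 < q := div_pos (by positivity) sqrt_three_pos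

@[simp] theorem k₁_zero : k₁ 0 = q / 2 := by simp [k₁]; ring
@[simp] theorem k₁_one : k₁ 1 = q * √3 / 2 := by simp [k₁]; ring
@[simp] theorem k₂_zero : k₂ 0 = q / 2 := by simp [k₂]; ring
@[simp] theorem k₂_one : k₂ 1 = -(q * √3 / 2) := by simp [k₂]; ring
@[simp] theorem v₁_zero : v₁ 0 = √3 / 2 := by simp [v₁]
@[simp] theorem v₁_one : v₁ 1 = 1 / 2 := by simp [v₁]
@[simp] theorem v₂_zero : v₂ 0 = √3 / 2 := by simp [v₂]
@[simp] theorem v₂_one : v₂ 1 = -(1 / 2) := by simp [v₂]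

theorem inner_k₁_v₁ : ⟪k₁, v₁⟫_ℝ = 2 * Real.pi := by
  rw [inner_plane]; simp; linear_combination q_mul_sqrt_three / 2
theorem inner_k₁_v₂ : ⟪k₁, v₂⟫_ℝ = 0 := by rw [inner_plane]; simp; ring
theorem inner_k₂_v₁ : ⟪k₂, v₁⟫_ℝ = 0 := by rw [inner_plane]; simp; ring
theorem inner_k₂_v₂ : ⟪k₂, v₂⟫_ℝ = 2 * Real.pi := by
  rw [inner_plane]; simp; linear_combination q_mul_sqrt_three / 2

theorem inner_dualVec (m : ℤ × ℤ) (a b : ℝ) :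
    ⟪dualVec m, a • v₁ + b • v₂⟫_ℝ = 2 * Real.pi * (m.1 * a + m.2 * b) := by
  simp only [dualVec, inner_add_left, inner_add_right, inner_smul_left, inner_smul_right,
    inner_k₁_v₁, inner_k₁_v₂, inner_k₂_v₁, inner_k₂_v₂]
  simp; ring

theorem dualVec_add (m n : ℤ × ℤ) : dualVec (m + n) = dualVec m + dualVec n := by
  simp only [dualVec, Prod.fst_add, Prod.snd_add, Int.cast_add]; module

theorem dualVec_sub (m n : ℤ × ℤ) : dualVec (m - n) = dualVec m - dualVec n := by
  simp only [dualVec, Prod.fst_sub, Prod.snd_sub, Int.cast_sub]; module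

theorem dualVec_neg (m : ℤ × ℤ) : dualVec (-m) = -dualVec m := by
  simp only [dualVec, Prod.fst_neg, Prod.snd_neg, Int.cast_neg]; module

@[simp] theorem dualVec_zero : dualVec 0 = 0 := by simp [dualVec]

theorem norm_sq_combination (a b : ℝ) :
    ‖a • k₁ + b • k₂‖ ^ 2 = q ^ 2 * (a ^ 2 + b ^ 2 - a * b) := by
  rw [norm_sq_plane]
  simp
  linear_combination (q ^ 2 * (a - b) ^ 2 / 4) * sqrt_three_sq

/-- In fact `q ^ 2 = 16 π ^ 2 / 3`. The constant `2` is what compensates the loss in `a ^ 2 + b ^ 2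
- a b ≥ (a ^ 2 + b ^ 2) / 2`. -/
theorem one_lt_q_sq : 2 ≤ q ^ 2 := by
  have h1 := q_mul_sqrt_three
  have h2 := Real.pi_gt_three
  have h3 := sqrt_three_sq
  have h4 := q_pos
  have h5 := sqrt_three_pos
  have : q ^ 2 * 3 = 16 * Real.pi ^ 2 := by
    linear_combination (q * √3 + 4 * Real.pi) * h1 - q ^ 2 * h3
  nlinarith

theorem sq_add_sq_le_norm_sq_dualVec (m : ℤ × ℤ) :
    (m.1 : ℝ) ^ 2 + (m.2 : ℝ) ^ 2 ≤ ‖dualVec m‖ ^ 2 := by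
  rw [dualVec, norm_sq_combination]
  have h := one_lt_q_sq
  nlinarith [sq_nonneg ((m.1 : ℝ) - m.2), sq_nonneg (m.1 : ℝ), sq_nonneg (m.2 : ℝ)]

theorem one_le_weight (m : ℤ × ℤ) : 1 ≤ weight m := by
  have := sq_nonneg ‖dualVec m‖; rw [weight]; linarith

theorem weight_pos (m : ℤ × ℤ) : 0 < weight m := zero_lt_one.trans_le (one_le_weight m)

theorem weight_ne_zero (m : ℤ × ℤ) : weight m ≠ 0 := (weight_pos m).ne'

theorem norm_dualVec_le_weight (m : ℤ × ℤ) : ‖dualVec m‖ ≤ weight m := by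
  rw [weight]; nlinarith [sq_nonneg (‖dualVec m‖ - 1), norm_nonneg (dualVec m)]

/-- Peetre's inequality. It makes convolutions with rapidly decaying sequences bounded on all
weighted spaces. -/
theorem weight_le_mul (m n : ℤ × ℤ) : weight m ≤ 2 * (weight (m - n) * weight n) := by
  have h1 : ‖dualVec m‖ ≤ ‖dualVec (m - n)‖ + ‖dualVec n‖ := by
    rw [dualVec_sub]
    simpa using norm_add_le (dualVec m - dualVec n) (dualVec n)
  have h2 : ‖dualVec m‖ ^ 2 ≤ (‖dualVec (m - n)‖ + ‖dualVec n‖) ^ 2 := by gcongr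
  simp only [weight]
  nlinarith [sq_nonneg (‖dualVec (m - n)‖ - ‖dualVec n‖),
    mul_nonneg (sq_nonneg ‖dualVec (m - n)‖) (sq_nonneg ‖dualVec n‖)]

theorem summable_inv_one_add_int_sq : Summable fun n : ℤ => (1 + (n : ℝ) ^ 2)⁻¹ := by
  refine Summable.of_norm_bounded_eventually (g := fun n : ℤ => 1 / (n : ℝ) ^ 2)
    (Real.summable_one_div_int_pow.2 (by norm_num)) ?_
  filter_upwards [(Set.finite_singleton (0 : ℤ)).compl_mem_cofinite] with n hn
  have hn0 : (n : ℝ) ≠ 0 := by exact_mod_cast hn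
  have : 0 < (n : ℝ) ^ 2 := by positivity
  rw [Real.norm_of_nonneg (by positivity), one_div]
  exact inv_anti₀ this (by linarith)

theorem summable_weight_inv_sq : Summable fun m => (weight m ^ 2)⁻¹ := by
  have h := summable_inv_one_add_int_sq.mul_of_nonneg summable_inv_one_add_int_sq
    (fun n => by positivity) (fun n => by positivity)
  refine Summable.of_nonneg_of_le (fun m => by have := weight_pos m; positivity) (fun m => ?_) h
  rw [← mul_inv]
  refine inv_anti₀ (by positivity) ?_
  have h1 := sq_add_sq_le_norm_sq_dualVec m
  have h2 : 1 + (m.1 : ℝ) ^ 2 + (m.2 : ℝ) ^ 2 ≤ weight m := by rw [weight]; linarith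
  calc (1 + (m.1 : ℝ) ^ 2) * (1 + (m.2 : ℝ) ^ 2)
      ≤ (1 + (m.1 : ℝ) ^ 2 + (m.2 : ℝ) ^ 2) ^ 2 := by
        nlinarith [sq_nonneg (m.1 : ℝ), sq_nonneg (m.2 : ℝ),
          mul_nonneg (sq_nonneg (m.1 : ℝ)) (sq_nonneg (m.2 : ℝ))]
    _ ≤ weight m ^ 2 := by gcongr

theorem tendsto_weight_inv : Tendsto (fun m => (weight m)⁻¹) cofinite (𝓝 0) := by
  have h := summable_weight_inv_sq.tendsto_cofinite_zero
  have h2 := (Real.continuous_sqrt.tendsto 0).comp h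
  rw [Real.sqrt_zero] at h2
  refine h2.congr fun m => ?_
  simp only [Function.comp, Real.sqrt_inv, Real.sqrt_sq (weight_pos m).le]

theorem planeWave_add_left (k k' x : Plane) :
    planeWave (k + k') x = planeWave k x * planeWave k' x := by
  rw [planeWave, planeWave, planeWave, ← Complex.exp_add, inner_add_left]; push_cast; ring_nf

theorem planeWave_add_right (k x y : Plane) :
    planeWave k (x + y) = planeWave k x * planeWave k y := by
  rw [planeWave, planeWave, planeWave, ← Complex.exp_add, inner_add_right]; push_cast; ring_nf

@[simp] theorem planeWave_zero_left (x : Plane) : planeWave 0 x = 1 := by simp [planeWave]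

theorem planeWave_neg_right (k x : Plane) : planeWave k (-x) = planeWave (-k) x := by
  simp [planeWave]

theorem conj_planeWave (k x : Plane) : starRingEnd ℂ (planeWave k x) = planeWave (-k) x := by
  rw [planeWave, planeWave, ← Complex.exp_conj]; simp

theorem norm_planeWave (k x : Plane) : ‖planeWave k x‖ = 1 := by
  rw [planeWave, mul_comm, Complex.norm_exp_ofReal_mul_I]

theorem planeWave_neg_mul (k x : Plane) : planeWave (-k) x * planeWave k x = 1 := by
  rw [← planeWave_add_left, neg_add_cancel, planeWave_zero_left]

theorem planeWave_mul_neg (k x : Plane) : planeWave k x * planeWave (-k) x = 1 := by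
  rw [← planeWave_add_left, add_neg_cancel, planeWave_zero_left]

theorem planeWave_ne_zero (k x : Plane) : planeWave k x ≠ 0 := Complex.exp_ne_zero _

theorem planeWave_dualVec_lattice (m : ℤ × ℤ) {v : Plane} (hv : v ∈ lattice) :
    planeWave (dualVec m) v = 1 := by
  obtain ⟨a, b, rfl⟩ := hv
  rw [planeWave, inner_dualVec, Complex.exp_eq_one_iff]
  exact ⟨m.1 * a + m.2 * b, by push_cast; ring⟩

theorem isLatticePeriodic_planeWave (m : ℤ × ℤ) : IsLatticePeriodic (planeWave (dualVec m)) :=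
  fun v hv x => by rw [planeWave_add_right, planeWave_dualVec_lattice m hv, mul_one]

theorem contDiff_planeWave {n : WithTop ℕ∞} (k : Plane) : ContDiff ℝ n (planeWave k) := by
  unfold planeWave
  exact (contDiff_const.mul (Complex.ofRealCLM.contDiff.comp
    (contDiff_const.inner ℝ contDiff_id))).cexp

theorem continuous_planeWave (k : Plane) : Continuous (planeWave k) :=
  (contDiff_planeWave (n := 0) k).continuous

theorem hasFDerivAt_planeWave (k x : Plane) : HasFDerivAt (planeWave k)
    (planeWave k x • (Complex.I • Complex.ofRealCLM.comp (innerSL ℝ k))) x := by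
  have h : HasFDerivAt (fun y : Plane => Complex.I * ((⟪k, y⟫_ℝ : ℝ) : ℂ))
      (Complex.I • Complex.ofRealCLM.comp (innerSL ℝ k)) x :=
    ((Complex.ofRealCLM.comp (innerSL ℝ k)).hasFDerivAt (x := x)).const_mul Complex.I
  exact h.cexp

end Geometry

/-! ### Integration over the period cell -/

section Cell

open MeasureTheory

/-- Coordinates with respect to `v₁, v₂`. -/
def latticeCoord : Plane ≃L[ℝ] (Fin 2 → ℝ) :=
  LinearEquiv.toContinuousLinearEquiv
    { toFun := fun x => ![⟪k₁, x⟫_ℝ / (2 * Real.pi), ⟪k₂, x⟫_ℝ / (2 * Real.pi)]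
      map_add' := fun x y => by
        ext i; fin_cases i <;> simp [inner_add_right, add_div]
      map_smul' := fun c x => by
        ext i; fin_cases i <;> simp [inner_smul_right, mul_div_assoc]
      invFun := fun θ => θ 0 • v₁ + θ 1 • v₂
      left_inv := fun x => by
        have h := q_mul_sqrt_three
        have hp := Real.pi_pos.ne'
        ext i; fin_cases i <;> simp [inner_plane] <;> field_simp <;> ring_nf
        · linear_combination 2 * (x 0) * h
        · linear_combination 2 * (x 1) * h
      right_inv := fun θ => by
        have hp := Real.pi_pos.ne'
        ext i; fin_cases i <;> simp [inner_add_right, inner_smul_right, inner_k₁_v₁, inner_k₁_v₂,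
          inner_k₂_v₁, inner_k₂_v₂, hp] }

theorem latticeCoord_symm (θ : Fin 2 → ℝ) : latticeCoord.symm θ = θ 0 • v₁ + θ 1 • v₂ := rfl

theorem latticeCoord_image_cell :
    cell = latticeCoord ⁻¹' (Set.Icc 0 1) := by
  ext x
  simp only [Set.mem_preimage, Set.mem_Icc, Pi.le_def, Fin.forall_fin_two]
  constructor
  · rintro ⟨a, ha, b, hb, rfl⟩
    have : latticeCoord (a • v₁ + b • v₂) = ![a, b] :=
      latticeCoord.apply_symm_apply ![a, b]
    rw [this]
    simpa using ⟨⟨ha.1, hb.1⟩, ha.2, hb.2⟩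
  · rintro ⟨⟨h1, h2⟩, h3, h4⟩
    exact ⟨_, ⟨h1, h3⟩, _, ⟨h2, h4⟩, (latticeCoord.symm_apply_apply x).symm⟩

theorem isCompact_cell : IsCompact cell := by
  have : cell = latticeCoord.symm '' (Set.Icc 0 1) := by
    rw [latticeCoord_image_cell]
    exact (latticeCoord.symm.toEquiv.image_eq_preimage_symm _).symm
  rw [this]
  exact isCompact_Icc.image latticeCoord.symm.continuous

theorem exists_lattice_sub_mem_cell (x : Plane) : ∃ v ∈ lattice, x - v ∈ cell := by
  set θ := latticeCoord x with hθ
  refine ⟨(⌊θ 0⌋ : ℝ) • v₁ + (⌊θ 1⌋ : ℝ) • v₂, ⟨_, _, rfl⟩, Int.fract (θ 0),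
    ⟨Int.fract_nonneg _, (Int.fract_lt_one _).le⟩, Int.fract (θ 1),
    ⟨Int.fract_nonneg _, (Int.fract_lt_one _).le⟩, ?_⟩
  have : x = θ 0 • v₁ + θ 1 • v₂ := (latticeCoord.symm_apply_apply x).symm
  rw [this, Int.fract, Int.fract]
  module

/-- Continuous periodic functions are bounded. -/
theorem IsLatticePeriodic.exists_bound {F : Type*} [SeminormedAddCommGroup F] {g : Plane → F}
    (hp : IsLatticePeriodic g) (hc : Continuous g) : ∃ C, ∀ x, ‖g x‖ ≤ C := by
  obtain ⟨C, hC⟩ := isCompact_cell.exists_bound_of_continuousOn hc.continuousOn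
  refine ⟨C, fun x => ?_⟩
  obtain ⟨v, hv, hx⟩ := exists_lattice_sub_mem_cell x
  have := hp v hv (x - v)
  rw [sub_add_cancel] at this
  rw [this]; exact hC _ hx

theorem volume_cell_lt_top : volume cell < ⊤ := isCompact_cell.measure_lt_top

instance : IsFiniteMeasure (volume.restrict cell) :=
  ⟨by simpa using volume_cell_lt_top⟩

theorem _root_.Continuous.integrable_cell {F : Type*} [NormedAddCommGroup F]
    {g : Plane → F} (hg : Continuous g) : IntegrableOn g cell :=
  hg.continuousOn.integrableOn_compact isCompact_cell

/-- The area of the period cell. -/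
def cellVol : ℝ := volume.real cell

theorem volume_box : (volume : Measure (Fin 2 → ℝ)) (Set.Icc 0 1) = 1 := by
  rw [Real.volume_Icc_pi]; simp

/-- The image of Lebesgue measure is a Haar measure, so a multiple of Lebesgue measure; the unit
box, whose preimage is the cell, determines the factor. -/
theorem map_latticeCoord : ∃ c : NNReal, c ≠ 0 ∧ (c : ℝ) = cellVol ∧
    Measure.map latticeCoord volume = c • (volume : Measure (Fin 2 → ℝ)) := by
  have hH : (Measure.map latticeCoord (volume : Measure Plane)).IsAddHaarMeasure :=
    latticeCoord.isAddHaarMeasure_map _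
  refine ⟨Measure.addHaarScalarFactor (Measure.map latticeCoord volume) volume, ?_, ?_,
    Measure.isAddLeftInvariant_eq_smul _ _⟩
  · exact (Measure.addHaarScalarFactor_pos_of_isAddHaarMeasure _ _).ne'
  · have h := congrArg (fun μ : Measure (Fin 2 → ℝ) => μ (Set.Icc 0 1))
      (Measure.isAddLeftInvariant_eq_smul (Measure.map latticeCoord volume) volume)
    simp only [Measure.smul_apply, volume_box] at h
    rw [Measure.map_apply latticeCoord.continuous.measurable measurableSet_Icc] at h
    rw [cellVol, Measure.real, latticeCoord_image_cell, h]
    simp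

theorem cellVol_pos : 0 < cellVol := by
  obtain ⟨c, hc, h, -⟩ := map_latticeCoord
  rw [← h]; exact_mod_cast pos_iff_ne_zero.2 hc

theorem setIntegral_cell {F : Type*} [NormedAddCommGroup F] [NormedSpace ℝ F] (g : Plane → F) :
    ∫ x in cell, g x = cellVol • ∫ θ in Set.Icc (0 : Fin 2 → ℝ) 1, g (latticeCoord.symm θ) := by
  obtain ⟨c, -, hc, hmap⟩ := map_latticeCoord
  have h := setIntegral_map_equiv (μ := volume) latticeCoord.toHomeomorph.toMeasurableEquiv
    (fun θ => g (latticeCoord.symm θ)) (Set.Icc 0 1)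
  have h1 : Measure.map (latticeCoord.toHomeomorph.toMeasurableEquiv) (volume : Measure Plane)
    = c • (volume : Measure (Fin 2 → ℝ)) := hmap
  have h2 : ∀ x : Plane, latticeCoord.symm (latticeCoord.toHomeomorph.toMeasurableEquiv x) = x :=
    fun x => latticeCoord.symm_apply_apply x
  rw [h1, Measure.restrict_smul, integral_smul_nnreal_measure] at h
  simp only [h2] at h
  rw [latticeCoord_image_cell]
  rw [← hc]
  exact h.symm

end Cell

/-! ### Fourier series of lattice-periodic functions -/

section Torus

open MeasureTheory

-- Haar measure of total mass one; the area of the cell therefore appears as an explicit factor in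
-- `integral_cell_eq_torus`.
local instance : MeasureSpace UnitAddCircle := ⟨AddCircle.haarAddCircle⟩

local instance : Measure.IsAddHaarMeasure (volume : Measure UnitAddCircle) :=
  inferInstanceAs (Measure.IsAddHaarMeasure AddCircle.haarAddCircle)

/-- The projection of the coordinate space to the torus. -/
def torusMk : (Fin 2 → ℝ) → UnitAddTorus (Fin 2) := Pi.map fun _ => QuotientAddGroup.mk

theorem isOpenQuotientMap_torusMk : IsOpenQuotientMap torusMk :=
  IsOpenQuotientMap.piMap fun _ => QuotientAddGroup.isOpenQuotientMap_mk

/-- The function on the torus induced by a periodic function on the plane. -/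
def torusFun {F : Type*} (f : Plane → F) (x : UnitAddTorus (Fin 2)) : F :=
  f (latticeCoord.symm fun i => (x i).out)

theorem torusFun_mk {F : Type*} {f : Plane → F} (hf : IsLatticePeriodic f) (θ : Fin 2 → ℝ) :
    torusFun f (torusMk θ) = f (latticeCoord.symm θ) := by
  have h : ∀ i, ∃ n : ℤ, Quotient.out (torusMk θ i) = θ i + n := by
    intro i
    have h1 : (QuotientAddGroup.mk (Quotient.out (torusMk θ i)) : UnitAddCircle)
      = QuotientAddGroup.mk (θ i) := Quotient.out_eq' _
    obtain ⟨n, hn⟩ := AddSubgroup.mem_zmultiples_iff.1 (QuotientAddGroup.eq.1 h1.symm)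
    refine ⟨n, ?_⟩
    rw [zsmul_eq_mul, mul_one] at hn
    rw [hn]; ring
  choose n hn using h
  have : (latticeCoord.symm fun i => (torusMk θ i).out)
      = latticeCoord.symm θ + ((n 0 : ℝ) • v₁ + (n 1 : ℝ) • v₂) := by
    simp only [latticeCoord_symm, hn]; module
  rw [torusFun, this]
  exact hf _ ⟨_, _, rfl⟩ _

theorem continuous_torusFun {F : Type*} [TopologicalSpace F] {f : Plane → F}
    (hf : IsLatticePeriodic f) (hc : Continuous f) : Continuous (torusFun f) := by
  rw [← isOpenQuotientMap_torusMk.continuous_comp_iff]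
  have : torusFun f ∘ torusMk = fun θ => f (latticeCoord.symm θ) :=
    funext fun θ => torusFun_mk hf θ
  rw [this]
  exact hc.comp latticeCoord.symm.continuous

theorem integral_cell_eq_torus {F : Type*} [NormedAddCommGroup F] [NormedSpace ℝ F]
    {f : Plane → F} (hf : IsLatticePeriodic f) :
    ∫ x in cell, f x = cellVol • ∫ x, torusFun f x := by
  rw [setIntegral_cell, UnitAddTorus.integral_preimage _ 0]
  congr 1
  have h : {x : Fin 2 → ℝ | ∀ i, x i ∈ Set.Ioc ((0 : Fin 2 → ℝ) i) ((0 : Fin 2 → ℝ) i + 1)}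
      = Set.univ.pi fun i => Set.Ioc ((0 : Fin 2 → ℝ) i) ((1 : Fin 2 → ℝ) i) := by
    ext x; simp [Set.mem_pi]
  have hae : (Set.univ.pi fun i => Set.Ioc ((0 : Fin 2 → ℝ) i) ((1 : Fin 2 → ℝ) i))
      =ᵐ[volume] Set.Icc 0 1 := Measure.univ_pi_Ioc_ae_eq_Icc
  rw [h, setIntegral_congr_set hae]
  refine integral_congr_ae (Eventually.of_forall fun θ => ?_)
  exact (torusFun_mk hf θ).symm

theorem integral_cell_translate {F : Type*} [NormedAddCommGroup F] [NormedSpace ℝ F]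
    {f : Plane → F} (hf : IsLatticePeriodic f) (h : Plane) :
    ∫ x in cell, f (x + h) = ∫ x in cell, f x := by
  have hf' : IsLatticePeriodic fun x => f (x + h) := fun v hv x => by
    change f (x + v + h) = f (x + h)
    rw [add_right_comm]; exact hf v hv _
  rw [integral_cell_eq_torus hf', integral_cell_eq_torus hf]
  congr 1
  rw [← integral_add_right_eq_self (torusFun f) (torusMk (latticeCoord h))]
  refine integral_congr_ae (Eventually.of_forall fun x => ?_)
  obtain ⟨θ, rfl⟩ := isOpenQuotientMap_torusMk.surjective x
  change torusFun (fun x => f (x + h)) (torusMk θ) = torusFun f (torusMk θ + torusMk (latticeCoord h))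
  have : torusMk θ + torusMk (latticeCoord h) = torusMk (θ + latticeCoord h) := by
    ext i; rfl
  rw [this, torusFun_mk hf', torusFun_mk hf, map_add, latticeCoord.symm_apply_apply]

/-- The Fourier coefficient of a periodic function. -/
def coef (f : Plane → ℂ) (m : ℤ × ℤ) : ℂ :=
  (cellVol : ℂ)⁻¹ * ∫ x in cell, planeWave (-dualVec m) x * f x

theorem IsLatticePeriodic.mul {f g : Plane → ℂ} (hf : IsLatticePeriodic f)
    (hg : IsLatticePeriodic g) : IsLatticePeriodic fun x => f x * g x :=
  fun v hv x => by simp only [hf v hv x, hg v hv x]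

theorem isLatticePeriodic_planeWave_neg (m : ℤ × ℤ) :
    IsLatticePeriodic (planeWave (-dualVec m)) := by
  rw [← dualVec_neg]; exact isLatticePeriodic_planeWave _

theorem mFourier_torusMk (n : Fin 2 → ℤ) (θ : Fin 2 → ℝ) :
    UnitAddTorus.mFourier n (torusMk θ) = planeWave (dualVec (n 0, n 1)) (latticeCoord.symm θ) := by
  have h : ∀ i, fourier (n i) (torusMk θ i) = Complex.exp (2 * Real.pi * Complex.I * n i * θ i) := by
    intro i
    exact (fourier_coe_apply (T := 1) (n := n i) (x := θ i)).trans (by simp)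
  have h2 : UnitAddTorus.mFourier n (torusMk θ) = ∏ i, fourier (n i) (torusMk θ i) := rfl
  rw [h2, Fin.prod_univ_two, h, h, ← Complex.exp_add, planeWave, latticeCoord_symm, inner_dualVec]
  congr 1
  push_cast
  ring

theorem mFourierCoeff_torusFun {f : Plane → ℂ} (hf : IsLatticePeriodic f) (n : Fin 2 → ℤ) :
    UnitAddTorus.mFourierCoeff (torusFun f) n = coef f (n 0, n 1) := by
  rw [coef, integral_cell_eq_torus ((isLatticePeriodic_planeWave_neg _).mul hf), Complex.real_smul,
    inv_mul_cancel_left₀ (by exact_mod_cast cellVol_pos.ne')]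
  refine integral_congr_ae (Eventually.of_forall fun x => ?_)
  obtain ⟨θ, rfl⟩ := isOpenQuotientMap_torusMk.surjective x
  simp only [smul_eq_mul]
  rw [torusFun_mk hf, torusFun_mk ((isLatticePeriodic_planeWave_neg _).mul hf), mFourier_torusMk,
    ← dualVec_neg]
  rfl

/-- A periodic function with summable Fourier coefficients is the sum of its Fourier series. -/
theorem hasSum_coef {f : Plane → ℂ} (hf : IsLatticePeriodic f) (hc : Continuous f)
    (hs : Summable (coef f)) (x : Plane) :
    HasSum (fun m => coef f m * planeWave (dualVec m) x) (f x) := by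
  let G : C(UnitAddTorus (Fin 2), ℂ) := ⟨torusFun f, continuous_torusFun hf hc⟩
  have hs' : Summable (UnitAddTorus.mFourierCoeff G) := by
    have : UnitAddTorus.mFourierCoeff G = coef f ∘ finTwoArrowEquiv ℤ :=
      funext fun n => mFourierCoeff_torusFun hf n
    rw [this]
    exact hs.comp_injective (finTwoArrowEquiv ℤ).injective
  have h := UnitAddTorus.hasSum_mFourier_series_apply_of_summable hs' (torusMk (latticeCoord x))
  have h2 : G (torusMk (latticeCoord x)) = f x :=
    (torusFun_mk hf _).trans (by rw [latticeCoord.symm_apply_apply])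
  rw [h2] at h
  rw [← (finTwoArrowEquiv ℤ).hasSum_iff]
  refine h.congr_fun ?_ |> id
  intro n
  simp only [Function.comp, smul_eq_mul]
  rw [mFourier_torusMk, latticeCoord.symm_apply_apply]
  exact congrArg (· * _) (mFourierCoeff_torusFun hf n).symm

theorem integral_cell_planeWave {m : ℤ × ℤ} (hm : m ≠ 0) :
    ∫ x in cell, planeWave (dualVec m) x = 0 := by
  -- Translating by a vector at which the plane wave is `-1` changes the sign of the integral but
  -- not its value.
  obtain ⟨h, hh⟩ : ∃ h, planeWave (dualVec m) h = -1 := by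
    have key : ∀ a b : ℝ, (m.1 : ℝ) * a + m.2 * b = 1 / 2 →
        planeWave (dualVec m) (a • v₁ + b • v₂) = -1 := by
      intro a b hab
      rw [planeWave, inner_dualVec, hab]
      rw [← Complex.exp_pi_mul_I]; congr 1; push_cast; ring
    by_cases h1 : m.1 = 0
    · have h2 : (m.2 : ℝ) ≠ 0 := by
        intro h2; exact hm (Prod.ext h1 (by exact_mod_cast h2))
      exact ⟨_, key 0 (1 / (2 * m.2)) (by field_simp; ring)⟩
    · have h2 : (m.1 : ℝ) ≠ 0 := by exact_mod_cast h1
      exact ⟨_, key (1 / (2 * m.1)) 0 (by field_simp; ring)⟩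
  have h1 := integral_cell_translate (isLatticePeriodic_planeWave m) h
  simp only [planeWave_add_right, hh, mul_neg, mul_one, integral_neg] at h1
  linear_combination -(1 / 2 : ℂ) * h1

theorem coef_planeWave (m n : ℤ × ℤ) :
    coef (planeWave (dualVec n)) m = if m = n then 1 else 0 := by
  have h : ∀ x, planeWave (-dualVec m) x * planeWave (dualVec n) x = planeWave (dualVec (n - m)) x :=
    fun x => by rw [← planeWave_add_left, dualVec_sub]; congr 1; abel
  simp only [coef, h]
  split_ifs with hmn
  · simp only [hmn, sub_self, dualVec_zero, planeWave_zero_left, integral_const,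
      Measure.real, Measure.restrict_apply_univ]
    change (cellVol : ℂ)⁻¹ * (cellVol • (1 : ℂ)) = 1
    rw [Complex.real_smul, mul_one, inv_mul_cancel₀ (by exact_mod_cast cellVol_pos.ne')]
  · rw [integral_cell_planeWave (sub_ne_zero.2 (Ne.symm hmn)), mul_zero]

theorem coef_const_mul (c : ℂ) (f : Plane → ℂ) (m : ℤ × ℤ) :
    coef (fun x => c * f x) m = c * coef f m := by
  rw [coef, coef]
  simp only [mul_left_comm _ c]
  rw [integral_const_mul, mul_left_comm]

theorem coef_add {f g : Plane → ℂ} (hf : Continuous f) (hg : Continuous g) (m : ℤ × ℤ) :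
    coef (fun x => f x + g x) m = coef f m + coef g m := by
  rw [coef, coef, coef]
  simp only [mul_add]
  rw [integral_add, mul_add]
  · exact ((continuous_planeWave _).mul hf).integrable_cell
  · exact ((continuous_planeWave _).mul hg).integrable_cell

theorem norm_coef_le {f : Plane → ℂ} {C : ℝ} (hC : ∀ x, ‖f x‖ ≤ C) (m : ℤ × ℤ) :
    ‖coef f m‖ ≤ C := by
  have h : ‖∫ x in cell, planeWave (-dualVec m) x * f x‖ ≤ C * volume.real cell :=
    norm_setIntegral_le_of_norm_le_const volume_cell_lt_top fun x _ => by
      rw [norm_mul, norm_planeWave, one_mul]; exact hC x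
  have h2 : C * volume.real cell = C * cellVol := rfl
  rw [coef, norm_mul, norm_inv, Complex.norm_real, Real.norm_of_nonneg cellVol_pos.le,
    inv_mul_le_iff₀ cellVol_pos, mul_comm, ← h2]
  exact h

/-- Coefficients of an absolutely convergent trigonometric series. -/
theorem coef_tsum {a : ℤ × ℤ → ℂ} (ha : Summable a) (m : ℤ × ℤ) :
    coef (fun x => ∑' n, a n * planeWave (dualVec n) x) m = a m := by
  have ha' := ha.norm
  have h1 : HasSum (fun n => ∫ x in cell, planeWave (-dualVec m) x * (a n * planeWave (dualVec n) x))
      (∫ x in cell, ∑' n, planeWave (-dualVec m) x * (a n * planeWave (dualVec n) x)) := by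
    refine hasSum_integral_of_summable_integral_norm (fun n => ?_) ?_
    · exact ((continuous_planeWave _).mul
        (continuous_const.mul (continuous_planeWave _))).integrable_cell
    · simp only [norm_mul, norm_planeWave, one_mul, mul_one, integral_const]
      exact ha'.const_smul _
  have h2 : ∀ x, ∑' n, planeWave (-dualVec m) x * (a n * planeWave (dualVec n) x)
      = planeWave (-dualVec m) x * ∑' n, a n * planeWave (dualVec n) x := fun x => tsum_mul_left
  simp only [h2] at h1
  have h3 := (h1.mul_left (cellVol : ℂ)⁻¹).tsum_eq
  rw [coef, ← h3]
  have h4 : ∀ n, (cellVol : ℂ)⁻¹ * ∫ x in cell, planeWave (-dualVec m) x *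
      (a n * planeWave (dualVec n) x) = if m = n then a n else 0 := by
    intro n
    have := coef_const_mul (a n) (planeWave (dualVec n)) m
    rw [coef_planeWave] at this
    rw [coef] at this
    rw [this]; split_ifs <;> simp
  simp only [h4]
  rw [tsum_eq_single m (by intro n hn; rw [if_neg hn.symm]), if_pos rfl]

/-- Parseval's formula. -/
theorem hasSum_cellInner {f g : Plane → ℂ} (hf : Continuous f) (hgc : Continuous g)
    (hg : IsLatticePeriodic g) (hs : Summable (coef g)) :
    HasSum (fun m => (cellVol : ℂ) * (starRingEnd ℂ (coef f m) * coef g m)) (cellInner f g) := by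
  have hs' := hs.norm
  -- Only `g` is expanded, so nothing but continuity is required of `f`.
  have h1 : HasSum (fun n => ∫ x in cell, starRingEnd ℂ (f x) * (coef g n * planeWave (dualVec n) x))
      (∫ x in cell, ∑' n, starRingEnd ℂ (f x) * (coef g n * planeWave (dualVec n) x)) := by
    refine hasSum_integral_of_summable_integral_norm (fun n => ?_) ?_
    · exact ((Complex.continuous_conj.comp hf).mul
        (continuous_const.mul (continuous_planeWave _))).integrable_cell
    · simp only [norm_mul, norm_planeWave, mul_one, integral_mul_const]
      exact hs'.mul_left _
  have h2 : ∀ x, ∑' n, starRingEnd ℂ (f x) * (coef g n * planeWave (dualVec n) x)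
      = starRingEnd ℂ (f x) * g x := fun x => by
    rw [tsum_mul_left, (hasSum_coef hg hgc hs x).tsum_eq]
  simp only [h2] at h1
  refine h1.congr_fun ?_ |> id
  intro n
  have h3 : ∫ x in cell, starRingEnd ℂ (f x) * (coef g n * planeWave (dualVec n) x)
      = coef g n * starRingEnd ℂ (∫ x in cell, planeWave (-dualVec n) x * f x) := by
    rw [← integral_conj, ← integral_const_mul]
    refine integral_congr_ae (Eventually.of_forall fun x => ?_)
    simp only [map_mul, conj_planeWave, neg_neg]
    ring
  have h4 : (cellVol : ℂ) ≠ 0 := by exact_mod_cast cellVol_pos.ne'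
  have h5 : starRingEnd ℂ (coef f n)
      = (cellVol : ℂ)⁻¹ * starRingEnd ℂ (∫ x in cell, planeWave (-dualVec n) x * f x) := by
    rw [coef, map_mul, map_inv₀, Complex.conj_ofReal]
  rw [h3, h5]
  field_simp

end Torus

/-! ### Decay of Fourier coefficients -/

section Decay

open MeasureTheory

theorem IsLatticePeriodic.fderiv {f : Plane → ℂ} (hf : IsLatticePeriodic f) :
    IsLatticePeriodic (fderiv ℝ f) := fun v hv x => by
  rw [← fderiv_comp_add_right]
  congr 1
  exact funext fun y => hf v hv y

theorem IsLatticePeriodic.fderiv_apply {f : Plane → ℂ} (hf : IsLatticePeriodic f) (w : Plane) :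
    IsLatticePeriodic (fun x => _root_.fderiv ℝ f x w) := fun v hv x => by
  simp only [hf.fderiv v hv x]

/-- The integral of the translate `f (x + h v)` over the cell does not depend on `h`; differentiate
it at `h = 0`. -/
theorem integral_cell_fderiv {f : Plane → ℂ} (hf : IsLatticePeriodic f) (hc : ContDiff ℝ 1 f)
    (v : Plane) : ∫ x in cell, fderiv ℝ f x v = 0 := by
  have hcont : Continuous fun x => fderiv ℝ f x v :=
    (hc.continuous_fderiv one_ne_zero).clm_apply continuous_const
  obtain ⟨C, hC⟩ := (hf.fderiv_apply v).exists_bound hcont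
  have hd := (hasDerivAt_integral_of_dominated_loc_of_deriv_le (μ := volume.restrict cell)
    (F := fun (h : ℝ) x => f (x + h • v)) (F' := fun h x => fderiv ℝ f (x + h • v) v) (x₀ := 0)
    (bound := fun _ => C) (s := Set.univ) univ_mem
    (Eventually.of_forall fun h =>
      (hc.continuous.comp (continuous_id.add continuous_const)).aestronglyMeasurable)
    (by simpa [IntegrableOn] using hc.continuous.integrable_cell)
    (hcont.comp (continuous_id.add continuous_const)).aestronglyMeasurable
    (Eventually.of_forall fun x h _ => hC _) (integrable_const _)
    (Eventually.of_forall fun x h _ => by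
      have h1 : HasDerivAt (fun h : ℝ => x + h • v) v h := by
        simpa using ((hasDerivAt_id h).smul_const v).const_add x
      exact ((hc.differentiable one_ne_zero _).hasFDerivAt).comp_hasDerivAt h h1)).2
  have h2 : (fun h : ℝ => ∫ x in cell, f (x + h • v)) = fun _ => ∫ x in cell, f x :=
    funext fun h => integral_cell_translate hf _
  rw [h2] at hd
  simpa using (hd.unique (hasDerivAt_const _ _))

theorem coef_fderiv {f : Plane → ℂ} (hf : IsLatticePeriodic f) (hc : ContDiff ℝ 1 f) (v : Plane)
    (m : ℤ × ℤ) : coef (fun x => fderiv ℝ f x v) m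
      = Complex.I * (⟪dualVec m, v⟫_ℝ : ℝ) * coef f m := by
  have hcont : Continuous fun x => fderiv ℝ f x v :=
    (hc.continuous_fderiv one_ne_zero).clm_apply continuous_const
  have hd : ∀ x, fderiv ℝ (fun x => planeWave (-dualVec m) x * f x) x v
      = planeWave (-dualVec m) x * fderiv ℝ f x v
        + -(Complex.I * (⟪dualVec m, v⟫_ℝ : ℝ)) * (planeWave (-dualVec m) x * f x) := by
    intro x
    have h : HasFDerivAt (fun x => planeWave (-dualVec m) x * f x) _ x :=
      (hasFDerivAt_planeWave (-dualVec m) x).mul (hc.differentiable one_ne_zero x).hasFDerivAt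
    rw [h.fderiv]
    simp
    ring
  have h0 := integral_cell_fderiv ((isLatticePeriodic_planeWave_neg m).mul hf)
    ((contDiff_planeWave _).mul hc) v
  simp only [hd] at h0
  have h1 : Continuous fun x => planeWave (-dualVec m) x * fderiv ℝ f x v :=
    (continuous_planeWave _).mul hcont
  have h2 : Continuous fun x => -(Complex.I * (⟪dualVec m, v⟫_ℝ : ℝ)) *
      (planeWave (-dualVec m) x * f x) :=
    continuous_const.mul ((continuous_planeWave _).mul hc.continuous)
  rw [integral_add h1.integrable_cell h2.integrable_cell, integral_const_mul] at h0
  rw [coef, coef]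
  linear_combination (cellVol : ℂ)⁻¹ * h0

/-- Rapid decay of a family of coefficients. -/
def RapidDecay (a : ℤ × ℤ → ℂ) : Prop := ∀ s : ℕ, ∃ C, ∀ m, weight m ^ s * ‖a m‖ ≤ C

theorem RapidDecay.summable {a : ℤ × ℤ → ℂ} (ha : RapidDecay a) (s : ℕ) :
    Summable fun m => weight m ^ s * ‖a m‖ := by
  obtain ⟨C, hC⟩ := ha (s + 2)
  refine Summable.of_nonneg_of_le (fun m => by have := weight_pos m; positivity) (fun m => ?_)
    (summable_weight_inv_sq.mul_left C)
  have h := weight_pos m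
  rw [← div_eq_mul_inv, le_div_iff₀ (by positivity)]
  calc weight m ^ s * ‖a m‖ * weight m ^ 2 = weight m ^ (s + 2) * ‖a m‖ := by ring
    _ ≤ C := hC m

theorem RapidDecay.summable_self {a : ℤ × ℤ → ℂ} (ha : RapidDecay a) : Summable a :=
  Summable.of_norm (by simpa using ha.summable 0)

/-- Coefficients of smooth periodic functions decay rapidly. -/
theorem rapidDecay_coef {f : Plane → ℂ} (hf : IsLatticePeriodic f) (hc : ContDiff ℝ ∞ f) :
    RapidDecay (coef f) := by
  intro s
  induction s generalizing f with
  | zero =>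
    obtain ⟨C, hC⟩ := hf.exists_bound hc.continuous
    exact ⟨C, fun m => by simpa using norm_coef_le hC m⟩
  | succ s ih =>
    have hsm : ∀ (g : Plane → ℂ) (v : Plane), ContDiff ℝ ∞ g → ContDiff ℝ ∞ fun x => fderiv ℝ g x v :=
      fun g v hg => (hg.fderiv_right (m := ∞) (by norm_cast)).clm_apply contDiff_const
    let e : Fin 2 → Plane := fun i => EuclideanSpace.single i 1
    let D : Fin 2 → Plane → ℂ := fun i x => fderiv ℝ (fun y => fderiv ℝ f y (e i)) x (e i)
    have hD : ∀ i, ContDiff ℝ ∞ (D i) := fun i => hsm _ _ (hsm _ _ hc)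
    have hDp : ∀ i, IsLatticePeriodic (D i) := fun i => (hf.fderiv_apply _).fderiv_apply _
    have hDc : ∀ i m, coef (D i) m = -((dualVec m i : ℝ) : ℂ) ^ 2 * coef f m := by
      intro i m
      have he : ⟪dualVec m, e i⟫_ℝ = dualVec m i := by
        simp [e, EuclideanSpace.inner_single_right]
      rw [coef_fderiv (hf.fderiv_apply _) ((hsm _ _ hc).of_le (by norm_cast)),
        coef_fderiv hf (hc.of_le (by norm_cast)), he]
      linear_combination ((dualVec m i : ℝ) : ℂ) ^ 2 * coef f m * Complex.I_sq
    -- The function `f - Δ f` has the coefficients of `f` multiplied by the weight, which yields one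
    -- more power.
    obtain ⟨C, hC⟩ := ih (f := fun x => (f x + -1 * D 0 x) + -1 * D 1 x)
      (fun v hv x => by simp only [hf v hv x, hDp 0 v hv x, hDp 1 v hv x])
      ((hc.add (contDiff_const.mul (hD 0))).add (contDiff_const.mul (hD 1)))
    refine ⟨C, fun m => ?_⟩
    have h1 : coef (fun x => (f x + -1 * D 0 x) + -1 * D 1 x) m = (weight m : ℂ) * coef f m := by
      have hm : ∀ i, Continuous fun x => -1 * D i x := fun i =>
        continuous_const.mul (hD i).continuous
      have hm' : Continuous fun x => f x + -1 * D 0 x := hc.continuous.add (hm 0)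
      rw [coef_add hm' (hm 1), coef_add hc.continuous (hm 0), coef_const_mul, coef_const_mul, hDc, hDc, weight,
        norm_sq_plane]
      push_cast
      ring
    have h2 := hC m
    rw [h1, norm_mul, Complex.norm_real, Real.norm_of_nonneg (weight_pos m).le] at h2
    calc weight m ^ (s + 1) * ‖coef f m‖ = weight m ^ s * (weight m * ‖coef f m‖) := by ring
      _ ≤ C := h2

end Decay

/-! ### Synthesis -/

section Synthesis

/-- The trigonometric series `∑ a_m exp(i (k + m₁ k₁ + m₂ k₂)·x)`. -/
def synth (k : Plane) (a : ℤ × ℤ → ℂ) (x : Plane) : ℂ := ∑' m, a m * planeWave (k + dualVec m) x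

theorem synth_eq (k : Plane) (a : ℤ × ℤ → ℂ) (x : Plane) :
    synth k a x = planeWave k x * synth 0 a x := by
  rw [synth, synth, ← tsum_mul_left]
  exact tsum_congr fun m => by rw [planeWave_add_left, zero_add]; ring

theorem synth_zero_eq (a : ℤ × ℤ → ℂ) (x : Plane) :
    synth 0 a x = ∑' m, a m * planeWave (dualVec m) x := by simp only [synth, zero_add]

theorem isLatticePeriodic_synth_zero (a : ℤ × ℤ → ℂ) : IsLatticePeriodic (synth 0 a) :=
  fun v hv x => by
    rw [synth_zero_eq, synth_zero_eq]
    exact tsum_congr fun m => by rw [isLatticePeriodic_planeWave m v hv x]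

theorem synth_add_lattice (k : Plane) (a : ℤ × ℤ → ℂ) {v : Plane} (hv : v ∈ lattice) (x : Plane) :
    synth k a (x + v) = planeWave k v * synth k a x := by
  rw [synth_eq, synth_eq k a x, isLatticePeriodic_synth_zero a v hv x, planeWave_add_right]; ring

theorem coef_synth_zero {a : ℤ × ℤ → ℂ} (ha : Summable a) (m : ℤ × ℤ) : coef (synth 0 a) m = a m := by
  have : synth 0 a = fun x => ∑' n, a n * planeWave (dualVec n) x := funext (synth_zero_eq a)
  rw [this]; exact coef_tsum ha m

theorem summable_mul_planeWave {a : ℤ × ℤ → ℂ} (ha : Summable a) (k : ℤ × ℤ → Plane) (x : Plane) :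
    Summable fun m => a m * planeWave (k m) x :=
  Summable.of_norm (by simpa only [norm_mul, norm_planeWave, mul_one] using ha.norm)

theorem synth_add {a b : ℤ × ℤ → ℂ} (ha : Summable a) (hb : Summable b) (k x : Plane) :
    synth k (fun m => a m + b m) x = synth k a x + synth k b x := by
  simp only [synth, add_mul]
  exact (summable_mul_planeWave ha _ x).tsum_add (summable_mul_planeWave hb _ x)

theorem synth_const_mul (c : ℂ) (a : ℤ × ℤ → ℂ) (k x : Plane) :
    synth k (fun m => c * a m) x = c * synth k a x := by
  simp only [synth, mul_assoc, tsum_mul_left]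

theorem norm_iteratedFDeriv_planeWave (n : ℕ) (k x : Plane) :
    ‖iteratedFDeriv ℝ n (planeWave k) x‖ ≤ ‖k‖ ^ n := by
  induction n with
  | zero => simp [norm_planeWave]
  | succ n ih =>
    let l : Plane →L[ℝ] ℂ := Complex.I • Complex.ofRealCLM.comp (innerSL ℝ k)
    let L : ℂ →L[ℝ] Plane →L[ℝ] ℂ :=
      ((ContinuousLinearMap.lsmul ℝ ℂ : ℂ →L[ℝ] (Plane →L[ℝ] ℂ) →L[ℝ] (Plane →L[ℝ] ℂ))).flip l
    have hl : ‖l‖ ≤ ‖k‖ := by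
      refine l.opNorm_le_bound (norm_nonneg _) fun y => ?_
      simpa [l] using abs_real_inner_le_norm k y
    have hL : ‖L‖ ≤ ‖k‖ := by
      refine L.opNorm_le_bound (norm_nonneg _) fun z => ?_
      change ‖z • l‖ ≤ _
      rw [norm_smul, mul_comm]
      gcongr
    have hfd : fderiv ℝ (planeWave k) = L ∘ planeWave k :=
      funext fun y => (hasFDerivAt_planeWave k y).fderiv
    rw [← norm_iteratedFDeriv_fderiv, hfd, pow_succ, mul_comm]
    refine (L.norm_iteratedFDeriv_comp_left (N := n) (contDiff_planeWave k).contDiffAt le_rfl).trans ?_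
    gcongr

theorem norm_add_dualVec_le (k : Plane) (m : ℤ × ℤ) : ‖k + dualVec m‖ ≤ (1 + ‖k‖) * weight m := by
  have h1 := norm_dualVec_le_weight m
  have h2 := one_le_weight m
  have h3 := norm_add_le k (dualVec m)
  nlinarith [norm_nonneg k]

theorem norm_iteratedFDeriv_mode (k : Plane) (c : ℂ) (m : ℤ × ℤ) (n : ℕ) (x : Plane) :
    ‖iteratedFDeriv ℝ n (fun y => c * planeWave (k + dualVec m) y) x‖
      ≤ (1 + ‖k‖) ^ n * (weight m ^ n * ‖c‖) := by
  have h : (fun y => c * planeWave (k + dualVec m) y) = c • planeWave (k + dualVec m) := rfl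
  rw [h, iteratedFDeriv_const_smul_apply (contDiff_planeWave _).contDiffAt, norm_smul]
  have h1 := norm_iteratedFDeriv_planeWave n (k + dualVec m) x
  have h2 : ‖k + dualVec m‖ ^ n ≤ ((1 + ‖k‖) * weight m) ^ n := by
    gcongr; exact norm_add_dualVec_le k m
  calc ‖c‖ * _ ≤ ‖c‖ * ((1 + ‖k‖) * weight m) ^ n := by gcongr; exact h1.trans h2
    _ = _ := by rw [mul_pow]; ring

theorem contDiff_synth {N : ℕ∞} {a : ℤ × ℤ → ℂ}
    (ha : ∀ n : ℕ, (n : ℕ∞) ≤ N → Summable fun m => weight m ^ n * ‖a m‖) (k : Plane) :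
    ContDiff ℝ N (synth k a) :=
  contDiff_tsum (fun _ => contDiff_const.mul (contDiff_planeWave _))
    (fun n hn => (ha n hn).mul_left ((1 + ‖k‖) ^ n))
    (fun n _ x _ => norm_iteratedFDeriv_mode k (a _) _ n x)

theorem hasSum_iteratedFDeriv_synth {N : ℕ∞} {a : ℤ × ℤ → ℂ}
    (ha : ∀ n : ℕ, (n : ℕ∞) ≤ N → Summable fun m => weight m ^ n * ‖a m‖) (k : Plane) {n : ℕ}
    (hn : (n : ℕ∞) ≤ N) (x : Plane) :
    HasSum (fun m => iteratedFDeriv ℝ n (fun y => a m * planeWave (k + dualVec m) y) x)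
      (iteratedFDeriv ℝ n (synth k a) x) := by
  have h := iteratedFDeriv_tsum_apply (𝕜 := ℝ) (N := N)
    (f := fun m (y : Plane) => a m * planeWave (k + dualVec m) y)
    (fun m => contDiff_const.mul (contDiff_planeWave _))
    (fun n hn => (ha n hn).mul_left ((1 + ‖k‖) ^ n))
    (fun n _ x _ => norm_iteratedFDeriv_mode k (a _) _ n x) hn x
  have h2 : synth k a = fun y => ∑' m, a m * planeWave (k + dualVec m) y := rfl
  rw [h2, h]
  refine (Summable.of_norm_bounded ((ha n hn).mul_left ((1 + ‖k‖) ^ n)) fun m => ?_).hasSum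
  exact norm_iteratedFDeriv_mode k (a m) m n x

/-- The Laplacian as a continuous linear function of the second derivative. -/
def contraction : (Plane [×2]→L[ℝ] ℂ) →L[ℝ] ℂ :=
  ∑ i : Fin 2, ContinuousMultilinearMap.apply ℝ (fun _ : Fin 2 => Plane) ℂ
    ![EuclideanSpace.single i 1, EuclideanSpace.single i 1]

theorem laplacian_eq_contraction (f : Plane → ℂ) (x : Plane) :
    Laplacian.laplacian f x = contraction (iteratedFDeriv ℝ 2 f x) := by
  rw [InnerProductSpace.laplacian_eq_iteratedFDeriv_orthonormalBasis f
    (EuclideanSpace.basisFun (Fin 2) ℝ)]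
  simp [contraction]

theorem laplacian_planeWave (k x : Plane) :
    Laplacian.laplacian (planeWave k) x = -(‖k‖ ^ 2 : ℝ) * planeWave k x := by
  have h1 : ∀ v : Plane, iteratedFDeriv ℝ 2 (planeWave k) x ![v, v]
      = -((⟪k, v⟫_ℝ : ℝ) : ℂ) ^ 2 * planeWave k x := by
    intro v
    rw [iteratedFDeriv_two_apply]
    have hfd : fderiv ℝ (planeWave k) = fun y => planeWave k y •
        (Complex.I • Complex.ofRealCLM.comp (innerSL ℝ k)) :=
      funext fun y => (hasFDerivAt_planeWave k y).fderiv
    have h2 : HasFDerivAt (fun y => planeWave k y • (Complex.I • Complex.ofRealCLM.comp (innerSL ℝ k)))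
        _ x := (hasFDerivAt_planeWave k x).smul_const _
    rw [hfd, h2.fderiv]
    simp
    linear_combination ((⟪k, v⟫_ℝ : ℝ) : ℂ) ^ 2 * planeWave k x * Complex.I_sq
  rw [InnerProductSpace.laplacian_eq_iteratedFDeriv_orthonormalBasis _
    (EuclideanSpace.basisFun (Fin 2) ℝ)]
  simp only [h1, Fin.sum_univ_two, norm_sq_plane]
  simp [EuclideanSpace.inner_single_right]
  ring

theorem laplacian_synth {a : ℤ × ℤ → ℂ} (ha : RapidDecay a) (k x : Plane) :
    Laplacian.laplacian (synth k a) x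
      = synth k (fun m => -((‖k + dualVec m‖ ^ 2 : ℝ) : ℂ) * a m) x := by
  have h := (hasSum_iteratedFDeriv_synth (N := ⊤) (fun n _ => ha.summable n) k (n := 2)
    le_top x).mapL contraction
  rw [laplacian_eq_contraction, ← h.tsum_eq, synth]
  refine tsum_congr fun m => ?_
  have h2 : (fun y => a m * planeWave (k + dualVec m) y) = a m • planeWave (k + dualVec m) := rfl
  rw [← laplacian_eq_contraction, h2, InnerProductSpace.laplacian_smul (a m)
    (contDiff_planeWave _).contDiffAt]
  simp only [smul_eq_mul]
  rw [laplacian_planeWave]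
  ring

theorem RapidDecay.mul_bounded {a : ℤ × ℤ → ℂ} (ha : RapidDecay a) {b : ℤ × ℤ → ℂ} {C : ℝ} {n : ℕ}
    (hb : ∀ m, ‖b m‖ ≤ C * weight m ^ n) : RapidDecay fun m => b m * a m := by
  intro s
  obtain ⟨C', hC'⟩ := ha (s + n)
  have hC0 : 0 ≤ C := by
    have := (norm_nonneg _).trans (hb 0)
    exact nonneg_of_mul_nonneg_left this (pow_pos (weight_pos 0) n)
  refine ⟨C * C', fun m => ?_⟩
  have h := weight_pos m
  calc weight m ^ s * ‖b m * a m‖ ≤ weight m ^ s * (C * weight m ^ n * ‖a m‖) := by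
        rw [norm_mul]; gcongr; exact hb m
    _ = C * (weight m ^ (s + n) * ‖a m‖) := by ring
    _ ≤ C * C' := by gcongr; exact hC' m

theorem contDiff_synth_of_rapidDecay {a : ℤ × ℤ → ℂ} (ha : RapidDecay a) (k : Plane) :
    ContDiff ℝ ∞ (synth k a) := contDiff_synth (N := ⊤) (fun n _ => ha.summable n) k

/-- The Hilbert space `ℓ²(ℤ²)`. -/
abbrev Ell2 : Type := lp (fun _ : ℤ × ℤ => ℂ) 2

theorem norm_ell2_apply_le (c : Ell2) (m : ℤ × ℤ) : ‖c m‖ ≤ ‖c‖ :=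
  lp.norm_apply_le_norm (by norm_num) c m

-- Derivatives of order at most two cost two powers of the weight, and `weight⁻²` is summable; hence
-- the exponent `4`. The map transfers analyticity from `ℓ²` to `C²` by composition with a bounded
-- linear map.
set_option maxSynthPendingDepth 5 in
theorem exists_derivative_map (n : ℕ) : ∃ J : Ell2 →L[ℂ] (Plane →ᵇ (Plane [×n]→L[ℝ] ℂ)),
    n ≤ 2 → ∀ c x, J c x = iteratedFDeriv ℝ n (synth 0 fun m => ((weight m ^ 4 : ℝ) : ℂ)⁻¹ * c m) x := by
  by_cases hn : n ≤ 2
  swap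
  · exact ⟨0, fun h => absurd h hn⟩
  let e : ℤ × ℤ → (Plane →ᵇ (Plane [×n]→L[ℝ] ℂ)) := fun m =>
    BoundedContinuousFunction.ofNormedAddCommGroup
      (iteratedFDeriv ℝ n (fun y => ((weight m ^ 4 : ℝ) : ℂ)⁻¹ * planeWave (0 + dualVec m) y))
      ((contDiff_const.mul (contDiff_planeWave (n := n) _)).continuous_iteratedFDeriv le_rfl)
      ((weight m ^ 2)⁻¹) (fun x => by
        refine (norm_iteratedFDeriv_mode 0 _ m n x).trans ?_
        have h := weight_pos m
        rw [norm_zero, add_zero, one_pow, one_mul, norm_inv, Complex.norm_real,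
          Real.norm_of_nonneg (by positivity), ← div_eq_mul_inv, div_le_iff₀ (by positivity)]
        calc weight m ^ n ≤ weight m ^ 2 := pow_le_pow_right₀ (one_le_weight m) hn
          _ = (weight m ^ 2)⁻¹ * weight m ^ 4 := by field_simp)
  have he : ∀ m, ‖e m‖ ≤ (weight m ^ 2)⁻¹ := fun m =>
    BoundedContinuousFunction.norm_ofNormedAddCommGroup_le _ (by have := weight_pos m; positivity) _
  let L : ℤ × ℤ → Ell2 →L[ℂ] (Plane →ᵇ (Plane [×n]→L[ℝ] ℂ)) := fun m =>
    (lp.evalCLM ℂ (fun _ : ℤ × ℤ => ℂ) 2 m).smulRight (e m)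
  have hL : ∀ m, ‖L m‖ ≤ (weight m ^ 2)⁻¹ := by
    intro m
    refine ContinuousLinearMap.opNorm_le_bound _ (by have := weight_pos m; positivity) fun c => ?_
    change ‖c m • e m‖ ≤ _
    rw [norm_smul, mul_comm]
    gcongr
    · exact he m
    · exact norm_ell2_apply_le c m
  have hsum : Summable L := Summable.of_norm_bounded summable_weight_inv_sq hL
  refine ⟨∑' m, L m, fun _ c x => ?_⟩
  have h1 : HasSum (fun m => L m c) ((∑' m, L m) c) :=
    hsum.hasSum.mapL (ContinuousLinearMap.apply ℂ (Plane →ᵇ (Plane [×n]→L[ℝ] ℂ)) c)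
  have h2 : HasSum (fun m => L m c x) ((∑' m, L m) c x) :=
    h1.mapL (BoundedContinuousFunction.evalCLM ℂ x)
  refine h2.unique ?_
  have ha : ∀ j : ℕ, (j : ℕ∞) ≤ (2 : ℕ) →
      Summable fun m => weight m ^ j * ‖((weight m ^ 4 : ℝ) : ℂ)⁻¹ * c m‖ := by
    intro j hj
    have hj' : j ≤ 2 := by exact_mod_cast hj
    refine Summable.of_nonneg_of_le (fun m => by have := weight_pos m; positivity) (fun m => ?_)
      (summable_weight_inv_sq.mul_right ‖c‖)
    have h := weight_pos m
    rw [norm_mul, norm_inv, Complex.norm_real, Real.norm_of_nonneg (by positivity), ← mul_assoc]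
    gcongr
    · rw [← div_eq_mul_inv, div_le_iff₀ (by positivity)]
      calc weight m ^ j ≤ weight m ^ 2 := pow_le_pow_right₀ (one_le_weight m) hj'
          _ = (weight m ^ 2)⁻¹ * weight m ^ 4 := by field_simp
    · exact norm_ell2_apply_le c m
  have h3 := hasSum_iteratedFDeriv_synth ha 0 (n := n) (by exact_mod_cast hn) x
  refine h3.congr_fun ?_ |> id
  intro m
  change c m • iteratedFDeriv ℝ n (fun y => ((weight m ^ 4 : ℝ) : ℂ)⁻¹ * planeWave (0 + dualVec m) y) x = _
  rw [← iteratedFDeriv_const_smul_apply (contDiff_const.mul (contDiff_planeWave _)).contDiffAt]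
  congr 1
  ext y
  simp only [Pi.smul_apply, smul_eq_mul]
  ring

end Synthesis

/-! ### Sandwiched inverses of coercive operators -/

section Sandwich

variable {H : Type} [NormedAddCommGroup H] [InnerProductSpace ℂ H] [CompleteSpace H]

/-- The operator `A B⁻¹ A`. -/
def sandwich (A B : H →L[ℂ] H) : H →L[ℂ] H := A * Ring.inverse B * A

variable {A B : H →L[ℂ] H} {c : ℝ}

/-- The Lax-Milgram theorem. -/
theorem isUnit_of_coercive (hc : 0 < c) (hB : ∀ x, c * ‖x‖ ^ 2 ≤ (⟪x, B x⟫_ℂ).re) : IsUnit B := by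
  refine ContinuousLinearMap.isUnit_of_forall_le_norm_inner_map B (c := ⟨c, hc.le⟩) hc fun x => ?_
  calc ‖x‖ ^ 2 * c ≤ (⟪x, B x⟫_ℂ).re := by rw [mul_comm]; exact hB x
    _ ≤ ‖⟪x, B x⟫_ℂ‖ := Complex.re_le_norm _
    _ = ‖⟪B x, x⟫_ℂ‖ := by rw [← inner_conj_symm, RCLike.norm_conj]

omit [CompleteSpace H] in
theorem apply_inverse (hB : IsUnit B) (x : H) : B (Ring.inverse B x) = x := by
  have := Ring.mul_inverse_cancel B hB
  exact congrArg (fun T : H →L[ℂ] H => T x) this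

omit [CompleteSpace H] in
theorem inverse_apply (hB : IsUnit B) (x : H) : Ring.inverse B (B x) = x := by
  have := Ring.inverse_mul_cancel B hB
  exact congrArg (fun T : H →L[ℂ] H => T x) this

omit [CompleteSpace H] in
theorem sandwich_apply (A B : H →L[ℂ] H) (x : H) : sandwich A B x = A (Ring.inverse B (A x)) := rfl

/-- For `y = B⁻¹ A x` the form of `A B⁻¹ A` at `x` is that of `B` at `y`, and `y ≠ 0` because `A` is
injective. Compactness comes from the factor `A`. -/
theorem sandwich_isCompactPos (hA : A.IsSymmetric) (hAc : IsCompactOperator A)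
    (hAi : ∀ x, A x = 0 → x = 0) (hBs : B.IsSymmetric) (hc : 0 < c)
    (hB : ∀ x, c * ‖x‖ ^ 2 ≤ (⟪x, B x⟫_ℂ).re) : IsCompactPos (sandwich A B) := by
  have hu := isUnit_of_coercive hc hB
  have hA' : ∀ x y, ⟪A x, y⟫_ℂ = ⟪x, A y⟫_ℂ := hA
  have hB' : ∀ x y, ⟪B x, y⟫_ℂ = ⟪x, B y⟫_ℂ := hBs
  refine ⟨fun x y => ?_, ?_, fun x hx => ?_⟩
  · change ⟪A (Ring.inverse B (A x)), y⟫_ℂ = ⟪x, A (Ring.inverse B (A y))⟫_ℂ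
    calc ⟪A (Ring.inverse B (A x)), y⟫_ℂ
        = ⟪Ring.inverse B (A x), B (Ring.inverse B (A y))⟫_ℂ := by rw [apply_inverse hu, hA']
      _ = ⟪x, A (Ring.inverse B (A y))⟫_ℂ := by rw [← hB', apply_inverse hu, hA']
  · exact hAc.comp_clm (Ring.inverse B * A)
  · have h0 : Ring.inverse B (A x) ≠ 0 := by
      intro h0
      have := apply_inverse hu (A x)
      rw [h0, map_zero] at this
      exact hx (hAi x this.symm)
    rw [sandwich_apply, hA', ← apply_inverse hu (A x), inverse_apply hu]
    exact lt_of_lt_of_le (by have := norm_pos_iff.2 h0; positivity) (hB _)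

theorem analyticAt_ringInverse_comp {B : ℝ → H →L[ℂ] H} {t : ℝ} (hB : AnalyticAt ℝ B t)
    (hu : IsUnit (B t)) : AnalyticAt ℝ (fun s => Ring.inverse (B s)) t := by
  obtain ⟨z, hz⟩ := hu
  refine AnalyticAt.comp (g := Ring.inverse) ?_ hB
  rw [← hz]
  exact analyticAt_inverse z

theorem analyticAt_sandwich (A : H →L[ℂ] H) {B : ℝ → H →L[ℂ] H} {t : ℝ} (hB : AnalyticAt ℝ B t)
    (hu : IsUnit (B t)) : AnalyticAt ℝ (fun s => sandwich A (B s)) t :=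
  (analyticAt_const.mul (analyticAt_ringInverse_comp hB hu)).mul analyticAt_const

/-- Bound for the logarithmic derivative of eigenvalues. -/
theorem abs_inner_deriv_sandwich_le (hA : A.IsSymmetric) {B : ℝ → H →L[ℂ] H} {t : ℝ}
    (hB : AnalyticAt ℝ B t) (hBs : (B t).IsSymmetric) (hc : 0 < c)
    (hBc : ∀ x, c * ‖x‖ ^ 2 ≤ (⟪x, B t x⟫_ℂ).re) {ν : ℝ} {u : H}
    (hu : sandwich A (B t) u = (ν : ℂ) • u) :
    |(⟪u, deriv (fun s => sandwich A (B s)) t u⟫_ℂ).re| ≤ ‖deriv B t‖ / c * ν * ‖u‖ ^ 2 := by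
  have hunit := isUnit_of_coercive hc hBc
  have hA' : ∀ x y, ⟪A x, y⟫_ℂ = ⟪x, A y⟫_ℂ := hA
  have hB' : ∀ x y, ⟪B t x, y⟫_ℂ = ⟪x, B t y⟫_ℂ := hBs
  have hd : HasDerivAt (fun s => Ring.inverse (B s))
      (-(Ring.inverse (B t) * deriv B t * Ring.inverse (B t))) t := by
    obtain ⟨z, hz⟩ := hunit
    have h1 := hasFDerivAt_ringInverse (𝕜 := ℝ) z
    rw [hz] at h1
    have h2 := h1.comp_hasDerivAt t hB.differentiableAt.hasDerivAt
    have h3 : Ring.inverse (B t) = (z⁻¹ : (H →L[ℂ] H)ˣ) := by rw [← hz, Ring.inverse_unit]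
    rw [h3]
    exact h2.congr_deriv (by simp)
  have hd2 : HasDerivAt (fun s => sandwich A (B s))
      (A * -(Ring.inverse (B t) * deriv B t * Ring.inverse (B t)) * A) t :=
    (hd.const_mul A).mul_const A
  set y := Ring.inverse (B t) (A u) with hy
  have hAy : A y = (ν : ℂ) • u := hu
  have hBy : B t y = A u := apply_inverse hunit _
  -- The derivative of the inverse is `-B⁻¹ B' B⁻¹`. Coercivity bounds `‖y‖ ^ 2` by the form of `B`
  -- at `y`, which equals `ν ‖u‖ ^ 2`; the resulting factor `ν` is essential for the Grönwall
  -- argument.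
  have h1 : ⟪u, deriv (fun s => sandwich A (B s)) t u⟫_ℂ = -⟪y, deriv B t y⟫_ℂ := by
    rw [hd2.deriv]
    change ⟪u, A (-(Ring.inverse (B t) (deriv B t y)))⟫_ℂ = _
    rw [map_neg, inner_neg_right, ← hA', ← hBy, hB', apply_inverse hunit]
  have h2 : (⟪y, B t y⟫_ℂ).re = ν * ‖u‖ ^ 2 := by
    rw [hBy, ← hA', hAy, inner_smul_left, Complex.conj_ofReal, inner_self_eq_norm_sq_to_K,
      Complex.re_ofReal_mul]
    norm_cast
  rw [h1, Complex.neg_re, abs_neg]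
  calc |(⟪y, deriv B t y⟫_ℂ).re| ≤ ‖⟪y, deriv B t y⟫_ℂ‖ := Complex.abs_re_le_norm _
    _ ≤ ‖y‖ * ‖deriv B t y‖ := norm_inner_le_norm _ _
    _ ≤ ‖y‖ * (‖deriv B t‖ * ‖y‖) := by gcongr; exact (deriv B t).le_opNorm y
    _ = ‖deriv B t‖ / c * (c * ‖y‖ ^ 2) := by field_simp
    _ ≤ ‖deriv B t‖ / c * (ν * ‖u‖ ^ 2) := by
        rw [← h2]; gcongr; exact hBc y
    _ = _ := by ring

end Sandwich

/-! ### Weighted shifts and convolutions on `ℓ²(ℤ²)` -/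

section WeightedShift

theorem memℓp_two_iff {f : ℤ × ℤ → ℂ} : Memℓp f 2 ↔ Summable fun m => ‖f m‖ ^ 2 := by
  rw [memℓp_gen_iff (by norm_num)]
  simp

theorem summable_norm_sq_ell2 (c : Ell2) : Summable fun m => ‖c m‖ ^ 2 :=
  memℓp_two_iff.1 (lp.memℓp c)

theorem norm_sq_ell2 (c : Ell2) : ‖c‖ ^ 2 = ∑' m, ‖c m‖ ^ 2 := by
  have := lp.norm_rpow_eq_tsum (p := 2) (by norm_num) c
  simpa using this

theorem shift_bound {g : ℤ × ℤ → ℂ} {K : ℝ} (hK : ∀ m, ‖g m‖ ≤ K) (d : ℤ × ℤ) (c : Ell2) (m : ℤ × ℤ) :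
    ‖g m * c (m - d)‖ ^ 2 ≤ K ^ 2 * ‖c (m - d)‖ ^ 2 := by
  rw [norm_mul, mul_pow]
  gcongr
  exact hK m

theorem summable_shift (d : ℤ × ℤ) (c : Ell2) : Summable fun m => ‖c (m - d)‖ ^ 2 :=
  (summable_norm_sq_ell2 c).comp_injective (Equiv.subRight d).injective

theorem memℓp_shift {g : ℤ × ℤ → ℂ} {K : ℝ} (hK : ∀ m, ‖g m‖ ≤ K) (d : ℤ × ℤ) (c : Ell2) :
    Memℓp (fun m => g m * c (m - d)) 2 :=
  memℓp_two_iff.2 (Summable.of_nonneg_of_le (fun _ => by positivity) (shift_bound hK d c)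
    ((summable_shift d c).mul_left _))

open Classical in
/-- The operator `c ↦ (g_m c_{m-d})_m` for a bounded `g`. -/
def wshift (g : ℤ × ℤ → ℂ) (d : ℤ × ℤ) : Ell2 →L[ℂ] Ell2 :=
  if h : ∃ K, ∀ m, ‖g m‖ ≤ K then
    LinearMap.mkContinuous
      { toFun := fun c => ⟨fun m => g m * c (m - d), memℓp_shift h.choose_spec d c⟩
        map_add' := fun x y => by ext m; exact mul_add _ _ _
        map_smul' := fun a x => by ext m; simp [mul_left_comm] }
      h.choose (fun c => by
        have hK : 0 ≤ h.choose := (norm_nonneg _).trans (h.choose_spec 0)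
        refine abs_le_of_sq_le_sq' ?_ (by positivity) |>.2
        rw [norm_sq_ell2, mul_pow, norm_sq_ell2, ← tsum_mul_left,
          ← (Equiv.subRight d).tsum_eq (fun m => h.choose ^ 2 * ‖c m‖ ^ 2)]
        exact Summable.tsum_le_tsum (shift_bound h.choose_spec d c)
          (memℓp_two_iff.1 (memℓp_shift h.choose_spec d c)) ((summable_shift d c).mul_left _))
  else 0

theorem wshift_apply {g : ℤ × ℤ → ℂ} {K : ℝ} (hK : ∀ m, ‖g m‖ ≤ K) (d : ℤ × ℤ) (c : Ell2)
    (m : ℤ × ℤ) : wshift g d c m = g m * c (m - d) := by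
  have h : ∃ K, ∀ m, ‖g m‖ ≤ K := ⟨K, hK⟩
  rw [wshift, dif_pos h]
  rfl

theorem norm_wshift_le {g : ℤ × ℤ → ℂ} {K : ℝ} (hK : ∀ m, ‖g m‖ ≤ K) (d : ℤ × ℤ) :
    ‖wshift g d‖ ≤ K := by
  have hK0 : 0 ≤ K := (norm_nonneg _).trans (hK 0)
  refine ContinuousLinearMap.opNorm_le_bound _ hK0 fun c => ?_
  refine abs_le_of_sq_le_sq' ?_ (by positivity) |>.2
  rw [norm_sq_ell2, mul_pow, norm_sq_ell2, ← tsum_mul_left,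
    ← (Equiv.subRight d).tsum_eq (fun m => K ^ 2 * ‖c m‖ ^ 2)]
  refine Summable.tsum_le_tsum (fun m => ?_) (summable_norm_sq_ell2 _)
    ((summable_shift d c).mul_left _)
  rw [wshift_apply hK]
  exact shift_bound hK d c m

/-- Diagonal operators. -/
def diag (g : ℤ × ℤ → ℝ) : Ell2 →L[ℂ] Ell2 := wshift (fun m => (g m : ℂ)) 0

theorem diag_apply {g : ℤ × ℤ → ℝ} {K : ℝ} (hK : ∀ m, |g m| ≤ K) (c : Ell2) (m : ℤ × ℤ) :
    diag g c m = g m * c m := by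
  rw [diag, wshift_apply (K := K) (fun m => by simpa using hK m), sub_zero]

theorem norm_diag_le {g : ℤ × ℤ → ℝ} {K : ℝ} (hK : ∀ m, |g m| ≤ K) : ‖diag g‖ ≤ K :=
  norm_wshift_le (fun m => by simpa using hK m) 0

theorem inner_ell2 (x y : Ell2) : ⟪x, y⟫_ℂ = ∑' m, starRingEnd ℂ (x m) * y m := by
  rw [lp.inner_eq_tsum]
  exact tsum_congr fun m => by rw [RCLike.inner_apply, mul_comm]

theorem hasSum_inner_ell2 (x y : Ell2) :
    HasSum (fun m => starRingEnd ℂ (x m) * y m) ⟪x, y⟫_ℂ := by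
  have h := lp.hasSum_inner (𝕜 := ℂ) x y
  refine h.congr_fun ?_ |> id
  intro m; rw [RCLike.inner_apply, mul_comm]

theorem diag_isSymmetric {g : ℤ × ℤ → ℝ} {K : ℝ} (hK : ∀ m, |g m| ≤ K) :
    (diag g).IsSymmetric := by
  intro x y
  change ⟪diag g x, y⟫_ℂ = ⟪x, diag g y⟫_ℂ
  rw [inner_ell2, inner_ell2]
  refine tsum_congr fun m => ?_
  rw [diag_apply hK, diag_apply hK, map_mul, Complex.conj_ofReal]
  ring

theorem re_inner_diag {g : ℤ × ℤ → ℝ} {K : ℝ} (hK : ∀ m, |g m| ≤ K) (x : Ell2) :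
    HasSum (fun m => g m * ‖x m‖ ^ 2) (⟪x, diag g x⟫_ℂ).re := by
  have h := Complex.hasSum_re (hasSum_inner_ell2 x (diag g x))
  refine h.congr_fun ?_ |> id
  intro m
  rw [diag_apply hK, mul_left_comm, Complex.re_ofReal_mul, ← Complex.normSq_eq_conj_mul_self,
    Complex.ofReal_re, Complex.normSq_eq_norm_sq]

/-- Diagonal operators with entries tending to zero are compact. -/
theorem diag_isCompactOperator {g : ℤ × ℤ → ℝ} (hg : Tendsto g cofinite (𝓝 0)) {K : ℝ}
    (hK : ∀ m, |g m| ≤ K) : IsCompactOperator (diag g) := by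
  classical
  let P : Finset (ℤ × ℤ) → ℤ × ℤ → ℝ := fun s m => if m ∈ s then g m else 0
  have hP : ∀ s m, |P s m| ≤ K := fun s m => by
    simp only [P]; split_ifs
    · exact hK m
    · simpa using (abs_nonneg _).trans (hK 0)
  have hev : ∀ m (c : Ell2), lp.evalCLM ℂ (fun _ : ℤ × ℤ => ℂ) 2 m c = c m := fun _ _ => rfl
  have hfin : ∀ s, IsCompactOperator (diag (P s)) := by
    intro s
    have h1 : diag (P s) = ∑ m ∈ s, (lp.evalCLM ℂ (fun _ : ℤ × ℤ => ℂ) 2 m).smulRight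
        (diag (P s) (lp.single 2 m 1)) := by
      ext c n
      rw [diag_apply (hP s)]
      simp only [_root_.sum_apply, ContinuousLinearMap.smulRight_apply,
        lp.coeFn_sum, Finset.sum_apply, lp.coeFn_smul, Pi.smul_apply, smul_eq_mul,
        diag_apply (hP s), hev]
      by_cases hn : n ∈ s
      · rw [Finset.sum_eq_single n]
        · simp; ring
        · intro b _ hb
          simp [hb.symm]
        · exact fun h => absurd hn h
      · rw [Finset.sum_eq_zero]
        · simp [P, hn]
        · intro b hb
          simp [P, hn]
    rw [h1]
    have h2 : ∀ m, IsCompactOperator ((lp.evalCLM ℂ (fun _ : ℤ × ℤ => ℂ) 2 m).smulRight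
        (diag (P s) (lp.single 2 m 1))) := fun m => by
      have h3 : IsCompactOperator (lp.evalCLM ℂ (fun _ : ℤ × ℤ => ℂ) 2 m) :=
        ⟨Metric.closedBall 0 1, isCompact_closedBall _ _, by
          refine (lp.evalCLM ℂ (fun _ : ℤ × ℤ => ℂ) 2 m).continuous.continuousAt.preimage_mem_nhds ?_
          rw [map_zero]; exact Metric.closedBall_mem_nhds _ one_pos⟩
      exact h3.clm_comp ((ContinuousLinearMap.id ℂ ℂ).smulRight (diag (P s) (lp.single 2 m 1)))
    have h4 : ∀ t : Finset (ℤ × ℤ), IsCompactOperator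
        (∑ m ∈ t, (lp.evalCLM ℂ (fun _ : ℤ × ℤ => ℂ) 2 m).smulRight
        (diag (P s) (lp.single 2 m 1)) : Ell2 →L[ℂ] Ell2) := by
      intro t
      induction t using Finset.induction_on with
      | empty => simpa using isCompactOperator_zero
      | insert a t ha ih => rw [Finset.sum_insert ha]; exact (h2 a).add ih
    exact h4 s
  refine isCompactOperator_of_tendsto (l := atTop) (F := fun s => diag (P s)) ?_
    (Eventually.of_forall hfin)
  rw [tendsto_iff_norm_sub_tendsto_zero, Metric.tendsto_atTop]
  intro ε hε
  have hfinset : {m | ¬ |g m| < ε / 2}.Finite := by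
    have := hg.eventually (Metric.ball_mem_nhds (0 : ℝ) (half_pos hε))
    simpa [Filter.eventually_cofinite] using this
  refine ⟨hfinset.toFinset, fun s hs => ?_⟩
  -- Finite-rank truncations converge in norm, since the remaining entries are uniformly small.
  have hsub : diag (P s) - diag g = diag fun m => P s m - g m := by
    ext c m
    rw [diag_apply (K := K + K) (fun m => (abs_sub _ _).trans (add_le_add (hP s m) (hK m)))]
    change diag (P s) c m - diag g c m = _
    rw [diag_apply (hP s), diag_apply hK]
    push_cast; ring
  have hle : ‖diag (P s) - diag g‖ ≤ ε / 2 := by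
    rw [hsub]
    refine norm_diag_le fun m => ?_
    by_cases hm : m ∈ s
    · simp [P, hm, (half_pos hε).le]
    · have : |g m| < ε / 2 := by
        by_contra h
        exact hm (hs (by simpa using h))
      simpa [P, hm] using this.le
  rw [Real.dist_eq, sub_zero, abs_of_nonneg (norm_nonneg _)]
  linarith

/-- The convolution of `w` and `a`. -/
def conv (w a : ℤ × ℤ → ℂ) (m : ℤ × ℤ) : ℂ := ∑' d, w d * a (m - d)

/-- Convolution by `w`, conjugated by the `s`-th power of the weight. -/
def potOp (w : ℤ × ℤ → ℂ) (s : ℕ) : Ell2 →L[ℂ] Ell2 :=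
  ∑' d, w d • wshift (fun m => (((weight m / weight (m - d)) ^ s : ℝ) : ℂ)) d

/-- By Peetre's inequality, conjugating a shift by powers of the weight costs only polynomial growth
in the shift, which the rapid decay of `w` absorbs. -/
theorem weight_quotient_le (s : ℕ) (d m : ℤ × ℤ) :
    ‖(((weight m / weight (m - d)) ^ s : ℝ) : ℂ)‖ ≤ 2 ^ s * weight d ^ s := by
  have h1 := weight_pos m
  have h2 := weight_pos (m - d)
  have h3 := weight_le_mul m (m - d)
  rw [sub_sub_cancel] at h3
  rw [Complex.norm_real, Real.norm_of_nonneg (by positivity), ← mul_pow]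
  gcongr
  rw [div_le_iff₀ h2]
  linarith

theorem summable_potOp {w : ℤ × ℤ → ℂ} (hw : RapidDecay w) (s : ℕ) :
    Summable fun d => w d • wshift (fun m => (((weight m / weight (m - d)) ^ s : ℝ) : ℂ)) d := by
  refine Summable.of_norm_bounded ((hw.summable s).mul_left (2 ^ s)) fun d => ?_
  rw [norm_smul]
  calc ‖w d‖ * _ ≤ ‖w d‖ * (2 ^ s * weight d ^ s) := by
        gcongr; exact norm_wshift_le (weight_quotient_le s d) d
    _ = _ := by ring

theorem hasSum_potOp {w : ℤ × ℤ → ℂ} (hw : RapidDecay w) (s : ℕ) (c : Ell2) (m : ℤ × ℤ) :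
    HasSum (fun d => w d * ((((weight m / weight (m - d)) ^ s : ℝ) : ℂ) * c (m - d)))
      (potOp w s c m) := by
  have h1 : HasSum (fun d => (w d • wshift (fun m => (((weight m / weight (m - d)) ^ s : ℝ) : ℂ)) d) c)
      (potOp w s c) :=
    (summable_potOp hw s).hasSum.mapL (ContinuousLinearMap.apply ℂ Ell2 c)
  have h2 := h1.mapL (lp.evalCLM ℂ (fun _ : ℤ × ℤ => ℂ) 2 m)
  refine h2.congr_fun ?_ |> id
  intro d
  change _ = w d * (wshift _ d c m)
  rw [wshift_apply (weight_quotient_le s d)]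

theorem potOp_zero_apply {w : ℤ × ℤ → ℂ} (hw : RapidDecay w) (c : Ell2) (m : ℤ × ℤ) :
    potOp w 0 c m = conv w c m := by
  have := (hasSum_potOp hw 0 c m).tsum_eq
  rw [← this, conv]
  exact tsum_congr fun d => by simp

/-- The potential acts in the weighted space of order `s` as the bounded operator `potOp w s` acts
on `ℓ²`. -/
theorem potOp_weight {w : ℤ × ℤ → ℂ} (hw : RapidDecay w) (s : ℕ) {c : Ell2} {a : ℤ × ℤ → ℂ}
    (hc : ∀ m, c m = ((weight m ^ s : ℝ) : ℂ) * a m) (m : ℤ × ℤ) :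
    potOp w s c m = ((weight m ^ s : ℝ) : ℂ) * conv w a m := by
  rw [← (hasSum_potOp hw s c m).tsum_eq, conv, ← tsum_mul_left]
  refine tsum_congr fun d => ?_
  have h : ((weight (m - d) : ℝ) : ℂ) ≠ 0 := by exact_mod_cast weight_ne_zero _
  rw [hc]
  push_cast
  rw [div_pow]
  field_simp

/-- The adjoint of the shift by `d` is the shift by `-d`; the condition on `w` is the reality of the
potential. -/
theorem potOp_isSymmetric {w : ℤ × ℤ → ℂ} (hw : RapidDecay w)
    (hsymm : ∀ d, w (-d) = starRingEnd ℂ (w d)) : (potOp w 0).IsSymmetric := by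
  intro x y
  change ⟪potOp w 0 x, y⟫_ℂ = ⟪x, potOp w 0 y⟫_ℂ
  let S : ℤ × ℤ → Ell2 →L[ℂ] Ell2 := fun d =>
    wshift (fun m => (((weight m / weight (m - d)) ^ 0 : ℝ) : ℂ)) d
  have hS : ∀ d c m, S d c m = c (m - d) := fun d c m => by
    simp only [S]; rw [wshift_apply (weight_quotient_le 0 d)]; simp
  have hadj : ∀ d, ⟪S d x, y⟫_ℂ = ⟪x, S (-d) y⟫_ℂ := by
    intro d
    rw [inner_ell2, inner_ell2, ← (Equiv.addRight d).tsum_eq]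
    exact tsum_congr fun m => by simp [hS]
  have h1 : HasSum (fun d => ⟪(w d • S d) x, y⟫_ℂ) ⟪potOp w 0 x, y⟫_ℂ := by
    have h1 : HasSum (fun d => (w d • S d) x) (potOp w 0 x) :=
      (summable_potOp hw 0).hasSum.mapL (ContinuousLinearMap.apply ℂ Ell2 x)
    have h2 := (h1.mapL (innerSL ℂ y)).map (starRingEnd ℂ) Complex.continuous_conj
    simp only [Function.comp_def, innerSL_apply_apply, inner_conj_symm] at h2
    exact h2
  have h2 : HasSum (fun d => ⟪x, (w d • S d) y⟫_ℂ) ⟪x, potOp w 0 y⟫_ℂ := by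
    have h1 : HasSum (fun d => (w d • S d) y) (potOp w 0 y) :=
      (summable_potOp hw 0).hasSum.mapL (ContinuousLinearMap.apply ℂ Ell2 y)
    exact h1.mapL (innerSL ℂ x)
  rw [← (Equiv.neg _).hasSum_iff] at h2
  refine h1.unique (h2.congr_fun ?_ |> id)
  intro d
  simp only [Function.comp, Equiv.neg_apply, _root_.smul_apply, inner_smul_left,
    inner_smul_right, hsymm, hadj]

end WeightedShift

/-! ### The resolvents of the Floquet-Bloch operators on `ℓ²(ℤ²)` -/

section Resolvent

/-- A spectral shift that makes the Floquet-Bloch operators positive. -/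
def specShift (w : ℤ × ℤ → ℂ) : ℝ := ‖potOp w 0‖ + 1

theorem one_le_specShift (w : ℤ × ℤ → ℂ) : 1 ≤ specShift w := by
  have := norm_nonneg (potOp w 0); rw [specShift]; linarith

/-- The operator of multiplication with `weight^{-1/2}`. -/
def sqrtOp : Ell2 →L[ℂ] Ell2 := diag fun m => (√(weight m))⁻¹

theorem sqrtOp_bound (m : ℤ × ℤ) : |(√(weight m))⁻¹| ≤ 1 := by
  rw [abs_of_nonneg (by positivity)]
  exact inv_le_one_of_one_le₀ (Real.one_le_sqrt.2 (one_le_weight m))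

theorem sqrtOp_apply (c : Ell2) (m : ℤ × ℤ) : sqrtOp c m = ((√(weight m))⁻¹ : ℝ) * c m :=
  diag_apply sqrtOp_bound c m

theorem sqrtOp_isSymmetric : sqrtOp.IsSymmetric := diag_isSymmetric sqrtOp_bound

theorem sqrtOp_isCompactOperator : IsCompactOperator sqrtOp := by
  refine diag_isCompactOperator ?_ sqrtOp_bound
  have h := (Real.continuous_sqrt.tendsto 0).comp tendsto_weight_inv
  rw [Real.sqrt_zero] at h
  exact h.congr fun m => by simp [Function.comp, Real.sqrt_inv]

theorem sqrtOp_injective (c : Ell2) (h : sqrtOp c = 0) : c = 0 := by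
  ext m
  have h1 : sqrtOp c m = 0 := by rw [h]; rfl
  rw [sqrtOp_apply] at h1
  have h2 : (((√(weight m))⁻¹ : ℝ) : ℂ) ≠ 0 := by
    have := Real.sqrt_pos.2 (weight_pos m); exact_mod_cast (inv_pos.2 this).ne'
  exact (mul_eq_zero.1 h1).resolve_left h2

/-- The symbol `(|k + ξ|² + μ) / (1 + |ξ|²)`. -/
def symbol (μ : ℝ) (k : Plane) (m : ℤ × ℤ) : ℝ := (‖k + dualVec m‖ ^ 2 + μ) / weight m

/-- From `|ξ|² ≤ 2 |k + ξ|² + 2 |k|²`. -/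
theorem symbol_lower {μ : ℝ} (hμ : 1 ≤ μ) (k : Plane) (m : ℤ × ℤ) :
    (2 + 2 * ‖k‖ ^ 2)⁻¹ ≤ symbol μ k m := by
  have h1 : ‖dualVec m‖ ≤ ‖k + dualVec m‖ + ‖k‖ := by
    have := norm_sub_le (k + dualVec m) k; rwa [add_sub_cancel_left] at this
  have h2 : ‖dualVec m‖ ^ 2 ≤ (‖k + dualVec m‖ + ‖k‖) ^ 2 := by gcongr
  rw [symbol, le_div_iff₀ (weight_pos m), inv_mul_le_iff₀ (by positivity), weight]
  nlinarith [sq_nonneg (‖k + dualVec m‖ - ‖k‖),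
    mul_nonneg (sq_nonneg ‖k‖) (sq_nonneg ‖k + dualVec m‖), sq_nonneg ‖k‖]

theorem symbol_bound {μ : ℝ} (hμ : 1 ≤ μ) (k : Plane) (m : ℤ × ℤ) :
    |symbol μ k m| ≤ 2 + 2 * ‖k‖ ^ 2 + μ := by
  have hw := one_le_weight m
  rw [symbol, abs_of_nonneg (by positivity), div_le_iff₀ (weight_pos m)]
  have h1 := norm_add_le k (dualVec m)
  have h2 : ‖k + dualVec m‖ ^ 2 ≤ (‖k‖ + ‖dualVec m‖) ^ 2 := by gcongr
  have h3 : ‖dualVec m‖ ^ 2 ≤ weight m := by rw [weight]; linarith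
  nlinarith [sq_nonneg (‖k‖ - ‖dualVec m‖), sq_nonneg ‖k‖,
    mul_nonneg (sq_nonneg ‖k‖) (sub_nonneg.2 hw), mul_nonneg (by linarith : 0 ≤ μ) (sub_nonneg.2 hw)]

theorem symbol_bound' (w : ℤ × ℤ → ℂ) (k : Plane) (m : ℤ × ℤ) :
    |symbol (specShift w) k m| ≤ 2 + 2 * ‖k‖ ^ 2 + specShift w :=
  symbol_bound (one_le_specShift w) k m

/-- The diagonal operator of the symbol. -/
def symbolOp (w : ℤ × ℤ → ℂ) (k : Plane) : Ell2 →L[ℂ] Ell2 := diag (symbol (specShift w) k)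

/-- `weight^{-1/2} (|k + ξ|² + w * + μ) weight^{-1/2}`. -/
def hamOp (w : ℤ × ℤ → ℂ) (k : Plane) : Ell2 →L[ℂ] Ell2 :=
  symbolOp w k + sqrtOp * potOp w 0 * sqrtOp

/-- The resolvent `(|k + ξ|² + w * + μ)⁻¹`. -/
def resolv (w : ℤ × ℤ → ℂ) (k : Plane) : Ell2 →L[ℂ] Ell2 := sandwich sqrtOp (hamOp w k)

theorem coercive_const_pos (k : Plane) : 0 < (2 + 2 * ‖k‖ ^ 2)⁻¹ := by positivity

theorem symbolOp_coercive (w : ℤ × ℤ → ℂ) (k : Plane) (x : Ell2) :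
    (2 + 2 * ‖k‖ ^ 2)⁻¹ * ‖x‖ ^ 2 ≤ (⟪x, symbolOp w k x⟫_ℂ).re := by
  have h := re_inner_diag (symbol_bound' w k) x
  rw [norm_sq_ell2, ← tsum_mul_left]
  change _ ≤ (⟪x, diag _ x⟫_ℂ).re
  rw [← h.tsum_eq]
  refine Summable.tsum_le_tsum (fun m => ?_) ((summable_norm_sq_ell2 x).mul_left _) h.summable
  gcongr
  exact symbol_lower (one_le_specShift w) k m

theorem isUnit_symbolOp (w : ℤ × ℤ → ℂ) (k : Plane) : IsUnit (symbolOp w k) :=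
  isUnit_of_coercive (coercive_const_pos k) (symbolOp_coercive w k)

theorem hamOp_coercive (w : ℤ × ℤ → ℂ) (k : Plane) (x : Ell2) :
    (2 + 2 * ‖k‖ ^ 2)⁻¹ * ‖x‖ ^ 2 ≤ (⟪x, hamOp w k x⟫_ℂ).re := by
  have h1 := re_inner_diag (symbol_bound' w k) x
  have h2 : HasSum (fun m => ‖sqrtOp x m‖ ^ 2) (‖sqrtOp x‖ ^ 2) := by
    rw [norm_sq_ell2]; exact (summable_norm_sq_ell2 _).hasSum
  have h3 : -(‖potOp w 0‖ * ‖sqrtOp x‖ ^ 2) ≤ (⟪sqrtOp x, potOp w 0 (sqrtOp x)⟫_ℂ).re := by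
    have a1 := Complex.abs_re_le_norm ⟪sqrtOp x, potOp w 0 (sqrtOp x)⟫_ℂ
    have a2 : ‖⟪sqrtOp x, potOp w 0 (sqrtOp x)⟫_ℂ‖ ≤ ‖sqrtOp x‖ * (‖potOp w 0‖ * ‖sqrtOp x‖) :=
      (norm_inner_le_norm _ _).trans (by gcongr; exact (potOp w 0).le_opNorm _)
    have a3 := (abs_le.1 (a1.trans a2)).1
    nlinarith
  have h4 : ⟪x, hamOp w k x⟫_ℂ = ⟪x, diag (symbol (specShift w) k) x⟫_ℂ
      + ⟪sqrtOp x, potOp w 0 (sqrtOp x)⟫_ℂ := by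
    have : ⟪sqrtOp x, potOp w 0 (sqrtOp x)⟫_ℂ = ⟪x, sqrtOp (potOp w 0 (sqrtOp x))⟫_ℂ :=
      sqrtOp_isSymmetric _ _
    rw [this, ← inner_add_right]; rfl
  have h5 := h1.sub (h2.mul_left ‖potOp w 0‖)
  have h6 : (2 + 2 * ‖k‖ ^ 2)⁻¹ * ‖x‖ ^ 2
      ≤ (⟪x, diag (symbol (specShift w) k) x⟫_ℂ).re - ‖potOp w 0‖ * ‖sqrtOp x‖ ^ 2 := by
    rw [norm_sq_ell2, ← tsum_mul_left, ← h5.tsum_eq]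
    refine Summable.tsum_le_tsum (fun m => ?_) ((summable_norm_sq_ell2 x).mul_left _) h5.summable
    have e1 : ‖sqrtOp x m‖ ^ 2 = (weight m)⁻¹ * ‖x m‖ ^ 2 := by
      rw [sqrtOp_apply, norm_mul, Complex.norm_real, mul_pow, Real.norm_eq_abs, sq_abs, inv_pow,
        Real.sq_sqrt (weight_pos m).le]
    -- The part `‖potOp w 0‖` of the shift absorbs the potential exactly; the remaining `1` provides
    -- the coercivity.
    have e2 : symbol (specShift w) k m = symbol 1 k m + ‖potOp w 0‖ * (weight m)⁻¹ := by
      rw [symbol, symbol, specShift]; field_simp; ring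
    have e3 := symbol_lower le_rfl k m
    rw [e1, e2]
    have := mul_le_mul_of_nonneg_right e3 (sq_nonneg ‖x m‖)
    linarith
  rw [h4, Complex.add_re]
  linarith

theorem isUnit_hamOp (w : ℤ × ℤ → ℂ) (k : Plane) : IsUnit (hamOp w k) :=
  isUnit_of_coercive (coercive_const_pos k) (hamOp_coercive w k)

variable {w : ℤ × ℤ → ℂ} (hw : RapidDecay w) (hsymm : ∀ d, w (-d) = starRingEnd ℂ (w d))

include hw hsymm in
theorem hamOp_isSymmetric (k : Plane) : (hamOp w k).IsSymmetric := by
  intro x y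
  have h1 : ⟪symbolOp w k x, y⟫_ℂ = ⟪x, symbolOp w k y⟫_ℂ :=
    diag_isSymmetric (symbol_bound' w k) x y
  have h2 : ∀ x y, ⟪sqrtOp x, y⟫_ℂ = ⟪x, sqrtOp y⟫_ℂ := sqrtOp_isSymmetric
  have h3 : ∀ x y, ⟪potOp w 0 x, y⟫_ℂ = ⟪x, potOp w 0 y⟫_ℂ := potOp_isSymmetric hw hsymm
  change ⟪symbolOp w k x + sqrtOp (potOp w 0 (sqrtOp x)), y⟫_ℂ
    = ⟪x, symbolOp w k y + sqrtOp (potOp w 0 (sqrtOp y))⟫_ℂ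
  rw [inner_add_left, inner_add_right, h1, h2, h3, h2]

include hw hsymm in
theorem resolv_isCompactPos (k : Plane) : IsCompactPos (resolv w k) :=
  sandwich_isCompactPos sqrtOp_isSymmetric sqrtOp_isCompactOperator sqrtOp_injective
    (hamOp_isSymmetric hw hsymm k) (coercive_const_pos k) (hamOp_coercive w k)

/-- Expansion of `|K + t κ + ξ|²`. The linear coefficient grows only like `|ξ|`, so it becomes
bounded after division by the weight. This is the source of all analyticity in `t`. -/
theorem exists_symbolOp_polynomial (w : ℤ × ℤ → ℂ) (K κ : Plane) : ∃ D₁ D₂ : Ell2 →L[ℂ] Ell2,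
    ∀ t : ℝ, symbolOp w (K + t • κ) = symbolOp w K + (t • D₁ + t ^ 2 • D₂) := by
  have hb1 : ∀ m, |2 * ⟪κ, K + dualVec m⟫_ℝ / weight m| ≤ 2 * ‖κ‖ * (1 + ‖K‖) := by
    intro m
    rw [abs_div, abs_of_pos (weight_pos m), div_le_iff₀ (weight_pos m), abs_mul,
      abs_of_pos (two_pos : (0 : ℝ) < 2)]
    calc 2 * |⟪κ, K + dualVec m⟫_ℝ| ≤ 2 * (‖κ‖ * ‖K + dualVec m‖) := by
          gcongr; exact abs_real_inner_le_norm _ _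
      _ ≤ 2 * (‖κ‖ * ((1 + ‖K‖) * weight m)) := by gcongr; exact norm_add_dualVec_le K m
      _ = _ := by ring
  have hb2 : ∀ m, |‖κ‖ ^ 2 / weight m| ≤ ‖κ‖ ^ 2 := by
    intro m
    rw [abs_of_nonneg (by have := weight_pos m; positivity)]
    exact div_le_self (by positivity) (one_le_weight m)
  refine ⟨diag fun m => 2 * ⟪κ, K + dualVec m⟫_ℝ / weight m, diag fun m => ‖κ‖ ^ 2 / weight m,
    fun t => ?_⟩
  ext c m
  change symbolOp w (K + t • κ) c m = symbolOp w K c m + (t • (diag _ c m) + t ^ 2 • (diag _ c m))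
  rw [symbolOp, symbolOp, diag_apply (symbol_bound' w _), diag_apply (symbol_bound' w _),
    diag_apply hb1, diag_apply hb2, Complex.real_smul, Complex.real_smul]
  have h1 : ‖K + t • κ + dualVec m‖ ^ 2
      = ‖K + dualVec m‖ ^ 2 + t * (2 * ⟪κ, K + dualVec m⟫_ℝ) + t ^ 2 * ‖κ‖ ^ 2 := by
    have : K + t • κ + dualVec m = (K + dualVec m) + t • κ := by abel
    rw [this, norm_add_sq_real, inner_smul_right, norm_smul, mul_pow, Real.norm_eq_abs, sq_abs,
      real_inner_comm]
    ring
  simp only [symbol, h1]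
  push_cast
  have : (weight m : ℂ) ≠ 0 := by exact_mod_cast weight_ne_zero m
  field_simp
  ring

theorem analyticAt_symbolOp (w : ℤ × ℤ → ℂ) (K κ : Plane) (t : ℝ) :
    AnalyticAt ℝ (fun t : ℝ => symbolOp w (K + t • κ)) t := by
  obtain ⟨D₁, D₂, h⟩ := exists_symbolOp_polynomial w K κ
  simp only [h]
  exact analyticAt_const.add ((analyticAt_id.smul analyticAt_const).add
    ((analyticAt_id.pow 2).smul analyticAt_const))

theorem analyticAt_hamOp (w : ℤ × ℤ → ℂ) (K κ : Plane) (t : ℝ) :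
    AnalyticAt ℝ (fun t : ℝ => hamOp w (K + t • κ)) t :=
  (analyticAt_symbolOp w K κ t).add analyticAt_const

theorem analyticAt_resolv (w : ℤ × ℤ → ℂ) (K κ : Plane) (t : ℝ) :
    AnalyticAt ℝ (fun t : ℝ => resolv w (K + t • κ)) t :=
  analyticAt_sandwich sqrtOp (analyticAt_hamOp w K κ t) (isUnit_hamOp w _)

-- One constant for the whole interval, by compactness; it controls the growth of the branches
-- during continuation.
include hw hsymm in
theorem exists_resolv_deriv_bound (K κ : Plane) : ∃ C : ℝ, ∀ t ∈ Set.Icc (-1 : ℝ) 1,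
    ∀ (ν : ℝ) (u : Ell2), resolv w (K + t • κ) u = (ν : ℂ) • u →
      |(⟪u, deriv (fun t : ℝ => resolv w (K + t • κ)) t u⟫_ℂ).re| ≤ C * ν * ‖u‖ ^ 2 := by
  have hc : ContinuousOn (fun t : ℝ => ‖deriv (fun t : ℝ => hamOp w (K + t • κ)) t‖
      / (2 + 2 * ‖K + t • κ‖ ^ 2)⁻¹) (Set.Icc (-1) 1) := by
    refine ContinuousOn.div (fun t _ => ?_) (by fun_prop (disch := intros; positivity))
      (fun t _ => (coercive_const_pos _).ne')
    exact (analyticAt_hamOp w K κ t).deriv.continuousAt.norm.continuousWithinAt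
  obtain ⟨C, hC⟩ := isCompact_Icc.exists_bound_of_continuousOn hc
  refine ⟨C, fun t ht ν u hu => ?_⟩
  have h1 := abs_inner_deriv_sandwich_le sqrtOp_isSymmetric (analyticAt_hamOp w K κ t)
    (hamOp_isSymmetric hw hsymm _) (coercive_const_pos _) (hamOp_coercive w _) hu
  refine h1.trans ?_
  have h2 : 0 ≤ ν * ‖u‖ ^ 2 := by
    by_cases hu0 : u = 0
    · simp [hu0]
    · have h3 := (resolv_isCompactPos hw hsymm (K + t • κ)).pos u hu0
      rw [hu, inner_smul_left, Complex.conj_ofReal, inner_self_eq_norm_sq_to_K,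
        Complex.re_ofReal_mul] at h3
      norm_cast at h3
      exact h3.le
  rw [mul_assoc, mul_assoc]
  exact mul_le_mul_of_nonneg_right ((le_abs_self _).trans (hC t ht)) h2

include hw in
theorem eigen_equation {k : Plane} {ν : ℝ} (hν : ν ≠ 0) {u : Ell2}
    (hu : resolv w k u = (ν : ℂ) • u) (m : ℤ × ℤ) :
    ((‖k + dualVec m‖ ^ 2 : ℝ) : ℂ) * u m + conv w u m = ((1 / ν - specShift w : ℝ) : ℂ) * u m := by
  set y := Ring.inverse (hamOp w k) (sqrtOp u) with hy
  have h1 : sqrtOp y = (ν : ℂ) • u := hu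
  have h2 : hamOp w k y = sqrtOp u := apply_inverse (isUnit_hamOp w k) _
  have h3 : symbolOp w k y m + sqrtOp (potOp w 0 (sqrtOp y)) m = sqrtOp u m := by
    rw [← h2]; rfl
  have hs : (((√(weight m))⁻¹ : ℝ) : ℂ) ≠ 0 := by
    have := Real.sqrt_pos.2 (weight_pos m); exact_mod_cast (inv_pos.2 this).ne'
  have h4 : (((√(weight m))⁻¹ : ℝ) : ℂ) * y m = ν * u m := by
    rw [← sqrtOp_apply, h1]; rfl
  rw [h1, symbolOp, diag_apply (symbol_bound' w k), sqrtOp_apply, sqrtOp_apply, map_smul,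
    lp.coeFn_smul, Pi.smul_apply, smul_eq_mul, potOp_zero_apply hw] at h3
  have h5 : (symbol (specShift w) k m : ℂ) * y m
      = (((√(weight m))⁻¹ : ℝ) : ℂ) * (((‖k + dualVec m‖ ^ 2 + specShift w : ℝ) : ℂ) * (ν * u m)) := by
    have e1 : symbol (specShift w) k m
        = (√(weight m))⁻¹ * (√(weight m))⁻¹ * (‖k + dualVec m‖ ^ 2 + specShift w) := by
      rw [← mul_inv, Real.mul_self_sqrt (weight_pos m).le, symbol]; field_simp
    rw [← h4, e1]
    push_cast
    ring
  rw [h5, ← mul_add] at h3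
  have h6 := mul_left_cancel₀ hs h3
  have hν' : (ν : ℂ) ≠ 0 := by exact_mod_cast hν
  push_cast at h6 ⊢
  field_simp
  linear_combination h6

-- The candidate for `B⁻¹ A u` is `ν √weight u`; the decay of `u` is what places it in `ℓ²`.
include hw in
theorem resolv_eq_of_eigen_equation {k : Plane} {ν : ℝ} (hν : ν ≠ 0) {u : Ell2}
    (hu : RapidDecay u) (h : ∀ m, ((‖k + dualVec m‖ ^ 2 : ℝ) : ℂ) * u m + conv w u m
      = ((1 / ν - specShift w : ℝ) : ℂ) * u m) : resolv w k u = (ν : ℂ) • u := by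
  have hmem : Memℓp (fun m => (ν : ℂ) * ((√(weight m) : ℝ) : ℂ) * u m) 2 := by
    rw [memℓp_two_iff]
    have h1 := (summable_norm_sq_ell2 u)
    obtain ⟨C, hC⟩ := hu 3
    refine Summable.of_nonneg_of_le (fun m => by positivity) (fun m => ?_)
      (summable_weight_inv_sq.mul_left (ν ^ 2 * C ^ 2))
    have hp := weight_pos m
    have h2 : ‖u m‖ ≤ C / weight m ^ 3 := by rw [le_div_iff₀ (by positivity), mul_comm]; exact hC m
    have hC0 : 0 ≤ C := by
      have h0 := weight_pos 0
      exact (by positivity : 0 ≤ weight 0 ^ 3 * ‖u 0‖).trans (hC 0)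
    rw [norm_mul, norm_mul, mul_pow, mul_pow, Complex.norm_real, Complex.norm_real,
      Real.norm_eq_abs, Real.norm_eq_abs, sq_abs, sq_abs, Real.sq_sqrt hp.le]
    calc ν ^ 2 * weight m * ‖u m‖ ^ 2 ≤ ν ^ 2 * weight m * (C / weight m ^ 3) ^ 2 := by gcongr
      _ = ν ^ 2 * C ^ 2 * (weight m ^ 5)⁻¹ := by field_simp
      _ ≤ ν ^ 2 * C ^ 2 * (weight m ^ 2)⁻¹ := by
        gcongr
        · exact one_le_weight m
        · norm_num
  let y : Ell2 := ⟨_, hmem⟩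
  have hym : ∀ m, y m = (ν : ℂ) * ((√(weight m) : ℝ) : ℂ) * u m := fun m => rfl
  have hsq : ∀ m, (((√(weight m) : ℝ) : ℂ)) ≠ 0 := fun m => by
    exact_mod_cast (Real.sqrt_pos.2 (weight_pos m)).ne'
  have hy : sqrtOp y = (ν : ℂ) • u := by
    ext m
    rw [sqrtOp_apply, hym, lp.coeFn_smul, Pi.smul_apply, smul_eq_mul]
    have := hsq m
    push_cast
    field_simp
  have hB : hamOp w k y = sqrtOp u := by
    ext m
    change symbolOp w k y m + sqrtOp (potOp w 0 (sqrtOp y)) m = sqrtOp u m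
    rw [hy, symbolOp, diag_apply (symbol_bound' w k), sqrtOp_apply, sqrtOp_apply, map_smul,
      lp.coeFn_smul, Pi.smul_apply, smul_eq_mul, potOp_zero_apply hw, hym]
    have hν' : (ν : ℂ) ≠ 0 := by exact_mod_cast hν
    have h1 := h m
    have h2 := hsq m
    have h3 : (weight m : ℂ) = (√(weight m) : ℝ) * (√(weight m) : ℝ) := by
      rw [← Complex.ofReal_mul, Real.mul_self_sqrt (weight_pos m).le]
    rw [symbol]
    push_cast at h1 ⊢
    rw [h3]
    field_simp at h1 ⊢
    linear_combination h1
  rw [resolv, sandwich_apply, ← hB, inverse_apply (isUnit_hamOp w k), hy]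

include hw in
/-- Eigenvectors that depend analytically on a parameter do so in every weighted space. -/
theorem exists_analytic_weighted {K κ : Plane} {ν : ℝ → ℝ} {u : ℝ → Ell2} {I : Set ℝ}
    (hν : ∀ t ∈ I, AnalyticAt ℝ ν t ∧ 0 < ν t)
    (hu : ∀ t ∈ I, AnalyticAt ℝ u t ∧ resolv w (K + t • κ) (u t) = (ν t : ℂ) • u t) (s : ℕ) :
    ∃ U : ℝ → Ell2, ∀ t ∈ I, AnalyticAt ℝ U t ∧ ∀ m, U t m = ((weight m ^ s : ℝ) : ℂ) * u t m := by
  induction s with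
  | zero => exact ⟨u, fun t ht => ⟨(hu t ht).1, fun m => by simp⟩⟩
  | succ s ih =>
    obtain ⟨U, hU⟩ := ih
    -- The equation `(|k + ξ|² + μ) u = ν⁻¹ u - w * u`, multiplied by `weight ^ s`. Since the factor
    -- on the left is the weight times the invertible symbol, inverting the symbol gains one power
    -- of the weight.
    refine ⟨fun t => Ring.inverse (symbolOp w (K + t • κ))
      ((((ν t)⁻¹ : ℝ) : ℂ) • U t - potOp w s (U t)), fun t ht => ⟨?_, fun m => ?_⟩⟩
    · refine analyticAt_clm_apply_real
        (analyticAt_ringInverse_comp (analyticAt_symbolOp w K κ t) (isUnit_symbolOp w _)) ?_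
      refine AnalyticAt.sub (analyticAt_complex_smul ?_ (hU t ht).1)
        (analyticAt_clm_const _ (hU t ht).1)
      exact (Complex.ofRealCLM.analyticAt _).comp ((hν t ht).1.inv (hν t ht).2.ne')
    · set z := Ring.inverse (symbolOp w (K + t • κ))
        ((((ν t)⁻¹ : ℝ) : ℂ) • U t - potOp w s (U t)) with hz
      have h1 : symbolOp w (K + t • κ) z m
          = (((ν t)⁻¹ : ℝ) : ℂ) * U t m - potOp w s (U t) m := by
        rw [hz, apply_inverse (isUnit_symbolOp w _)]; rfl
      rw [symbolOp, diag_apply (symbol_bound' w _), potOp_weight hw s (hU t ht).2, (hU t ht).2] at h1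
      have h2 := eigen_equation hw (hν t ht).2.ne' (hu t ht).2 m
      have h3 : (symbol (specShift w) (K + t • κ) m : ℂ) ≠ 0 := by
        exact_mod_cast ((coercive_const_pos _).trans_le
          (symbol_lower (one_le_specShift w) (K + t • κ) m)).ne'
      refine mul_left_cancel₀ h3 (h1.trans ?_)
      have h4 : (weight m : ℂ) ≠ 0 := by exact_mod_cast weight_ne_zero m
      have hν' : (ν t : ℂ) ≠ 0 := by exact_mod_cast (hν t ht).2.ne'
      rw [symbol]
      push_cast at h2 ⊢
      field_simp at h2 ⊢
      linear_combination -(weight m : ℂ) ^ (s + 1) * h2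

end Resolvent

/-! ### The ordered eigenvalues of a compact positive operator -/

section Bands

open Module

variable {H : Type} [NormedAddCommGroup H] [InnerProductSpace ℂ H]

/-- The `b`-th eigenvalue of `T` in nonincreasing order, `b ≥ 1`. -/
def nuBand (T : H →L[ℂ] H) (b : ℕ) : ℝ := sSup {ν | 0 < ν ∧ b ≤ finrank ℂ (specSpace T ν)}

namespace IsCompactPos

variable {T : H →L[ℂ] H} (hT : IsCompactPos T)
include hT

theorem finrank_specSpace_eq_zero {ν : ℝ} (h : ‖T‖ < ν) : finrank ℂ (specSpace T ν) = 0 := by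
  have : specSpace T ν = ⊥ := by
    refine (Submodule.eq_bot_iff _).2 fun x hx => ?_
    by_contra hx0
    have h1 := hT.inner_le_of_mem hx
    have h2 : (⟪T x, x⟫_ℂ).re ≤ ‖T‖ * ‖x‖ ^ 2 := by
      refine (Complex.re_le_norm _).trans ((norm_inner_le_norm _ _).trans ?_)
      calc ‖T x‖ * ‖x‖ ≤ ‖T‖ * ‖x‖ * ‖x‖ := by gcongr; exact T.le_opNorm x
        _ = _ := by ring
    have h3 : 0 < ‖x‖ ^ 2 := by have := norm_pos_iff.2 hx0; positivity
    nlinarith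
  rw [this, finrank_bot]

variable [CompleteSpace H] (hinf : ¬ FiniteDimensional ℂ H)

theorem finrank_specSpace_antitone {ν ν' : ℝ} (hν : 0 < ν) (h : ν ≤ ν') :
    finrank ℂ (specSpace T ν') ≤ finrank ℂ (specSpace T ν) := by
  have := hT.finiteDimensional_specSpace hν
  exact Submodule.finrank_mono (specSpace_antitone T h)

include hinf

/-- The supremum is attained: the variational bound at the supremum has a strict gap, so the count
at slightly smaller thresholds is already the count there. -/
theorem nuBand_spec {b : ℕ} (hb : 1 ≤ b) :
    0 < nuBand T b ∧ ∀ ν, 0 < ν → (b ≤ finrank ℂ (specSpace T ν) ↔ ν ≤ nuBand T b) := by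
  set S := {ν | 0 < ν ∧ b ≤ finrank ℂ (specSpace T ν)} with hS
  have hbdd : BddAbove S := ⟨‖T‖, fun ν hν => by
    by_contra! h
    have := hT.finrank_specSpace_eq_zero h
    have := hν.2
    omega⟩
  obtain ⟨ν₁, h1, h1'⟩ := hT.exists_le_finrank hinf b
  have hpos : 0 < sSup S := h1.trans_le (le_csSup hbdd ⟨h1, h1'⟩)
  refine ⟨hpos, fun ν hν => ⟨fun h => le_csSup hbdd ⟨hν, h⟩, fun h => ?_⟩⟩
  have hlt : ∀ c, 0 < c → c < sSup S → b ≤ finrank ℂ (specSpace T c) := by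
    intro c hc hcs
    obtain ⟨ν', hν', hc'⟩ := exists_lt_of_lt_csSup (s := S) ⟨ν₁, h1, h1'⟩ hcs
    exact hν'.2.trans (hT.finrank_specSpace_antitone hc hc'.le)
  rcases h.lt_or_eq with h | h
  · exact hlt ν hν h
  · obtain ⟨ρ, hρ, hfin⟩ := hT.exists_finrank_le hν
    obtain ⟨c, hc1, hc2⟩ := exists_between (max_lt hρ hν)
    have hc0 : 0 < c := (le_max_right _ _).trans_lt hc1
    have := hT.finiteDimensional_specSpace hc0
    exact (hlt c hc0 (by rw [h] at hc2; exact hc2)).trans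
      (hfin _ c ((le_max_left _ _).trans_lt hc1) fun x hx => hT.inner_le_of_mem hx)

theorem nuBand_pos {b : ℕ} (hb : 1 ≤ b) : 0 < nuBand T b := (hT.nuBand_spec hinf hb).1

theorem le_nuBand_iff {b : ℕ} (hb : 1 ≤ b) {ν : ℝ} (hν : 0 < ν) :
    ν ≤ nuBand T b ↔ b ≤ finrank ℂ (specSpace T ν) := ((hT.nuBand_spec hinf hb).2 ν hν).symm

theorem le_finrank_nuBand {b : ℕ} (hb : 1 ≤ b) : b ≤ finrank ℂ (specSpace T (nuBand T b)) :=
  (hT.le_nuBand_iff hinf hb (hT.nuBand_pos hinf hb)).1 le_rfl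

theorem nuBand_antitone {b b' : ℕ} (hb : 1 ≤ b) (h : b ≤ b') : nuBand T b' ≤ nuBand T b :=
  (hT.le_nuBand_iff hinf hb (hT.nuBand_pos hinf (hb.trans h))).2
    (h.trans (hT.le_finrank_nuBand hinf (hb.trans h)))

/-- Weyl's inequality for ordered eigenvalues; it gives their continuity in the parameter. -/
theorem nuBand_sub_le {T' : H →L[ℂ] H} (hT' : IsCompactPos T') {b : ℕ} (hb : 1 ≤ b) :
    nuBand T b - ‖T - T'‖ ≤ nuBand T' b := by
  rcases le_or_gt (nuBand T b - ‖T - T'‖) 0 with h | h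
  · exact h.trans (hT'.nuBand_pos hinf hb).le
  · refine (hT'.le_nuBand_iff hinf hb h).2 ((hT.le_finrank_nuBand hinf hb).trans ?_)
    exact hT.finrank_specSpace_le hT' h (by linarith)

/-- Every eigenvalue is one of the `nuBand`. -/
theorem exists_eq_nuBand {ν : ℝ} (hν : 0 < ν) {x : H} (hx0 : x ≠ 0) (hx : T x = (ν : ℂ) • x) :
    ∃ j, 1 ≤ j ∧ nuBand T j = ν := by
  have := hT.finiteDimensional_specSpace hν
  have hmem : x ∈ specSpace T ν :=
    eigenspace_le_specSpace T le_rfl (End.mem_eigenspace_iff.2 hx)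
  have h1 : 1 ≤ finrank ℂ (specSpace T ν) := by
    by_contra! h
    have h0 : finrank ℂ (specSpace T ν) = 0 := by omega
    rw [Submodule.finrank_eq_zero] at h0
    rw [h0] at hmem
    exact hx0 hmem
  -- The index is the number of eigenvalues at least `ν`. A larger value of `nuBand` would make
  -- `specSpace` constant down to `ν`, and `x` orthogonal to itself.
  refine ⟨_, h1, le_antisymm ?_ ((hT.le_nuBand_iff hinf h1 hν).2 le_rfl)⟩
  by_contra! hlt
  have h2 := hT.le_finrank_nuBand hinf h1
  have h3 := Submodule.eq_of_le_of_finrank_le (specSpace_antitone T hlt.le) h2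
  have h4 := hT.inner_eq_zero_of_lt hlt hx (y := x) (by rw [h3]; exact hmem)
  exact hx0 (inner_self_eq_zero.1 h4)

/-- If `nuBand T b` were below the least eigenvalue occurring in its `specSpace`, the count would
not change up to that eigenvalue, contradicting maximality. -/
theorem exists_eigenvector_nuBand {b : ℕ} (hb : 1 ≤ b) :
    ∃ x, x ≠ 0 ∧ T x = (nuBand T b : ℂ) • x := by
  have h1 := hT.le_finrank_nuBand hinf hb
  have hpos := hT.nuBand_pos hinf hb
  have hne : specSpace T (nuBand T b) ≠ ⊥ := by
    intro h; rw [h, finrank_bot] at h1; omega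
  obtain ⟨ν₀, h2, h3, h4⟩ := hT.exists_min_eigenvalue hpos hne
  rw [h4, ← hT.le_nuBand_iff hinf hb (hpos.trans_le h2)] at h1
  rw [le_antisymm h1 h2] at h3
  obtain ⟨x, hx, hx0⟩ := (Submodule.ne_bot_iff _).1 h3
  exact ⟨x, hx0, End.mem_eigenspace_iff.1 hx⟩

omit hinf in
theorem finrank_sup_of_orthogonal {ν ν' : ℝ} (hν : 0 < ν) (h : ν < ν') {W : Submodule ℂ H}
    [FiniteDimensional ℂ W] (hW : ∀ x ∈ W, ∀ y ∈ specSpace T ν', ⟪x, y⟫_ℂ = 0) :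
    finrank ℂ ↥(specSpace T ν' ⊔ W) = finrank ℂ (specSpace T ν') + finrank ℂ W := by
  have := hT.finiteDimensional_specSpace (hν.trans h)
  have hdisj : specSpace T ν' ⊓ W = ⊥ := by
    refine (Submodule.eq_bot_iff _).2 fun x hx => ?_
    exact inner_self_eq_zero.1 (hW x hx.2 x hx.1)
  have := Submodule.finrank_sup_add_finrank_inf_eq (specSpace T ν') W
  rw [hdisj, finrank_bot] at this
  omega

omit hinf hT [CompleteSpace H] in
theorem finrank_span_pair {u v : H} (hu : u ≠ 0) (hv : v ≠ 0) (huv : ⟪u, v⟫_ℂ = 0) :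
    finrank ℂ (Submodule.span ℂ {u, v}) = 2 := by
  have hli : LinearIndependent ℂ ![u, v] := by
    refine linearIndependent_of_ne_zero_of_inner_eq_zero (𝕜 := ℂ) ?_ ?_
    · intro i; fin_cases i <;> simpa
    · intro i j hij
      have hvu : ⟪v, u⟫_ℂ = 0 := inner_eq_zero_symm.1 huv
      fin_cases i <;> fin_cases j <;> simp_all
  have := finrank_span_eq_card hli
  rwa [Matrix.range_cons_cons_empty, Fintype.card_fin] at this

/-- Strict separation of the eigenvalues `b, b + 1` from the others. -/
def _root_.Honeycomb.NuIsolated (T : H →L[ℂ] H) (b : ℕ) : Prop :=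
  nuBand T (b + 2) < nuBand T (b + 1) ∧ (2 ≤ b → nuBand T b < nuBand T (b - 1))

/-- If the eigenvalues `b, b + 1` are isolated, then every eigenvector with eigenvalue between
these is in the span of any two orthogonal ones. -/
theorem mem_span_pair_of_isolated {b : ℕ} (hb : 1 ≤ b) (hiso : NuIsolated T b) {u v x : H}
    {α β γ : ℝ} (hu0 : u ≠ 0) (hv0 : v ≠ 0) (huv : ⟪u, v⟫_ℂ = 0)
    (hα : α ∈ Set.Icc (nuBand T (b + 1)) (nuBand T b)) (hu : T u = (α : ℂ) • u)
    (hβ : β ∈ Set.Icc (nuBand T (b + 1)) (nuBand T b)) (hv : T v = (β : ℂ) • v)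
    (hγ : γ ∈ Set.Icc (nuBand T (b + 1)) (nuBand T b)) (hx : T x = (γ : ℂ) • x) :
    x ∈ Submodule.span ℂ {u, v} := by
  have ha := hT.nuBand_pos hinf (show 1 ≤ b + 1 by omega)
  have hc := hT.nuBand_pos hinf hb
  have := hT.finiteDimensional_specSpace ha
  have hup : finrank ℂ (specSpace T (nuBand T (b + 1))) ≤ b + 1 := by
    by_contra! h
    exact absurd ((hT.le_nuBand_iff hinf (show 1 ≤ b + 2 by omega) ha).2 h) (not_le.2 hiso.1)
  -- For `b = 1` there is no preceding eigenvalue, and any threshold above `nuBand T b` will do.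
  obtain ⟨c', hc', hlow⟩ : ∃ c', nuBand T b < c' ∧ b - 1 ≤ finrank ℂ (specSpace T c') := by
    rcases Nat.lt_or_ge b 2 with h | h
    · exact ⟨nuBand T b + 1, by linarith, by omega⟩
    · exact ⟨_, hiso.2 h, hT.le_finrank_nuBand hinf (by omega)⟩
  set W := Submodule.span ℂ {u, v} with hW
  have horth : ∀ {α : ℝ} {u : H}, α ∈ Set.Icc (nuBand T (b + 1)) (nuBand T b) →
      T u = (α : ℂ) • u → ∀ y ∈ specSpace T c', ⟪u, y⟫_ℂ = 0 := fun hα hu y hy =>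
    hT.inner_eq_zero_of_lt (hα.2.trans_lt hc') hu hy
  have hmem : ∀ {α : ℝ} {u : H}, α ∈ Set.Icc (nuBand T (b + 1)) (nuBand T b) →
      T u = (α : ℂ) • u → u ∈ specSpace T (nuBand T (b + 1)) := fun hα hu =>
    eigenspace_le_specSpace T hα.1 (End.mem_eigenspace_iff.2 hu)
  have hWo : ∀ z ∈ W, ∀ y ∈ specSpace T c', ⟪z, y⟫_ℂ = 0 := by
    intro z hz y hy
    obtain ⟨p, q, rfl⟩ := Submodule.mem_span_pair.1 hz
    rw [inner_add_left, inner_smul_left, inner_smul_left, horth hα hu y hy, horth hβ hv y hy,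
      mul_zero, mul_zero, add_zero]
  have hWle : W ≤ specSpace T (nuBand T (b + 1)) := by
    rw [hW, Submodule.span_le]
    rintro z (rfl | rfl)
    exacts [hmem hα hu, hmem hβ hv]
  have hba := hT.nuBand_antitone hinf hb (Nat.le_succ b)
  have : FiniteDimensional ℂ W := FiniteDimensional.span_of_finite ℂ (Set.toFinite _)
  have hsup := hT.finrank_sup_of_orthogonal hc hc' hWo
  rw [hW, finrank_span_pair hu0 hv0 huv] at hsup
  -- The orthogonal spaces on the left have dimensions at least `b - 1` and equal to `2`, while the
  -- space on the right has dimension at most `b + 1`.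
  have heq : specSpace T c' ⊔ W = specSpace T (nuBand T (b + 1)) :=
    Submodule.eq_of_le_of_finrank_le
      (sup_le (specSpace_antitone T (hba.trans hc'.le)) hWle) (by rw [hsup]; omega)
  have hxm := hmem hγ hx
  rw [← heq] at hxm
  obtain ⟨y, hy, z, hz, hyz⟩ := Submodule.mem_sup.1 hxm
  have : y = 0 := by
    have h1 := horth hγ hx y hy
    rw [← hyz, inner_add_left, hWo z hz y hy, add_zero] at h1
    exact inner_self_eq_zero.1 h1
  rw [← hyz, this, zero_add]
  exact hz

/-- Isolation at an eigenvalue of multiplicity two. -/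
theorem nuIsolated_of_finrank_eq_two {b : ℕ} (hb : 1 ≤ b) {ν : ℝ} (h1 : nuBand T b = ν)
    (h2 : nuBand T (b + 1) = ν) (h3 : finrank ℂ (End.eigenspace T.toLinearMap (ν : ℂ)) = 2) :
    NuIsolated T b := by
  have hν : 0 < ν := h1 ▸ hT.nuBand_pos hinf hb
  obtain ⟨ν₀, h4, h5⟩ := hT.exists_specSpace_eq_sup hν
  have h6 : ∀ x ∈ End.eigenspace T.toLinearMap (ν : ℂ), ∀ y ∈ specSpace T ν₀, ⟪x, y⟫_ℂ = 0 :=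
    fun x hx y hy => hT.inner_eq_zero_of_lt h4 (End.mem_eigenspace_iff.1 hx) hy
  have : FiniteDimensional ℂ (End.eigenspace T.toLinearMap (ν : ℂ)) :=
    FiniteDimensional.of_finrank_pos (by omega)
  have h7 := hT.finrank_sup_of_orthogonal hν h4 h6
  rw [← h5, h3] at h7
  have h8 : b + 1 ≤ finrank ℂ (specSpace T ν) := by
    rw [← h2]; exact hT.le_finrank_nuBand hinf (by omega)
  have h9 : ¬ b ≤ finrank ℂ (specSpace T ν₀) := by
    rw [← hT.le_nuBand_iff hinf hb (hν.trans h4), h1]; exact not_le.2 h4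
  -- Fewer than `b` eigenvalues lie above `ν`, and adding the double eigenvalue yields at least `b +
  -- 1`. So there are exactly `b - 1` above `ν` and `b + 1` from `ν` on.
  refine ⟨?_, fun hb2 => ?_⟩
  · rw [h2]
    by_contra! h
    rw [hT.le_nuBand_iff hinf (by omega) hν] at h
    omega
  · rw [h1]
    refine h4.trans_le ((hT.le_nuBand_iff hinf (by omega) (hν.trans h4)).2 ?_)
    omega

end IsCompactPos

theorem continuousAt_nuBand [CompleteSpace H] (hinf : ¬ FiniteDimensional ℂ H)
    {X : Type} [TopologicalSpace X] {T : X → H →L[ℂ] H}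
    (hcp : ∀ t, IsCompactPos (T t)) {t : X} (hT : ContinuousAt T t) {b : ℕ} (hb : 1 ≤ b) :
    ContinuousAt (fun s => nuBand (T s) b) t := by
  rw [ContinuousAt, tendsto_iff_norm_sub_tendsto_zero]
  have h := tendsto_iff_norm_sub_tendsto_zero.1 hT
  refine squeeze_zero (fun s => norm_nonneg _) (fun s => ?_) h
  rw [Real.norm_eq_abs, abs_le]
  have h1 := (hcp s).nuBand_sub_le hinf (hcp t) hb
  have h2 := (hcp t).nuBand_sub_le hinf (hcp s) hb
  rw [norm_sub_rev] at h2
  constructor <;> linarith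

end Bands

open MeasureTheory

/-! ### The Fourier transform of the eigenvalue problem -/

section Transform

/-- The Fourier coefficients of the potential. -/
def potCoef (V : Plane → ℝ) : ℤ × ℤ → ℂ := coef fun x => (V x : ℂ)

theorem coef_conj (f : Plane → ℂ) (m : ℤ × ℤ) :
    coef (fun x => starRingEnd ℂ (f x)) m = starRingEnd ℂ (coef f (-m)) := by
  rw [coef, coef, map_mul, ← integral_conj, map_inv₀, Complex.conj_ofReal]
  simp only [map_mul, conj_planeWave, dualVec_neg, neg_neg]

theorem coef_planeWave_neg_mul (f : Plane → ℂ) (m n : ℤ × ℤ) :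
    coef (fun x => planeWave (-dualVec m) x * f x) n = coef f (n + m) := by
  rw [coef, coef, dualVec_add, neg_add]
  simp only [planeWave_add_left, mul_assoc]

/-- Parseval's formula, expanding `V` and treating the plane wave times `f` as the other factor. -/
theorem coef_potential_mul {V : Plane → ℝ} (hV : Continuous V) (hVp : IsLatticePeriodic V)
    (hVs : Summable (potCoef V)) {f : Plane → ℂ} (hf : Continuous f) (m : ℤ × ℤ) :
    coef (fun x => (V x : ℂ) * f x) m = conv (potCoef V) (coef f) m := by
  have hVc : Continuous fun x => (V x : ℂ) := Complex.continuous_ofReal.comp hV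
  have h := hasSum_cellInner (f := fun x => starRingEnd ℂ (planeWave (-dualVec m) x * f x))
    (g := fun x => (V x : ℂ))
    (Complex.continuous_conj.comp ((continuous_planeWave _).mul hf)) hVc
    (fun v hv x => congrArg Complex.ofReal (hVp v hv x)) hVs
  have h1 : ∀ d, (cellVol : ℂ) * (starRingEnd ℂ
      (coef (fun x => starRingEnd ℂ (planeWave (-dualVec m) x * f x)) d) * coef (fun x => (V x : ℂ)) d)
      = (cellVol : ℂ) * (potCoef V d * coef f (m - d)) := by
    intro d
    rw [coef_conj, Complex.conj_conj, coef_planeWave_neg_mul, potCoef, neg_add_eq_sub]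
    ring
  simp only [h1] at h
  have h2 : (cellVol : ℂ) ≠ 0 := by exact_mod_cast cellVol_pos.ne'
  rw [conv]
  refine mul_left_cancel₀ h2 ?_
  rw [← tsum_mul_left, h.tsum_eq, coef, mul_inv_cancel_left₀ h2, cellInner]
  simp only [Complex.conj_conj]
  exact integral_congr_ae (Eventually.of_forall fun x => by ring)

variable {V : Plane → ℝ} (hV : ContDiff ℝ ∞ V) (hVp : IsLatticePeriodic V)

theorem potCoef_neg (V : Plane → ℝ) (d : ℤ × ℤ) : potCoef V (-d) = starRingEnd ℂ (potCoef V d) := by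
  have := coef_conj (fun x => (V x : ℂ)) (-d)
  simpa only [Complex.conj_ofReal, neg_neg, potCoef] using this

include hV hVp in
theorem rapidDecay_potCoef : RapidDecay (potCoef V) :=
  rapidDecay_coef (fun v hv x => congrArg Complex.ofReal (hVp v hv x)) (Complex.ofRealCLM.contDiff.comp hV)

/-- The Floquet-Bloch operator at quasi-momentum `k` minus `E`, on the level of coefficients. -/
def eigenDefect (w : ℤ × ℤ → ℂ) (k : Plane) (E : ℝ) (a : ℤ × ℤ → ℂ) (m : ℤ × ℤ) : ℂ :=
  ((‖k + dualVec m‖ ^ 2 : ℝ) : ℂ) * a m + conv w a m - (E : ℂ) * a m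

theorem IsLatticePeriodic.synth_coef {f : Plane → ℂ} (hf : IsLatticePeriodic f)
    (hc : Continuous f) (hs : Summable (coef f)) (x : Plane) : synth 0 (coef f) x = f x := by
  rw [synth_zero_eq, (hasSum_coef hf hc hs x).tsum_eq]

include hV hVp in
theorem rapidDecay_conv {a : ℤ × ℤ → ℂ} (ha : RapidDecay a) : RapidDecay (conv (potCoef V) a) := by
  have hc := contDiff_synth_of_rapidDecay ha 0
  have h : conv (potCoef V) a = coef fun x => (V x : ℂ) * synth 0 a x := by
    funext m
    rw [coef_potential_mul hV.continuous hVp (rapidDecay_potCoef hV hVp).summable_self hc.continuous]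
    congr 1
    exact funext fun n => (coef_synth_zero ha.summable_self n).symm
  rw [h]
  refine rapidDecay_coef (fun v hv x => ?_) ((Complex.ofRealCLM.contDiff.comp hV).mul hc)
  simp only [hVp v hv x, isLatticePeriodic_synth_zero a v hv x]

include hV hVp in
theorem synth_conv {a : ℤ × ℤ → ℂ} (ha : RapidDecay a) (k x : Plane) :
    synth k (conv (potCoef V) a) x = (V x : ℂ) * synth k a x := by
  have hc := contDiff_synth_of_rapidDecay ha 0
  have h : conv (potCoef V) a = coef fun x => (V x : ℂ) * synth 0 a x := by
    funext m
    rw [coef_potential_mul hV.continuous hVp (rapidDecay_potCoef hV hVp).summable_self hc.continuous]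
    congr 1
    exact funext fun n => (coef_synth_zero ha.summable_self n).symm
  rw [synth_eq, synth_eq k a, h, IsLatticePeriodic.synth_coef (f := fun x => (V x : ℂ) * synth 0 a x)]
  · ring
  · intro v hv x
    simp only [hVp v hv x, isLatticePeriodic_synth_zero a v hv x]
  · exact (Complex.continuous_ofReal.comp hV.continuous).mul hc.continuous
  · rw [← h]; exact (rapidDecay_conv hV hVp ha).summable_self

theorem rapidDecay_kinetic {a : ℤ × ℤ → ℂ} (ha : RapidDecay a) (k : Plane) :
    RapidDecay fun m => ((‖k + dualVec m‖ ^ 2 : ℝ) : ℂ) * a m :=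
  ha.mul_bounded (C := (1 + ‖k‖) ^ 2) (n := 2) fun m => by
    rw [Complex.norm_real, Real.norm_of_nonneg (by positivity), ← mul_pow]
    gcongr
    exact norm_add_dualVec_le k m

theorem RapidDecay.const_mul {a : ℤ × ℤ → ℂ} (ha : RapidDecay a) (c : ℂ) :
    RapidDecay fun m => c * a m :=
  ha.mul_bounded (C := ‖c‖) (n := 0) fun m => by simp

theorem RapidDecay.add {a b : ℤ × ℤ → ℂ} (ha : RapidDecay a) (hb : RapidDecay b) :
    RapidDecay fun m => a m + b m := fun s => by
  obtain ⟨C, hC⟩ := ha s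
  obtain ⟨D, hD⟩ := hb s
  refine ⟨C + D, fun m => ?_⟩
  have := weight_pos m
  calc weight m ^ s * ‖a m + b m‖ ≤ weight m ^ s * (‖a m‖ + ‖b m‖) := by gcongr; exact norm_add_le _ _
    _ ≤ C + D := by rw [mul_add]; exact add_le_add (hC m) (hD m)

include hV hVp in
theorem rapidDecay_eigenDefect {a : ℤ × ℤ → ℂ} (ha : RapidDecay a) (k : Plane) (E : ℝ) :
    RapidDecay (eigenDefect (potCoef V) k E a) := by
  have h := ((rapidDecay_kinetic ha k).add (rapidDecay_conv hV hVp ha)).add (ha.const_mul (-(E : ℂ)))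
  convert h using 2 with m
  rw [eigenDefect]; ring

include hV hVp in
theorem synth_eigenDefect {a : ℤ × ℤ → ℂ} (ha : RapidDecay a) (k : Plane) (E : ℝ) (x : Plane) :
    synth k (eigenDefect (potCoef V) k E a) x
      = -(Laplacian.laplacian (synth k a) x) + (V x : ℂ) * synth k a x - (E : ℂ) * synth k a x := by
  have h1 := rapidDecay_kinetic ha k
  have h2 := rapidDecay_conv hV hVp ha
  have h3 : eigenDefect (potCoef V) k E a = fun m => (((‖k + dualVec m‖ ^ 2 : ℝ) : ℂ) * a m
      + conv (potCoef V) a m) + (-(E : ℂ)) * a m := by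
    funext m; rw [eigenDefect]; ring
  have h4 : (fun m => -((‖k + dualVec m‖ ^ 2 : ℝ) : ℂ) * a m)
      = fun m => (-1 : ℂ) * (((‖k + dualVec m‖ ^ 2 : ℝ) : ℂ) * a m) := by funext m; ring
  rw [h3, synth_add (h1.add h2).summable_self (ha.const_mul _).summable_self,
    synth_add h1.summable_self h2.summable_self, synth_const_mul, synth_conv hV hVp ha,
    laplacian_synth ha, h4, synth_const_mul]
  ring

theorem eq_of_synth_eq {a b : ℤ × ℤ → ℂ} (ha : Summable a) (hb : Summable b) {k : Plane}
    (h : ∀ x, synth k a x = synth k b x) : a = b := by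
  have h1 : synth 0 a = synth 0 b := funext fun x => by
    have := h x
    rw [synth_eq, synth_eq k b] at this
    exact mul_left_cancel₀ (planeWave_ne_zero k x) this
  funext m
  rw [← coef_synth_zero ha, h1, coef_synth_zero hb]

include hV hVp in
theorem synth_mem_eigenspace_iff {a : ℤ × ℤ → ℂ} (ha : RapidDecay a) {k : Plane} {E : ℝ} :
    synth k a ∈ eigenspace V k E ↔ ∀ m, eigenDefect (potCoef V) k E a m = 0 := by
  constructor
  · rintro ⟨-, -, h⟩ m
    have h1 : eigenDefect (potCoef V) k E a = fun _ => 0 := by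
      refine eq_of_synth_eq (rapidDecay_eigenDefect hV hVp ha k E).summable_self summable_zero
        (k := k) fun x => ?_
      rw [synth_eigenDefect hV hVp ha, h x, sub_self]
      simp [synth]
    rw [h1]
  · intro h
    refine ⟨contDiff_synth_of_rapidDecay ha k, fun v hv x => synth_add_lattice k a hv x, fun x => ?_⟩
    have h1 := synth_eigenDefect hV hVp ha k E x
    rw [synth] at h1
    simp only [h, zero_mul, tsum_zero] at h1
    exact (sub_eq_zero.1 h1.symm)

/-- The Fourier coefficients of a function with quasi-momentum `k`. -/
def blochCoef (k : Plane) (Φ : Plane → ℂ) : ℤ × ℤ → ℂ := coef fun x => planeWave (-k) x * Φ x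

theorem periodicPart {k : Plane} {Φ : Plane → ℂ}
    (h : ∀ v ∈ lattice, ∀ x, Φ (x + v) = planeWave k v * Φ x) :
    IsLatticePeriodic fun x => planeWave (-k) x * Φ x := fun v hv x => by
  change planeWave (-k) (x + v) * Φ (x + v) = planeWave (-k) x * Φ x
  rw [h v hv x, planeWave_add_right]
  linear_combination planeWave (-k) x * Φ x * planeWave_neg_mul k v

theorem rapidDecay_blochCoef {k : Plane} {E : ℝ} {Φ : Plane → ℂ} (h : Φ ∈ eigenspace V k E) :
    RapidDecay (blochCoef k Φ) :=
  rapidDecay_coef (periodicPart h.2.1) ((contDiff_planeWave _).mul h.1)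

theorem synth_blochCoef {k : Plane} {E : ℝ} {Φ : Plane → ℂ} (h : Φ ∈ eigenspace V k E) :
    synth k (blochCoef k Φ) = Φ := by
  funext x
  rw [synth_eq, blochCoef, IsLatticePeriodic.synth_coef (periodicPart h.2.1)
    ((continuous_planeWave _).mul h.1.continuous) (rapidDecay_blochCoef h).summable_self,
    ← mul_assoc, planeWave_mul_neg, one_mul]

theorem blochCoef_synth (k : Plane) {a : ℤ × ℤ → ℂ} (ha : Summable a) : blochCoef k (synth k a) = a := by
  have : (fun x => planeWave (-k) x * synth k a x) = synth 0 a := funext fun x => by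
    rw [synth_eq, ← mul_assoc, planeWave_neg_mul, one_mul]
  rw [blochCoef, this]
  exact funext (coef_synth_zero ha)

/-- A rapidly decaying sequence as an element of `ℓ²`. -/
theorem RapidDecay.exists_ell2 {a : ℤ × ℤ → ℂ} (ha : RapidDecay a) : ∃ u : Ell2, ∀ m, u m = a m := by
  have hmem : Memℓp a 2 := by
    rw [memℓp_two_iff]
    obtain ⟨C, hC⟩ := ha 0
    refine Summable.of_nonneg_of_le (fun m => by positivity) (fun m => ?_)
      (ha.summable_self.norm.mul_left C)
    have := hC m
    rw [pow_zero, one_mul] at this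
    rw [sq]
    gcongr
  exact ⟨⟨a, hmem⟩, fun m => rfl⟩

/-- Elliptic regularity, obtained from the weighted bootstrap for the constant family with `κ = 0`.
-/
theorem rapidDecay_of_eigenvector {w : ℤ × ℤ → ℂ} (hw : RapidDecay w) {k : Plane} {ν : ℝ} (hν : 0 < ν)
    {u : Ell2} (hu : resolv w k u = (ν : ℂ) • u) : RapidDecay u := fun s => by
  obtain ⟨U, hU⟩ := exists_analytic_weighted hw (K := k) (κ := 0) (ν := fun _ => ν) (u := fun _ => u)
    (I := Set.univ) (fun t _ => ⟨analyticAt_const, hν⟩)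
    (fun t _ => ⟨analyticAt_const, by simpa using hu⟩) s
  refine ⟨‖U 0‖, fun m => ?_⟩
  have h := norm_ell2_apply_le (U 0) m
  rw [(hU 0 trivial).2 m, norm_mul, Complex.norm_real, Real.norm_of_nonneg (by
    have := weight_pos m; positivity)] at h
  exact h

include hV hVp in
theorem synth_mem_eigenspace_iff_resolv {k : Plane} {ν : ℝ} (hν : 0 < ν) {u : Ell2}
    (hu : RapidDecay u) : synth k u ∈ eigenspace V k (1 / ν - specShift (potCoef V))
      ↔ resolv (potCoef V) k u = (ν : ℂ) • u := by
  rw [synth_mem_eigenspace_iff hV hVp hu]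
  have hw := rapidDecay_potCoef hV hVp
  exact ⟨fun h => resolv_eq_of_eigen_equation hw hν.ne' hu fun m => sub_eq_zero.1 (h m),
    fun h m => sub_eq_zero.2 (eigen_equation hw hν.ne' h m)⟩

include hV hVp in
theorem exists_resolv_of_mem_eigenspace {k : Plane} {ν : ℝ} (hν : 0 < ν) {Φ : Plane → ℂ}
    (hΦ : Φ ∈ eigenspace V k (1 / ν - specShift (potCoef V))) : ∃ u : Ell2, RapidDecay u ∧
      resolv (potCoef V) k u = (ν : ℂ) • u ∧ Φ = synth k u ∧ ∀ m, u m = blochCoef k Φ m := by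
  have ha := rapidDecay_blochCoef hΦ
  obtain ⟨u, hu⟩ := ha.exists_ell2
  have h1 : ⇑u = blochCoef k Φ := funext hu
  have h2 : RapidDecay u := by rw [h1]; exact ha
  have h3 : Φ = synth k u := by rw [h1, synth_blochCoef hΦ]
  refine ⟨u, h2, ?_, h3, hu⟩
  rw [← synth_mem_eigenspace_iff_resolv hV hVp hν h2, ← h3]
  exact hΦ

-- For such `E` one has `|k + ξ|² - E ≥ μ`, whereas the potential has norm `μ - 1`; the two sides of
-- the eigenvalue equation can balance only at zero. Hence all energies are visible to the
-- resolvent.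
include hV hVp in
theorem eigenspace_eq_bot {k : Plane} {E : ℝ} (hE : E ≤ -specShift (potCoef V)) :
    eigenspace V k E = ⊥ := by
  refine (Submodule.eq_bot_iff _).2 fun Φ hΦ => ?_
  have ha := rapidDecay_blochCoef hΦ
  obtain ⟨u, hu⟩ := ha.exists_ell2
  have h1 : ⇑u = blochCoef k Φ := funext hu
  have h2 : RapidDecay u := by rw [h1]; exact ha
  have h3 : Φ = synth k u := by rw [h1, synth_blochCoef hΦ]
  rw [h3, synth_mem_eigenspace_iff hV hVp h2] at hΦ
  set μ := specShift (potCoef V) with hμ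
  have hμ1 : 1 ≤ μ := one_le_specShift _
  have h4 : μ ^ 2 * ‖u‖ ^ 2 ≤ ‖potOp (potCoef V) 0 u‖ ^ 2 := by
    rw [norm_sq_ell2, norm_sq_ell2, ← tsum_mul_left]
    refine Summable.tsum_le_tsum (fun m => ?_) ((summable_norm_sq_ell2 u).mul_left _)
      (summable_norm_sq_ell2 _)
    have h5 := hΦ m
    rw [eigenDefect, ← potOp_zero_apply (rapidDecay_potCoef hV hVp)] at h5
    have h6 : potOp (potCoef V) 0 u m = ((E - ‖k + dualVec m‖ ^ 2 : ℝ) : ℂ) * u m := by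
      push_cast at h5 ⊢; linear_combination h5
    rw [h6, norm_mul, Complex.norm_real, mul_pow, Real.norm_eq_abs, sq_abs]
    refine mul_le_mul_of_nonneg_right ?_ (by positivity)
    rw [← neg_sq (E - _)]
    gcongr
    nlinarith [sq_nonneg ‖k + dualVec m‖]
  have h5 : μ * ‖u‖ ≤ ‖potOp (potCoef V) 0 u‖ := by
    rw [← mul_pow] at h4
    exact (abs_le_of_sq_le_sq' h4 (norm_nonneg _)).2
  have h6 := (potOp (potCoef V) 0).le_opNorm u
  have h7 : ‖potOp (potCoef V) 0‖ = μ - 1 := by rw [hμ, specShift]; ring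
  rw [h7] at h6
  have h8 : u = 0 := norm_eq_zero.1 (le_antisymm (by linarith) (norm_nonneg u))
  rw [h3, h8]
  funext x
  simp [synth]

theorem cellInner_synth {k : Plane} {u v : Ell2} (hu : RapidDecay u) (hv : RapidDecay v) :
    cellInner (synth k u) (synth k v) = (cellVol : ℂ) * ⟪u, v⟫_ℂ := by
  have h1 : cellInner (synth k u) (synth k v) = cellInner (synth 0 u) (synth 0 v) := by
    refine integral_congr_ae (Eventually.of_forall fun x => ?_)
    change starRingEnd ℂ (synth k u x) * synth k v x = starRingEnd ℂ (synth 0 u x) * synth 0 v x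
    rw [synth_eq, synth_eq k v, map_mul, conj_planeWave]
    linear_combination starRingEnd ℂ (synth 0 u x) * synth 0 v x * planeWave_neg_mul k x
  have hc : coef (synth 0 v) = v := funext (coef_synth_zero hv.summable_self)
  have h := hasSum_cellInner (contDiff_synth_of_rapidDecay hu 0).continuous
    (contDiff_synth_of_rapidDecay hv 0).continuous (isLatticePeriodic_synth_zero v)
    (by rw [hc]; exact hv.summable_self)
  rw [hc] at h
  simp only [coef_synth_zero hu.summable_self] at h
  rw [h1]
  exact h.unique ((hasSum_inner_ell2 u v).mul_left _)

end Transform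

/-! ### Bands and the eigenvalues of the resolvent -/

section BandEnergy

open Module

theorem not_finiteDimensional_ell2 : ¬ FiniteDimensional ℂ Ell2 := fun _ => by
  classical
  have hli : LinearIndependent ℂ fun m : ℤ × ℤ => (lp.single 2 m (1 : ℂ) : Ell2) := by
    refine linearIndependent_of_ne_zero_of_inner_eq_zero (𝕜 := ℂ) (fun m h => ?_) fun m n hmn => ?_
    · have := congrArg (fun u : Ell2 => u m) h
      simp at this
    · change ⟪(lp.single 2 m (1 : ℂ) : Ell2), lp.single 2 n (1 : ℂ)⟫_ℂ = 0
      rw [lp.inner_single_left]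
      simp [Pi.single_eq_of_ne hmn]
  exact Set.infinite_univ.not_finite (Set.finite_univ_iff.2 hli.finite_of_isNoetherian)

/-- The rapidly decaying elements of `ℓ²`. -/
def rapidSubmodule : Submodule ℂ Ell2 where
  carrier := {u | RapidDecay u}
  add_mem' hu hv := RapidDecay.add hu hv
  zero_mem' := fun _ => ⟨0, fun m => by simp⟩
  smul_mem' c _ hu := RapidDecay.const_mul hu c

/-- The series is additive only where it is summable, so a linear map on all of `ℓ²` is obtained by
an arbitrary extension from the rapidly decaying sequences. Only its values on these matter. -/
theorem exists_synthMap (k : Plane) :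
    ∃ G : Ell2 →ₗ[ℂ] (Plane → ℂ), ∀ u : Ell2, RapidDecay u → G u = synth k u := by
  let g : rapidSubmodule →ₗ[ℂ] (Plane → ℂ) :=
    { toFun := fun u => synth k (u : Ell2)
      map_add' := fun u v => funext fun x =>
        synth_add (RapidDecay.summable_self u.2) (RapidDecay.summable_self v.2) k x
      map_smul' := fun c u => funext fun x => synth_const_mul c _ k x }
  obtain ⟨G, hG⟩ := LinearMap.exists_extend g
  exact ⟨G, fun u hu => LinearMap.congr_fun hG ⟨u, hu⟩⟩

theorem rank_map_synthMap {k : Plane} {G : Ell2 →ₗ[ℂ] (Plane → ℂ)}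
    (hG : ∀ u : Ell2, RapidDecay u → G u = synth k u) {W : Submodule ℂ Ell2}
    (hW : W ≤ rapidSubmodule) : Module.rank ℂ (W.map G) = Module.rank ℂ W := by
  have hinj : Function.Injective (G.domRestrict W) := by
    rintro ⟨u, hu⟩ ⟨v, hv⟩ h
    have hu' : RapidDecay u := hW hu
    have hv' : RapidDecay v := hW hv
    have h' : G u = G v := h
    rw [hG u hu', hG v hv'] at h'
    have := eq_of_synth_eq hu'.summable_self hv'.summable_self (congrFun h')
    exact Subtype.ext (lp.ext this)
  rw [← LinearMap.range_domRestrict]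
  exact rank_range_of_injective _ hinj

variable {V : Plane → ℝ} (hV : ContDiff ℝ ∞ V) (hVp : IsLatticePeriodic V)
include hV hVp

theorem resolv_potCoef_isCompactPos (k : Plane) : IsCompactPos (resolv (potCoef V) k) :=
  resolv_isCompactPos (rapidDecay_potCoef hV hVp) (potCoef_neg V) k

theorem eigenspace_resolv_le_rapid {k : Plane} {ν : ℝ} (hν : 0 < ν) :
    End.eigenspace (resolv (potCoef V) k).toLinearMap (ν : ℂ) ≤ rapidSubmodule := fun _ hu =>
  rapidDecay_of_eigenvector (rapidDecay_potCoef hV hVp) hν (End.mem_eigenspace_iff.1 hu)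

theorem specSpace_resolv_le_rapid {k : Plane} {ν : ℝ} (hν : 0 < ν) :
    specSpace (resolv (potCoef V) k) ν ≤ rapidSubmodule :=
  specSpace_le_iff.2 fun _ h => eigenspace_resolv_le_rapid hV hVp (hν.trans_le h)

theorem eigenspace_eq_map {k : Plane} {G : Ell2 →ₗ[ℂ] (Plane → ℂ)}
    (hG : ∀ u : Ell2, RapidDecay u → G u = synth k u) {ν : ℝ} (hν : 0 < ν) :
    eigenspace V k (1 / ν - specShift (potCoef V))
      = (End.eigenspace (resolv (potCoef V) k).toLinearMap (ν : ℂ)).map G := by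
  ext Φ
  rw [Submodule.mem_map]
  constructor
  · intro h
    obtain ⟨u, hu, h1, h2, -⟩ := exists_resolv_of_mem_eigenspace hV hVp hν h
    exact ⟨u, End.mem_eigenspace_iff.2 h1, by rw [hG u hu, h2]⟩
  · rintro ⟨u, hu, rfl⟩
    have hu' := eigenspace_resolv_le_rapid hV hVp hν hu
    rw [hG u hu']
    exact (synth_mem_eigenspace_iff_resolv hV hVp hν hu').2 (End.mem_eigenspace_iff.1 hu)

theorem finrank_eigenspace {k : Plane} {ν : ℝ} (hν : 0 < ν) :
    finrank ℂ (eigenspace V k (1 / ν - specShift (potCoef V)))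
      = finrank ℂ (End.eigenspace (resolv (potCoef V) k).toLinearMap (ν : ℂ)) := by
  obtain ⟨G, hG⟩ := exists_synthMap k
  rw [eigenspace_eq_map hV hVp hG hν, finrank, rank_map_synthMap hG (eigenspace_resolv_le_rapid hV hVp hν),
    finrank]

/-- The correspondence `ν' = 1 / (E' + μ)` reverses the order: energies up to `E` become eigenvalues
from `1 / (E + μ)` on. -/
theorem rank_iSup_eigenspace {k : Plane} {E : ℝ} (hE : -specShift (potCoef V) < E) :
    Module.rank ℂ ↥(⨆ E' ∈ Set.Iic E, eigenspace V k E')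
      = Module.rank ℂ (specSpace (resolv (potCoef V) k) (1 / (E + specShift (potCoef V)))) := by
  obtain ⟨G, hG⟩ := exists_synthMap k
  set μ := specShift (potCoef V) with hμ
  have hpos : 0 < 1 / (E + μ) := one_div_pos.2 (by linarith)
  rw [← rank_map_synthMap hG (specSpace_resolv_le_rapid hV hVp hpos)]
  suffices h : (⨆ E' ∈ Set.Iic E, eigenspace V k E')
      = (specSpace (resolv (potCoef V) k) (1 / (E + μ))).map G by rw [h]
  refine le_antisymm (iSup₂_le fun E' hE' => ?_) ?_
  · rcases le_or_gt E' (-μ) with h | h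
    · rw [eigenspace_eq_bot hV hVp h]; exact bot_le
    · have h1 : E' = 1 / (1 / (E' + μ)) - μ := by rw [one_div_one_div]; ring
      rw [h1, eigenspace_eq_map hV hVp hG (one_div_pos.2 (by linarith))]
      refine Submodule.map_mono (eigenspace_le_specSpace _ ?_)
      exact one_div_le_one_div_of_le (by linarith) (by have := Set.mem_Iic.1 hE'; linarith)
  · rw [Submodule.map_le_iff_le_comap, specSpace_le_iff]
    intro ν' hν'
    rw [← Submodule.map_le_iff_le_comap, ← eigenspace_eq_map hV hVp hG (hpos.trans_le hν')]
    refine le_iSup₂_of_le (1 / ν' - μ) ?_ le_rfl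
    rw [Set.mem_Iic]
    have := (one_div_le (hpos.trans_le hν') (by linarith)).2 hν'
    linarith

theorem bandEnergy_eq (k : Plane) {b : ℕ} (hb : 1 ≤ b) :
    bandEnergy V b k = 1 / nuBand (resolv (potCoef V) k) b - specShift (potCoef V) := by
  have hcp := resolv_potCoef_isCompactPos hV hVp k
  set T := resolv (potCoef V) k with hT
  set μ := specShift (potCoef V) with hμ
  have hν := hcp.nuBand_pos not_finiteDimensional_ell2 hb
  have hset : {E : ℝ | (b : Cardinal) ≤ Module.rank ℂ ↥(⨆ E' ∈ Set.Iic E, eigenspace V k E')}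
      = Set.Ici (1 / nuBand T b - μ) := by
    ext E
    rw [Set.mem_ofPred_eq, Set.mem_Ici]
    rcases le_or_gt E (-μ) with h | h
    · have h1 : (⨆ E' ∈ Set.Iic E, eigenspace V k E') = ⊥ := by
        rw [eq_bot_iff]
        refine iSup₂_le fun E' hE' => ?_
        rw [eigenspace_eq_bot hV hVp ((Set.mem_Iic.1 hE').trans h)]
      have h2 : 0 < 1 / nuBand T b := one_div_pos.2 hν
      rw [h1, rank_bot]
      constructor
      · intro h3
        have : b = 0 := by exact_mod_cast le_antisymm h3 zero_le
        omega
      · intro h3; linarith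
    · rw [rank_iSup_eigenspace hV hVp h]
      have hpos : 0 < 1 / (E + μ) := one_div_pos.2 (by linarith)
      have := hcp.finiteDimensional_specSpace hpos
      rw [← finrank_eq_rank, Nat.cast_le, ← hcp.le_nuBand_iff not_finiteDimensional_ell2 hb hpos,
        one_div_le (by linarith) hν, sub_le_iff_le_add]
  rw [bandEnergy, hset, csInf_Ici]

end BandEnergy

/-! ### Isolated pairs of bands -/

section Isolation

variable {H : Type} [NormedAddCommGroup H] [InnerProductSpace ℂ H] [CompleteSpace H]

theorem eventually_nuIsolated (hinf : ¬ FiniteDimensional ℂ H) {T : ℝ → H →L[ℂ] H}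
    (hcp : ∀ t, IsCompactPos (T t)) (hT : Continuous T) {b : ℕ} (hb : 1 ≤ b) {t₀ : ℝ}
    (h : NuIsolated (T t₀) b) : ∀ᶠ t in 𝓝 t₀, NuIsolated (T t) b := by
  have hc : ∀ j, 1 ≤ j → ContinuousAt (fun s => nuBand (T s) j) t₀ := fun j hj =>
    continuousAt_nuBand hinf hcp hT.continuousAt hj
  have h1 := (hc (b + 2) (by omega)).eventually_lt (hc (b + 1) (by omega)) h.1
  rcases Nat.lt_or_ge b 2 with hb2 | hb2
  · filter_upwards [h1] with t ht
    exact ⟨ht, fun h2 => absurd h2 (not_le.2 hb2)⟩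
  · filter_upwards [h1, (hc b hb).eventually_lt (hc (b - 1) (by omega)) (h.2 hb2)] with t ht ht'
    exact ⟨ht, fun _ => ht'⟩

/-- A continuous eigenvalue that starts in an isolated pair of bands stays in it. -/
theorem mem_Icc_nuBand_of_isolated (hinf : ¬ FiniteDimensional ℂ H) {T : ℝ → H →L[ℂ] H}
    (hcp : ∀ t, IsCompactPos (T t)) (hT : Continuous T) {b : ℕ} (hb : 1 ≤ b) {ν : ℝ → ℝ} {t : ℝ}
    (hν : ∀ r ∈ Set.Icc (0 : ℝ) 1, ContinuousAt ν (r * t) ∧ 0 < ν (r * t) ∧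
      ∃ x, x ≠ 0 ∧ T (r * t) x = (ν (r * t) : ℂ) • x)
    (h0 : ν 0 ∈ Set.Icc (nuBand (T 0) (b + 1)) (nuBand (T 0) b))
    (hiso : ∀ r ∈ Set.Icc (0 : ℝ) 1, NuIsolated (T (r * t)) b) :
    ν t ∈ Set.Icc (nuBand (T t) (b + 1)) (nuBand (T t) b) := by
  let m : unitInterval → ℝ := fun r => r * t
  have hm : Continuous m := continuous_subtype_val.mul continuous_const
  have hνc : Continuous fun r => ν (m r) := continuous_iff_continuousAt.2 fun r =>
    ContinuousAt.comp (f := m) (hν r r.2).1 hm.continuousAt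
  have hg : ∀ j, 1 ≤ j → Continuous fun r => nuBand (T (m r)) j := fun j hj =>
    (continuous_iff_continuousAt.2 fun s => continuousAt_nuBand hinf hcp hT.continuousAt hj).comp hm
  set A : Set unitInterval := {r | ν (m r) ∈ Set.Icc (nuBand (T (m r)) (b + 1)) (nuBand (T (m r)) b)}
    with hA
  have hAcl : IsClosed A :=
    (isClosed_le (hg _ (by omega)) hνc).inter (isClosed_le hνc (hg _ hb))
  -- Every eigenvalue is some `nuBand`, so outside the pair it is bounded by the neighbouring ones;
  -- isolation gives the converse. This exhibits the complement as closed, and the unit interval is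
  -- connected.
  have hAc : Aᶜ = {r | ν (m r) ≤ nuBand (T (m r)) (b + 2)}
      ∪ {r | 2 ≤ b ∧ nuBand (T (m r)) (b - 1) ≤ ν (m r)} := by
    ext r
    have hi := hiso r r.2
    simp only [hA, Set.mem_compl_iff, Set.mem_ofPred_eq, Set.mem_union, Set.mem_Icc, not_and_or, not_le]
    constructor
    · intro h
      obtain ⟨x, hx0, hx⟩ := (hν r r.2).2.2
      obtain ⟨j, hj1, hj⟩ := (hcp (m r)).exists_eq_nuBand hinf (hν r r.2).2.1 hx0 hx
      have hj' : nuBand (T (m r)) j = ν (m r) := hj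
      rcases Nat.lt_or_ge j b with h1 | h1
      · right
        refine ⟨by omega, ?_⟩
        rw [← hj']
        exact (hcp _).nuBand_antitone hinf hj1 (by omega)
      · rcases Nat.lt_or_ge j (b + 2) with h2 | h2
        · exfalso
          rw [← hj'] at h
          rcases h with h | h
          · exact absurd ((hcp _).nuBand_antitone hinf hj1 (by omega)) (not_le.2 h)
          · exact absurd ((hcp _).nuBand_antitone hinf hb h1) (not_le.2 h)
        · left
          rw [← hj']
          exact (hcp _).nuBand_antitone hinf (by omega) h2
    · rintro (h | ⟨h2, h⟩)
      · left; exact h.trans_lt hi.1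
      · right; exact (hi.2 h2).trans_le h
  have hBcl : IsClosed Aᶜ := by
    rw [hAc]
    refine (isClosed_le hνc (hg _ (by omega))).union ?_
    by_cases hb2 : 2 ≤ b
    · simp only [hb2, true_and]
      exact isClosed_le (hg _ (by omega)) hνc
    · simp [hb2]
  have hclopen : IsClopen A := ⟨hAcl, isClosed_compl_iff.1 hBcl⟩
  have huniv := hclopen.eq_univ ⟨0, by simpa [hA, m] using h0⟩
  have h1 : (1 : unitInterval) ∈ A := huniv ▸ Set.mem_univ _
  simpa [hA, m] using h1

end Isolation

/-! ### Spans of eigenfunctions of an isolated pair of bands. -/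

section SpansBands

open Module

variable {V : Plane → ℝ} (hV : ContDiff ℝ ∞ V) (hVp : IsLatticePeriodic V)

theorem map_span_pair {k : Plane} {G : Ell2 →ₗ[ℂ] (Plane → ℂ)}
    (hG : ∀ u : Ell2, RapidDecay u → G u = synth k u) {u v : Ell2} (hu : RapidDecay u)
    (hv : RapidDecay v) :
    Submodule.span ℂ {synth k u, synth k v} = (Submodule.span ℂ {u, v}).map G := by
  rw [Submodule.map_span, Set.image_pair, hG u hu, hG v hv]

include hV hVp

theorem spansBands_of_pair {k : Plane} {b : ℕ} (hb : 1 ≤ b)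
    (hiso : NuIsolated (resolv (potCoef V) k) b) {u v : Ell2} {α β : ℝ} (hu0 : u ≠ 0) (hv0 : v ≠ 0)
    (huv : ⟪u, v⟫_ℂ = 0)
    (hα : α ∈ Set.Icc (nuBand (resolv (potCoef V) k) (b + 1)) (nuBand (resolv (potCoef V) k) b))
    (hu : resolv (potCoef V) k u = (α : ℂ) • u)
    (hβ : β ∈ Set.Icc (nuBand (resolv (potCoef V) k) (b + 1)) (nuBand (resolv (potCoef V) k) b))
    (hv : resolv (potCoef V) k v = (β : ℂ) • v) :
    SpansBands V b k (Submodule.span ℂ {synth k u, synth k v}) := by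
  have hcp := resolv_potCoef_isCompactPos hV hVp k
  have hinf := not_finiteDimensional_ell2
  have hw := rapidDecay_potCoef hV hVp
  set T := resolv (potCoef V) k with hT
  have hp1 := hcp.nuBand_pos hinf hb
  have hp2 := hcp.nuBand_pos hinf (show 1 ≤ b + 1 by omega)
  have hba := hcp.nuBand_antitone hinf hb (Nat.le_succ b)
  have hcv : (0 : ℝ) < cellVol := cellVol_pos
  constructor
  -- Eigenvectors of distinct eigenvalues are automatically orthogonal; if the two bands coincide,
  -- the given pair serves.
  · obtain ⟨x, y, hx0, hy0, hx, hy, hxy⟩ : ∃ x y, x ≠ 0 ∧ y ≠ 0 ∧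
        T x = (nuBand T b : ℂ) • x ∧ T y = (nuBand T (b + 1) : ℂ) • y ∧ ⟪x, y⟫_ℂ = 0 := by
      rcases hba.lt_or_eq with hlt | heq
      · obtain ⟨x, hx0, hx⟩ := hcp.exists_eigenvector_nuBand hinf hb
        obtain ⟨y, hy0, hy⟩ := hcp.exists_eigenvector_nuBand hinf (show 1 ≤ b + 1 by omega)
        refine ⟨x, y, hx0, hy0, hx, hy, inner_eq_zero_symm.1 (hcp.inner_eq_zero_of_lt hlt hy ?_)⟩
        exact eigenspace_le_specSpace T le_rfl (End.mem_eigenspace_iff.2 hx)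
      · have e : ∀ {γ}, γ ∈ Set.Icc (nuBand T (b + 1)) (nuBand T b) → γ = nuBand T b :=
          fun hγ => le_antisymm hγ.2 (heq ▸ hγ.1)
        refine ⟨u, v, hu0, hv0, by rw [← e hα]; exact hu, ?_, huv⟩
        rw [show nuBand T (b + 1) = nuBand T b from heq, ← e hβ]; exact hv
    have hc : ∀ z : Ell2, z ≠ 0 → (cellVol : ℂ) * ⟪(((√cellVol * ‖z‖)⁻¹ : ℝ) : ℂ) • z,
        (((√cellVol * ‖z‖)⁻¹ : ℝ) : ℂ) • z⟫_ℂ = 1 := by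
      intro z hz
      have h1 := norm_pos_iff.2 hz
      rw [inner_self_eq_norm_sq_to_K, norm_smul, Complex.norm_real, Real.norm_of_nonneg (by positivity)]
      have h2 : cellVol * ((√cellVol * ‖z‖)⁻¹ * ‖z‖) ^ 2 = 1 := by
        rw [mul_pow, inv_pow, mul_pow, Real.sq_sqrt hcv.le]; field_simp
      change (cellVol : ℂ) * (((√cellVol * ‖z‖)⁻¹ * ‖z‖ : ℝ) : ℂ) ^ 2 = 1
      exact_mod_cast h2
    have hrx := rapidDecay_of_eigenvector hw hp1 hx
    have hry := rapidDecay_of_eigenvector hw hp2 hy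
    refine ⟨synth k ((((√cellVol * ‖x‖)⁻¹ : ℝ) : ℂ) • x : Ell2),
      synth k ((((√cellVol * ‖y‖)⁻¹ : ℝ) : ℂ) • y : Ell2), ?_, ?_, ?_, ?_, ?_⟩
    · rw [bandEnergy_eq hV hVp k hb, synth_mem_eigenspace_iff_resolv hV hVp hp1 (hrx.const_mul _),
        map_smul, ← hT, hx, smul_comm]
    · rw [bandEnergy_eq hV hVp k (show 1 ≤ b + 1 by omega),
        synth_mem_eigenspace_iff_resolv hV hVp hp2 (hry.const_mul _), map_smul, ← hT, hy, smul_comm]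
    · rw [cellInner_synth (hrx.const_mul _) (hrx.const_mul _), hc x hx0]
    · rw [cellInner_synth (hry.const_mul _) (hry.const_mul _), hc y hy0]
    · rw [cellInner_synth (hrx.const_mul _) (hry.const_mul _), inner_smul_left, inner_smul_right, hxy]
      simp
  · intro φ ψ h
    have hm1 := h.mem_lower
    have hm2 := h.mem_upper
    rw [bandEnergy_eq hV hVp k hb] at hm1
    rw [bandEnergy_eq hV hVp k (show 1 ≤ b + 1 by omega)] at hm2
    obtain ⟨x, hrx, hx, rfl, -⟩ := exists_resolv_of_mem_eigenspace hV hVp hp1 hm1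
    obtain ⟨y, hry, hy, rfl, -⟩ := exists_resolv_of_mem_eigenspace hV hVp hp2 hm2
    have hx0 : x ≠ 0 := by
      rintro rfl
      have := h.norm_lower
      rw [cellInner_synth hrx hrx] at this
      simp at this
    have hy0 : y ≠ 0 := by
      rintro rfl
      have := h.norm_upper
      rw [cellInner_synth hry hry] at this
      simp at this
    have hxy : ⟪x, y⟫_ℂ = 0 := by
      have := h.orthogonal
      rw [cellInner_synth hrx hry] at this
      exact (mul_eq_zero.1 this).resolve_left (by exact_mod_cast hcv.ne')
    obtain ⟨G, hG⟩ := exists_synthMap k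
    have hru := rapidDecay_of_eigenvector hw (hp2.trans_le hα.1) hu
    have hrv := rapidDecay_of_eigenvector hw (hp2.trans_le hβ.1) hv
    rw [map_span_pair hG hru hrv, map_span_pair hG hrx hry]
    have hmb : nuBand T b ∈ Set.Icc (nuBand T (b + 1)) (nuBand T b) := ⟨hba, le_rfl⟩
    have hma : nuBand T (b + 1) ∈ Set.Icc (nuBand T (b + 1)) (nuBand T b) := ⟨le_rfl, hba⟩
    congr 1
    refine le_antisymm (Submodule.span_le.2 ?_) (Submodule.span_le.2 ?_)
    · rintro z (rfl | rfl)
      · exact hcp.mem_span_pair_of_isolated hinf hb hiso hx0 hy0 hxy hmb hx hma hy hα hu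
      · exact hcp.mem_span_pair_of_isolated hinf hb hiso hx0 hy0 hxy hmb hx hma hy hβ hv
    · rintro z (rfl | rfl)
      · exact hcp.mem_span_pair_of_isolated hinf hb hiso hu0 hv0 huv hα hu hβ hv hmb hx
      · exact hcp.mem_span_pair_of_isolated hinf hb hiso hu0 hv0 huv hα hu hβ hv hma hy

theorem bandEnergy_le_iff {k : Plane} {i j : ℕ} (hi : 1 ≤ i) (hj : 1 ≤ j) :
    bandEnergy V i k ≤ bandEnergy V j k
      ↔ nuBand (resolv (potCoef V) k) j ≤ nuBand (resolv (potCoef V) k) i := by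
  have hcp := resolv_potCoef_isCompactPos hV hVp k
  rw [bandEnergy_eq hV hVp k hi, bandEnergy_eq hV hVp k hj, sub_le_sub_iff_right,
    one_div_le_one_div (hcp.nuBand_pos not_finiteDimensional_ell2 hi)
      (hcp.nuBand_pos not_finiteDimensional_ell2 hj)]

theorem nuIsolated_of_bandsIsolated {k : Plane} {b : ℕ} (hb : 1 ≤ b) (h : BandsIsolated V b k) :
    NuIsolated (resolv (potCoef V) k) b := by
  have hcp := resolv_potCoef_isCompactPos hV hVp k
  have hanti := fun {i j : ℕ} (hi : 1 ≤ i) (hij : i ≤ j) =>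
    (bandEnergy_le_iff hV hVp (k := k) hi (hi.trans hij)).2
      (hcp.nuBand_antitone not_finiteDimensional_ell2 hi hij)
  constructor
  · by_contra! hle
    refine h (b + 2) (by omega) (by omega) (by omega) ⟨hanti hb (by omega), ?_⟩
    exact (bandEnergy_le_iff hV hVp (by omega) (by omega)).2 hle
  · intro hb2
    by_contra! hle
    refine h (b - 1) (by omega) (by omega) (by omega) ⟨?_, hanti (by omega) (by omega)⟩
    exact (bandEnergy_le_iff hV hVp hb (by omega)).2 hle

end SpansBands

/-! ### The rotation of the frequencies -/

section Rotation

/-- The rotation of the indices of the frequencies `K + m₁ k₁ + m₂ k₂`. -/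
def rotIdx : ℤ × ℤ ≃ ℤ × ℤ where
  toFun m := (-m.2, m.1 - m.2 + 1)
  invFun m := (m.2 - m.1 - 1, -m.1)
  left_inv m := by ext <;> dsimp only <;> ring
  right_inv m := by ext <;> dsimp only <;> ring

theorem rotIdx_three (m : ℤ × ℤ) : rotIdx (rotIdx (rotIdx m)) = m := by
  ext <;> simp only [rotIdx, Equiv.coe_fn_mk] <;> ring

/-- A fixed point would satisfy `3 * m.2 = 1`. Thus all orbits have three elements. -/
theorem rotIdx_ne (m : ℤ × ℤ) : rotIdx m ≠ m := fun h => by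
  have h1 := congrArg Prod.fst h
  have h2 := congrArg Prod.snd h
  simp only [rotIdx, Equiv.coe_fn_mk] at h1 h2
  omega

theorem rotIdx_two_ne (m : ℤ × ℤ) : rotIdx (rotIdx m) ≠ m := fun h => by
  have := congrArg rotIdx h
  rw [rotIdx_three] at this
  exact rotIdx_ne m this.symm

@[simp] theorem rot_zero (x : Plane) : rot x 0 = -(1 / 2) * x 0 + √3 / 2 * x 1 := by
  simp [rot, rotMatrix, Matrix.toLpLin_apply, dotProduct, Fin.sum_univ_two]

@[simp] theorem rot_one (x : Plane) : rot x 1 = -(√3 / 2) * x 0 + -(1 / 2) * x 1 := by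
  simp [rot, rotMatrix, Matrix.toLpLin_apply, dotProduct, Fin.sum_univ_two]

@[simp] theorem rotAdj_zero (x : Plane) : rotAdj x 0 = -(1 / 2) * x 0 + -(√3 / 2) * x 1 := by
  simp [rotAdj, rotMatrix, Matrix.toLpLin_apply]

@[simp] theorem rotAdj_one (x : Plane) : rotAdj x 1 = √3 / 2 * x 0 + -(1 / 2) * x 1 := by
  simp [rotAdj, rotMatrix, Matrix.toLpLin_apply]

theorem planeWave_rotAdj (k x : Plane) : planeWave k (rotAdj x) = planeWave (rot k) x := by
  rw [planeWave, planeWave, inner_plane, inner_plane]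
  congr 3
  simp
  ring

theorem freq_zero (m : ℤ × ℤ) : freq m 0 = q / 2 * (m.1 + m.2) := by
  simp [freq, vertexK]; ring

theorem freq_one (m : ℤ × ℤ) : freq m 1 = q * √3 / 2 * (2 / 3 + m.1 - m.2) := by
  simp [freq, vertexK]; ring

theorem rot_freq (m : ℤ × ℤ) : rot (freq m) = freq (rotIdx m) := by
  ext i
  fin_cases i
  · change rot (freq m) 0 = freq (rotIdx m) 0
    rw [rot_zero, freq_zero, freq_zero, freq_one]
    simp only [rotIdx, Equiv.coe_fn_mk]
    push_cast
    linear_combination (q / 4 * (2 / 3 + m.1 - m.2)) * sqrt_three_sq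
  · change rot (freq m) 1 = freq (rotIdx m) 1
    rw [rot_one, freq_one, freq_zero, freq_one]
    simp only [rotIdx, Equiv.coe_fn_mk]
    push_cast
    ring

theorem freq_injective : Function.Injective freq := fun m n h => by
  have h1 : dualVec (m - n) = 0 := by
    rw [freq_eq, freq_eq] at h
    rw [dualVec_sub, add_left_cancel h, sub_self]
  have h2 := sq_add_sq_le_norm_sq_dualVec (m - n)
  rw [h1, norm_zero] at h2
  have h3 : ((m - n).1 : ℝ) = 0 := by nlinarith [sq_nonneg ((m - n).1 : ℝ), sq_nonneg ((m - n).2 : ℝ)]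
  have h4 : ((m - n).2 : ℝ) = 0 := by nlinarith [sq_nonneg ((m - n).1 : ℝ), sq_nonneg ((m - n).2 : ℝ)]
  have h5 : (m - n).1 = 0 := by exact_mod_cast h3
  have h6 : (m - n).2 = 0 := by exact_mod_cast h4
  exact sub_eq_zero.1 (Prod.ext h5 h6)

/-- The point `(1, i)·k` of the complex plane. -/
def toC (k : Plane) : ℂ := (k 0 : ℂ) + Complex.I * (k 1 : ℂ)

theorem tau_eq : tau = ⟨-(1 / 2), √3 / 2⟩ := by
  have h : (2 * Real.pi * Complex.I / 3 : ℂ) = ((Real.pi - Real.pi / 3 : ℝ) : ℂ) * Complex.I := by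
    push_cast; ring
  rw [tau, h]
  apply Complex.ext
  · rw [Complex.exp_ofReal_mul_I_re, Real.cos_pi_sub, Real.cos_pi_div_three]
  · rw [Complex.exp_ofReal_mul_I_im, Real.sin_pi_sub, Real.sin_pi_div_three]

theorem tau_mul_conj : tau * starRingEnd ℂ tau = 1 := by
  rw [Complex.mul_conj, tau_eq, Complex.normSq_mk]
  have := sqrt_three_sq
  norm_cast
  linear_combination this / 4

theorem tau_ne_one : tau ≠ 1 := fun h => by
  have := congrArg Complex.re h
  rw [tau_eq] at this
  norm_num at this

theorem conj_tau_ne_one : starRingEnd ℂ tau ≠ 1 := fun h => tau_ne_one (by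
  have := congrArg (starRingEnd ℂ) h; simpa using this)

theorem conj_tau_sq : starRingEnd ℂ tau ^ 2 = tau := by
  rw [tau_eq]
  have := sqrt_three_sq
  apply Complex.ext
  · simp [sq]; linear_combination (-1 / 4 : ℝ) * this
  · simp [sq]; ring

theorem toC_rot (k : Plane) : toC (rot k) = starRingEnd ℂ tau * toC k := by
  rw [tau_eq]
  apply Complex.ext
  · simp [toC]
  · simp [toC]; ring

theorem toC_rotIdx (m : ℤ × ℤ) : toC (freq (rotIdx m)) = starRingEnd ℂ tau * toC (freq m) := by
  rw [← rot_freq, toC_rot]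

/-- Splits the momentum into two parts on which the rotation acts by the characters `conj τ` and
`τ`. -/
theorem two_inner_eq (κ k : Plane) : ((2 * ⟪κ, k⟫_ℝ : ℝ) : ℂ)
    = starRingEnd ℂ (toC κ) * toC k + toC κ * starRingEnd ℂ (toC k) := by
  rw [inner_plane]
  apply Complex.ext
  · simp [toC]; ring
  · simp [toC]; ring

theorem norm_toC (k : Plane) : ‖toC k‖ = ‖k‖ := by
  have h : ‖toC k‖ ^ 2 = ‖k‖ ^ 2 := by
    rw [norm_sq_plane, ← Complex.normSq_eq_norm_sq, Complex.normSq_apply]; simp [toC]; ring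
  exact (pow_left_inj₀ (norm_nonneg _) (norm_nonneg _) two_ne_zero).1 h

theorem mem_repSystem_iff {m s : ℤ × ℤ} :
    (freq m = freq s ∨ freq m = rot (freq s) ∨ freq m = rot (rot (freq s)))
      ↔ (m = s ∨ rotIdx (rotIdx m) = s ∨ rotIdx m = s) := by
  rw [rot_freq, rot_freq, freq_injective.eq_iff, freq_injective.eq_iff, freq_injective.eq_iff]
  refine or_congr Iff.rfl (or_congr ⟨?_, ?_⟩ ⟨?_, ?_⟩)
  all_goals rintro rfl
  all_goals simp only [rotIdx_three]

/-- Summation over the orbits of the rotation. -/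
theorem tsum_repSystem {S : Set (ℤ × ℤ)} (hS : IsRepSystem S) {f : ℤ × ℤ → ℂ} (hf : Summable f)
    (hinv : ∀ m, f (rotIdx m) = f m) : ∑' m, f m = 3 * ∑' m : S, f m := by
  classical
  have h1 : ∀ m, S.indicator f m + S.indicator f (rotIdx m) + S.indicator f (rotIdx (rotIdx m)) = f m := by
    intro m
    obtain ⟨s, ⟨hsS, hs⟩, huniq⟩ := hS m
    rw [mem_repSystem_iff] at hs
    have huniq' : ∀ s', s' ∈ S → (m = s' ∨ rotIdx (rotIdx m) = s' ∨ rotIdx m = s') → s' = s :=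
      fun s' h1 h2 => huniq s' ⟨h1, mem_repSystem_iff.2 h2⟩
    have e1 : m ∈ S → m = s := fun h => huniq' _ h (Or.inl rfl)
    have e2 : rotIdx (rotIdx m) ∈ S → rotIdx (rotIdx m) = s := fun h =>
      huniq' _ h (Or.inr (Or.inl rfl))
    have e3 : rotIdx m ∈ S → rotIdx m = s := fun h => huniq' _ h (Or.inr (Or.inr rfl))
    have n1 := rotIdx_ne m
    have n2 := rotIdx_two_ne m
    have n3 := rotIdx_ne (rotIdx m)
    rcases hs with rfl | rfl | rfl
    · have a2 : rotIdx m ∉ S := fun h => n1 (e3 h)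
      have a3 : rotIdx (rotIdx m) ∉ S := fun h => n2 (e2 h)
      simp [hsS, a2, a3]
    · have a2 : rotIdx m ∉ S := fun h => n3 (e3 h).symm
      have a3 : m ∉ S := fun h => n2 (e1 h).symm
      simp [hsS, a2, a3, hinv]
    · have a2 : rotIdx (rotIdx m) ∉ S := fun h => n3 (e2 h)
      have a3 : m ∉ S := fun h => n1 (e1 h).symm
      simp [hsS, a2, a3, hinv]
  have hi : Summable (S.indicator f) := hf.indicator S
  have hi2 := rotIdx.summable_iff.2 hi
  have hi3 := rotIdx.summable_iff.2 hi2
  have h2 := (hi.add hi2).add hi3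
  rw [tsum_subtype, ← tsum_congr h1]
  have h3 := (hi.add hi2).tsum_add hi3
  have h4 := hi.tsum_add hi2
  have h5 : ∑' m, (S.indicator f ∘ rotIdx) m = ∑' m, S.indicator f m := rotIdx.tsum_eq _
  have h6 : ∑' m, ((S.indicator f ∘ rotIdx) ∘ rotIdx) m = ∑' m, S.indicator f m :=
    (rotIdx.tsum_eq (S.indicator f ∘ rotIdx)).trans h5
  simp only [Function.comp] at h3 h4 h5 h6
  rw [h3, h4, h5, h6]
  ring

/-- Reindexing by the rotation multiplies the sum by `c ≠ 1`. This selection rule removes all but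
one term of the first-order matrix. -/
theorem tsum_eq_zero_of_rotIdx {f : ℤ × ℤ → ℂ} {c : ℂ} (hc : c ≠ 1)
    (h : ∀ m, f (rotIdx m) = c * f m) : ∑' m, f m = 0 := by
  have h1 : ∑' m, f m = c * ∑' m, f m := by
    rw [← tsum_mul_left, ← rotIdx.tsum_eq f]
    exact tsum_congr h
  have h2 : (1 - c) * ∑' m, f m = 0 := by linear_combination h1
  exact (mul_eq_zero.1 h2).resolve_left (sub_ne_zero.2 hc.symm)

end Rotation

open Module

/-! ### Fourier coefficients of the eigenfunctions at the Dirac point -/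

section DiracCoefficients

theorem planeWave_freq_mul (m : ℤ × ℤ) (Φ : Plane → ℂ) :
    cellInner (planeWave (freq m)) Φ = (cellVol : ℂ) * blochCoef vertexK Φ m := by
  have h : (cellVol : ℂ) ≠ 0 := by exact_mod_cast cellVol_pos.ne'
  rw [blochCoef, coef, mul_inv_cancel_left₀ h, cellInner]
  refine integral_congr_ae (Eventually.of_forall fun x => ?_)
  change starRingEnd ℂ (planeWave (freq m) x) * Φ x = _
  rw [conj_planeWave, freq_eq, neg_add, planeWave_add_left]
  ring

theorem cellInner_tauMode {Φ : Plane → ℂ} (hΦ : Continuous Φ) (m : ℤ × ℤ) :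
    tauCoeff Φ m = ((√(3 * cellVol))⁻¹ : ℝ) * ((cellVol : ℂ) * (blochCoef vertexK Φ m
      + tau * blochCoef vertexK Φ (rotIdx m)
      + starRingEnd ℂ tau * blochCoef vertexK Φ (rotIdx (rotIdx m)))) := by
  have hi : ∀ n (c : ℂ), Integrable (fun x => c * (starRingEnd ℂ (planeWave (freq n) x) * Φ x))
      (volume.restrict cell) := fun n c =>
    (continuous_const.mul ((Complex.continuous_conj.comp (continuous_planeWave _)).mul hΦ)).integrable_cell
  have h1 : ∀ x, starRingEnd ℂ (tauMode m x) * Φ x = ((√(3 * cellVol))⁻¹ : ℝ) *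
      (1 * (starRingEnd ℂ (planeWave (freq m) x) * Φ x)
        + tau * (starRingEnd ℂ (planeWave (freq (rotIdx m)) x) * Φ x)
        + starRingEnd ℂ tau * (starRingEnd ℂ (planeWave (freq (rotIdx (rotIdx m))) x) * Φ x)) := by
    intro x
    rw [tauMode, rot_freq, rot_freq]
    simp only [map_mul, map_add, Complex.conj_ofReal, Complex.conj_conj]
    rw [show volume.real cell = cellVol from rfl]
    ring
  rw [tauCoeff, cellInner]
  simp only [h1]
  rw [integral_const_mul, integral_add
    (f := fun x => 1 * (starRingEnd ℂ (planeWave (freq m) x) * Φ x)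
      + tau * (starRingEnd ℂ (planeWave (freq (rotIdx m)) x) * Φ x))
    ((hi _ _).add (hi _ _)) (hi _ _),
    integral_add (hi _ _) (hi _ _), integral_const_mul, integral_const_mul, integral_const_mul]
  have h2 : ∀ n, ∫ x in cell, starRingEnd ℂ (planeWave (freq n) x) * Φ x
      = (cellVol : ℂ) * blochCoef vertexK Φ n := fun n => planeWave_freq_mul n Φ
  rw [h2, h2, h2]
  ring

/-- Rotating the argument by `R*` rotates the frequencies by `R`, which permutes the indices;
compare coefficients. -/
theorem synth_rotAdj {a : ℤ × ℤ → ℂ} {c : ℂ} (ha : Summable a)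
    (h : ∀ x, synth vertexK a (rotAdj x) = c * synth vertexK a x) (m : ℤ × ℤ) :
    a m = c * a (rotIdx m) := by
  have h1 : (fun m => a (rotIdx.symm m)) = fun m => c * a m := by
    refine eq_of_synth_eq (k := vertexK) (rotIdx.symm.summable_iff.2 ha) (ha.mul_left c) fun x => ?_
    rw [synth_const_mul, ← h x, synth, synth, ← rotIdx.tsum_eq]
    refine tsum_congr fun m => ?_
    rw [Equiv.symm_apply_apply, planeWave_rotAdj, ← freq_eq, ← freq_eq, rot_freq]
  have := congrFun h1 (rotIdx m)
  rwa [Equiv.symm_apply_apply] at this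

theorem conjInv_synth (k : Plane) (a : ℤ × ℤ → ℂ) :
    conjInv (synth k a) = synth k fun m => starRingEnd ℂ (a m) := by
  funext x
  rw [conjInv, synth, synth, Complex.conj_tsum]
  refine tsum_congr fun m => ?_
  rw [map_mul, conj_planeWave, planeWave_neg_right, neg_neg]

/-- Two elements of `ℓ²` are the sequences of Fourier coefficients of the functions `Φ₁, Φ₂` that
span the nullspace at a Dirac point. -/
structure IsDiracCoef (w : ℤ × ℤ → ℂ) (ν : ℝ) (u₁ u₂ : Ell2) : Prop where
  pos : 0 < ν
  rapid_one : RapidDecay u₁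
  rapid_two : RapidDecay u₂
  conj : ∀ m, u₂ m = starRingEnd ℂ (u₁ m)
  rot : ∀ m, u₁ (rotIdx m) = starRingEnd ℂ tau * u₁ m
  norm_one : ‖u₁‖ ^ 2 = cellVol⁻¹
  norm_two : ‖u₂‖ ^ 2 = cellVol⁻¹
  orthogonal : ⟪u₁, u₂⟫_ℂ = 0
  eigenspace : End.eigenspace (resolv w vertexK).toLinearMap (ν : ℂ) = Submodule.span ℂ {u₁, u₂}
  finrank : finrank ℂ (End.eigenspace (resolv w vertexK).toLinearMap (ν : ℂ)) = 2

variable {V : Plane → ℝ} (hV : ContDiff ℝ ∞ V) (hVp : IsLatticePeriodic V)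
include hV hVp

theorem IsDiracPoint.exists_coef {Estar : ℝ} {b : ℕ} {Φ₁ : Plane → ℂ}
    (hD : IsDiracPoint V Estar b Φ₁) : ∃ (ν : ℝ) (u₁ u₂ : Ell2), IsDiracCoef (potCoef V) ν u₁ u₂ ∧
      Estar = 1 / ν - specShift (potCoef V) ∧ Φ₁ = synth vertexK u₁ ∧ conjInv Φ₁ = synth vertexK u₂ := by
  have hm1 : Φ₁ ∈ Honeycomb.eigenspace V vertexK Estar := by
    rw [hD.nullspace]; exact Submodule.subset_span (by simp)
  have hm2 : conjInv Φ₁ ∈ Honeycomb.eigenspace V vertexK Estar := by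
    rw [hD.nullspace]; exact Submodule.subset_span (by simp)
  have hE : -specShift (potCoef V) < Estar := by
    by_contra! h
    have h2 := hD.multiplicity_two
    rw [eigenspace_eq_bot hV hVp h, finrank_bot] at h2
    omega
  set μ := specShift (potCoef V) with hμ
  have hν : 0 < 1 / (Estar + μ) := one_div_pos.2 (by linarith)
  set ν := 1 / (Estar + μ) with hνdef
  have hEν : Estar = 1 / ν - μ := by rw [hνdef, one_div_one_div]; ring
  have hfin := hD.multiplicity_two
  have hspan := hD.nullspace
  rw [hEν] at hm1 hm2 hfin hspan
  obtain ⟨u₁, hr1, he1, hs1, hc1⟩ := exists_resolv_of_mem_eigenspace hV hVp hν hm1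
  obtain ⟨u₂, hr2, he2, hs2, hc2⟩ := exists_resolv_of_mem_eigenspace hV hVp hν hm2
  have hcv : (cellVol : ℂ) ≠ 0 := by exact_mod_cast cellVol_pos.ne'
  have hnorm : ∀ u : Ell2, (cellVol : ℂ) * ⟪u, u⟫_ℂ = 1 → ‖u‖ ^ 2 = cellVol⁻¹ := by
    intro u h
    rw [inner_self_eq_norm_sq_to_K] at h
    change (cellVol : ℂ) * ((‖u‖ : ℝ) : ℂ) ^ 2 = 1 at h
    have h' : cellVol * ‖u‖ ^ 2 = 1 := by exact_mod_cast h
    exact eq_inv_of_mul_eq_one_right h'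
  have hn1 := hD.norm_one
  have hn2 := hD.norm_two
  have ho := hD.orthogonal
  rw [hs2] at hn2 ho
  rw [hs1] at hn1 ho
  rw [cellInner_synth hr1 hr1] at hn1
  rw [cellInner_synth hr2 hr2] at hn2
  rw [cellInner_synth hr1 hr2] at ho
  have horth : ⟪u₁, u₂⟫_ℂ = 0 := (mul_eq_zero.1 ho).resolve_left hcv
  rw [finrank_eigenspace hV hVp hν] at hfin
  have hne : ∀ u : Ell2, ‖u‖ ^ 2 = cellVol⁻¹ → u ≠ 0 := by
    rintro u h rfl
    have := cellVol_pos
    have h3 : (0 : ℝ) < cellVol⁻¹ := by positivity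
    rw [← h] at h3
    simp at h3
  refine ⟨ν, u₁, u₂, ⟨hν, hr1, hr2, ?_, ?_, hnorm _ hn1, hnorm _ hn2, horth, ?_, hfin⟩, hEν, hs1, hs2⟩
  · have h1 : synth vertexK u₂ = synth vertexK fun m => starRingEnd ℂ (u₁ m) := by
      rw [← conjInv_synth, ← hs1, hs2]
    exact congrFun (eq_of_synth_eq hr2.summable_self
      (Complex.conjCLE.summable.2 hr1.summable_self) (congrFun h1))
  · intro m
    have h1 := synth_rotAdj (c := tau) hr1.summable_self (by rw [← hs1]; exact hD.rot_one) m
    rw [h1]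
    linear_combination -(u₁ (rotIdx m)) * tau_mul_conj
  · have : FiniteDimensional ℂ (End.eigenspace (resolv (potCoef V) vertexK).toLinearMap (ν : ℂ)) :=
      FiniteDimensional.of_finrank_pos (by omega)
    symm
    refine Submodule.eq_of_le_of_finrank_le (Submodule.span_le.2 ?_) ?_
    · rintro z (rfl | rfl)
      · exact End.mem_eigenspace_iff.2 he1
      · exact End.mem_eigenspace_iff.2 he2
    · rw [hfin, IsCompactPos.finrank_span_pair (hne _ (hnorm _ hn1)) (hne _ (hnorm _ hn2)) horth]

end DiracCoefficients

/-! ### Symmetry of the momentum matrix and the value of `λ_♯`. -/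

section Momentum

variable {w : ℤ × ℤ → ℂ} {ν : ℝ} {u₁ u₂ : Ell2} (h : IsDiracCoef w ν u₁ u₂)

theorem norm_toC_freq_le (m : ℤ × ℤ) : ‖toC (freq m)‖ ≤ (1 + ‖vertexK‖) * weight m ^ 1 := by
  rw [norm_toC, freq_eq, pow_one]; exact norm_add_dualVec_le _ _

include h

theorem IsDiracCoef.rapidDecay_mul_toC : RapidDecay fun m => u₁ m * toC (freq m) := by
  simp only [mul_comm (u₁ _)]
  exact h.rapid_one.mul_bounded norm_toC_freq_le

theorem IsDiracCoef.summable_sq : Summable fun m => u₁ m ^ 2 * toC (freq m) := by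
  refine ((h.rapidDecay_mul_toC.mul_bounded (b := u₁) (C := ‖u₁‖) (n := 0) fun m => ?_).summable_self).congr
    fun m => by ring
  rw [pow_zero, mul_one]; exact norm_ell2_apply_le u₁ m

/-- The three coefficients in an orbit contribute equally to `tauCoeff`, so its square is `3 |Ω_h|
u₁(m)²`. The summand is rotation invariant, as its three characters `conj τ` multiply to `1`, and
the factor `3` turns the sum over `S` into a sum over all indices. -/
theorem IsDiracCoef.lambdaSharp_eq {S : Set (ℤ × ℤ)} (hS : IsRepSystem S) :
    lambdaSharp S (synth vertexK u₁) = cellVol * ∑' m, u₁ m ^ 2 * toC (freq m) := by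
  have hc : blochCoef vertexK (synth vertexK u₁) = u₁ := blochCoef_synth _ h.rapid_one.summable_self
  have hct : Continuous (synth vertexK u₁) := (contDiff_synth_of_rapidDecay h.rapid_one _).continuous
  have hcv := cellVol_pos
  have h1 : ∀ m, tauCoeff (synth vertexK u₁) m ^ 2 = 3 * cellVol * u₁ m ^ 2 := by
    intro m
    rw [cellInner_tauMode hct, hc, h.rot (rotIdx m), h.rot m]
    have e1 : u₁ m + tau * (starRingEnd ℂ tau * u₁ m)
        + starRingEnd ℂ tau * (starRingEnd ℂ tau * (starRingEnd ℂ tau * u₁ m)) = 3 * u₁ m := by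
      linear_combination (2 * u₁ m) * tau_mul_conj + (starRingEnd ℂ tau * u₁ m) * conj_tau_sq
    rw [e1]
    have e2 : ((√(3 * cellVol))⁻¹) ^ 2 * (cellVol * 3) ^ 2 = 3 * cellVol := by
      rw [inv_pow, Real.sq_sqrt (by positivity)]; field_simp
    have e3 : ((((√(3 * cellVol))⁻¹ : ℝ) : ℂ)) ^ 2 * ((cellVol : ℂ) * 3) ^ 2 = 3 * cellVol := by
      exact_mod_cast e2
    linear_combination u₁ m ^ 2 * e3
  rw [lambdaSharp, tsum_repSystem hS h.summable_sq, ← tsum_mul_left, ← tsum_mul_left]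
  · refine tsum_congr fun m => ?_
    rw [h1, toC]
    ring
  · intro m
    rw [h.rot, toC_rotIdx]
    linear_combination (u₁ m ^ 2 * toC (freq m)) * ((starRingEnd ℂ tau) * conj_tau_sq + tau_mul_conj)

/-- The vectors `2 κ·(K + ξ) u_j`. -/
theorem IsDiracCoef.exists_momentum (κ : Plane) : ∃ η₁ η₂ : Ell2,
    (∀ m, η₁ m = ((2 * ⟪κ, freq m⟫_ℝ : ℝ) : ℂ) * u₁ m) ∧
    (∀ m, η₂ m = ((2 * ⟪κ, freq m⟫_ℝ : ℝ) : ℂ) * u₂ m) := by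
  have hb : ∀ m, ‖((2 * ⟪κ, freq m⟫_ℝ : ℝ) : ℂ)‖ ≤ (2 * ‖κ‖ * (1 + ‖vertexK‖)) * weight m ^ 1 := by
    intro m
    rw [Complex.norm_real, norm_mul, Real.norm_of_nonneg zero_le_two, mul_assoc, mul_assoc]
    gcongr
    refine (norm_inner_le_norm _ _).trans ?_
    gcongr
    rw [← norm_toC (freq m)]
    exact norm_toC_freq_le m
  obtain ⟨η₁, h1⟩ := (h.rapid_one.mul_bounded hb).exists_ell2
  obtain ⟨η₂, h2⟩ := (h.rapid_two.mul_bounded hb).exists_ell2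
  exact ⟨η₁, η₂, h1, h2⟩

/-- `|u₁|²` is rotation invariant, while both parts of the momentum carry a nontrivial character. -/
theorem IsDiracCoef.sum_diagonal (κ : Plane) :
    ∑' m, ((2 * ⟪κ, freq m⟫_ℝ : ℝ) : ℂ) * (u₁ m * starRingEnd ℂ (u₁ m)) = 0 := by
  have hs1 : Summable fun m => (u₁ m * starRingEnd ℂ (u₁ m)) * toC (freq m) := by
    refine ((h.rapidDecay_mul_toC.mul_bounded (b := fun m => starRingEnd ℂ (u₁ m)) (C := ‖u₁‖) (n := 0)
      fun m => ?_).summable_self).congr fun m => by ring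
    rw [pow_zero, mul_one, RCLike.norm_conj]; exact norm_ell2_apply_le u₁ m
  have hs2 : Summable fun m => (u₁ m * starRingEnd ℂ (u₁ m)) * starRingEnd ℂ (toC (freq m)) := by
    refine (Complex.conjCLE.summable.2 hs1).congr fun m => ?_
    simp only [Complex.conjCLE_apply, map_mul, Complex.conj_conj]
    ring
  have h1 : ∑' m, (u₁ m * starRingEnd ℂ (u₁ m)) * toC (freq m) = 0 := by
    refine tsum_eq_zero_of_rotIdx conj_tau_ne_one fun m => ?_
    rw [h.rot, toC_rotIdx, map_mul, Complex.conj_conj]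
    linear_combination (u₁ m * starRingEnd ℂ (u₁ m) * (starRingEnd ℂ tau) * toC (freq m)) * tau_mul_conj
  have h2 : ∑' m, (u₁ m * starRingEnd ℂ (u₁ m)) * starRingEnd ℂ (toC (freq m)) = 0 := by
    refine tsum_eq_zero_of_rotIdx tau_ne_one fun m => ?_
    rw [h.rot, toC_rotIdx, map_mul, map_mul, Complex.conj_conj]
    linear_combination (u₁ m * starRingEnd ℂ (u₁ m) * tau * starRingEnd ℂ (toC (freq m))) * tau_mul_conj
  have h3 := ((hs1.mul_left (starRingEnd ℂ (toC κ))).tsum_add (hs2.mul_left (toC κ)))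
  rw [tsum_mul_left, tsum_mul_left, h1, h2, mul_zero, mul_zero, add_zero] at h3
  rw [← h3]
  refine tsum_congr fun m => ?_
  rw [two_inner_eq]; ring

/-- `u₁²` has the character `conj τ²`, so that only the part of the momentum with character `conj τ`
survives. -/
theorem IsDiracCoef.sum_offDiagonal (κ : Plane) :
    ∑' m, ((2 * ⟪κ, freq m⟫_ℝ : ℝ) : ℂ) * u₁ m ^ 2
      = starRingEnd ℂ (toC κ) * ∑' m, u₁ m ^ 2 * toC (freq m) := by
  have hs2 : Summable fun m => u₁ m ^ 2 * starRingEnd ℂ (toC (freq m)) := by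
    refine Summable.of_norm (h.summable_sq.norm.congr fun m => ?_)
    rw [norm_mul, norm_mul, RCLike.norm_conj]
  have h2 : ∑' m, u₁ m ^ 2 * starRingEnd ℂ (toC (freq m)) = 0 := by
    refine tsum_eq_zero_of_rotIdx conj_tau_ne_one fun m => ?_
    rw [h.rot, toC_rotIdx, map_mul, Complex.conj_conj]
    linear_combination
      (u₁ m ^ 2 * starRingEnd ℂ tau * starRingEnd ℂ (toC (freq m))) * tau_mul_conj
  have h3 := ((h.summable_sq.mul_left (starRingEnd ℂ (toC κ))).tsum_add (hs2.mul_left (toC κ)))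
  rw [tsum_mul_left, tsum_mul_left, h2, mul_zero, add_zero] at h3
  rw [← h3]
  refine tsum_congr fun m => ?_
  rw [two_inner_eq]; ring

/-- The matrix of the momentum operator in the nullspace at a Dirac point. -/
theorem IsDiracCoef.inner_momentum {S : Set (ℤ × ℤ)} (hS : IsRepSystem S) {κ : Plane} {η₁ η₂ : Ell2}
    (h1 : ∀ m, η₁ m = ((2 * ⟪κ, freq m⟫_ℝ : ℝ) : ℂ) * u₁ m)
    (h2 : ∀ m, η₂ m = ((2 * ⟪κ, freq m⟫_ℝ : ℝ) : ℂ) * u₂ m) :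
    ⟪η₁, u₁⟫_ℂ = 0 ∧ ⟪η₂, u₂⟫_ℂ = 0 ∧
    ⟪η₁, u₂⟫_ℂ = toC κ * starRingEnd ℂ (lambdaSharp S (synth vertexK u₁)) * (cellVol : ℂ)⁻¹ ∧
    ⟪η₂, u₁⟫_ℂ = starRingEnd ℂ (toC κ * starRingEnd ℂ (lambdaSharp S (synth vertexK u₁)))
      * (cellVol : ℂ)⁻¹ := by
  have hcv : (cellVol : ℂ) ≠ 0 := by exact_mod_cast cellVol_pos.ne'
  have key : ⟪η₂, u₁⟫_ℂ = starRingEnd ℂ (toC κ * starRingEnd ℂ (lambdaSharp S (synth vertexK u₁)))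
      * (cellVol : ℂ)⁻¹ := by
    rw [inner_ell2, h.lambdaSharp_eq hS]
    simp only [map_mul, Complex.conj_conj, Complex.conj_ofReal]
    rw [show ∀ a b c d : ℂ, a * (b * c) * d = (b * d) * (a * c) by intros; ring,
      mul_inv_cancel₀ hcv, one_mul, ← h.sum_offDiagonal κ]
    refine tsum_congr fun m => ?_
    rw [h2, h.conj, map_mul, Complex.conj_ofReal, Complex.conj_conj]; ring
  refine ⟨?_, ?_, ?_, key⟩
  · rw [inner_ell2, ← h.sum_diagonal κ]
    refine tsum_congr fun m => ?_
    rw [h1, map_mul, Complex.conj_ofReal]; ring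
  · rw [inner_ell2, ← h.sum_diagonal κ]
    refine tsum_congr fun m => ?_
    rw [h2, h.conj, map_mul, Complex.conj_ofReal, Complex.conj_conj]; ring
  · have h3 : ⟪η₁, u₂⟫_ℂ = starRingEnd ℂ ⟪η₂, u₁⟫_ℂ := by
      rw [inner_ell2, inner_ell2, Complex.conj_tsum]
      refine tsum_congr fun m => ?_
      rw [h1, h2, h.conj]
      simp only [map_mul, Complex.conj_ofReal, Complex.conj_conj]
    rw [h3, key]
    simp only [map_mul, Complex.conj_conj, map_inv₀, Complex.conj_ofReal]

end Momentum

/-! ### Perturbation of the eigenvalue at the Dirac point -/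

section Perturbation

variable {w : ℤ × ℤ → ℂ} (hw : RapidDecay w) (hsymm : ∀ d, w (-d) = starRingEnd ℂ (w d))
include hw hsymm

/-- Pairing the two eigenvalue equations cancels the potential by symmetry and leaves the difference
`2 t κ·(K + ξ) + t² |κ|²` of the kinetic terms. The identity is exact, so no derivative of `u` is
needed for the first-order theory. -/
theorem inner_perturbation {κ : Plane} {φ η u : Ell2} {ν₀ ν t : ℝ} (hν₀ : 0 < ν₀) (hν : 0 < ν)
    (hφ : resolv w vertexK φ = (ν₀ : ℂ) • φ)
    (hη : ∀ m, η m = ((2 * ⟪κ, freq m⟫_ℝ : ℝ) : ℂ) * φ m)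
    (hu : resolv w (vertexK + t • κ) u = (ν : ℂ) • u) :
    (t : ℂ) * (⟪η, u⟫_ℂ + t * (‖κ‖ ^ 2 : ℝ) * ⟪φ, u⟫_ℂ) = ((1 / ν - 1 / ν₀ : ℝ) : ℂ) * ⟪φ, u⟫_ℂ := by
  have hrφ := rapidDecay_of_eigenvector hw hν₀ hφ
  have hru := rapidDecay_of_eigenvector hw hν hu
  obtain ⟨ψ, hψ⟩ := (rapidDecay_kinetic hrφ vertexK).exists_ell2
  obtain ⟨U, hU⟩ := (rapidDecay_kinetic hru (vertexK + t • κ)).exists_ell2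
  have h1 : potOp w 0 φ = ((1 / ν₀ - specShift w : ℝ) : ℂ) • φ - ψ := by
    ext m
    have := eigen_equation hw hν₀.ne' hφ m
    rw [← hψ, ← potOp_zero_apply hw] at this
    exact eq_sub_of_add_eq' this
  have h2 : potOp w 0 u = ((1 / ν - specShift w : ℝ) : ℂ) • u - U := by
    ext m
    have := eigen_equation hw hν.ne' hu m
    rw [← hU, ← potOp_zero_apply hw] at this
    exact eq_sub_of_add_eq' this
  have h3 : ⟪potOp w 0 φ, u⟫_ℂ = ⟪φ, potOp w 0 u⟫_ℂ := potOp_isSymmetric hw hsymm φ u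
  have h4 : ⟪φ, U⟫_ℂ = ⟪ψ + ((t : ℂ) • η + ((t ^ 2 * ‖κ‖ ^ 2 : ℝ) : ℂ) • φ), u⟫_ℂ := by
    rw [inner_ell2, inner_ell2]
    refine tsum_congr fun m => ?_
    have e1 : (ψ + ((t : ℂ) • η + ((t ^ 2 * ‖κ‖ ^ 2 : ℝ) : ℂ) • φ)) m
        = ψ m + ((t : ℂ) * η m + ((t ^ 2 * ‖κ‖ ^ 2 : ℝ) : ℂ) * φ m) := rfl
    have e2 : ‖vertexK + t • κ + dualVec m‖ ^ 2
        = ‖vertexK + dualVec m‖ ^ 2 + t * (2 * ⟪κ, freq m⟫_ℝ) + t ^ 2 * ‖κ‖ ^ 2 := by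
      have : vertexK + t • κ + dualVec m = freq m + t • κ := by rw [freq_eq]; abel
      rw [this, norm_add_sq_real, inner_smul_right, norm_smul, mul_pow, Real.norm_eq_abs, sq_abs,
        real_inner_comm, freq_eq]
      ring
    rw [e1, hU, hψ, hη, e2]
    simp only [map_add, map_mul, Complex.conj_ofReal]
    push_cast
    ring
  rw [h1, h2, inner_sub_left, inner_sub_right, inner_smul_left, inner_smul_right, h4, inner_add_left,
    inner_add_left, inner_smul_left, inner_smul_left] at h3
  simp only [Complex.conj_ofReal] at h3
  push_cast at h3 ⊢
  linear_combination h3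

/-- First order perturbation theory. -/
theorem inner_deriv {κ : Plane} {φ η : Ell2} {ν₀ e : ℝ} {ν : ℝ → ℝ} {u : ℝ → Ell2} (hν₀ : 0 < ν₀)
    (hφ : resolv w vertexK φ = (ν₀ : ℂ) • φ)
    (hη : ∀ m, η m = ((2 * ⟪κ, freq m⟫_ℝ : ℝ) : ℂ) * φ m)
    (hν : ∀ᶠ t in 𝓝 0, 0 < ν t) (h0 : ν 0 = ν₀) (hu : ContinuousAt u 0)
    (heig : ∀ᶠ t in 𝓝 (0 : ℝ), resolv w (vertexK + t • κ) (u t) = (ν t : ℂ) • u t)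
    (hd : HasDerivAt (fun t => 1 / ν t) e 0) : (e : ℂ) * ⟪φ, u 0⟫_ℂ = ⟪η, u 0⟫_ℂ := by
  have hs := hasDerivAt_iff_tendsto_slope.1 hd
  have hcφ : Tendsto (fun t => ⟪φ, u t⟫_ℂ) (𝓝[≠] 0) (𝓝 ⟪φ, u 0⟫_ℂ) :=
    (ContinuousAt.inner (𝕜 := ℂ) continuousAt_const hu).tendsto.mono_left nhdsWithin_le_nhds
  have hcη : Tendsto (fun t => ⟪η, u t⟫_ℂ) (𝓝[≠] 0) (𝓝 ⟪η, u 0⟫_ℂ) :=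
    (ContinuousAt.inner (𝕜 := ℂ) continuousAt_const hu).tendsto.mono_left nhdsWithin_le_nhds
  have ht : Tendsto (fun t : ℝ => (t : ℂ) * (‖κ‖ ^ 2 : ℝ)) (𝓝[≠] 0) (𝓝 0) := by
    have : Continuous fun t : ℝ => (t : ℂ) * (‖κ‖ ^ 2 : ℝ) := by fun_prop
    have h := this.tendsto 0
    rw [Complex.ofReal_zero, zero_mul] at h
    exact h.mono_left nhdsWithin_le_nhds
  have l1 := ((Complex.continuous_ofReal.tendsto e).comp hs).mul hcφ
  have l2 := hcη.add (ht.mul hcφ)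
  rw [zero_mul, add_zero] at l2
  refine tendsto_nhds_unique l1 (l2.congr' ?_)
  filter_upwards [nhdsWithin_le_nhds hν, nhdsWithin_le_nhds heig, self_mem_nhdsWithin] with t h1 h2 h3
  have h4 := inner_perturbation hw hsymm hν₀ h1 hφ hη h2
  have h3' : (t : ℂ) ≠ 0 := by exact_mod_cast h3
  rw [Function.comp, slope_def_field, h0]
  refine mul_left_cancel₀ h3' ?_
  rw [h4]
  push_cast
  rw [sub_zero]
  field_simp

end Perturbation

/-! ### Eigenvalues and eigenvectors of the two-by-two first-order problem. -/

section TwoLevel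

/-- The eigenvalues of the off-diagonal hermitian matrix with entry `M`. -/
theorem exists_sign_of_offDiagonal {M c₁ c₂ : ℂ} {e : ℝ} (h1 : (e : ℂ) * c₁ = c₂ * M)
    (h2 : (e : ℂ) * c₂ = c₁ * starRingEnd ℂ M) (h0 : c₁ ≠ 0 ∨ c₂ ≠ 0) :
    ∃ s : ℤˣ, e = ((s : ℤ) : ℝ) * ‖M‖ := by
  have h3 : ((e : ℂ) ^ 2 - (‖M‖ : ℂ) ^ 2) * c₁ = 0 ∧ ((e : ℂ) ^ 2 - (‖M‖ : ℂ) ^ 2) * c₂ = 0 := by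
    have hM := Complex.mul_conj' M
    constructor
    · linear_combination (e : ℂ) * h1 + M * h2 + c₁ * hM
    · linear_combination (e : ℂ) * h2 + starRingEnd ℂ M * h1 + c₂ * hM
  have h4 : (e : ℂ) ^ 2 - (‖M‖ : ℂ) ^ 2 = 0 := by
    rcases h0 with h | h
    · exact (mul_eq_zero.1 h3.1).resolve_right h
    · exact (mul_eq_zero.1 h3.2).resolve_right h
  have h5 : e ^ 2 = ‖M‖ ^ 2 := by exact_mod_cast sub_eq_zero.1 h4
  rcases sq_eq_sq_iff_eq_or_eq_neg.1 h5 with h | h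
  · exact ⟨1, by simpa using h⟩
  · exact ⟨-1, by simpa using h⟩

theorem sign_mul_self (s : ℤˣ) : (((s : ℤ) : ℂ)) * ((s : ℤ) : ℂ) = 1 := by
  rcases Int.units_eq_one_or s with rfl | rfl <;> simp

theorem coefficient_of_offDiagonal {M c₁ c₂ : ℂ} {s : ℤˣ} (hM : M ≠ 0)
    (h1 : ((((s : ℤ) : ℝ) * ‖M‖ : ℝ) : ℂ) * c₁ = c₂ * M) : c₁ = ((s : ℤ) : ℂ) * c₂ * (M / ‖M‖) := by
  have h2 : (‖M‖ : ℂ) ≠ 0 := by exact_mod_cast (norm_pos_iff.2 hM).ne'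
  have h3 := sign_mul_self s
  field_simp
  push_cast at h1
  linear_combination ((s : ℤ) : ℂ) * h1 - (‖M‖ : ℂ) * c₁ * h3

end TwoLevel

/-! ### First-order behaviour of branches through the Dirac point. -/

section DiracBranches

variable {w : ℤ × ℤ → ℂ} {ν₀ : ℝ} {u₁ u₂ : Ell2} (h : IsDiracCoef w ν₀ u₁ u₂)

/-- The off-diagonal entry of the first order perturbation. -/
def diracEntry (κ : Plane) (l : ℂ) : ℂ := toC κ * starRingEnd ℂ l

/-- The eigenvector of the first order perturbation with sign `s`. -/
def diracVec (M : ℂ) (u₁ u₂ : Ell2) (s : ℤˣ) : Ell2 := (M / ‖M‖) • u₁ + ((s : ℤ) : ℂ) • u₂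

include h

theorem IsDiracCoef.norm_diracVec {M : ℂ} (hM : M ≠ 0) (s : ℤˣ) :
    ‖diracVec M u₁ u₂ s‖ ^ 2 = 2 * cellVol⁻¹ := by
  have h1 : ⟪(M / ‖M‖) • u₁, ((s : ℤ) : ℂ) • u₂⟫_ℂ = 0 := by
    rw [inner_smul_left, inner_smul_right, h.orthogonal]; simp
  have h2 := norm_add_sq_eq_norm_sq_add_norm_sq_of_inner_eq_zero _ _ h1
  have h3 : ‖((s : ℤ) : ℂ)‖ = 1 := by rcases Int.units_eq_one_or s with rfl | rfl <;> simp
  have h4 : ‖M / (‖M‖ : ℂ)‖ = 1 := by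
    rw [norm_div, Complex.norm_real, norm_norm, div_self (norm_ne_zero_iff.2 hM)]
  rw [norm_smul, norm_smul, h3, h4, one_mul, one_mul, ← sq, ← sq, ← sq, h.norm_one, h.norm_two] at h2
  rw [diracVec, h2]
  ring

variable (hw : RapidDecay w) (hsymm : ∀ d, w (-d) = starRingEnd ℂ (w d))
include hw hsymm

/-- Testing first-order perturbation theory against `u₁` and `u₂` gives `e c₁ = c₂ M` and `e c₂ = c₁
conj M`, whence `e = ± |M|`. The area of the cell cancels between the norms and the momentum matrix.
-/
theorem IsDiracCoef.branch {S : Set (ℤ × ℤ)} (hS : IsRepSystem S) {κ : Plane} {ν : ℝ → ℝ}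
    {u : ℝ → Ell2} (hν : AnalyticAt ℝ ν 0) (hν0 : ν 0 = ν₀) (hu : ContinuousAt u 0) (hu0 : u 0 ≠ 0)
    (heig : ∀ᶠ t in 𝓝 (0 : ℝ), resolv w (vertexK + t • κ) (u t) = (ν t : ℂ) • u t) :
    ∃ (s : ℤˣ) (c₁ c₂ : ℂ),
      HasDerivAt (fun t => 1 / ν t)
        (((s : ℤ) : ℝ) * ‖diracEntry κ (lambdaSharp S (synth vertexK u₁))‖) 0 ∧
      u 0 = c₁ • u₁ + c₂ • u₂ ∧
      ((((s : ℤ) : ℝ) * ‖diracEntry κ (lambdaSharp S (synth vertexK u₁))‖ : ℝ) : ℂ) * c₁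
        = c₂ * diracEntry κ (lambdaSharp S (synth vertexK u₁)) := by
  set M := diracEntry κ (lambdaSharp S (synth vertexK u₁)) with hM
  obtain ⟨η₁, η₂, h1, h2⟩ := h.exists_momentum κ
  obtain ⟨i1, i2, i3, i4⟩ := h.inner_momentum hS h1 h2
  have hcv : (cellVol : ℂ) ≠ 0 := by exact_mod_cast cellVol_pos.ne'
  have hmem : ∀ z ∈ Submodule.span ℂ {u₁, u₂}, resolv w vertexK z = (ν₀ : ℂ) • z := fun z hz =>
    End.mem_eigenspace_iff.1 (h.eigenspace ▸ hz)
  have he0 : u 0 ∈ Submodule.span ℂ {u₁, u₂} := by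
    rw [← h.eigenspace]
    refine End.mem_eigenspace_iff.2 ?_
    have := heig.self_of_nhds
    rw [zero_smul, add_zero, hν0] at this
    exact this
  obtain ⟨c₁, c₂, hc⟩ := Submodule.mem_span_pair.1 he0
  have hd : HasDerivAt (fun t => 1 / ν t) (deriv (fun t => 1 / ν t) 0) 0 := by
    have : AnalyticAt ℝ (fun t => 1 / ν t) 0 :=
      analyticAt_const.div hν (by rw [hν0]; exact h.pos.ne')
    exact this.differentiableAt.hasDerivAt
  set e := deriv (fun t => 1 / ν t) 0 with hedef
  have hνpos : ∀ᶠ t in 𝓝 0, 0 < ν t :=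
    hν.continuousAt.eventually (lt_mem_nhds (by rw [hν0]; exact h.pos))
  have d1 := inner_deriv hw hsymm h.pos (hmem u₁ (Submodule.subset_span (by simp))) h1 hνpos hν0 hu heig hd
  have d2 := inner_deriv hw hsymm h.pos (hmem u₂ (Submodule.subset_span (by simp))) h2 hνpos hν0 hu heig hd
  have hn : ∀ z : Ell2, ‖z‖ ^ 2 = cellVol⁻¹ → ⟪z, z⟫_ℂ = (cellVol : ℂ)⁻¹ := by
    intro z hz
    rw [inner_self_eq_norm_sq_to_K]
    change ((‖z‖ : ℝ) : ℂ) ^ 2 = _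
    rw [← Complex.ofReal_pow, hz, Complex.ofReal_inv]
  have ho2 : ⟪u₂, u₁⟫_ℂ = 0 := inner_eq_zero_symm.1 h.orthogonal
  rw [← hc, inner_add_right, inner_add_right, inner_smul_right, inner_smul_right, inner_smul_right,
    inner_smul_right, hn _ h.norm_one, h.orthogonal, i1, i3] at d1
  rw [← hc, inner_add_right, inner_add_right, inner_smul_right, inner_smul_right, inner_smul_right,
    inner_smul_right, hn _ h.norm_two, ho2, i2, i4] at d2
  have e1 : (e : ℂ) * c₁ = c₂ * M := by
    rw [hM, diracEntry]
    field_simp at d1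
    linear_combination d1
  have e2 : (e : ℂ) * c₂ = c₁ * starRingEnd ℂ M := by
    rw [hM, diracEntry]
    field_simp at d2
    linear_combination d2
  have h0 : c₁ ≠ 0 ∨ c₂ ≠ 0 := by
    by_contra! hcon
    rw [← hc, hcon.1, hcon.2] at hu0
    simp at hu0
  obtain ⟨s, hs⟩ := exists_sign_of_offDiagonal e1 e2 h0
  exact ⟨s, c₁, c₂, hs ▸ hd, hc.symm, hs ▸ e1⟩

omit h hw hsymm in
theorem smul_diracVec {M c₁ c₂ : ℂ} {s : ℤˣ} (hM : M ≠ 0)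
    (h1 : ((((s : ℤ) : ℝ) * ‖M‖ : ℝ) : ℂ) * c₁ = c₂ * M) :
    c₁ • u₁ + c₂ • u₂ = (((s : ℤ) : ℂ) * c₂) • diracVec M u₁ u₂ s := by
  rw [coefficient_of_offDiagonal hM h1, diracVec, smul_add, smul_smul, smul_smul]
  congr 2
  linear_combination -c₂ * sign_mul_self s

end DiracBranches

/-! ### The two branches through the Dirac point -/

section Branches

variable {w : ℤ × ℤ → ℂ} {ν₀ : ℝ} {u₁ u₂ : Ell2} (h : IsDiracCoef w ν₀ u₁ u₂)
  (hw : RapidDecay w) (hsymm : ∀ d, w (-d) = starRingEnd ℂ (w d))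

theorem eventually_ne_of_hasDerivAt {ν ν' : ℝ → ℝ} {e e' : ℝ} (hν : AnalyticAt ℝ ν 0)
    (hν' : AnalyticAt ℝ ν' 0) (hd : HasDerivAt (fun t => 1 / ν t) e 0)
    (hd' : HasDerivAt (fun t => 1 / ν' t) e' 0) (hne : e ≠ e') : ∀ᶠ t in 𝓝[≠] 0, ν t ≠ ν' t := by
  rcases hν.eventually_eq_or_eventually_ne hν' with h | h
  · refine absurd (hd.unique (hd'.congr_of_eventuallyEq ?_)) hne
    filter_upwards [h] with t ht
    rw [ht]
  · exact h

include h hw hsymm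

theorem IsDiracCoef.exists_simpleBranch {S : Set (ℤ × ℤ)} (hS : IsRepSystem S) {κ : Plane}
    (hM : diracEntry κ (lambdaSharp S (synth vertexK u₁)) ≠ 0) (s : ℤˣ) : ∃ ν : ℝ → ℝ, ν 0 = ν₀ ∧
      HasDerivAt (fun t => 1 / ν t)
        (((s : ℤ) : ℝ) * ‖diracEntry κ (lambdaSharp S (synth vertexK u₁))‖) 0 ∧
      SimpleBranchAt (fun t : ℝ => resolv w (vertexK + t • κ)) ν 0 := by
  set M := diracEntry κ (lambdaSharp S (synth vertexK u₁)) with hMdef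
  have hK : vertexK + (0 : ℝ) • κ = vertexK := by rw [zero_smul, add_zero]
  obtain ⟨ι, _, ν, u, hcard, han, hLI, heig, ε, hε, hex⟩ :=
    rellich_compact (T := fun t : ℝ => resolv w (vertexK + t • κ)) (t₀ := 0)
      (analyticAt_resolv w vertexK κ 0) (fun t => (resolv_isCompactPos hw hsymm _).symm)
      (resolv_isCompactPos hw hsymm _).compact h.pos.ne'
  rw [hK, h.finrank] at hcard
  have hbr := fun i => h.branch hw hsymm hS (κ := κ) (han i).1 (han i).2.2 (han i).2.1.continuousAt
    (hLI.ne_zero i) (heig.mono fun t ht => ht i)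
  choose σ c₁ c₂ hd hu hc using hbr
  -- Two branches with the same sign would start at multiples of the same vector `diracVec`, against
  -- linear independence. As there are two branches, each sign occurs exactly once.
  have hinj : Function.Injective σ := by
    intro i j hij
    by_contra hne
    have hpair : LinearIndependent ℂ ![u i 0, u j 0] := by
      have hcomp := hLI.comp ![i, j] (by
        intro a b hab
        fin_cases a <;> fin_cases b <;> simp_all [Ne.symm])
      have hfun : (fun i => u i 0) ∘ ![i, j] = ![u i 0, u j 0] := by
        funext a
        fin_cases a <;> rfl
      rw [hfun] at hcomp
      exact hcomp
    rw [LinearIndependent.pair_iff] at hpair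
    have hi := (hu i).trans (smul_diracVec hM (hc i))
    have hj := (hu j).trans (smul_diracVec hM (hc j))
    rw [← hij] at hj
    set α := ((σ i : ℤ) : ℂ) * c₂ i
    set β := ((σ i : ℤ) : ℂ) * c₂ j
    have h1 := hpair β (-α) (by rw [hi, hj, smul_smul, smul_smul, ← add_smul]; ring_nf; rw [zero_smul])
    have h2 : β = 0 := h1.1
    rw [h2, zero_smul] at hj
    exact hLI.ne_zero j hj
  have hbij : Function.Bijective σ :=
    (Fintype.bijective_iff_injective_and_card σ).2 ⟨hinj, by rw [hcard]; rfl⟩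
  obtain ⟨i, rfl⟩ := hbij.2 s
  refine ⟨ν i, (han i).2.2, hd i,
    simpleBranchAt_of_branches h.pos han hLI heig hε hex i fun j hj => ?_⟩
  refine eventually_ne_of_hasDerivAt (han j).1 (han i).1 (hd j) (hd i) fun heq => ?_
  have h1 := mul_right_cancel₀ (norm_ne_zero_iff.2 hM) heq
  exact hj (hinj (Units.ext (by exact_mod_cast h1)))

/-- At a point with conical bands the first order perturbation does not vanish. -/
theorem IsDiracCoef.diracEntry_ne_zero {S : Set (ℤ × ℤ)} (hS : IsRepSystem S) {κ : Plane} {b : ℕ}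
    (hb : 1 ≤ b) (h0 : nuBand (resolv w vertexK) b = ν₀) {c : ℝ} (hc : 0 < c)
    (hcone : ∀ᶠ t in 𝓝 (0 : ℝ), c * |t| ≤ |1 / nuBand (resolv w (vertexK + t • κ)) b - 1 / ν₀|) :
    diracEntry κ (lambdaSharp S (synth vertexK u₁)) ≠ 0 := by
  intro hM
  have hK : vertexK + (0 : ℝ) • κ = vertexK := by rw [zero_smul, add_zero]
  have hcp : ∀ t : ℝ, IsCompactPos (resolv w (vertexK + t • κ)) := fun t =>
    resolv_isCompactPos hw hsymm _
  obtain ⟨ι, _, ν, u, hcard, han, hLI, heig, ε, hε, hex⟩ :=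
    rellich_compact (T := fun t : ℝ => resolv w (vertexK + t • κ)) (t₀ := 0)
      (analyticAt_resolv w vertexK κ 0) (fun t => (hcp t).symm) (hcp 0).compact h.pos.ne'
  -- With a vanishing matrix entry both slopes `± |M|` are zero.
  have hd : ∀ i, HasDerivAt (fun t => 1 / ν i t) 0 0 := by
    intro i
    obtain ⟨s, -, -, hd, -⟩ := h.branch hw hsymm hS (κ := κ) (han i).1 (han i).2.2
      (han i).2.1.continuousAt (hLI.ne_zero i) (heig.mono fun t ht => ht i)
    rwa [hM, norm_zero, mul_zero] at hd
  have hsmall : ∀ᶠ t in 𝓝 (0 : ℝ), ∀ i, |1 / ν i t - 1 / ν₀| ≤ c / 2 * |t| := by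
    refine eventually_all.2 fun i => ?_
    have h1 := (hasDerivAt_iff_isLittleO.1 (hd i)).def (half_pos hc)
    filter_upwards [h1] with t ht
    simpa [(han i).2.2] using ht
  have hLI' : ∀ᶠ t in 𝓝 (0 : ℝ), LinearIndependent ℂ (fun i => u i t) := by
    have hcu : ContinuousAt (fun t => fun i => u i t) 0 :=
      continuousAt_pi.2 fun i => (han i).2.1.continuousAt
    exact hcu.eventually hLI.eventually
  have hband : ∀ᶠ t in 𝓝 (0 : ℝ), |nuBand (resolv w (vertexK + t • κ)) b - ν₀| < ε := by
    have hct := continuousAt_nuBand not_finiteDimensional_ell2 hcp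
      (analyticAt_resolv w vertexK κ 0).continuousAt hb
    have := hct.eventually (Metric.ball_mem_nhds _ hε)
    simpa only [hK, h0, Metric.mem_ball, Real.dist_eq] using this
  -- Near `0` the band takes its values among the branches, which deviate by at most `c |t| / 2`,
  -- while the cone requires `c |t|`.
  have hfalse : ∀ᶠ t in 𝓝[≠] (0 : ℝ), False := by
    filter_upwards [nhdsWithin_le_nhds hsmall, nhdsWithin_le_nhds hLI', nhdsWithin_le_nhds hband,
      nhdsWithin_le_nhds heig, nhdsWithin_le_nhds hex, nhdsWithin_le_nhds hcone,
      self_mem_nhdsWithin] with t a1 a2 a3 a4 a5 a6 a7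
    obtain ⟨x, hx0, hx⟩ := (hcp t).exists_eigenvector_nuBand not_finiteDimensional_ell2 hb
    obtain ⟨d, -, hd1, i, hd2⟩ := exists_eq_branch_of_mem_span (ν := fun i => ν i t) a2 a4 hx
      (a5 _ a3 x hx) hx0
    have h1 := a1 i
    rw [hd1 i hd2] at h1
    have h2 : 0 < c * |t| := mul_pos hc (abs_pos.2 a7)
    have := a6.trans h1
    linarith
  exact hfalse.exists.elim fun _ hf => hf

/-- The two branches of eigenvalues and eigenvectors that emanate from a Dirac point. -/
theorem IsDiracCoef.exists_family {S : Set (ℤ × ℤ)} (hS : IsRepSystem S) {κ : Plane}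
    (hM : diracEntry κ (lambdaSharp S (synth vertexK u₁)) ≠ 0) :
    ∃ (ν : ℤˣ → ℝ → ℝ) (u : ℤˣ → ℝ → Ell2),
      (∀ s, ∀ t ∈ Set.Icc (-(1 / 2) : ℝ) (1 / 2), AnalyticAt ℝ (ν s) t ∧ 0 < ν s t ∧
        AnalyticAt ℝ (u s) t ∧ ‖u s t‖ ^ 2 = cellVol⁻¹ ∧
        resolv w (vertexK + t • κ) (u s t) = (ν s t : ℂ) • u s t) ∧
      (∀ t ∈ Set.Icc (-(1 / 2) : ℝ) (1 / 2), ⟪u (-1) t, u 1 t⟫_ℂ = 0) ∧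
      ∀ s, ν s 0 = ν₀ ∧ HasDerivAt (fun t => 1 / ν s t)
        (((s : ℤ) : ℝ) * ‖diracEntry κ (lambdaSharp S (synth vertexK u₁))‖) 0 ∧
        u s 0 = (((√2)⁻¹ : ℝ) : ℂ) •
          diracVec (diracEntry κ (lambdaSharp S (synth vertexK u₁))) u₁ u₂ s := by
  set M := diracEntry κ (lambdaSharp S (synth vertexK u₁)) with hMdef
  have hcp : ∀ t : ℝ, IsCompactPos (resolv w (vertexK + t • κ)) := fun t =>
    resolv_isCompactPos hw hsymm _
  obtain ⟨C, hC⟩ := exists_resolv_deriv_bound hw hsymm vertexK κ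
  have key : ∀ s : ℤˣ, ∃ (ν : ℝ → ℝ) (u : ℝ → Ell2),
      (∀ t ∈ Set.Icc (-(1 / 2) : ℝ) (1 / 2), AnalyticAt ℝ ν t ∧ 0 < ν t ∧
        AnalyticAt ℝ u t ∧ ‖u t‖ ^ 2 = cellVol⁻¹ ∧
        resolv w (vertexK + t • κ) (u t) = (ν t : ℂ) • u t) ∧
      ν 0 = ν₀ ∧ HasDerivAt (fun t => 1 / ν t) (((s : ℤ) : ℝ) * ‖M‖) 0 ∧
        u 0 = (((√2)⁻¹ : ℝ) : ℂ) • diracVec M u₁ u₂ s := by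
    intro s
    obtain ⟨ν', h0, hd, hsb⟩ := h.exists_simpleBranch hw hsymm hS hM s
    obtain ⟨ν, hνν', hbr⟩ := exists_branch (analyticAt_resolv w vertexK κ) hcp hC hsb
    obtain ⟨u, hu⟩ := exists_analytic_unit_eigenvector hbr
    have h0mem : (0 : ℝ) ∈ Set.Icc (-(1 / 2) : ℝ) (1 / 2) := by norm_num
    have h0mem1 : (0 : ℝ) ∈ Set.Icc (-1 : ℝ) 1 := by norm_num
    have hν0 : ν 0 = ν₀ := hνν'.eq_of_nhds.trans h0
    have hd' : HasDerivAt (fun t => 1 / ν t) (((s : ℤ) : ℝ) * ‖M‖) 0 :=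
      hd.congr_of_eventuallyEq (hνν'.mono fun t ht => by simp only [ht])
    have hu0 : u 0 ≠ 0 := norm_ne_zero_iff.1 (by rw [(hu 0 h0mem).2.1]; exact one_ne_zero)
    have hev : ∀ᶠ t in 𝓝 (0 : ℝ), resolv w (vertexK + t • κ) (u t) = (ν t : ℂ) • u t := by
      filter_upwards [Icc_mem_nhds (show (-(1 / 2) : ℝ) < 0 by norm_num)
        (show (0 : ℝ) < 1 / 2 by norm_num)] with t ht
      exact (hu t ht).2.2
    obtain ⟨s', c₁, c₂, hd2, hc, hcM⟩ := h.branch hw hsymm hS (hbr 0 h0mem1).analytic hν0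
      (hu 0 h0mem).1.continuousAt hu0 hev
    have hs : s' = s := by
      have h1 := mul_right_cancel₀ (norm_ne_zero_iff.2 hM) (hd2.unique hd')
      exact Units.ext (by exact_mod_cast h1)
    subst hs
    rw [smul_diracVec hM hcM] at hc
    set γ := ((s' : ℤ) : ℂ) * c₂ with hγ
    have hγ0 : γ ≠ 0 := fun h1 => hu0 (by rw [hc, h1, zero_smul])
    -- A constant rescaling gives the prescribed vector at `0`. It turns the constant norm `1` into
    -- `1 / √|Ω_h|`, the normalization for functions on the cell.
    have hu0' : ((((√2)⁻¹ : ℝ) : ℂ) * γ⁻¹) • u 0 = (((√2)⁻¹ : ℝ) : ℂ) • diracVec M u₁ u₂ s' := by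
      rw [hc, smul_smul, mul_assoc, inv_mul_cancel₀ hγ0, mul_one]
    refine ⟨ν, fun t => ((((√2)⁻¹ : ℝ) : ℂ) * γ⁻¹) • u t, fun t ht => ?_, hν0, hd', hu0'⟩
    have ht1 : t ∈ Set.Icc (-1 : ℝ) 1 := ⟨by linarith [ht.1], by linarith [ht.2]⟩
    refine ⟨(hbr t ht1).analytic, (hbr t ht1).pos,
      analyticAt_complex_smul analyticAt_const (hu t ht).1, ?_, ?_⟩
    · have h1 : ‖((((√2)⁻¹ : ℝ) : ℂ) * γ⁻¹) • u t‖ = ‖((((√2)⁻¹ : ℝ) : ℂ) * γ⁻¹) • u 0‖ := by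
        rw [norm_smul, norm_smul, (hu t ht).2.1, (hu 0 h0mem).2.1]
      rw [h1, hu0', norm_smul, mul_pow, h.norm_diracVec hM, Complex.norm_real, Real.norm_eq_abs,
        sq_abs, inv_pow, Real.sq_sqrt zero_le_two]
      ring
    · rw [map_smul, (hu t ht).2.2, smul_comm]
  choose ν u h1 h2 h3 h4 using key
  refine ⟨ν, u, h1, fun t ht => ?_, fun s => ⟨h2 s, h3 s, h4 s⟩⟩
  have hI : Set.Icc (-(1 / 2) : ℝ) (1 / 2) ∈ 𝓝 (0 : ℝ) :=
    Icc_mem_nhds (by norm_num) (by norm_num)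
  have h0mem : (0 : ℝ) ∈ Set.Icc (-(1 / 2) : ℝ) (1 / 2) := by norm_num
  have hne : ∀ᶠ t in 𝓝[≠] (0 : ℝ), ν (-1) t ≠ ν 1 t := by
    refine eventually_ne_of_hasDerivAt (h1 (-1) 0 h0mem).1 (h1 1 0 h0mem).1 (h3 (-1)) (h3 1) fun heq => ?_
    have := mul_right_cancel₀ (norm_ne_zero_iff.2 hM) heq
    norm_num at this
  -- The branches have different slopes, so near `0` they belong to different eigenvalues.
  -- Orthogonality spreads to the whole interval by analyticity, even across later crossings.
  have hzero : ∀ᶠ t in 𝓝[≠] (0 : ℝ), ⟪u (-1) t, u 1 t⟫_ℂ = 0 := by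
    filter_upwards [hne, nhdsWithin_le_nhds hI] with t ha hb
    have hne' : (ν (-1) t : ℂ) ≠ ν 1 t := by exact_mod_cast ha
    exact (hcp t).symm.orthogonalFamily_eigenspaces hne'
      ⟨_, End.mem_eigenspace_iff.2 (h1 (-1) t hb).2.2.2.2⟩
      ⟨_, End.mem_eigenspace_iff.2 (h1 1 t hb).2.2.2.2⟩
  have han : AnalyticOnNhd ℝ (fun t => ⟪u (-1) t, u 1 t⟫_ℂ) (Set.Icc (-(1 / 2) : ℝ) (1 / 2)) :=
    fun t ht => analyticAt_inner (h1 (-1) t ht).2.2.1 (h1 1 t ht).2.2.1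
  exact han.eqOn_zero_of_preconnected_of_frequently_eq_zero isPreconnected_Icc h0mem
    hzero.frequently ht

end Branches

/-! ### Analytic families of Bloch functions -/

section Families

/-- The remainder is the twofold difference quotient at `0`, which is again analytic there and so
bounded near `0`. -/
theorem exists_second_order {E : ℝ → ℝ} {e : ℝ} (hE : AnalyticAt ℝ E 0) (hd : HasDerivAt E e 0) :
    ∃ (E₂ : ℝ → ℝ) (C : ℝ), (∀ t, E t = E 0 + e * t + E₂ t * t ^ 2) ∧ ∀ᶠ t in 𝓝 0, |E₂ t| ≤ C := by
  have hana : ∀ {f : ℝ → ℝ}, AnalyticAt ℝ f 0 → AnalyticAt ℝ (dslope f 0) 0 := fun ⟨_, hp⟩ =>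
    ⟨_, hp.has_fpower_series_dslope_fslope⟩
  refine ⟨dslope (dslope E 0) 0, |dslope (dslope E 0) 0 0| + 1, fun t => ?_, ?_⟩
  · have h1 := sub_smul_dslope E 0 t
    have h2 := sub_smul_dslope (dslope E 0) 0 t
    rw [dslope_same, hd.deriv, sub_zero, smul_eq_mul] at h2
    rw [sub_zero, smul_eq_mul] at h1
    linear_combination -h1 - t * h2
  · have hc := (hana (hana hE)).continuousAt.abs
    exact (hc.eventually (gt_mem_nhds (lt_add_one _))).mono fun t ht => ht.le

theorem analyticAt_planeWave_line (k κ x : Plane) (t : ℝ) :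
    AnalyticAt ℝ (fun t : ℝ => planeWave (k + t • κ) x) t := by
  have h : (fun t : ℝ => planeWave (k + t • κ) x) = fun t : ℝ => planeWave k x * planeWave κ (t • x) := by
    funext t
    rw [planeWave_add_left, planeWave, planeWave, planeWave, inner_smul_left, inner_smul_right]
    rfl
  rw [h]
  have h2 : ContDiff ℝ ω fun t : ℝ => planeWave κ (t • x) :=
    (contDiff_planeWave κ).comp (contDiff_id.smul contDiff_const)
  exact analyticAt_const.mul h2.contDiffAt.analyticAt

set_option maxSynthPendingDepth 5 in
theorem exists_analyticInC2 {w : ℤ × ℤ → ℂ} (hw : RapidDecay w) {K κ : Plane} {ν : ℝ → ℝ}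
    {u : ℝ → Ell2} (hν : ∀ t ∈ Set.Icc (-(1 / 2) : ℝ) (1 / 2), AnalyticAt ℝ ν t ∧ 0 < ν t)
    (hu : ∀ t ∈ Set.Icc (-(1 / 2) : ℝ) (1 / 2),
      AnalyticAt ℝ u t ∧ resolv w (K + t • κ) (u t) = (ν t : ℂ) • u t) :
    ∃ p : ℝ → Plane → ℂ, AnalyticInC2 p (Set.Icc (-(1 / 2)) (1 / 2)) ∧
      (∀ t ∈ Set.Icc (-(1 / 2) : ℝ) (1 / 2), p t = synth 0 (u t)) ∧
      (∀ x, AnalyticOnNhd ℝ (fun t => p t x) (Set.Icc (-(1 / 2)) (1 / 2))) ∧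
      ∀ n ≤ 2, ∃ C : ℝ, ∀ᶠ t in 𝓝 (0 : ℝ), ∀ x,
        ‖iteratedFDeriv ℝ n (fun y => p t y - p 0 y) x‖ ≤ C * |t| := by
  obtain ⟨U, hU⟩ := exists_analytic_weighted hw hν hu 4
  have hI : Set.Icc (-(1 / 2) : ℝ) (1 / 2) ∈ 𝓝 (0 : ℝ) := Icc_mem_nhds (by norm_num) (by norm_num)
  have h0 : (0 : ℝ) ∈ Set.Icc (-(1 / 2) : ℝ) (1 / 2) := by norm_num
  choose J hJ using exists_derivative_map
  -- Defined through `U` rather than `u`, so that its derivatives are given by `J` for every real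
  -- `t`, as `AnalyticInC2` demands, and not only on the interval.
  let p : ℝ → Plane → ℂ := fun t => synth 0 fun m => ((weight m ^ 4 : ℝ) : ℂ)⁻¹ * U t m
  have hp : ∀ t ∈ Set.Icc (-(1 / 2) : ℝ) (1 / 2), p t = synth 0 (u t) := by
    intro t ht
    change synth 0 _ = _
    congr 1
    funext m
    have : ((weight m ^ 4 : ℝ) : ℂ) ≠ 0 := by exact_mod_cast (pow_pos (weight_pos m) 4).ne'
    rw [(hU t ht).2, inv_mul_cancel_left₀ this]
  have hF : ∀ n, ∀ t ∈ Set.Icc (-(1 / 2) : ℝ) (1 / 2), AnalyticAt ℝ (fun t => J n (U t)) t :=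
    fun n t ht => analyticAt_clm_const (J n) (hU t ht).1
  have hsm : ∀ t ∈ Set.Icc (-(1 / 2) : ℝ) (1 / 2), ContDiff ℝ ∞ (p t) := fun t ht => by
    rw [hp t ht]
    exact contDiff_synth_of_rapidDecay (rapidDecay_of_eigenvector hw (hν t ht).2 (hu t ht).2) 0
  refine ⟨p, fun n hn => ⟨fun t => J n (U t), hF n, fun t x => hJ n hn _ x⟩, hp, fun x t ht => ?_,
    fun n hn => ?_⟩
  · have h1 : (fun t => p t x) = fun t =>
        (((ContinuousMultilinearMap.apply ℝ (fun _ : Fin 0 => Plane) ℂ 0).comp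
          (BoundedContinuousFunction.evalCLM ℝ x)) (J 0 (U t))) := by
      funext t
      change _ = (J 0 (U t) x) 0
      rw [hJ 0 (by norm_num), iteratedFDeriv_zero_apply]
    rw [h1]
    exact (ContinuousLinearMap.analyticAt _ _).comp (hF 0 t ht)
  -- Differentiability at `0` in the sup norm gives the linear bound uniformly in `x`.
  · obtain ⟨C, hC⟩ := ((hF n 0 h0).differentiableAt.isBigO_sub).bound
    refine ⟨C, ?_⟩
    filter_upwards [hC, hI] with t h1 h2 x
    have h3 : iteratedFDeriv ℝ n (fun y => p t y - p 0 y) x = (J n (U t) - J n (U 0)) x := by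
      change iteratedFDeriv ℝ n (p t - p 0) x = J n (U t) x - J n (U 0) x
      rw [hJ n hn, hJ n hn, iteratedFDeriv_sub_apply ((hsm t h2).contDiffAt.of_le (by exact_mod_cast le_top))
        ((hsm 0 h0).contDiffAt.of_le (by exact_mod_cast le_top))]
    rw [h3]
    refine (BoundedContinuousFunction.norm_coe_le_norm _ x).trans (h1.trans ?_)
    rw [sub_zero, Real.norm_eq_abs]

end Families

/-! ### Translation of the Dirac point conditions to the resolvent. -/

section DiracPoint

/-- Its squared length is `q² (a₁² + a₁ b₁ + b₁²)`, a positive definite form, and coprime integers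
are not both zero. -/
theorem toC_dualK₂_ne_zero {a₁ b₁ : ℤ} (hab : IsCoprime a₁ b₁) : toC (dualK₂ a₁ b₁) ≠ 0 := by
  rw [← norm_ne_zero_iff, norm_toC]
  intro h
  have h1 := norm_sq_combination (-(b₁ : ℝ)) (a₁ : ℝ)
  rw [← dualK₂, h] at h1
  have h2 : (b₁ : ℝ) ^ 2 + (a₁ : ℝ) ^ 2 + b₁ * a₁ = 0 := by
    have h3 := q_pos
    have h4 : q ^ 2 * ((b₁ : ℝ) ^ 2 + (a₁ : ℝ) ^ 2 + b₁ * a₁) = 0 := by linear_combination -h1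
    exact (mul_eq_zero.1 h4).resolve_left (by positivity)
  have h3 : (b₁ : ℝ) = 0 := by nlinarith [sq_nonneg ((b₁ : ℝ) + 2 * a₁), sq_nonneg (b₁ : ℝ)]
  have h4 : (a₁ : ℝ) = 0 := by nlinarith [sq_nonneg ((a₁ : ℝ) + 2 * b₁), sq_nonneg (a₁ : ℝ)]
  have h5 : b₁ = 0 := by exact_mod_cast h3
  have h6 : a₁ = 0 := by exact_mod_cast h4
  rw [h5, h6] at hab
  exact not_isCoprime_zero_zero hab

variable {V : Plane → ℝ} (hV : ContDiff ℝ ∞ V) (hVp : IsLatticePeriodic V)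
include hV hVp

theorem IsDiracPoint.nuBand_eq {Estar : ℝ} {b : ℕ} {Φ₁ : Plane → ℂ} (hD : IsDiracPoint V Estar b Φ₁)
    {ν : ℝ} (hE : Estar = 1 / ν - specShift (potCoef V)) :
    nuBand (resolv (potCoef V) vertexK) b = ν ∧ nuBand (resolv (potCoef V) vertexK) (b + 1) = ν := by
  obtain ⟨l, ζ, C, L, eLow, eHigh, -, hζ, -, -, -, -, -, h⟩ := hD.cones
  obtain ⟨h1, h2, -, -⟩ := h vertexK (Metric.mem_ball_self hζ)
  rw [sub_self, norm_zero, mul_zero, zero_mul, bandEnergy_eq hV hVp _ (by omega), hE] at h1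
  rw [sub_self, norm_zero, mul_zero, zero_mul, neg_zero, bandEnergy_eq hV hVp _ hD.one_le, hE] at h2
  constructor
  · exact inv_injective (by simp only [one_div] at h2; linarith)
  · exact inv_injective (by simp only [one_div] at h1; linarith)

/-- For `C |k - K| ≤ 1 / 2` the correction `1 + eHigh` is at least `1 / 2`, so half the slope of the
upper cone remains. -/
theorem IsDiracPoint.cone_lower {Estar : ℝ} {b : ℕ} {Φ₁ : Plane → ℂ} (hD : IsDiracPoint V Estar b Φ₁)
    {ν : ℝ} (hE : Estar = 1 / ν - specShift (potCoef V)) {κ : Plane} (hκ : κ ≠ 0) :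
    ∃ c > 0, ∀ᶠ t in 𝓝 (0 : ℝ), c * |t|
      ≤ |1 / nuBand (resolv (potCoef V) (vertexK + t • κ)) (b + 1) - 1 / ν| := by
  obtain ⟨l, ζ, C, L, eLow, eHigh, hl, hζ, hC, -, -, -, -, h⟩ := hD.cones
  have hlp := norm_pos_iff.2 hl
  have hκp := norm_pos_iff.2 hκ
  refine ⟨‖l‖ * ‖κ‖ / 2, by positivity, ?_⟩
  have hct : Tendsto (fun t : ℝ => ‖t • κ‖) (𝓝 0) (𝓝 0) := by
    have : Continuous fun t : ℝ => ‖t • κ‖ := by fun_prop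
    simpa using this.tendsto 0
  filter_upwards [hct.eventually (gt_mem_nhds hζ),
    hct.eventually (gt_mem_nhds (show 0 < 1 / (2 * C) by positivity))] with t h1 h2
  obtain ⟨h3, -, -, h4⟩ := h (vertexK + t • κ) (by rwa [mem_ball_iff_norm, add_sub_cancel_left])
  rw [add_sub_cancel_left] at h3 h4
  rw [bandEnergy_eq hV hVp _ (by omega), hE] at h3
  have h5 : 1 / nuBand (resolv (potCoef V) (vertexK + t • κ)) (b + 1) - 1 / ν
      = ‖l‖ * ‖t • κ‖ * (1 + eHigh (vertexK + t • κ)) := by rw [← h3]; ring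
  have h6 : C * ‖t • κ‖ ≤ 1 / 2 := by
    have := mul_le_mul_of_nonneg_left h2.le hC.le
    have h7 : C * (1 / (2 * C)) = 1 / 2 := by field_simp
    linarith
  have h7 := (abs_le.1 (h4.trans h6)).1
  refine le_trans ?_ (le_abs_self _)
  rw [h5, norm_smul, Real.norm_eq_abs]
  have h8 : 0 ≤ ‖l‖ * (|t| * ‖κ‖) := by positivity
  nlinarith

end DiracPoint

/-! ### Values at the Dirac point and spans -/

section Values

theorem synth_diracVec {u₁ u₂ : Ell2} (h1 : RapidDecay u₁) (h2 : RapidDecay u₂) (k κ : Plane) (l : ℂ)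
    (s : ℤˣ) : synth k ((((√2)⁻¹ : ℝ) : ℂ) • diracVec (diracEntry κ l) u₁ u₂ s : Ell2)
      = diracComb l κ s (synth k u₁) (synth k u₂) := by
  funext x
  have e1 : ⇑((((√2)⁻¹ : ℝ) : ℂ) • diracVec (diracEntry κ l) u₁ u₂ s : Ell2)
      = fun m => (((√2)⁻¹ : ℝ) : ℂ) * (diracEntry κ l / ‖diracEntry κ l‖ * u₁ m
        + ((s : ℤ) : ℂ) * u₂ m) := rfl
  rw [e1, synth_const_mul, synth_add (h1.const_mul _).summable_self (h2.const_mul _).summable_self,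
    synth_const_mul, synth_const_mul, diracComb]
  congr 3
  rw [diracEntry, norm_mul, RCLike.norm_conj]
  change toC κ * starRingEnd ℂ l / ((‖toC κ‖ * ‖l‖ : ℝ) : ℂ) = starRingEnd ℂ l / (‖l‖ : ℂ)
    * (toC κ / (‖toC κ‖ : ℂ))
  push_cast
  rw [mul_comm (‖toC κ‖ : ℂ), mul_comm (toC κ), mul_div_mul_comm]

theorem cellInner_family {u : ℤˣ → Ell2} (hr : ∀ s, RapidDecay (u s)) (hn : ∀ s, ‖u s‖ ^ 2 = cellVol⁻¹)
    (ho : ⟪u (-1), u 1⟫_ℂ = 0) (k : Plane) (s s' : ℤˣ) :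
    cellInner (synth k (u s)) (synth k (u s')) = if s = s' then 1 else 0 := by
  rw [cellInner_synth (hr s) (hr s')]
  have hcv : (cellVol : ℂ) ≠ 0 := by exact_mod_cast cellVol_pos.ne'
  have ho' : ⟪u 1, u (-1)⟫_ℂ = 0 := inner_eq_zero_symm.1 ho
  have h1 : ∀ s, (cellVol : ℂ) * ⟪u s, u s⟫_ℂ = 1 := by
    intro s
    rw [inner_self_eq_norm_sq_to_K]
    change (cellVol : ℂ) * ((‖u s‖ : ℝ) : ℂ) ^ 2 = 1
    rw [← Complex.ofReal_pow, hn, Complex.ofReal_inv, mul_inv_cancel₀ hcv]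
  split_ifs with h
  · rw [h, h1]
  · rcases Int.units_eq_one_or s with rfl | rfl <;> rcases Int.units_eq_one_or s' with rfl | rfl
    · exact absurd rfl h
    · rw [ho', mul_zero]
    · rw [ho, mul_zero]
    · exact absurd rfl h

theorem ne_zero_of_norm_sq_eq_inv_cellVol {u : Ell2} (h : ‖u‖ ^ 2 = cellVol⁻¹) : u ≠ 0 := by
  rintro rfl
  have h1 : (0 : ℝ) < cellVol⁻¹ := inv_pos.2 cellVol_pos
  rw [← h, norm_zero] at h1
  norm_num at h1

end Values

/-! ### The branches span the pair of bands. -/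

section Spans

variable {V : Plane → ℝ} (hV : ContDiff ℝ ∞ V) (hVp : IsLatticePeriodic V)
include hV hVp

/-- Two orthogonal branches in an isolated pair of bands span the pair. -/
theorem spansBands_of_family {K κ : Plane} {b : ℕ} (hb : 1 ≤ b) {ν : ℤˣ → ℝ → ℝ}
    {u : ℤˣ → ℝ → Ell2}
    (hu : ∀ s, ∀ t ∈ Set.Icc (-(1 / 2) : ℝ) (1 / 2), AnalyticAt ℝ (ν s) t ∧ 0 < ν s t ∧
        AnalyticAt ℝ (u s) t ∧ ‖u s t‖ ^ 2 = cellVol⁻¹ ∧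
        resolv (potCoef V) (K + t • κ) (u s t) = (ν s t : ℂ) • u s t)
    (ho : ∀ t ∈ Set.Icc (-(1 / 2) : ℝ) (1 / 2), ⟪u (-1) t, u 1 t⟫_ℂ = 0)
    (h0 : ∀ s, ν s 0 = nuBand (resolv (potCoef V) K) b
      ∧ ν s 0 = nuBand (resolv (potCoef V) K) (b + 1))
    {t : ℝ} (ht : t ∈ Set.Icc (-(1 / 2) : ℝ) (1 / 2))
    (hiso : ∀ r ∈ Set.Icc (0 : ℝ) 1, NuIsolated (resolv (potCoef V) (K + (r * t) • κ)) b) :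
    SpansBands V b (K + t • κ)
      (Submodule.span ℂ {synth (K + t • κ) (u (-1) t), synth (K + t • κ) (u 1 t)}) := by
  have hcp : ∀ t : ℝ, IsCompactPos (resolv (potCoef V) (K + t • κ)) := fun t =>
    resolv_potCoef_isCompactPos hV hVp _
  have hc : Continuous fun t : ℝ => resolv (potCoef V) (K + t • κ) :=
    continuous_iff_continuousAt.2 fun t => (analyticAt_resolv _ K κ t).continuousAt
  have hmem : ∀ s, ν s t ∈ Set.Icc (nuBand (resolv (potCoef V) (K + t • κ)) (b + 1))
      (nuBand (resolv (potCoef V) (K + t • κ)) b) := by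
    intro s
    refine mem_Icc_nuBand_of_isolated not_finiteDimensional_ell2 hcp hc hb (fun r hr => ?_) ?_ hiso
    · have hrt : r * t ∈ Set.Icc (-(1 / 2) : ℝ) (1 / 2) := by
        refine abs_le.1 ?_
        rw [abs_mul, abs_of_nonneg hr.1]
        exact (mul_le_of_le_one_left (abs_nonneg t) hr.2).trans (abs_le.2 ht)
      obtain ⟨a1, a2, -, a4, a5⟩ := hu s _ hrt
      exact ⟨a1.continuousAt, a2, _, ne_zero_of_norm_sq_eq_inv_cellVol a4, a5⟩
    · rw [zero_smul, add_zero, ← (h0 s).1, ← (h0 s).2]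
      exact Set.left_mem_Icc.2 le_rfl
  have h1 := hu (-1) t ht
  have h2 := hu 1 t ht
  have hiso1 := hiso 1 (by norm_num)
  rw [one_mul] at hiso1
  exact spansBands_of_pair hV hVp hb hiso1 (ne_zero_of_norm_sq_eq_inv_cellVol h1.2.2.2.1)
    (ne_zero_of_norm_sq_eq_inv_cellVol h2.2.2.2.1) (ho t ht) (hmem _) h1.2.2.2.2 (hmem _) h2.2.2.2.2

end Spans

end Honeycomb

end

/-! ### The main theorem. -/

open Honeycomb Filter Topology in
theorem mainTheorem8
    (V : Honeycomb.Plane → ℝ) (hV_smooth : ContDiff ℝ ∞ V)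
    (hV_periodic : Honeycomb.IsLatticePeriodic V) (hV_even : ∀ x, V (-x) = V x)
    (Estar : ℝ) (b : ℕ) (Φ₁ : Honeycomb.Plane → ℂ)
    (hDirac : Honeycomb.IsDiracPoint V Estar b Φ₁)
    (S : Set (ℤ × ℤ)) (hS : Honeycomb.IsRepSystem S)
    (a₁ b₁ : ℤ) (hab : IsCoprime a₁ b₁)
    (K κ : Honeycomb.Plane) (hK : K = Honeycomb.vertexK) (hκ : κ = Honeycomb.dualK₂ a₁ b₁)
    (l : ℂ) (hl : l = Honeycomb.lambdaSharp S Φ₁)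
    (Φ₂ P₁ P₂ : Honeycomb.Plane → ℂ) (hΦ₂ : Φ₂ = Honeycomb.conjInv Φ₁)
    (hP₁ : P₁ = fun x => Honeycomb.planeWave (-K) x * Φ₁ x)
    (hP₂ : P₂ = fun x => Honeycomb.planeWave (-K) x * Φ₂ x) :
    ∃ (E : ℤˣ → ℝ → ℝ) (Φ p : ℤˣ → ℝ → Honeycomb.Plane → ℂ),
      -- real-analytic orthonormal eigenpairs along the slice
      (∀ s, AnalyticOnNhd ℝ (E s) (Set.Icc (-(1 / 2)) (1 / 2)) ∧
        (∀ x, AnalyticOnNhd ℝ (fun t => Φ s t x) (Set.Icc (-(1 / 2)) (1 / 2))) ∧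
        Honeycomb.AnalyticInC2 (p s) (Set.Icc (-(1 / 2)) (1 / 2))) ∧
      (∀ t ∈ Set.Icc (-(1 / 2) : ℝ) (1 / 2), ∀ s,
        Φ s t ∈ Honeycomb.eigenspace V (K + t • κ) (E s t) ∧
        Honeycomb.IsLatticePeriodic (p s t) ∧
        (∀ x, Φ s t x = Honeycomb.planeWave (K + t • κ) x * p s t x) ∧
        ∀ s', Honeycomb.cellInner (Φ s t) (Φ s' t) = (if s = s' then 1 else 0) ∧
          Honeycomb.cellInner (p s t) (p s' t) = (if s = s' then 1 else 0)) ∧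
      -- they span the two touching bands as long as no other band meets these
      (∀ t ∈ Set.Icc (-(1 / 2) : ℝ) (1 / 2),
        (∀ r ∈ Set.Icc (0 : ℝ) 1, Honeycomb.BandsIsolated V b (K + (r * t) • κ)) →
        Honeycomb.SpansBands V b (K + t • κ) (Submodule.span ℂ {Φ (-1) t, Φ 1 t})) ∧
      -- values at the Dirac point
      (∀ s, p s 0 = Honeycomb.diracComb l κ s P₁ P₂ ∧
        Φ s 0 = Honeycomb.diracComb l κ s Φ₁ Φ₂) ∧
      -- local expansions
      ∃ ζ₀ C C' : ℝ, 0 < ζ₀ ∧ ζ₀ ≤ 1 / 2 ∧ 0 < C ∧ 0 < C' ∧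
        (∀ t : ℝ, |t| < ζ₀ →
          Honeycomb.SpansBands V b (K + t • κ) (Submodule.span ℂ {Φ (-1) t, Φ 1 t})) ∧
        (∃ E₂ : ℤˣ → ℝ → ℝ, ∀ s, ∀ t : ℝ, |t| < ζ₀ →
          E s t = Estar + ((s : ℤ) : ℝ) * (‖l‖ * ‖κ‖ * t) + E₂ s t * t ^ 2 ∧ |E₂ s t| ≤ C) ∧
        ∀ s, ∀ t : ℝ, |t| < ζ₀ → ∀ n : ℕ, n ≤ 2 → ∀ x,
          ‖iteratedFDeriv ℝ n
            (fun y => p s t y - Honeycomb.diracComb l κ s P₁ P₂ y) x‖ ≤ C' * |t| := by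
  classical
  subst hK hκ hΦ₂
  obtain ⟨ν₀, u₁, u₂, hc, hE, hs1, hs2⟩ := hDirac.exists_coef hV_smooth hV_periodic
  have hw := rapidDecay_potCoef hV_smooth hV_periodic
  have hsymm := potCoef_neg V
  set κ := dualK₂ a₁ b₁ with hκ
  have hκ0 : toC κ ≠ 0 := toC_dualK₂_ne_zero hab
  have hκn : κ ≠ 0 := norm_ne_zero_iff.1 (by rw [← norm_toC]; exact norm_ne_zero_iff.2 hκ0)
  have hb := hDirac.one_le
  obtain ⟨hn1, hn2⟩ := hDirac.nuBand_eq hV_smooth hV_periodic hE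
  obtain ⟨c, hcpos, hcone⟩ := hDirac.cone_lower hV_smooth hV_periodic hE hκn
  have hM := hc.diracEntry_ne_zero hw hsymm hS (show 1 ≤ b + 1 by omega) hn2 hcpos hcone
  obtain ⟨ν, u, hfam, horth, hzero⟩ := hc.exists_family hw hsymm hS hM
  rw [← hs1, ← hl] at hzero
  have hMnorm : ‖diracEntry κ l‖ = ‖l‖ * ‖κ‖ := by
    rw [diracEntry, norm_mul, RCLike.norm_conj, norm_toC, mul_comm]
  have hrap : ∀ s, ∀ t ∈ Set.Icc (-(1 / 2) : ℝ) (1 / 2), RapidDecay (u s t) := fun s t ht =>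
    rapidDecay_of_eigenvector hw (hfam s t ht).2.1 (hfam s t ht).2.2.2.2
  have hp := fun s => exists_analyticInC2 hw (fun t ht => ⟨(hfam s t ht).1, (hfam s t ht).2.1⟩)
    (fun t ht => ⟨(hfam s t ht).2.2.1, (hfam s t ht).2.2.2.2⟩)
  choose p hpC2 hpu hpan hpbound using hp
  let E : ℤˣ → ℝ → ℝ := fun s t => 1 / ν s t - specShift (potCoef V)
  let Φ : ℤˣ → ℝ → Plane → ℂ := fun s t x => planeWave (vertexK + t • κ) x * p s t x
  have hΦ : ∀ s, ∀ t ∈ Set.Icc (-(1 / 2) : ℝ) (1 / 2), Φ s t = synth (vertexK + t • κ) (u s t) := by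
    intro s t ht
    funext x
    rw [synth_eq, ← hpu s t ht]
  have hEan : ∀ s, AnalyticOnNhd ℝ (E s) (Set.Icc (-(1 / 2)) (1 / 2)) := fun s t ht =>
    (analyticAt_const.div (hfam s t ht).1 (hfam s t ht).2.1.ne').sub analyticAt_const
  have h0 : (0 : ℝ) ∈ Set.Icc (-(1 / 2) : ℝ) (1 / 2) := by norm_num
  have hspan : ∀ t ∈ Set.Icc (-(1 / 2) : ℝ) (1 / 2),
      (∀ r ∈ Set.Icc (0 : ℝ) 1, NuIsolated (resolv (potCoef V) (vertexK + (r * t) • κ)) b) →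
      SpansBands V b (vertexK + t • κ) (Submodule.span ℂ {Φ (-1) t, Φ 1 t}) := by
    intro t ht hiso
    rw [hΦ _ t ht, hΦ _ t ht]
    exact spansBands_of_family hV_smooth hV_periodic hb hfam horth
      (fun s => ⟨(hzero s).1.trans hn1.symm, (hzero s).1.trans hn2.symm⟩) ht hiso
  have hp0 : ∀ s, p s 0 = diracComb l κ s P₁ P₂ := by
    intro s
    rw [hpu s 0 h0, (hzero s).2.2, synth_diracVec hc.rapid_one hc.rapid_two, hP₁, hP₂, hs2, hs1]
    congr 1 <;> funext x <;> rw [synth_eq vertexK, ← mul_assoc, planeWave_neg_mul, one_mul]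
  have hΦ0 : ∀ s, Φ s 0 = diracComb l κ s Φ₁ (conjInv Φ₁) := by
    intro s
    rw [hΦ s 0 h0, (hzero s).2.2, zero_smul, add_zero, synth_diracVec hc.rapid_one hc.rapid_two,
      hs2, hs1]
  refine ⟨E, Φ, p, fun s => ⟨hEan s, fun x t ht => ?_, hpC2 s⟩, fun t ht s => ⟨?_, ?_, fun x => rfl,
    fun s' => ⟨?_, ?_⟩⟩, fun t ht hiso => hspan t ht fun r hr =>
      nuIsolated_of_bandsIsolated hV_smooth hV_periodic hb (hiso r hr),
    fun s => ⟨hp0 s, hΦ0 s⟩, ?_⟩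
  · exact (analyticAt_planeWave_line vertexK κ x t).mul (hpan s x t ht)
  · rw [hΦ s t ht]
    exact (synth_mem_eigenspace_iff_resolv hV_smooth hV_periodic (hfam s t ht).2.1
      (hrap s t ht)).2 (hfam s t ht).2.2.2.2
  · rw [hpu s t ht]
    exact isLatticePeriodic_synth_zero _
  · rw [hΦ s t ht, hΦ s' t ht]
    exact cellInner_family (u := fun s => u s t) (fun s => hrap s t ht)
      (fun s => (hfam s t ht).2.2.2.1) (horth t ht) _ s s'
  · rw [hpu s t ht, hpu s' t ht]
    exact cellInner_family (u := fun s => u s t) (fun s => hrap s t ht)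
      (fun s => (hfam s t ht).2.2.2.1) (horth t ht) _ s s'
  · have hcp : ∀ t : ℝ, IsCompactPos (resolv (potCoef V) (vertexK + t • κ)) := fun t =>
      resolv_potCoef_isCompactPos hV_smooth hV_periodic _
    have hTc : Continuous fun t : ℝ => resolv (potCoef V) (vertexK + t • κ) :=
      continuous_iff_continuousAt.2 fun t => (analyticAt_resolv _ vertexK κ t).continuousAt
    -- Multiplicity two leaves no room for a third band at the Dirac point, and isolation is an open
    -- condition. This is why the span statement holds unconditionally for small `t`.
    have hiso0 : NuIsolated (resolv (potCoef V) (vertexK + (0 : ℝ) • κ)) b := by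
      rw [zero_smul, add_zero]
      exact (resolv_potCoef_isCompactPos hV_smooth hV_periodic _).nuIsolated_of_finrank_eq_two
        not_finiteDimensional_ell2 hb hn1 hn2 hc.finrank
    have hev1 := eventually_nuIsolated not_finiteDimensional_ell2 hcp hTc hb hiso0
    have hE2 := fun s => exists_second_order (E := E s) (hEan s 0 h0) ((hzero s).2.1.sub_const _)
    choose E₂ C hE2a hE2b using hE2
    choose D hD using hpbound
    have hev2 : ∀ᶠ t in 𝓝 (0 : ℝ), ∀ s, |E₂ s t| ≤ C s := eventually_all.2 hE2b
    have hev3 : ∀ᶠ t in 𝓝 (0 : ℝ), ∀ s, ∀ n : Fin 3, ∀ x,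
        ‖iteratedFDeriv ℝ n (fun y => p s t y - p s 0 y) x‖ ≤ D s n (by omega) * |t| :=
      eventually_all.2 fun s => eventually_all.2 fun n => hD s n (by omega)
    obtain ⟨δ, hδ, hall⟩ := Metric.eventually_nhds_iff.1 (hev1.and (hev2.and hev3))
    have hdist : ∀ {t : ℝ}, |t| < min δ (1 / 2) → dist t 0 < δ := fun h => by
      rw [Real.dist_0_eq_abs]; exact h.trans_le (min_le_left _ _)
    have hIcc : ∀ {t : ℝ}, |t| < min δ (1 / 2) → t ∈ Set.Icc (-(1 / 2) : ℝ) (1 / 2) := fun h =>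
      abs_le.1 (h.le.trans (min_le_right _ _))
    have hCle : ∀ s, C s ≤ |C 1| + |C (-1)| + 1 := fun s => by
      have e1 := le_abs_self (C s)
      have e2 := abs_nonneg (C 1)
      have e3 := abs_nonneg (C (-1))
      rcases Int.units_eq_one_or s with rfl | rfl <;> linarith
    set D' : ℝ := ∑ s : ℤˣ, ∑ n : Fin 3, |D s n (by omega)| with hD'
    have hDle : ∀ s (n : Fin 3), D s n (by omega) ≤ D' + 1 := fun s n => by
      have e1 := Finset.single_le_sum (f := fun n : Fin 3 => |D s n (by omega)|)
        (fun _ _ => abs_nonneg _) (Finset.mem_univ n)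
      have e2 := Finset.single_le_sum (f := fun s => ∑ n : Fin 3, |D s n (by omega)|)
        (fun _ _ => Finset.sum_nonneg fun _ _ => abs_nonneg _) (Finset.mem_univ s)
      have e3 := le_abs_self (D s n (by omega))
      linarith
    have hD'0 : 0 ≤ D' := Finset.sum_nonneg fun _ _ => Finset.sum_nonneg fun _ _ => abs_nonneg _
    -- The constants are made common to both signs and all orders by summing absolute values; the
    -- added `1` makes them positive.
    refine ⟨min δ (1 / 2), |C 1| + |C (-1)| + 1, D' + 1, lt_min hδ (by norm_num), min_le_right _ _,
      by positivity, by positivity, fun t ht => hspan t (hIcc ht) fun r hr => ?_,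
      ⟨E₂, fun s t ht => ⟨?_, ?_⟩⟩, fun s t ht n hn x => ?_⟩
    · refine (hall (hdist ?_)).1
      rw [abs_mul, abs_of_nonneg hr.1]
      exact (mul_le_of_le_one_left (abs_nonneg t) hr.2).trans_lt ht
    · rw [hE2a s t, hMnorm]
      have : E s 0 = Estar := by
        rw [hE]; simp only [E, (hzero s).1]
      rw [this]; ring
    · exact ((hall (hdist ht)).2.1 s).trans (hCle s)
    · rw [← hp0 s]
      refine ((hall (hdist ht)).2.2 s ⟨n, by omega⟩ x).trans ?_
      exact mul_le_mul_of_nonneg_right (hDle s ⟨n, by omega⟩) (abs_nonneg t)
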